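/- Consider the field equation $$-\ddot\xi+\Delta_{\mathbb S^2}\xi=\tfrac14(1+\csc^2 t)\,\xi\qquad\text{on }(0,\pi)\times\mathbb S^2 .$$ Let $\mathcal S^{KG}$ be the real vector space of its smooth real solutions, on which $SO(3)$ acts by $(D(g)\xi)(t,s)=\xi(t,g^{-1}s)$, with the (time independent) symplectic form $\Omega(\xi_1,\xi_2)=\int_{\mathbb S^2}(\xi_2\dot\xi_1-\xi_1\dot\xi_2)$, and let $\mathcal S\subset\mathcal S^{KG}$ be the subspace of solutions invariant under rotations about a fixed axis. An $SO(3)$-invariant complex structure is a linear map $J:\mathcal S^{KG}\to\mathcal S^{KG}$ with $J^2=-1$, $\Omega(J\xi_1,J\xi_2)=\Omega(\xi_1,\xi_2)$, $\Omega(J\xi,\xi)>0$ for $\xi\ne0$, and $JD(g)=D(g)J$ for all $g\in SO(3)$. Parameters. Let $\tilde u_{0\ell}=\sqrt{\sin t}\,P_\ell(\cos t)/\sqrt2$ and $\tilde v_{0\ell}=\sqrt{\sin t}\,Q_\ell(\cos t)/\sqrt2$, with $P_\ell,Q_\ell$ the Legendre functions of the first and second kind. Such a $J$ is described by pairs $(\rho_\ell,\nu_\ell)\in(0,\infty)\times\mathbb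 R$, $\ell\ge 0$, for which $z_\ell=\rho_\ell\tilde u_{0\ell}+(\nu_\ell+i\rho_\ell^{-1})\tilde v_{0\ell}$ satisfies $J(z_\ell Y_{\ell0})=i\,z_\ell Y_{\ell0}$ ($J$ extended complex linearly). Fock representation. Let $\mathscr H_J$ be the completion of $\mathcal S$, with complex structure $J$, for $\langle\varphi_1|\varphi_2\rangle_J=\frac12\Omega(J\varphi_1,\varphi_2)-\frac i2\Omega(\varphi_1,\varphi_2)$. The Fock representation defined by $J$ assigns to $\varphi\in\mathcal S$ the unitary operator $\pi_J(W(\varphi))=\exp\big(i\hat\Omega(\varphi,\cdot)\big)$, $\hat\Omega(\varphi,\cdot)=i\,(A(\varphi)-C(\varphi))$, on the symmetric Fock space $\mathscr F_+(\mathscr H_J)$, where $A$ and $C$ are the annihilation and creation operators. The Fock representations of $J$ and $J'$ are unitarily equivalent if a unitary $U:\mathscr F_+(\mathscr H_J)\to\mathscr F_+(\mathscr H_{J'})$ satisfies $U\pi_J(W(\varphi))=\pi_{J'}(W(\varphi))U$ for all $\varphi\in\mathcal S$. Dynamics. For $t_0,t_1\in(0,\pi)$ let $\mathcal T_{(t_1,t_0)}\varphi$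 be the solution whose data $(Q,P)=(\xi,\dot\xi-\frac12\cot t\,\xi)$ at time $t_0$ are the data of $\varphi$ at time $t_1$. The dynamics is unitary for $J$ if for all $t_0,t_1\in(0,\pi)$ there is a unitary $U$ on $\mathscr F_+(\mathscr H_J)$ with $U^{-1}\pi_J(W(\varphi))U=\pi_J(W(\mathcal T_{(t_1,t_0)}\varphi))$ for all $\varphi\in\mathcal S$. Theorem. (1) For every $SO(3)$-invariant complex structure $J$, the dynamics is unitary for $J$ if and only if its parameters satisfy $$\rho_\ell=\sqrt{\pi/2}+x_\ell>0,\quad (x_\ell)_{\ell\ge0}\in\ell^2(\mathbb R),\quad (\nu_\ell)_{\ell\ge0}\in\ell^2(\mathbb R).\qquad(*)$$ (2) If $J$ and $J'$ are $SO(3)$-invariant complex structures which both satisfy $(*)$, then the Fock representations defined by $J$ and $J'$ are unitarily equivalent. (3) In particular, the Fock representations of any two $SO(3)$-invariant complex structures for which the dynamics is unitary are unitarily equivalent. -/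

import Mathlib

open scoped ContDiff Laplacian

noncomputable section

namespace Gowdy

/-! ### The field equation on `(0, π) × S²` -/

/-- Euclidean three-space. -/
abbrev E3 : Type := EuclideanSpace ℝ (Fin 3)

/-- The round unit two-sphere. -/
abbrev S2 : Type := Metric.sphere (0 : E3) 1

/-- Extension of a function on the sphere to `ℝ³`, constant along open rays from the origin
(and zero at the origin). -/
def radialExt (f : S2 → ℝ) (x : E3) : ℝ :=
  if h : x = 0 then 0
  else f ⟨‖x‖⁻¹ • x, by
    rw [mem_sphere_zero_iff_norm, norm_smul, norm_inv, norm_norm,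
      inv_mul_cancel₀ (norm_ne_zero_iff.mpr h)]⟩

/-- The Laplace–Beltrami operator of the round unit sphere: on the unit sphere it is the Euclidean
Laplacian of the extension that is constant along rays. -/
def sphereLaplacian (f : S2 → ℝ) (s : S2) : ℝ := (Δ (radialExt f)) (s : E3)

/-- `ξ` is a smooth real solution of `-∂ₜ²ξ + Δ ξ = ¼ (1 + csc² t) ξ` on `(0, π) × S²`.
Functions on `(0, π) × S²` are represented by functions of `(t, s) ∈ ℝ × S²` which are zero for `t`
outside `(0, π)`; smoothness is expressed through the extension constant along rays. -/
structure IsSolution (ξ : ℝ → S2 → ℝ) : Prop where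
  smooth : ContDiffOn ℝ ∞ (fun p : ℝ × E3 => radialExt (ξ p.1) p.2)
    (Set.Ioo 0 Real.pi ×ˢ {0}ᶜ)
  equation : ∀ t ∈ Set.Ioo 0 Real.pi, ∀ s : S2,
    -iteratedDeriv 2 (fun τ => ξ τ s) t + sphereLaplacian (ξ t) s
      = 1 / 4 * (1 + 1 / Real.sin t ^ 2) * ξ t s
  zero_off : ∀ t, t ∉ Set.Ioo 0 Real.pi → ∀ s, ξ t s = 0

lemma radialExt_coe (f : S2 → ℝ) (s : S2) : radialExt f (s : E3) = f s := by
  have h1 : ‖(s : E3)‖ = 1 := mem_sphere_zero_iff_norm.mp s.2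
  have h : (s : E3) ≠ 0 := by
    intro h; rw [h, norm_zero] at h1; exact zero_ne_one h1
  rw [radialExt, dif_neg h]
  congr 1
  ext1
  simp [h1]

lemma radialExt_add (f g : S2 → ℝ) : radialExt (f + g) = radialExt f + radialExt g := by
  funext x
  by_cases h : x = 0 <;> simp [radialExt, h]

lemma radialExt_smul (c : ℝ) (f : S2 → ℝ) : radialExt (c • f) = c • radialExt f := by
  funext x
  by_cases h : x = 0 <;> simp [radialExt, h]

lemma coe_ne_zero (s : S2) : (s : E3) ≠ 0 := by
  have h1 : ‖(s : E3)‖ = 1 := mem_sphere_zero_iff_norm.mp s.2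
  intro h; rw [h, norm_zero] at h1; exact zero_ne_one h1

lemma IsSolution.contDiffAt_uncurry {ξ : ℝ → S2 → ℝ} (h : IsSolution ξ) {t : ℝ}
    (ht : t ∈ Set.Ioo 0 Real.pi) {x : E3} (hx : x ≠ 0) :
    ContDiffAt ℝ ∞ (fun p : ℝ × E3 => radialExt (ξ p.1) p.2) (t, x) :=
  h.smooth.contDiffAt ((isOpen_Ioo.prod isOpen_compl_singleton).mem_nhds ⟨ht, hx⟩)

lemma IsSolution.contDiffAt_space {ξ : ℝ → S2 → ℝ} (h : IsSolution ξ) {t : ℝ}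
    (ht : t ∈ Set.Ioo 0 Real.pi) {x : E3} (hx : x ≠ 0) :
    ContDiffAt ℝ ∞ (radialExt (ξ t)) x :=
  (h.contDiffAt_uncurry ht hx).comp x (f := fun y : E3 => (t, y))
    (contDiffAt_const.prodMk contDiffAt_id)

lemma IsSolution.contDiffAt_time {ξ : ℝ → S2 → ℝ} (h : IsSolution ξ) {t : ℝ}
    (ht : t ∈ Set.Ioo 0 Real.pi) (s : S2) :
    ContDiffAt ℝ ∞ (fun τ => ξ τ s) t := by
  have := (h.contDiffAt_uncurry ht (coe_ne_zero s)).comp t (f := fun τ : ℝ => (τ, (s : E3)))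
    (contDiffAt_id.prodMk contDiffAt_const)
  refine this.congr_of_eventuallyEq (Filter.Eventually.of_forall fun τ => ?_)
  simp [radialExt_coe]

/-- The real vector space of smooth solutions, no axial symmetry being imposed. -/
def Sol : Submodule ℝ (ℝ → S2 → ℝ) where
  carrier := {ξ | IsSolution ξ}
  zero_mem' := by
    have h0 : radialExt (0 : S2 → ℝ) = 0 := by
      funext x; by_cases h : x = 0 <;> simp [radialExt, h]
    refine ⟨?_, ?_, ?_⟩
    · simp only [Pi.zero_apply, h0]
      exact contDiffOn_const
    · intro t _ s
      have h1 : (Δ (0 : E3 → ℝ)) (s : E3) = 0 := by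
        have := InnerProductSpace.laplacian_const (E := E3) (c := (0 : ℝ))
        exact congrFun this _
      simp [sphereLaplacian, h0, h1]
    · intro t _ s; rfl
  add_mem' := by
    intro ξ η hξ hη
    refine ⟨?_, ?_, ?_⟩
    · refine (hξ.smooth.add hη.smooth).congr fun p _ => ?_
      simp [radialExt_add]
    · intro t ht s
      have e1 : iteratedDeriv 2 (fun τ => (ξ + η) τ s) t
          = iteratedDeriv 2 (fun τ => ξ τ s) t + iteratedDeriv 2 (fun τ => η τ s) t :=
        iteratedDeriv_fun_add ((hξ.contDiffAt_time ht s).of_le (by norm_cast))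
          ((hη.contDiffAt_time ht s).of_le (by norm_cast))
      have e2 : sphereLaplacian ((ξ + η) t) s
          = sphereLaplacian (ξ t) s + sphereLaplacian (η t) s := by
        simp only [sphereLaplacian, Pi.add_apply, radialExt_add]
        exact ((hξ.contDiffAt_space ht (coe_ne_zero s)).of_le
          (by norm_cast)).laplacian_add
          ((hη.contDiffAt_space ht (coe_ne_zero s)).of_le (by norm_cast))
      rw [e1, e2]
      have := hξ.equation t ht s
      have := hη.equation t ht s
      simp only [Pi.add_apply]
      linarith
    · intro t ht s
      simp [hξ.zero_off t ht s, hη.zero_off t ht s]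
  smul_mem' := by
    intro c ξ hξ
    refine ⟨?_, ?_, ?_⟩
    · refine (hξ.smooth.const_smul c).congr fun p _ => ?_
      simp [radialExt_smul]
    · intro t ht s
      have e1 : iteratedDeriv 2 (fun τ => (c • ξ) τ s) t
          = c * iteratedDeriv 2 (fun τ => ξ τ s) t :=
        iteratedDeriv_const_mul_field c (fun τ => ξ τ s)
      have e2 : sphereLaplacian ((c • ξ) t) s = c * sphereLaplacian (ξ t) s := by
        simp only [sphereLaplacian, Pi.smul_apply, radialExt_smul]
        exact InnerProductSpace.laplacian_smul c
          ((hξ.contDiffAt_space ht (coe_ne_zero s)).of_le (by norm_cast))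
      rw [e1, e2]
      have := hξ.equation t ht s
      simp only [Pi.smul_apply, smul_eq_mul]
      linear_combination c * this
    · intro t ht s
      simp [hξ.zero_off t ht s]

/-! ### The action of `SO(3)` and axial symmetry -/

/-- The rotation group `SO(3)`: linear isometries of `ℝ³` with determinant one. -/
def SO3 : Subgroup (E3 ≃ₗᵢ[ℝ] E3) where
  carrier := {g | LinearMap.det (g.toLinearEquiv : E3 →ₗ[ℝ] E3) = 1}
  one_mem' := LinearMap.det_id
  mul_mem' := by
    intro a b ha hb
    have : ((a * b).toLinearEquiv : E3 →ₗ[ℝ] E3)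
        = (a.toLinearEquiv : E3 →ₗ[ℝ] E3) ∘ₗ (b.toLinearEquiv : E3 →ₗ[ℝ] E3) := rfl
    simp only [Set.mem_ofPred_eq] at *
    rw [this, LinearMap.det_comp, ha, hb, one_mul]
  inv_mem' := by
    intro a ha
    simp only [Set.mem_ofPred_eq] at *
    have h : ((a⁻¹).toLinearEquiv : E3 →ₗ[ℝ] E3) ∘ₗ (a.toLinearEquiv : E3 →ₗ[ℝ] E3)
        = LinearMap.id := by
      ext1 x
      exact a.symm_apply_apply x
    have := congrArg LinearMap.det h
    rwa [LinearMap.det_comp, ha, mul_one, LinearMap.det_id] at this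

/-- The rotation `g` acting on the sphere. -/
def rotatePoint (g : E3 ≃ₗᵢ[ℝ] E3) (s : S2) : S2 :=
  ⟨g s, by rw [mem_sphere_zero_iff_norm, g.norm_map]; exact mem_sphere_zero_iff_norm.mp s.2⟩

/-- `(D(g) ξ)(t, s) = ξ(t, g⁻¹ s)`. -/
def rotateFun (g : E3 ≃ₗᵢ[ℝ] E3) (ξ : ℝ → S2 → ℝ) : ℝ → S2 → ℝ :=
  fun t s => ξ t (rotatePoint g⁻¹ s)

lemma radialExt_rotate (g : E3 ≃ₗᵢ[ℝ] E3) (f : S2 → ℝ) (x : E3) :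
    radialExt (fun s => f (rotatePoint g s)) x = radialExt f (g x) := by
  by_cases h : x = 0
  · simp [radialExt, h]
  · have h' : g x ≠ 0 := by simpa using h
    rw [radialExt, radialExt, dif_neg h, dif_neg h']
    congr 1
    ext1
    simp [rotatePoint]

lemma laplacian_comp_isometry (g : E3 ≃ₗᵢ[ℝ] E3) (f : E3 → ℝ) (x : E3) :
    (Δ (fun y => f (g y))) x = (Δ f) (g x) := by
  let v := stdOrthonormalBasis ℝ E3
  rw [congrFun (InnerProductSpace.laplacian_eq_iteratedFDeriv_orthonormalBasis
      (fun y => f (g y)) v) x,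
    congrFun (InnerProductSpace.laplacian_eq_iteratedFDeriv_orthonormalBasis f (v.map g)) (g x)]
  refine Finset.sum_congr rfl fun i _ => ?_
  have := g.toContinuousLinearEquiv.iteratedFDerivWithin_comp_right (𝕜 := ℝ) f
    (s := Set.univ) uniqueDiffOn_univ (x := x) (Set.mem_univ _) 2
  rw [Set.preimage_univ, iteratedFDerivWithin_univ, iteratedFDerivWithin_univ] at this
  have h2 : (f ∘ g.toContinuousLinearEquiv) = fun y => f (g y) := rfl
  rw [h2] at this
  rw [this, ContinuousMultilinearMap.compContinuousLinearMap_apply]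
  congr 1
  funext j
  fin_cases j <;> simp

lemma IsSolution.rotate {ξ : ℝ → S2 → ℝ} (h : IsSolution ξ) (g : E3 ≃ₗᵢ[ℝ] E3) :
    IsSolution (rotateFun g ξ) := by
  refine ⟨?_, ?_, ?_⟩
  · have hm : ContDiffOn ℝ ∞ (fun p : ℝ × E3 => (p.1, g⁻¹ p.2)) (Set.Ioo 0 Real.pi ×ˢ {0}ᶜ) :=
      (contDiff_fst.prodMk ((g⁻¹).toContinuousLinearEquiv.contDiff.comp contDiff_snd)).contDiffOn
    refine (h.smooth.comp hm ?_).congr ?_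
    · rintro ⟨t, x⟩ ⟨ht, hx⟩
      refine ⟨ht, ?_⟩
      simp only [Set.mem_compl_iff, Set.mem_singleton_iff] at hx ⊢
      simpa using hx
    · rintro ⟨t, x⟩ _
      exact radialExt_rotate g⁻¹ (ξ t) x
  · intro t ht s
    have e : sphereLaplacian (rotateFun g ξ t) s = sphereLaplacian (ξ t) (rotatePoint g⁻¹ s) := by
      have h1 : radialExt (rotateFun g ξ t) = fun x => radialExt (ξ t) (g⁻¹ x) :=
        funext fun x => radialExt_rotate g⁻¹ (ξ t) x
      rw [sphereLaplacian, h1, laplacian_comp_isometry]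
      rfl
    rw [e]
    exact h.equation t ht (rotatePoint g⁻¹ s)
  · intro t ht s
    exact h.zero_off t ht _

/-- The natural representation of rotations on the solution space. -/
def rotate (g : E3 ≃ₗᵢ[ℝ] E3) : Sol →ₗ[ℝ] Sol where
  toFun ξ := ⟨rotateFun g ξ, IsSolution.rotate ξ.2 g⟩
  map_add' _ _ := rfl
  map_smul' _ _ := rfl

/-- The axis of symmetry. -/
def axis : E3 := EuclideanSpace.single 2 1

/-- The axially symmetric solutions: those invariant under all rotations about the axis. -/
def AxiSol : Submodule ℝ Sol where
  carrier := {ξ | ∀ g ∈ SO3, g axis = axis → rotate g ξ = ξ}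
  zero_mem' := fun g _ _ => map_zero (rotate g)
  add_mem' := fun ha hb g hg hx => by rw [map_add, ha g hg hx, hb g hg hx]
  smul_mem' := fun c _ ha g hg hx => by rw [map_smul, ha g hg hx]

/-! ### Symplectic structure, complex structures, time evolution -/

/-- The time derivative. -/
def dt (ξ : ℝ → S2 → ℝ) (t : ℝ) (s : S2) : ℝ := deriv (fun τ => ξ τ s) t

/-- The symplectic form `Ω(ξ, η) = ∫_{S²} (η ∂ₜξ - ξ ∂ₜη)` with respect to the round area measure.
On solutions the integral does not depend on the time; it is evaluated at `t = π/2`. -/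
def Omega (ξ η : Sol) : ℝ :=
  ∫ s : S2, ((η : ℝ → S2 → ℝ) (Real.pi / 2) s * dt ξ (Real.pi / 2) s
    - (ξ : ℝ → S2 → ℝ) (Real.pi / 2) s * dt η (Real.pi / 2) s)
    ∂((MeasureTheory.volume : MeasureTheory.Measure E3).toSphere)

/-- `J` is an `SO(3)`-invariant complex structure on the space of solutions, compatible with the
symplectic form (symplectic, with `½ Ω(J ·, ·)` positive definite). -/
structure IsInvariantComplexStructure (J : Sol →ₗ[ℝ] Sol) : Prop where
  sq : ∀ ξ, J (J ξ) = -ξ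
  symplectic : ∀ ξ η, Omega (J ξ) (J η) = Omega ξ η
  pos : ∀ ξ, ξ ≠ 0 → 0 < Omega (J ξ) ξ
  invariant : ∀ g ∈ SO3, ∀ ξ, J (rotate g ξ) = rotate g (J ξ)

/-- `ξ' = T_{(t₁,t₀)} ξ`: the canonical data `(Q, P) = (ξ, ∂ₜξ - ½ cot t ξ)` of `ξ` at time `t₁`
are the canonical data of `ξ'` at time `t₀`. -/
def IsEvolution (t₁ t₀ : ℝ) (ξ ξ' : ℝ → S2 → ℝ) : Prop :=
  ∀ s : S2, ξ' t₀ s = ξ t₁ s ∧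
    dt ξ' t₀ s - 1 / 2 * Real.cot t₀ * ξ' t₀ s = dt ξ t₁ s - 1 / 2 * Real.cot t₁ * ξ t₁ s

/-! ### Fock representations -/

/-- The inner product `⟨ξ|η⟩_J = ½ Ω(Jξ, η) - (i/2) Ω(ξ, η)`. -/
def innerJ (J : Sol →ₗ[ℝ] Sol) (ξ η : Sol) : ℂ :=
  ((1 / 2 * Omega (J ξ) η : ℝ) : ℂ) - Complex.I * ((1 / 2 * Omega ξ η : ℝ) : ℂ)

/-- `e` is an orthonormal basis, consisting of axially symmetric solutions, of the one-particle
Hilbert space of `J`, the completion of the space of axially symmetric solutions with the complex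
structure `J` and the inner product `⟨·|·⟩_J`. Completeness is expressed by Parseval's identity. -/
structure IsOneParticleBasis (J : Sol →ₗ[ℝ] Sol) (e : ℕ → AxiSol) : Prop where
  orthonormal : ∀ k l, innerJ J (e k) (e l) = if k = l then 1 else 0
  complete : ∀ φ : AxiSol,
    HasSum (fun k => ‖innerJ J (e k) φ‖ ^ 2) (1 / 2 * Omega (J φ) φ)

/-- The symmetric Fock space over a separable Hilbert space with a chosen orthonormal basis
`(f_k)`, in the occupation number representation: `n : ℕ →₀ ℕ` labels the orthonormal basis vector
`|n⟩` with `n k` particles in the state `f_k`. -/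
abbrev Fock : Type := lp (fun _ : ℕ →₀ ℕ => ℂ) 2

/-- The creation operator `C(f) = ∑ₖ fₖ aₖ†`, where `aₖ† |n⟩ = √(n k + 1) |n + δₖ⟩`. -/
def creation (f : ℕ → ℂ) (ψ : (ℕ →₀ ℕ) → ℂ) (n : ℕ →₀ ℕ) : ℂ :=
  ∑ k ∈ n.support, f k * (Real.sqrt (n k) : ℂ) * ψ (n - Finsupp.single k 1)

/-- The annihilation operator `A(f) = ∑ₖ f̄ₖ aₖ`, where `aₖ |n⟩ = √(n k) |n - δₖ⟩`. -/
def annihilation (f : ℕ → ℂ) (ψ : (ℕ →₀ ℕ) → ℂ) (n : ℕ →₀ ℕ) : ℂ :=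
  ∑' k, star (f k) * (Real.sqrt (n k + 1) : ℂ) * ψ (n + Finsupp.single k 1)

/-- The fundamental observable `i (A(f) - C(f))`. -/
def fieldOperator (f : ℕ → ℂ) (ψ : (ℕ →₀ ℕ) → ℂ) : (ℕ →₀ ℕ) → ℂ :=
  fun n => Complex.I * (annihilation f ψ n - creation f ψ n)

/-- States with a bounded number of particles. -/
def FiniteParticle (ψ : Fock) : Prop := ∃ N : ℕ, ∀ n : ℕ →₀ ℕ, N < n.degree → ψ n = 0

/-- The unitary operator `V` is `exp (i (i (A(f) - C(f))))`: on the (dense) subspace of states with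
a bounded number of particles, which are analytic vectors, it is given by the norm convergent
exponential series. -/
def IsWeylOperator (f : ℕ → ℂ) (V : Fock ≃ₗᵢ[ℂ] Fock) : Prop :=
  ∀ ψ : Fock, FiniteParticle ψ → ∃ v : ℕ → Fock,
    (∀ m, (v m : (ℕ →₀ ℕ) → ℂ)
      = (fun χ : (ℕ →₀ ℕ) → ℂ => Complex.I • fieldOperator f χ)^[m] ψ) ∧
    HasSum (fun m => ((m.factorial : ℂ))⁻¹ • v m) (V ψ)

/-- `π` gives the Weyl operators `π(W(φ)) = exp (i Ω̂(φ, ·))`, `φ` an axially symmetric solution, of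
the Fock representation defined by the complex structure `J`, with
`Ω̂(φ, ·) = i (A(φ) - C(φ))` on the symmetric Fock space over the one-particle Hilbert space of `J`
(written in some orthonormal basis of the latter). -/
def IsFockRepresentation (J : Sol →ₗ[ℝ] Sol) (π : AxiSol → (Fock ≃ₗᵢ[ℂ] Fock)) : Prop :=
  ∃ e : ℕ → AxiSol, IsOneParticleBasis J e ∧
    ∀ φ : AxiSol, IsWeylOperator (fun k => innerJ J (e k) φ) (π φ)

/-- The Fock representations of the Weyl algebra defined by `J` and `J'` exist and are unitarily
equivalent. -/
def FockEquivalent (J J' : Sol →ₗ[ℝ] Sol) : Prop :=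
  ∃ π π' : AxiSol → (Fock ≃ₗᵢ[ℂ] Fock),
    IsFockRepresentation J π ∧ IsFockRepresentation J' π' ∧
    ∃ U : Fock ≃ₗᵢ[ℂ] Fock, ∀ (φ : AxiSol) (ψ : Fock), U (π φ ψ) = π' φ (U ψ)

/-- The classical time evolution is unitarily implementable in the Fock representation defined by
`J`: for all `t₀, t₁` there is a unitary `U` with `U⁻¹ π(W(φ)) U = π(W(T_{(t₁,t₀)} φ))`. -/
def UnitaryDynamics (J : Sol →ₗ[ℝ] Sol) : Prop :=
  ∃ π : AxiSol → (Fock ≃ₗᵢ[ℂ] Fock), IsFockRepresentation J π ∧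
    ∀ t₀ ∈ Set.Ioo 0 Real.pi, ∀ t₁ ∈ Set.Ioo 0 Real.pi,
      ∃ U : Fock ≃ₗᵢ[ℂ] Fock, ∀ φ φ' : AxiSol,
        IsEvolution t₁ t₀ (φ : Sol) (φ' : Sol) →
          ∀ ψ : Fock, U.symm (π φ (U ψ)) = π φ' ψ

/-! ### The parameters of an invariant complex structure -/

/-- Solutions of Legendre's recurrence `(ℓ+2) R_{ℓ+2} = (2ℓ+3) x R_{ℓ+1} - (ℓ+1) R_ℓ` with given
`R₀` and `R₁`. -/
def legendreRec (R₀ R₁ x : ℝ) : ℕ → ℝ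
  | 0 => R₀
  | 1 => R₁
  | ℓ + 2 => ((2 * ℓ + 3) * x * legendreRec R₀ R₁ x (ℓ + 1)
      - (ℓ + 1) * legendreRec R₀ R₁ x ℓ) / (ℓ + 2)

/-- The Legendre polynomial `P_ℓ(x)`. -/
def legendreP (ℓ : ℕ) (x : ℝ) : ℝ := legendreRec 1 x x ℓ

/-- The Legendre function of the second kind `Q_ℓ(x)`, `-1 < x < 1`. -/
def legendreQ (ℓ : ℕ) (x : ℝ) : ℝ :=
  legendreRec (1 / 2 * Real.log ((1 + x) / (1 - x)))
    (x * (1 / 2 * Real.log ((1 + x) / (1 - x))) - 1) x ℓ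

/-- `ũ_{0ℓ}(t) = √(sin t) P_ℓ(cos t) / √2`. -/
def u₀ (ℓ : ℕ) (t : ℝ) : ℝ := Real.sqrt (Real.sin t) * (legendreP ℓ (Real.cos t) / Real.sqrt 2)

/-- `ṽ_{0ℓ}(t) = √(sin t) Q_ℓ(cos t) / √2`. -/
def v₀ (ℓ : ℕ) (t : ℝ) : ℝ := Real.sqrt (Real.sin t) * (legendreQ ℓ (Real.cos t) / Real.sqrt 2)

/-- The spherical harmonic `Y_{ℓ0} = √((2ℓ+1)/(4π)) P_ℓ(cos θ)`. -/
def Yl0 (ℓ : ℕ) (s : S2) : ℝ :=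
  Real.sqrt ((2 * ℓ + 1) / (4 * Real.pi)) * legendreP ℓ ((s : E3) 2)

/-- The solution `ξ` is the mode `z(t) Y_{ℓ0}(s)`. -/
def IsMode (ξ : Sol) (z : ℝ → ℝ) (ℓ : ℕ) : Prop :=
  ∀ t ∈ Set.Ioo 0 Real.pi, ∀ s : S2, (ξ : ℝ → S2 → ℝ) t s = z t * Yl0 ℓ s

/-- `J` is the complex structure with parameters `(ρ_ℓ, ν_ℓ)`: with
`z_ℓ = ρ_ℓ ũ_{0ℓ} + (ν_ℓ + i ρ_ℓ⁻¹) ṽ_{0ℓ}`, the complex linear extension of `J` satisfies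
`J (z_ℓ Y_{ℓ0}) = i z_ℓ Y_{ℓ0}`; in terms of the real part `x` and the imaginary part `y` of
`z_ℓ Y_{ℓ0}` this reads `J x = -y`, `J y = x`. -/
def HasParameters (J : Sol →ₗ[ℝ] Sol) (ρ ν : ℕ → ℝ) : Prop :=
  ∀ ℓ, 0 < ρ ℓ ∧ ∃ x y : Sol,
    IsMode x (fun t => ρ ℓ * u₀ ℓ t + ν ℓ * v₀ ℓ t) ℓ ∧
    IsMode y (fun t => (ρ ℓ)⁻¹ * v₀ ℓ t) ℓ ∧
    J x = -y ∧ J y = x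

/-- The parameters of `J` satisfy `ρ_ℓ = √(π/2) + x_ℓ > 0` with `(x_ℓ) ∈ ℓ²` and `(ν_ℓ) ∈ ℓ²`. -/
def HasSummableParameters (J : Sol →ₗ[ℝ] Sol) : Prop :=
  ∃ ρ ν : ℕ → ℝ, HasParameters J ρ ν ∧
    Summable (fun ℓ => (ρ ℓ - Real.sqrt (Real.pi / 2)) ^ 2) ∧
    Summable (fun ℓ => ν ℓ ^ 2)

end Gowdy

end

noncomputable section
namespace Gowdy

/-! ### Legendre functions -/

/-! Expansion in the zonal harmonics decouples the problem. The coefficient of `Yl0 l` is an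
oscillator with squared frequency (l + 1/2)² + 1/(4 sin² t), solved by `u₀ l` and `v₀ l`, and
Parseval's identity turns Ω into a sum of Wronskians. Rotation invariance forces J to preserve every
zonal mode (`isMode_map`). This is Schur's lemma, carried out with finite sums of rotations because
J is not assumed continuous. Positivity and J² = -1 then produce the parameters (`exists_param`),
and in the complex coordinate attached to z_l the map J is multiplication by i. A time evolution,
and likewise the passage from J to J', acts on these coordinates one mode at a time by f_l ↦ α_l f_l
+ β_l f̄_l with |α_l|² - |β_l|² = 1.

On the quantum side, such a diagonal transformation is implemented by a unitary exactly when ∑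
|β_l|² < ∞ (Shale's criterion). Sufficiency is `exists_implementer`. Each mode has an explicit
squeezing matrix whose vacuum entry c_l satisfies 1 - |β_l|² ≤ c_l ≤ 1, and the product of these
operators over all modes converges strongly because the vacuum overlaps multiply to a convergent
product. Necessity is `summable_of_implemented`. The transformed vacuum is annihilated by ᾱ_l A(F_l)
- β_l C(F_l). Hence it cannot be orthogonal to the vacuum, and its pair amplitudes are (β_l/ᾱ_l)
times that overlap, up to conjugation. Amplitudes of this kind are square summable over any
orthonormal system.

On the classical side, z_l is split into an incoming amplitude w_l and an outgoing amplitude v_l of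
frequency λ_l = l + 1/2. After removal of the phases they vary by a relative amount O(1/λ_l) on
compact time intervals, so that |β_l(t₁,t₀)| = |w_l| |v_l| |sin λ_l(t₁ - t₀)| + O(|w_l|²/λ_l), the
amplitudes being taken at t = π/2 (`exists_evB_bound`). Since |w_l|² = 2 + |v_l|², summability of
|v_l|² makes every evolution implementable. Conversely, for t₁ - t₀ = π/2 the sine has modulus √2/2
for every l, so this single evolution recovers the summability of |v_l|².

At t = π/2 the Legendre functions are evaluated at 0, where Wallis' product applies. It gives
2|v_l|² = (ρ_l κ_l - 1/(ρ_l κ_l))² + ν_l²/κ_l² with κ_l √(π/2) = 1 + O(1/λ_l) (`exists_kappa`), and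
summability of this expression is condition (*). For two parameter families satisfying (*) the
coefficient β_l of the change of frame is explicit in the parameters and square summable
(`summable_bogB_change`), which gives (2). Statement (3) combines (1) and (2). -/

/-- The value `Q₀(x) = ½ log ((1 + x) / (1 - x))`. -/
def artanhLog (x : ℝ) : ℝ := 1 / 2 * Real.log ((1 + x) / (1 - x))

lemma hasDerivAt_artanhLog {x : ℝ} (hx : x ∈ Set.Ioo (-1 : ℝ) 1) :
    HasDerivAt artanhLog (1 / (1 - x ^ 2)) x := by
  have h1 : (1 : ℝ) + x ≠ 0 := by linarith [hx.1]
  have h2 : (1 : ℝ) - x ≠ 0 := by linarith [hx.2]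
  have h3 : (1 : ℝ) - x ^ 2 ≠ 0 := by
    have : (1 : ℝ) - x ^ 2 = (1 + x) * (1 - x) := by ring
    rw [this]; exact mul_ne_zero h1 h2
  have hd : HasDerivAt (fun y : ℝ => (1 + y) / (1 - y))
      ((1 * (1 - x) - (1 + x) * (-1)) / (1 - x) ^ 2) x :=
    ((hasDerivAt_id x).const_add 1).div ((hasDerivAt_id x).const_sub 1) h2
  have := (hd.log (div_ne_zero h1 h2)).const_mul (1 / 2)
  refine this.congr_deriv ?_
  have h4 : (1 : ℝ) - x ^ 2 = (1 + x) * (1 - x) := by ring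
  rw [h4]
  field_simp
  ring

lemma legendreRec_succ_succ (R₀ R₁ x : ℝ) (l : ℕ) :
    ((l : ℝ) + 2) * legendreRec R₀ R₁ x (l + 2)
      = (2 * l + 3) * x * legendreRec R₀ R₁ x (l + 1) - (l + 1) * legendreRec R₀ R₁ x l := by
  have : ((l : ℝ) + 2) ≠ 0 := by positivity
  rw [legendreRec]
  field_simp

lemma legendreQ_eq (l : ℕ) (x : ℝ) :
    legendreQ l x = legendreRec (artanhLog x) (x * artanhLog x - 1) x l := rfl

/-- The derivative of a solution `R` of Legendre's recurrence. -/
def legendreD (R : ℕ → ℝ → ℝ) (l : ℕ) (x : ℝ) : ℝ :=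
  (l + 1) * (x * R l x - R (l + 1) x) / (1 - x ^ 2)

/-- Families of functions on `(-1, 1)` that satisfy the recurrences of the Legendre functions. -/
structure IsLegendre (R : ℕ → ℝ → ℝ) : Prop where
  recur : ∀ (l : ℕ) (x : ℝ), ((l : ℝ) + 2) * R (l + 2) x = (2 * l + 3) * x * R (l + 1) x - (l + 1) * R l x
  deriv_zero : ∀ x ∈ Set.Ioo (-1 : ℝ) 1, HasDerivAt (R 0) (legendreD R 0 x) x
  deriv_one : ∀ x ∈ Set.Ioo (-1 : ℝ) 1, HasDerivAt (R 1) ((R 0 x - x * R 1 x) / (1 - x ^ 2)) x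

lemma one_sub_sq_pos {x : ℝ} (hx : x ∈ Set.Ioo (-1 : ℝ) 1) : 0 < 1 - x ^ 2 := by
  nlinarith [hx.1, hx.2]

lemma isLegendre_P : IsLegendre legendreP := by
  refine ⟨fun l x => legendreRec_succ_succ _ _ _ _, fun x hx => ?_, fun x hx => ?_⟩
  · have : legendreP 0 = fun _ => 1 := rfl
    rw [this]
    refine (hasDerivAt_const x (1 : ℝ)).congr_deriv ?_
    simp [legendreD, legendreP, legendreRec]
  · have : legendreP 1 = fun x => x := rfl
    rw [this]
    refine (hasDerivAt_id x).congr_deriv ?_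
    have := (one_sub_sq_pos hx).ne'
    simp only [legendreP, legendreRec]
    field_simp

lemma isLegendre_Q : IsLegendre legendreQ := by
  refine ⟨fun l x => legendreRec_succ_succ _ _ _ _, fun x hx => ?_, fun x hx => ?_⟩
  · have : legendreQ 0 = artanhLog := rfl
    rw [this]
    refine (hasDerivAt_artanhLog hx).congr_deriv ?_
    simp [legendreD, legendreQ_eq, legendreRec]
  · have : legendreQ 1 = fun x => x * artanhLog x - 1 := rfl
    rw [this]
    refine (((hasDerivAt_id x).mul (hasDerivAt_artanhLog hx)).sub_const 1).congr_deriv ?_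
    have := (one_sub_sq_pos hx).ne'
    simp only [legendreQ_eq, legendreRec, id]
    field_simp
    ring

namespace IsLegendre

variable {R : ℕ → ℝ → ℝ}

/-- The two classical first order formulas, through the upper and through the lower neighbour, must
be carried through the induction together: the recurrence converts the lower form at l + 1 into the
upper form, and differentiating the recurrence yields the lower form at l + 2. -/
lemma hasDerivAt_aux (hR : IsLegendre R) (l : ℕ) {x : ℝ} (hx : x ∈ Set.Ioo (-1 : ℝ) 1) :
    HasDerivAt (R l) (legendreD R l x) x ∧
    HasDerivAt (R (l + 1)) ((l + 1) * (R l x - x * R (l + 1) x) / (1 - x ^ 2)) x := by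
  have hne := (one_sub_sq_pos hx).ne'
  induction l with
  | zero => exact ⟨hR.deriv_zero x hx, (hR.deriv_one x hx).congr_deriv (by simp)⟩
  | succ l ih =>
    obtain ⟨h0, h1⟩ := ih
    have hl : ((l : ℝ) + 2) ≠ 0 := by positivity
    have r := hR.recur l x
    have h1' : HasDerivAt (R (l + 1)) (legendreD R (l + 1) x) x := by
      refine h1.congr_deriv ?_
      rw [legendreD]
      push_cast
      congr 1
      linear_combination r
    refine ⟨h1', ?_⟩
    have e : R (l + 2) = fun x => ((2 * l + 3) * x * R (l + 1) x - (l + 1) * R l x) / (l + 2) := by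
      funext y
      have := hR.recur l y
      field_simp
      linear_combination this
    have hd := ((((hasDerivAt_id x).const_mul (2 * (l : ℝ) + 3)).mul h1).sub
      (h0.const_mul ((l : ℝ) + 1))).div_const ((l : ℝ) + 2)
    show HasDerivAt (R (l + 2)) _ x
    rw [e]
    refine hd.congr_deriv ?_
    have e2 : R (l + 2) x = ((2 * l + 3) * x * R (l + 1) x - (l + 1) * R l x) / (l + 2) :=
      congrFun e x
    simp only [legendreD, id]
    push_cast
    field_simp
    ring

lemma hasDerivAt (hR : IsLegendre R) (l : ℕ) {x : ℝ} (hx : x ∈ Set.Ioo (-1 : ℝ) 1) :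
    HasDerivAt (R l) (legendreD R l x) x := (hR.hasDerivAt_aux l hx).1

/-- Legendre's equation, solved for the second derivative. Only the first order formulas enter, so P
and Q are treated at once. -/
lemma hasDerivAt_D (hR : IsLegendre R) (l : ℕ) {x : ℝ} (hx : x ∈ Set.Ioo (-1 : ℝ) 1) :
    HasDerivAt (legendreD R l)
      ((2 * x * legendreD R l x - l * (l + 1) * R l x) / (1 - x ^ 2)) x := by
  have hne := (one_sub_sq_pos hx).ne'
  obtain ⟨h0, h1⟩ := hR.hasDerivAt_aux l hx
  have hden : HasDerivAt (fun y : ℝ => 1 - y ^ 2) (-(2 * x)) x := by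
    simpa using ((hasDerivAt_pow 2 x).const_sub 1)
  have := ((((hasDerivAt_id x).mul h0).sub h1).const_mul ((l : ℝ) + 1)).div hden hne
  refine this.congr_deriv ?_
  simp only [legendreD, id, Pi.mul_apply, Pi.sub_apply]
  field_simp
  ring

lemma contDiffAt (hR : IsLegendre R) (l : ℕ) {x : ℝ}
    (h0 : ContDiffAt ℝ ∞ (R 0) x) (h1 : ContDiffAt ℝ ∞ (R 1) x) : ContDiffAt ℝ ∞ (R l) x := by
  have : ∀ l, ContDiffAt ℝ ∞ (R l) x ∧ ContDiffAt ℝ ∞ (R (l + 1)) x := by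
    intro l
    induction l with
    | zero => exact ⟨h0, h1⟩
    | succ l ih =>
      refine ⟨ih.2, ?_⟩
      have e : R (l + 2) = fun x =>
          ((2 * l + 3) * x * R (l + 1) x - (l + 1) * R l x) / (l + 2) := by
        funext y
        have := hR.recur l y
        field_simp
        linear_combination this
      show ContDiffAt ℝ ∞ (R (l + 2)) x
      rw [e]
      exact (((contDiffAt_const.mul contDiffAt_id).mul ih.2).sub
        (contDiffAt_const.mul ih.1)).div_const _
  exact (this l).1

end IsLegendre

lemma contDiff_legendreP (l : ℕ) : ContDiff ℝ ∞ (legendreP l) := by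
  have : ∀ l, ContDiff ℝ ∞ (legendreP l) ∧ ContDiff ℝ ∞ (legendreP (l + 1)) := by
    intro l
    induction l with
    | zero => exact ⟨contDiff_const, contDiff_id⟩
    | succ l ih =>
      refine ⟨ih.2, ?_⟩
      have e : legendreP (l + 2) = fun x =>
          ((2 * l + 3) * x * legendreP (l + 1) x - (l + 1) * legendreP l x) / (l + 2) := by
        funext y
        have := isLegendre_P.recur l y
        field_simp
        linear_combination this
      show ContDiff ℝ ∞ (legendreP (l + 2))
      rw [e]
      exact (((contDiff_const.mul contDiff_id).mul ih.2).sub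
        (contDiff_const.mul ih.1)).div_const _
  exact (this l).1

lemma contDiffAt_legendreQ (l : ℕ) {x : ℝ} (hx : x ∈ Set.Ioo (-1 : ℝ) 1) :
    ContDiffAt ℝ ∞ (legendreQ l) x := by
  have h0 : ContDiffAt ℝ ∞ artanhLog x := by
    have h1 : (1 : ℝ) + x ≠ 0 := by linarith [hx.1]
    have h2 : (1 : ℝ) - x ≠ 0 := by linarith [hx.2]
    exact contDiffAt_const.mul (((contDiffAt_const.add contDiffAt_id).div
      (contDiffAt_const.sub contDiffAt_id) h2).log (div_ne_zero h1 h2))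
  exact isLegendre_Q.contDiffAt l h0 ((contDiffAt_id.mul h0).sub contDiffAt_const)

lemma legendreP_one (l : ℕ) : legendreP l 1 = 1 := by
  have : ∀ l, legendreP l 1 = 1 ∧ legendreP (l + 1) 1 = 1 := by
    intro l
    induction l with
    | zero => simp [legendreP, legendreRec]
    | succ l ih =>
      refine ⟨ih.2, ?_⟩
      have := isLegendre_P.recur l 1
      rw [ih.1, ih.2] at this
      have hl : ((l : ℝ) + 2) ≠ 0 := by positivity
      apply mul_left_cancel₀ hl
      show ((l : ℝ) + 2) * legendreP (l + 2) 1 = _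
      rw [this]; ring
  exact (this l).1

/-- The discrete Wronskian of two solutions of one three term recurrence is conserved; at l = 0 it
is x Q₀ - (x Q₀ - 1) = 1. -/
lemma legendre_casoratian (l : ℕ) (x : ℝ) :
    ((l : ℝ) + 1) * (legendreP (l + 1) x * legendreQ l x - legendreP l x * legendreQ (l + 1) x)
      = 1 := by
  induction l with
  | zero => simp [legendreP, legendreQ, legendreRec]
  | succ l ih =>
    have hP := isLegendre_P.recur l x
    have hQ := isLegendre_Q.recur l x
    push_cast
    show ((l : ℝ) + 1 + 1) * (legendreP (l + 2) x * legendreQ (l + 1) x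
      - legendreP (l + 1) x * legendreQ (l + 2) x) = 1
    linear_combination ih + legendreQ (l + 1) x * hP - legendreP (l + 1) x * hQ

lemma legendre_wronskian (l : ℕ) {x : ℝ} (hx : x ∈ Set.Ioo (-1 : ℝ) 1) :
    (1 - x ^ 2) * (legendreP l x * legendreD legendreQ l x
      - legendreD legendreP l x * legendreQ l x) = 1 := by
  have hne := (one_sub_sq_pos hx).ne'
  have := legendre_casoratian l x
  rw [legendreD, legendreD]
  field_simp
  linear_combination this

/-- Every polynomial function is a linear combination of Legendre polynomials. -/
lemma exists_legendre_expansion (p : Polynomial ℝ) :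
    ∃ (n : ℕ) (c : ℕ → ℝ), ∀ x : ℝ, p.eval x = ∑ l ∈ Finset.range n, c l * legendreP l x := by
  have key : ∀ k : ℕ, (fun x : ℝ => x ^ k) ∈ Submodule.span ℝ (Set.range legendreP) := by
    intro k
    -- The recurrence writes x P_{l+1} through P_{l+2} and P_l, so the span is stable under
    -- multiplication by x and contains all monomials.
    have mulX : ∀ f ∈ Submodule.span ℝ (Set.range legendreP),
        (fun x : ℝ => x * f x) ∈ Submodule.span ℝ (Set.range legendreP) := by
      intro f hf
      induction hf using Submodule.span_induction with
      | mem f h =>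
        obtain ⟨l, rfl⟩ := h
        cases l with
        | zero =>
          refine Submodule.subset_span ⟨1, ?_⟩
          funext x; simp [legendreP, legendreRec]
        | succ l =>
          have e : (fun x : ℝ => x * legendreP (l + 1) x)
              = (((l : ℝ) + 2) / (2 * l + 3)) • legendreP (l + 2)
                + (((l : ℝ) + 1) / (2 * l + 3)) • legendreP l := by
            funext x
            have := isLegendre_P.recur l x
            simp only [Pi.add_apply, Pi.smul_apply, smul_eq_mul]
            field_simp
            linear_combination -this
          rw [e]
          exact Submodule.add_mem _ (Submodule.smul_mem _ _ (Submodule.subset_span ⟨_, rfl⟩))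
            (Submodule.smul_mem _ _ (Submodule.subset_span ⟨_, rfl⟩))
      | zero =>
        have : (fun x : ℝ => x * (0 : ℝ → ℝ) x) = 0 := by funext x; simp
        rw [this]; exact Submodule.zero_mem _
      | add f g _ _ hf hg =>
        have : (fun x : ℝ => x * (f + g) x) = (fun x => x * f x) + fun x => x * g x := by
          funext x; simp [mul_add]
        rw [this]; exact Submodule.add_mem _ hf hg
      | smul c f _ hf =>
        have : (fun x : ℝ => x * (c • f) x) = c • fun x => x * f x := by
          funext x; simp only [Pi.smul_apply, smul_eq_mul]; ring
        rw [this]; exact Submodule.smul_mem _ _ hf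
    induction k with
    | zero =>
      refine Submodule.subset_span ⟨0, ?_⟩
      funext x; simp [legendreP, legendreRec]
    | succ k ih =>
      have := mulX _ ih
      simpa only [pow_succ'] using this
  have hp : (fun x => p.eval x) ∈ Submodule.span ℝ (Set.range legendreP) := by
    have : (fun x => p.eval x) = ∑ k ∈ Finset.range (p.natDegree + 1),
        p.coeff k • fun x : ℝ => x ^ k := by
      funext x
      simp [Polynomial.eval_eq_sum_range]
    rw [this]
    exact Submodule.sum_mem _ fun k _ => Submodule.smul_mem _ _ (key k)
  rw [Finsupp.mem_span_range_iff_exists_finsupp] at hp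
  obtain ⟨c, hc⟩ := hp
  refine ⟨c.support.sup id + 1, c, fun x => ?_⟩
  have := congrFun hc x
  rw [← this, Finsupp.sum, Finset.sum_apply]
  simp only [Pi.smul_apply, smul_eq_mul]
  refine Finset.sum_subset (fun l hl => ?_) (fun l _ hl => ?_)
  · exact Finset.mem_range_succ_iff.mpr (Finset.le_sup (f := id) hl)
  · simp [Finsupp.notMem_support_iff.mp hl]


/-! ### Rotations about the coordinate axes -/

/-- The coordinate unit vectors. -/
def ev (i : Fin 3) : E3 := EuclideanSpace.single i 1

lemma ev_apply (i j : Fin 3) : ev i j = if j = i then 1 else 0 := by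
  simp [ev]

lemma eq_sum_ev (x : E3) : x = x 0 • ev 0 + x 1 • ev 1 + x 2 • ev 2 := by
  ext j; fin_cases j <;> simp [ev_apply]

/-- The generator `x ↦ eᵢ × x` of the rotations about the `i`-th axis. -/
def gen (i : Fin 3) : E3 →L[ℝ] E3 :=
  LinearMap.toContinuousLinearMap
    { toFun := fun x => -(x (i + 2)) • ev (i + 1) + x (i + 1) • ev (i + 2)
      map_add' := fun x y => by simp only [PiLp.add_apply]; module
      map_smul' := fun c x => by simp only [PiLp.smul_apply, smul_eq_mul, RingHom.id_apply]; module }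

lemma gen_apply (i : Fin 3) (x : E3) :
    gen i x = -(x (i + 2)) • ev (i + 1) + x (i + 1) • ev (i + 2) := rfl

/-- The rotation by the angle `a` about the `i`-th axis, as a function. -/
def rotVec (i : Fin 3) (a : ℝ) (x : E3) : E3 :=
  x i • ev i + Real.cos a • (x (i + 1) • ev (i + 1) + x (i + 2) • ev (i + 2)) + Real.sin a • gen i x

lemma rotVec_apply (i : Fin 3) (a : ℝ) (x : E3) :
    rotVec i a x i = x i ∧
    rotVec i a x (i + 1) = Real.cos a * x (i + 1) - Real.sin a * x (i + 2) ∧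
    rotVec i a x (i + 2) = Real.sin a * x (i + 1) + Real.cos a * x (i + 2) := by
  fin_cases i <;> simp [rotVec, gen_apply, ev_apply] <;> ring_nf <;> simp

lemma ext_axis (i : Fin 3) {x y : E3} (h0 : x i = y i) (h1 : x (i + 1) = y (i + 1))
    (h2 : x (i + 2) = y (i + 2)) : x = y := by
  ext j
  fin_cases i <;> fin_cases j <;> simp_all

lemma rotVec_add (i : Fin 3) (a b : ℝ) (x : E3) :
    rotVec i (a + b) x = rotVec i a (rotVec i b x) := by
  obtain ⟨p0, p1, p2⟩ := rotVec_apply i (a + b) x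
  obtain ⟨q0, q1, q2⟩ := rotVec_apply i a (rotVec i b x)
  obtain ⟨r0, r1, r2⟩ := rotVec_apply i b x
  rw [r1, r2] at q1 q2
  apply ext_axis i
  · rw [p0, q0, r0]
  · rw [p1, q1, Real.cos_add, Real.sin_add]; ring
  · rw [p2, q2, Real.cos_add, Real.sin_add]; ring

lemma rotVec_zero (i : Fin 3) (x : E3) : rotVec i 0 x = x := by
  obtain ⟨p0, p1, p2⟩ := rotVec_apply i 0 x
  apply ext_axis i
  · rw [p0]
  · rw [p1]; simp
  · rw [p2]; simp

lemma norm_sq_axis (i : Fin 3) (x : E3) :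
    ‖x‖ ^ 2 = x i ^ 2 + x (i + 1) ^ 2 + x (i + 2) ^ 2 := by
  rw [EuclideanSpace.norm_sq_eq, Fin.sum_univ_three]
  simp only [Real.norm_eq_abs, sq_abs]
  fin_cases i <;> simp <;> ring

/-- The rotation by the angle `a` about the `i`-th axis. -/
def rot (i : Fin 3) (a : ℝ) : E3 ≃ₗᵢ[ℝ] E3 where
  toFun := rotVec i a
  invFun := rotVec i (-a)
  left_inv x := by rw [← rotVec_add, neg_add_cancel, rotVec_zero]
  right_inv x := by rw [← rotVec_add, add_neg_cancel, rotVec_zero]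
  map_add' x y := by simp only [rotVec, map_add, PiLp.add_apply]; module
  map_smul' c x := by
    simp only [rotVec, map_smul, PiLp.smul_apply, smul_eq_mul, RingHom.id_apply]; module
  norm_map' x := by
    have : ‖rotVec i a x‖ ^ 2 = ‖x‖ ^ 2 := by
      obtain ⟨p0, p1, p2⟩ := rotVec_apply i a x
      rw [norm_sq_axis i, norm_sq_axis i, p0, p1, p2]
      linear_combination (x (i + 1) ^ 2 + x (i + 2) ^ 2) * Real.sin_sq_add_cos_sq a
    exact (sq_eq_sq₀ (norm_nonneg _) (norm_nonneg _)).mp this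

lemma rot_apply (i : Fin 3) (a : ℝ) (x : E3) : rot i a x = rotVec i a x := rfl

lemma rot_add (i : Fin 3) (a b : ℝ) : rot i (a + b) = rot i a * rot i b := by
  ext1 x; exact rotVec_add i a b x

lemma rot_zero (i : Fin 3) : rot i 0 = 1 := by
  ext1 x; exact rotVec_zero i x

lemma rot_inv (i : Fin 3) (a : ℝ) : (rot i a)⁻¹ = rot i (-a) := by
  rw [inv_eq_iff_mul_eq_one, ← rot_add, add_neg_cancel, rot_zero]

lemma rot_mem_SO3 (i : Fin 3) (a : ℝ) : rot i a ∈ SO3 := by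
  show LinearMap.det ((rot i a).toLinearEquiv : E3 →ₗ[ℝ] E3) = 1
  rw [← LinearMap.det_toMatrix (EuclideanSpace.basisFun (Fin 3) ℝ).toBasis, Matrix.det_fin_three]
  simp only [LinearMap.toMatrix_apply, OrthonormalBasis.coe_toBasis,
    OrthonormalBasis.coe_toBasis_repr_apply, EuclideanSpace.basisFun_repr,
    EuclideanSpace.basisFun_apply]
  have h : ∀ j k : Fin 3, ((rot i a).toLinearEquiv : E3 →ₗ[ℝ] E3) (EuclideanSpace.single j 1) k
      = rotVec i a (ev j) k := fun _ _ => rfl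
  simp only [h]
  have hs := Real.sin_sq_add_cos_sq a
  fin_cases i <;> simp [rotVec, gen_apply, ev_apply] <;> nlinarith [hs]

lemma hasDerivAt_rotVec (i : Fin 3) (a : ℝ) (x : E3) :
    HasDerivAt (fun a => rotVec i a x) (gen i (rotVec i a x)) a := by
  have h := ((((Real.hasDerivAt_cos a).smul_const
    (x (i + 1) • ev (i + 1) + x (i + 2) • ev (i + 2))).const_add (x i • ev i))).add
    ((Real.hasDerivAt_sin a).smul_const (gen i x))
  refine h.congr_deriv ?_
  obtain ⟨p0, p1, p2⟩ := rotVec_apply i a x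
  rw [gen_apply i (rotVec i a x), p1, p2, gen_apply]
  module

/-! ### The sphere Laplacian through rotations -/

/-- Smooth functions on the sphere. -/
def SmoothS (f : S2 → ℝ) : Prop := ContDiffOn ℝ ∞ (radialExt f) {0}ᶜ

lemma SmoothS.contDiffAt {f : S2 → ℝ} (hf : SmoothS f) {x : E3} (hx : x ≠ 0) :
    ContDiffAt ℝ ∞ (radialExt f) x :=
  ContDiffOn.contDiffAt hf (isOpen_compl_singleton.mem_nhds hx)

/-- The derivative of a function on the sphere along the rotations about the `i`-th axis. -/
def angDeriv (i : Fin 3) (f : S2 → ℝ) (s : S2) : ℝ :=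
  deriv (fun a => f (rotatePoint (rot i a) s)) 0

lemma radialExt_pos_smul (f : S2 → ℝ) {r : ℝ} (hr : 0 < r) (x : E3) :
    radialExt f (r • x) = radialExt f x := by
  by_cases hx : x = 0
  · simp [hx]
  · have h' : r • x ≠ 0 := smul_ne_zero hr.ne' hx
    rw [radialExt, radialExt, dif_neg hx, dif_neg h']
    congr 1
    ext1
    have : ‖r • x‖⁻¹ • r • x = ‖x‖⁻¹ • x := by
      rw [norm_smul, Real.norm_of_nonneg hr.le, smul_smul]
      congr 1
      have := norm_ne_zero_iff.mpr hx
      field_simp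
    exact this

/-- The point of the sphere in the direction of `x ≠ 0`. -/
def dirPt (x : E3) (hx : x ≠ 0) : S2 := ⟨‖x‖⁻¹ • x, by
  rw [mem_sphere_zero_iff_norm, norm_smul, norm_inv, norm_norm,
      inv_mul_cancel₀ (norm_ne_zero_iff.mpr hx)]⟩

lemma radialExt_of_ne (f : S2 → ℝ) {x : E3} (hx : x ≠ 0) : radialExt f x = f (dirPt x hx) := by
  rw [radialExt, dif_neg hx]; rfl

lemma apply_rotatePoint (f : S2 → ℝ) (g : E3 ≃ₗᵢ[ℝ] E3) (s : S2) :
    f (rotatePoint g s) = radialExt f (g s) := (radialExt_coe f (rotatePoint g s)).symm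

lemma rot_ne_zero (i : Fin 3) (a : ℝ) {x : E3} (hx : x ≠ 0) : rotVec i a x ≠ 0 := by
  rw [← rot_apply]
  intro h
  exact hx ((rot i a).map_eq_zero_iff.mp h)

lemma hasDerivAt_radialExt_rot {f : S2 → ℝ} (hf : SmoothS f) (i : Fin 3) (a : ℝ) {x : E3}
    (hx : x ≠ 0) :
    HasDerivAt (fun a => radialExt f (rotVec i a x))
      (fderiv ℝ (radialExt f) (rotVec i a x) (gen i (rotVec i a x))) a := by
  have h : HasFDerivAt (radialExt f) (fderiv ℝ (radialExt f) (rotVec i a x)) (rotVec i a x) :=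
    ((hf.contDiffAt (rot_ne_zero i a hx)).differentiableAt (by simp)).hasFDerivAt
  exact h.comp_hasDerivAt a (hasDerivAt_rotVec i a x)

lemma angDeriv_eq {f : S2 → ℝ} (hf : SmoothS f) (i : Fin 3) (s : S2) :
    angDeriv i f s = fderiv ℝ (radialExt f) s (gen i s) := by
  have := (hasDerivAt_radialExt_rot hf i 0 (coe_ne_zero s)).deriv
  simp only [rotVec_zero] at this
  rw [← this, angDeriv]
  congr 1
  funext a
  exact apply_rotatePoint f (rot i a) s

lemma hasDerivAt_rotatePoint {f : S2 → ℝ} (hf : SmoothS f) (i : Fin 3) (a : ℝ) (s : S2) :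
    HasDerivAt (fun a => f (rotatePoint (rot i a) s)) (angDeriv i f (rotatePoint (rot i a) s)) a := by
  rw [angDeriv_eq hf]
  have := hasDerivAt_radialExt_rot hf i a (coe_ne_zero s)
  refine this.congr_of_eventuallyEq (Filter.Eventually.of_forall fun b => ?_)
  exact apply_rotatePoint f (rot i b) s

/-- Euler's relation for a function that is homogeneous of degree 0. -/
lemma fderiv_radialExt_self {f : S2 → ℝ} (hf : SmoothS f) {x : E3} (hx : x ≠ 0) :
    fderiv ℝ (radialExt f) x x = 0 := by
  have h1 : HasDerivAt (fun r : ℝ => radialExt f (r • x)) (fderiv ℝ (radialExt f) x x) 1 := by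
    have h2 : HasDerivAt (fun r : ℝ => r • x) ((1 : ℝ) • x) 1 := (hasDerivAt_id 1).smul_const x
    have h3 : HasFDerivAt (radialExt f) (fderiv ℝ (radialExt f) x) ((1 : ℝ) • x) := by
      rw [one_smul]
      exact ((hf.contDiffAt hx).differentiableAt (by simp)).hasFDerivAt
    have := h3.comp_hasDerivAt (1 : ℝ) h2
    rwa [one_smul] at this
  have h4 : HasDerivAt (fun r : ℝ => radialExt f (r • x)) 0 1 := by
    refine (hasDerivAt_const (1 : ℝ) (radialExt f x)).congr_of_eventuallyEq ?_
    filter_upwards [lt_mem_nhds (zero_lt_one' ℝ)] with r hr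
    exact radialExt_pos_smul f hr x
  exact h1.unique h4

lemma fderiv_radialExt_smul {f : S2 → ℝ} (hf : SmoothS f) {x : E3} (hx : x ≠ 0) {r : ℝ}
    (hr : 0 < r) (v : E3) :
    fderiv ℝ (radialExt f) (r • x) (r • v) = fderiv ℝ (radialExt f) x v := by
  have hrx : r • x ≠ 0 := smul_ne_zero hr.ne' hx
  have h1 : HasFDerivAt (fun y => radialExt f (r • y))
      ((fderiv ℝ (radialExt f) (r • x)).comp (r • ContinuousLinearMap.id ℝ E3)) x :=
    ((hf.contDiffAt hrx).differentiableAt (by simp)).hasFDerivAt.comp x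
      ((hasFDerivAt_id x).const_smul r)
  have h2 : (fun y => radialExt f (r • y)) = radialExt f :=
    funext fun y => radialExt_pos_smul f hr y
  rw [h2] at h1
  rw [h1.fderiv]; simp

/-- Differentiation along a linear vector field keeps homogeneity of degree 0, so radial extension
commutes with angular derivatives, and these can be iterated. -/
lemma radialExt_angDeriv {f : S2 → ℝ} (hf : SmoothS f) (i : Fin 3) {x : E3} (hx : x ≠ 0) :
    radialExt (angDeriv i f) x = fderiv ℝ (radialExt f) x (gen i x) := by
  rw [radialExt_of_ne _ hx, angDeriv_eq hf]
  have hr : 0 < ‖x‖⁻¹ := inv_pos.mpr (norm_pos_iff.mpr hx)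
  have h : ((dirPt x hx : S2) : E3) = ‖x‖⁻¹ • x := rfl
  rw [h, map_smul]
  exact fderiv_radialExt_smul hf hx hr _

lemma SmoothS.angDeriv {f : S2 → ℝ} (hf : SmoothS f) (i : Fin 3) : SmoothS (angDeriv i f) := by
  have h : ContDiffOn ℝ ∞ (fun x => fderiv ℝ (radialExt f) x (gen i x)) {0}ᶜ :=
    (ContDiffOn.fderiv_of_isOpen hf isOpen_compl_singleton (by simp)).clm_apply
      (gen i).contDiff.contDiffOn
  exact h.congr fun x hx => radialExt_angDeriv hf i hx

/-- Let H be the Hessian of the radial extension at s. Then ∑ H(eᵢ × s, eᵢ × s) = |s|² tr H - H(s,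
s). The radial term H(s, s) vanishes by differentiating Euler's relation, and the first order terms
add up to the derivative along ∑ eᵢ × (eᵢ × s) = -2s, which Euler's relation also kills. In this
form integration by parts reduces to rotation invariance of the area. -/
lemma sphereLaplacian_eq_angDeriv {f : S2 → ℝ} (hf : SmoothS f) (s : S2) :
    sphereLaplacian f s = ∑ i, angDeriv i (angDeriv i f) s := by
  set F := radialExt f with hF
  have hs := coe_ne_zero s
  have hd : DifferentiableAt ℝ (fderiv ℝ F) s :=
    ((hf.contDiffAt hs).fderiv_right (m := 1) (by norm_cast)).differentiableAt (by simp)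
  set H := fderiv ℝ (fderiv ℝ F) s with hH
  have e1 : ∀ i, angDeriv i (angDeriv i f) s
      = H (gen i s) (gen i s) + fderiv ℝ F s (gen i (gen i s)) := by
    intro i
    rw [angDeriv_eq (hf.angDeriv i)]
    have : HasFDerivAt (fun x => fderiv ℝ F x (gen i x))
        ((fderiv ℝ F s).comp (gen i) + H.flip (gen i s)) s :=
      hd.hasFDerivAt.clm_apply (gen i).hasFDerivAt
    have h2 : radialExt (angDeriv i f) =ᶠ[nhds (s : E3)] fun x => fderiv ℝ F x (gen i x) := by
      filter_upwards [isOpen_compl_singleton.mem_nhds hs] with x hx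
      exact radialExt_angDeriv hf i hx
    rw [h2.fderiv_eq, this.fderiv]
    simp only [add_apply, ContinuousLinearMap.comp_apply,
      ContinuousLinearMap.flip_apply]
    ring
  have e2 : H s s = 0 := by
    have h1 : HasFDerivAt (fun x => fderiv ℝ F x x)
        ((fderiv ℝ F s).comp (ContinuousLinearMap.id ℝ E3) + H.flip s) s :=
      hd.hasFDerivAt.clm_apply (hasFDerivAt_id (s : E3))
    have h2 : (fun x => fderiv ℝ F x x) =ᶠ[nhds (s : E3)] fun _ => (0 : ℝ) := by
      filter_upwards [isOpen_compl_singleton.mem_nhds hs] with x hx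
      exact fderiv_radialExt_self hf hx
    have h3 := h2.fderiv_eq (𝕜 := ℝ)
    rw [h1.fderiv] at h3
    have h4 := congrArg (fun T : E3 →L[ℝ] ℝ => T s) h3
    simp only [add_apply, ContinuousLinearMap.comp_apply,
      ContinuousLinearMap.flip_apply, ContinuousLinearMap.id_apply, fderiv_fun_const] at h4
    rw [hF, fderiv_radialExt_self hf hs] at h4
    simpa using h4
  have e3 : sphereLaplacian f s = H (ev 0) (ev 0) + H (ev 1) (ev 1) + H (ev 2) (ev 2) := by
    rw [sphereLaplacian, congrFun (InnerProductSpace.laplacian_eq_iteratedFDeriv_orthonormalBasis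
      (radialExt f) (EuclideanSpace.basisFun (Fin 3) ℝ)) s, Fin.sum_univ_three]
    simp only [iteratedFDeriv_two_apply]
    simp [ev, hH, hF]
  have e4 : ∑ i, fderiv ℝ F s (gen i (gen i s)) = 0 := by
    rw [← map_sum]
    have : ∑ i, gen i (gen i (s : E3)) = (-2 : ℝ) • (s : E3) := by
      rw [Fin.sum_univ_three]
      ext j
      fin_cases j <;> simp [gen_apply, ev_apply] <;> ring
    rw [this, map_smul, fderiv_radialExt_self hf hs, smul_zero]
  have hn : (s : E3) 0 ^ 2 + (s : E3) 1 ^ 2 + (s : E3) 2 ^ 2 = 1 := by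
    have := norm_sq_axis 0 (s : E3)
    rw [mem_sphere_zero_iff_norm.mp s.2] at this
    simpa using this.symm
  rw [Finset.sum_congr rfl fun i _ => e1 i, Finset.sum_add_distrib, e4, add_zero, e3,
    Fin.sum_univ_three]
  rw [eq_sum_ev (s : E3)] at e2
  simp only [gen_apply, map_add, map_smul, map_neg, add_apply,
    smul_apply, smul_eq_mul, neg_smul, neg_apply] at e2 ⊢
  have f1 : (0 : Fin 3) + 1 = 1 := rfl
  have f2 : (0 : Fin 3) + 2 = 2 := rfl
  have f3 : (1 : Fin 3) + 1 = 2 := rfl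
  have f4 : (1 : Fin 3) + 2 = 0 := rfl
  have f5 : (2 : Fin 3) + 1 = 0 := rfl
  have f6 : (2 : Fin 3) + 2 = 1 := rfl
  simp only [f1, f2, f3, f4, f5, f6]
  linear_combination e2 - (H (ev 0) (ev 0) + H (ev 1) (ev 1) + H (ev 2) (ev 2)) * hn


/-! ### Harmonic analysis of axially symmetric functions on the sphere. -/

open MeasureTheory

/-! ### The area measure of the sphere and Green's formula -/

/-- The round area measure of the unit sphere. -/
abbrev area : Measure S2 := (volume : Measure E3).toSphere

lemma rotatePoint_coe (g : E3 ≃ₗᵢ[ℝ] E3) (s : S2) : (rotatePoint g s : E3) = g s := rfl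

lemma rotatePoint_mul (g h : E3 ≃ₗᵢ[ℝ] E3) (s : S2) :
    rotatePoint (g * h) s = rotatePoint g (rotatePoint h s) := rfl

lemma rotatePoint_one (s : S2) : rotatePoint 1 s = s := rfl

lemma rotatePoint_inv_apply (g : E3 ≃ₗᵢ[ℝ] E3) (s : S2) :
    rotatePoint g (rotatePoint g⁻¹ s) = s := by
  rw [← rotatePoint_mul, mul_inv_cancel, rotatePoint_one]

lemma rotatePoint_apply_inv (g : E3 ≃ₗᵢ[ℝ] E3) (s : S2) :
    rotatePoint g⁻¹ (rotatePoint g s) = s := by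
  rw [← rotatePoint_mul, inv_mul_cancel, rotatePoint_one]

lemma continuous_rotatePoint (g : E3 ≃ₗᵢ[ℝ] E3) : Continuous (rotatePoint g) :=
  (g.continuous.comp continuous_subtype_val).subtype_mk _

/-- A rotation as a homeomorphism of the sphere. -/
def rotHomeo (g : E3 ≃ₗᵢ[ℝ] E3) : S2 ≃ₜ S2 where
  toFun := rotatePoint g
  invFun := rotatePoint g⁻¹
  left_inv := rotatePoint_apply_inv g
  right_inv := rotatePoint_inv_apply g
  continuous_toFun := continuous_rotatePoint g
  continuous_invFun := continuous_rotatePoint g⁻¹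

-- The area of a set is defined by the volume of the cone over it, and a rotation carries cones to
-- cones and preserves volume.
open scoped Pointwise in
lemma measurePreserving_rotatePoint (g : E3 ≃ₗᵢ[ℝ] E3) :
    MeasurePreserving (rotatePoint g) area area := by
  refine ⟨(continuous_rotatePoint g).measurable, ?_⟩
  ext s hs
  rw [Measure.map_apply (continuous_rotatePoint g).measurable hs,
    Measure.toSphere_apply' _ hs,
    Measure.toSphere_apply' _ ((continuous_rotatePoint g).measurable hs)]
  congr 1
  have h : (Set.Ioo (0 : ℝ) 1 • (Subtype.val '' (rotatePoint g ⁻¹' s)) : Set E3)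
      = g ⁻¹' (Set.Ioo (0 : ℝ) 1 • (Subtype.val '' s)) := by
    ext x
    simp only [Set.mem_smul, Set.mem_image, Set.mem_preimage]
    constructor
    · rintro ⟨r, hr, _, ⟨y, hy, rfl⟩, rfl⟩
      exact ⟨r, hr, _, ⟨_, hy, rfl⟩, by rw [map_smul]; rfl⟩
    · rintro ⟨r, hr, _, ⟨y, hy, rfl⟩, h⟩
      refine ⟨r, hr, _, ⟨rotatePoint g⁻¹ y, ?_, rfl⟩, ?_⟩
      · rwa [rotatePoint_inv_apply]
      · apply g.injective
        rw [map_smul, ← rotatePoint_coe, rotatePoint_inv_apply, h]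
  rw [h]
  exact (MeasurePreserving.measure_preimage_equiv (f := g.toMeasurableEquiv)
    g.measurePreserving _)

lemma integral_rotatePoint (g : E3 ≃ₗᵢ[ℝ] E3) (f : S2 → ℝ) :
    ∫ s, f (rotatePoint g s) ∂area = ∫ s, f s ∂area :=
  (measurePreserving_rotatePoint g).integral_comp (rotHomeo g).measurableEmbedding f

lemma integrable_mul_of_continuous {f g : S2 → ℝ} (hf : Continuous f) (hg : Continuous g) :
    Integrable (fun s => f s * g s) area :=
  (hf.mul hg).integrable_of_hasCompactSupport (HasCompactSupport.of_compactSpace _)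

lemma integrable_of_continuous {f : S2 → ℝ} (hf : Continuous f) : Integrable f area :=
  hf.integrable_of_hasCompactSupport (HasCompactSupport.of_compactSpace f)

/-- Differentiation under the integral sign over the sphere. -/
lemma hasDerivAt_integral_area {G G' : ℝ → S2 → ℝ} {U : Set ℝ} (hU : IsOpen U) {t : ℝ}
    (ht : t ∈ U) (hG : ∀ τ ∈ U, Continuous (G τ))
    (hG' : ContinuousOn (fun p : ℝ × S2 => G' p.1 p.2) (U ×ˢ Set.univ))
    (hd : ∀ τ ∈ U, ∀ s, HasDerivAt (fun τ => G τ s) (G' τ s) τ) :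
    HasDerivAt (fun τ => ∫ s, G τ s ∂area) (∫ s, G' t s ∂area) t := by
  obtain ⟨ε, hε, hball⟩ := Metric.nhds_basis_closedBall.mem_iff.mp (hU.mem_nhds ht)
  have hc : IsCompact (Metric.closedBall t ε ×ˢ (Set.univ : Set S2)) :=
    (isCompact_closedBall t ε).prod isCompact_univ
  obtain ⟨C, hC⟩ := hc.exists_bound_of_continuousOn
    (hG'.mono (Set.prod_mono hball subset_rfl))
  have hG't : Continuous (G' t) := by
    rw [← continuousOn_univ]
    exact hG'.comp (f := fun s : S2 => (t, s)) (by fun_prop) fun s _ => ⟨ht, trivial⟩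
  refine (hasDerivAt_integral_of_dominated_loc_of_deriv_le (bound := fun _ => C)
    (Metric.closedBall_mem_nhds t hε) ?_ (integrable_of_continuous (hG t ht))
    hG't.aestronglyMeasurable ?_ (integrable_const C) ?_).2
  · filter_upwards [hU.mem_nhds ht] with τ hτ
    exact (hG τ hτ).aestronglyMeasurable
  · exact Filter.Eventually.of_forall fun s τ hτ => hC (τ, s) ⟨hτ, trivial⟩
  · exact Filter.Eventually.of_forall fun s τ hτ => hd τ (hball hτ) s

namespace SmoothS

lemma continuous {f : S2 → ℝ} (hf : SmoothS f) : Continuous f := by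
  have : f = fun s : S2 => radialExt f s := funext fun s => (radialExt_coe f s).symm
  rw [this]
  exact (ContDiffOn.continuousOn hf).comp_continuous continuous_subtype_val coe_ne_zero

lemma mul {f g : S2 → ℝ} (hf : SmoothS f) (hg : SmoothS g) : SmoothS (fun s => f s * g s) := by
  refine (ContDiffOn.mul hf hg).congr fun x hx => ?_
  rw [radialExt_of_ne _ hx, radialExt_of_ne _ hx, radialExt_of_ne _ hx]

lemma add {f g : S2 → ℝ} (hf : SmoothS f) (hg : SmoothS g) : SmoothS (f + g) := by
  rw [SmoothS, radialExt_add]; exact ContDiffOn.add hf hg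

lemma const_smul {f : S2 → ℝ} (hf : SmoothS f) (c : ℝ) : SmoothS (c • f) := by
  rw [SmoothS, radialExt_smul]; exact ContDiffOn.const_smul c hf

lemma rotate {f : S2 → ℝ} (hf : SmoothS f) (g : E3 ≃ₗᵢ[ℝ] E3) :
    SmoothS (fun s => f (rotatePoint g s)) := by
  have : ContDiffOn ℝ ∞ (fun x => radialExt f (g x)) {0}ᶜ :=
    ContDiffOn.comp (t := {0}ᶜ) hf g.contDiff.contDiffOn fun x hx => by simpa using hx
  exact this.congr fun x _ => radialExt_rotate g f x

end SmoothS

/-- The integral of the rotated function does not depend on the angle; this is its derivative at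
angle 0. -/
lemma integral_angDeriv {f : S2 → ℝ} (hf : SmoothS f) (i : Fin 3) :
    ∫ s, angDeriv i f s ∂area = 0 := by
  have h := hasDerivAt_integral_area (G := fun a s => f (rotatePoint (rot i a) s))
    (G' := fun a s => angDeriv i f (rotatePoint (rot i a) s)) isOpen_univ (Set.mem_univ (0 : ℝ))
    (fun a _ => hf.continuous.comp (continuous_rotatePoint _)) ?_
    (fun a _ s => hasDerivAt_rotatePoint hf i a s)
  · simp only [integral_rotatePoint] at h
    exact h.unique (hasDerivAt_const _ _)
  · refine ((hf.angDeriv i).continuous.comp ?_).continuousOn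
    refine Continuous.subtype_mk ?_ _
    show Continuous fun p : ℝ × S2 => rotVec i p.1 p.2
    unfold rotVec
    fun_prop

lemma angDeriv_mul {f g : S2 → ℝ} (hf : SmoothS f) (hg : SmoothS g) (i : Fin 3) (s : S2) :
    angDeriv i (fun s => f s * g s) s = angDeriv i f s * g s + f s * angDeriv i g s := by
  have h := (hasDerivAt_rotatePoint hf i 0 s).mul (hasDerivAt_rotatePoint hg i 0 s)
  rw [rot_zero, rotatePoint_one] at h
  exact h.deriv

lemma integral_angDeriv_mul {f g : S2 → ℝ} (hf : SmoothS f) (hg : SmoothS g) (i : Fin 3) :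
    ∫ s, angDeriv i f s * g s ∂area = -∫ s, f s * angDeriv i g s ∂area := by
  have h := integral_angDeriv (hf.mul hg) i
  simp only [angDeriv_mul hf hg] at h
  rw [integral_add (integrable_mul_of_continuous (hf.angDeriv i).continuous hg.continuous)
    (integrable_mul_of_continuous hf.continuous (hg.angDeriv i).continuous)] at h
  linarith

lemma continuous_sphereLaplacian {f : S2 → ℝ} (hf : SmoothS f) :
    Continuous (sphereLaplacian f) := by
  have : sphereLaplacian f = fun s => ∑ i, angDeriv i (angDeriv i f) s :=
    funext fun s => sphereLaplacian_eq_angDeriv hf s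
  rw [this]
  exact continuous_finsetSum _ fun i _ => ((hf.angDeriv i).angDeriv i).continuous

/-- Green's formula on the sphere. -/
lemma integral_sphereLaplacian_mul {f g : S2 → ℝ} (hf : SmoothS f) (hg : SmoothS g) :
    ∫ s, sphereLaplacian f s * g s ∂area = ∫ s, f s * sphereLaplacian g s ∂area := by
  have e1 : ∀ s, sphereLaplacian f s * g s = ∑ i, angDeriv i (angDeriv i f) s * g s := fun s => by
    rw [sphereLaplacian_eq_angDeriv hf, Finset.sum_mul]
  have e2 : ∀ s, f s * sphereLaplacian g s = ∑ i, f s * angDeriv i (angDeriv i g) s := fun s => by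
    rw [sphereLaplacian_eq_angDeriv hg, Finset.mul_sum]
  simp only [e1, e2]
  rw [integral_finsetSum _ fun i _ => integrable_mul_of_continuous
      ((hf.angDeriv i).angDeriv i).continuous hg.continuous,
    integral_finsetSum _ fun i _ => integrable_mul_of_continuous
      hf.continuous ((hg.angDeriv i).angDeriv i).continuous]
  refine Finset.sum_congr rfl fun i _ => ?_
  rw [integral_angDeriv_mul (hf.angDeriv i) hg, integral_angDeriv_mul hf (hg.angDeriv i), neg_neg]

/-! ### Zonal functions -/

lemma sphere_sq_sum (s : S2) : (s : E3) 0 ^ 2 + (s : E3) 1 ^ 2 + (s : E3) 2 ^ 2 = 1 := by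
  have := norm_sq_axis 0 (s : E3)
  rw [mem_sphere_zero_iff_norm.mp s.2] at this
  simpa using this.symm

lemma sphere_coord_mem (s : S2) : (s : E3) 2 ∈ Set.Icc (-1 : ℝ) 1 := by
  have := sphere_sq_sum s
  constructor <;> nlinarith [sq_nonneg ((s : E3) 0), sq_nonneg ((s : E3) 1)]

/-- The zonal function with profile `q`. -/
def zonal (q : ℝ → ℝ) (s : S2) : ℝ := q ((s : E3) 2)

lemma smoothS_coord (i : Fin 3) : SmoothS (fun s => (s : E3) i) := by
  have : ContDiffOn ℝ ∞ (fun x : E3 => ‖x‖⁻¹ * x i) {0}ᶜ := by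
    intro x hx
    have h1 : ContDiffAt ℝ ∞ (fun x : E3 => ‖x‖⁻¹) x :=
      (contDiffAt_norm ℝ hx).inv (norm_ne_zero_iff.mpr hx)
    exact (h1.mul (by fun_prop)).contDiffWithinAt
  refine this.congr fun x hx => ?_
  rw [radialExt_of_ne _ hx]
  rfl

lemma smoothS_zonal {q : ℝ → ℝ} (hq : ContDiff ℝ ∞ q) : SmoothS (zonal q) := by
  refine (hq.comp_contDiffOn (smoothS_coord 2)).congr fun x hx => ?_
  rw [radialExt_of_ne _ hx]
  simp only [Function.comp]
  rw [radialExt_of_ne _ hx]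
  rfl

lemma angDeriv_zonal {q : ℝ → ℝ} (hq : ContDiff ℝ ∞ q) :
    angDeriv 0 (zonal q) = (fun s => zonal (deriv q) s * (s : E3) 1) ∧
    angDeriv 1 (zonal q) = (fun s => -(zonal (deriv q) s * (s : E3) 0)) ∧
    angDeriv 2 (zonal q) = fun _ => 0 := by
  have key : ∀ (i : Fin 3) (s : S2), angDeriv i (zonal q) s
      = deriv q ((s : E3) 2) * (gen i (s : E3)) 2 := by
    intro i s
    have h1 : HasDerivAt (fun a => rotVec i a (s : E3) 2) (gen i (s : E3) 2) 0 := by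
      have h0 := hasDerivAt_rotVec i 0 (s : E3)
      rw [rotVec_zero] at h0
      exact (EuclideanSpace.proj (𝕜 := ℝ) (2 : Fin 3)).hasFDerivAt.comp_hasDerivAt (0 : ℝ) h0
    have h2 : HasDerivAt q (deriv q ((s : E3) 2)) (rotVec i 0 (s : E3) 2) := by
      rw [rotVec_zero]
      exact (hq.differentiable (by simp)).differentiableAt.hasDerivAt
    exact (h2.comp (0 : ℝ) h1).deriv
  refine ⟨?_, ?_, ?_⟩ <;> funext s <;> rw [key] <;> simp [gen_apply, ev_apply, zonal]

lemma angDeriv_coord (i j : Fin 3) (s : S2) :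
    angDeriv i (fun s => (s : E3) j) s = gen i (s : E3) j := by
  have h0 := hasDerivAt_rotVec i 0 (s : E3)
  rw [rotVec_zero] at h0
  exact ((EuclideanSpace.proj (𝕜 := ℝ) j).hasFDerivAt.comp_hasDerivAt (0 : ℝ) h0).deriv

lemma sphereLaplacian_zonal {q : ℝ → ℝ} (hq : ContDiff ℝ ∞ q) (s : S2) :
    sphereLaplacian (zonal q) s = (1 - (s : E3) 2 ^ 2) * deriv (deriv q) ((s : E3) 2)
      - 2 * (s : E3) 2 * deriv q ((s : E3) 2) := by
  have hq' : ContDiff ℝ ∞ (deriv q) := (contDiff_infty_iff_deriv.mp hq).2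
  obtain ⟨a0, a1, a2⟩ := angDeriv_zonal hq
  obtain ⟨b0, b1, b2⟩ := angDeriv_zonal hq'
  rw [sphereLaplacian_eq_angDeriv (smoothS_zonal hq), Fin.sum_univ_three, a0, a1, a2]
  have e : (fun s : S2 => -(zonal (deriv q) s * (s : E3) 0))
      = (-1 : ℝ) • fun s : S2 => zonal (deriv q) s * (s : E3) 0 := by
    funext s; simp
  have e0 : angDeriv 2 (fun _ => (0 : ℝ)) s = 0 := by simp [angDeriv]
  have e1 : ∀ h : S2 → ℝ, angDeriv 1 ((-1 : ℝ) • h) s = -angDeriv 1 h s := by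
    intro h; simp [angDeriv]
  rw [e0, e, e1, angDeriv_mul (smoothS_zonal hq') (smoothS_coord 1),
    angDeriv_mul (smoothS_zonal hq') (smoothS_coord 0), b0, b1, angDeriv_coord, angDeriv_coord]
  have := sphere_sq_sum s
  simp only [gen_apply, zonal]
  simp [ev_apply]
  linear_combination (deriv (deriv q) ((s : E3) 2)) * this


open MeasureTheory

/-! ### The zonal harmonics -/

/-- Legendre's equation. -/
lemma legendreP_ode (l : ℕ) {x : ℝ} (hx : x ∈ Set.Icc (-1 : ℝ) 1) :
    (1 - x ^ 2) * deriv (deriv (legendreP l)) x - 2 * x * deriv (legendreP l) x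
      = -(l * (l + 1)) * legendreP l x := by
  have hP := contDiff_legendreP l
  have hP1 : ContDiff ℝ ∞ (deriv (legendreP l)) := (contDiff_infty_iff_deriv.mp hP).2
  have hP2 : ContDiff ℝ ∞ (deriv (deriv (legendreP l))) := (contDiff_infty_iff_deriv.mp hP1).2
  have c0 := hP.continuous
  have c1 := hP1.continuous
  have c2 := hP2.continuous
  -- The derivative formulas divide by 1 - x² and hold only inside the interval; the poles x = ±1
  -- are reached by continuity.
  have hcl : IsClosed {x : ℝ | (1 - x ^ 2) * deriv (deriv (legendreP l)) x
      - 2 * x * deriv (legendreP l) x = -(l * (l + 1)) * legendreP l x} :=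
    isClosed_eq (by fun_prop) (by fun_prop)
  have hsub : Set.Ioo (-1 : ℝ) 1 ⊆ {x : ℝ | (1 - x ^ 2) * deriv (deriv (legendreP l)) x
      - 2 * x * deriv (legendreP l) x = -(l * (l + 1)) * legendreP l x} := by
    intro y hy
    have hd : deriv (legendreP l) =ᶠ[nhds y] legendreD legendreP l := by
      filter_upwards [isOpen_Ioo.mem_nhds hy] with z hz
      exact (isLegendre_P.hasDerivAt l hz).deriv
    have hne := (one_sub_sq_pos hy).ne'
    show (1 - y ^ 2) * deriv (deriv (legendreP l)) y - 2 * y * deriv (legendreP l) y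
      = -(l * (l + 1)) * legendreP l y
    rw [hd.deriv_eq, hd.self_of_nhds, (isLegendre_P.hasDerivAt_D l hy).deriv]
    field_simp
    ring
  have := closure_minimal hsub hcl
  rw [closure_Ioo (by norm_num)] at this
  exact this hx

lemma Yl0_eq (l : ℕ) :
    Yl0 l = Real.sqrt ((2 * l + 1) / (4 * Real.pi)) • zonal (legendreP l) := rfl

lemma smoothS_Yl0 (l : ℕ) : SmoothS (Yl0 l) :=
  (smoothS_zonal (contDiff_legendreP l)).const_smul _

lemma sphereLaplacian_smul {f : S2 → ℝ} (hf : SmoothS f) (c : ℝ) (s : S2) :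
    sphereLaplacian (c • f) s = c * sphereLaplacian f s := by
  simp only [sphereLaplacian, radialExt_smul]
  exact InnerProductSpace.laplacian_smul c
    ((hf.contDiffAt (coe_ne_zero s)).of_le (by norm_cast))

lemma sphereLaplacian_zonal_P (l : ℕ) (s : S2) :
    sphereLaplacian (zonal (legendreP l)) s = -(l * (l + 1)) * zonal (legendreP l) s := by
  rw [sphereLaplacian_zonal (contDiff_legendreP l), legendreP_ode l (sphere_coord_mem s)]; rfl

lemma sphereLaplacian_Yl0 (l : ℕ) (s : S2) :
    sphereLaplacian (Yl0 l) s = -(l * (l + 1)) * Yl0 l s := by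
  rw [Yl0_eq, sphereLaplacian_smul (smoothS_zonal (contDiff_legendreP l)),
    sphereLaplacian_zonal_P]
  simp only [Pi.smul_apply, smul_eq_mul]
  ring

lemma continuous_zonal_P (l : ℕ) : Continuous (zonal (legendreP l)) :=
  (smoothS_zonal (contDiff_legendreP l)).continuous

/-- Eigenfunctions of the sphere Laplacian are orthogonal to the other zonal harmonics. -/
lemma integral_mul_Yl0_of_eigen {f : S2 → ℝ} (hf : SmoothS f) {l m : ℕ} (hlm : l ≠ m)
    (h : ∀ s, sphereLaplacian f s = -(l * (l + 1)) * f s) : ∫ s, f s * Yl0 m s ∂area = 0 := by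
  have := integral_sphereLaplacian_mul hf (smoothS_Yl0 m)
  simp only [h, sphereLaplacian_Yl0] at this
  have e1 : ∀ s, -((l : ℝ) * (l + 1)) * f s * Yl0 m s
      = -((l : ℝ) * (l + 1)) * (f s * Yl0 m s) := fun s => by ring
  have e2 : ∀ s, f s * (-((m : ℝ) * (m + 1)) * Yl0 m s)
      = -((m : ℝ) * (m + 1)) * (f s * Yl0 m s) := fun s => by ring
  simp only [e1, e2] at this
  rw [integral_const_mul, integral_const_mul] at this
  have hne : (l : ℝ) * (l + 1) - m * (m + 1) ≠ 0 := by
    have : (l : ℝ) * (l + 1) - m * (m + 1) = (l - m) * (l + m + 1) := by ring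
    rw [this]
    refine mul_ne_zero ?_ (by positivity)
    rw [sub_ne_zero]; exact_mod_cast hlm
  have h3 : ((l : ℝ) * (l + 1) - m * (m + 1)) * ∫ s, f s * Yl0 m s ∂area = 0 := by linarith
  exact (mul_eq_zero.mp h3).resolve_left hne

lemma integral_zonal_P_mul {l m : ℕ} (hlm : l ≠ m) :
    ∫ s, zonal (legendreP l) s * zonal (legendreP m) s ∂area = 0 := by
  have h := integral_mul_Yl0_of_eigen (smoothS_zonal (contDiff_legendreP l)) hlm
    (sphereLaplacian_zonal_P l)
  have e : ∀ s, zonal (legendreP l) s * Yl0 m s = Real.sqrt ((2 * m + 1) / (4 * Real.pi)) *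
      (zonal (legendreP l) s * zonal (legendreP m) s) := fun s => by
    rw [Yl0_eq]; simp only [Pi.smul_apply, smul_eq_mul]; ring
  simp only [e] at h
  rw [integral_const_mul] at h
  refine (mul_eq_zero.mp h).resolve_left (Real.sqrt_ne_zero'.mpr (by positivity))

lemma area_univ : area.real Set.univ = 4 * Real.pi := by
  rw [measureReal_def, Measure.toSphere_apply_univ, EuclideanSpace.volume_ball_fin_three]
  simp only [finrank_euclideanSpace, Fintype.card_fin, ENNReal.ofReal_one, one_pow, one_mul,
    ENNReal.toReal_mul]
  rw [ENNReal.toReal_ofReal (by positivity)]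
  simp
  ring

/-- With N_l the integral and K = ∫ x P_l P_{l+1}, the recurrence for P_{l+2} tested against P_l
gives (2l+3) K = (l+1) N_l. The recurrence for P_{l+1} tested against P_{l+1} gives (l+1) N_{l+1} =
(2l+1) K. Orthogonality removes the remaining integrals, and N₀ is the area 4π. -/
lemma integral_zonal_P_sq (l : ℕ) :
    ∫ s, zonal (legendreP l) s * zonal (legendreP l) s ∂area = 4 * Real.pi / (2 * l + 1) := by
  induction l with
  | zero =>
    have : ∀ s, zonal (legendreP 0) s = 1 := fun s => rfl
    simp only [this]
    rw [integral_const, area_univ]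
    simp
  | succ l ih =>
    have i : ∀ a b, Integrable (fun s => zonal (legendreP a) s * zonal (legendreP b) s) area :=
      fun a b => integrable_mul_of_continuous (continuous_zonal_P a) (continuous_zonal_P b)
    set K := ∫ s : S2, (s : E3) 2 * (zonal (legendreP l) s * zonal (legendreP (l + 1)) s) ∂area
    have e1 : ((l : ℝ) + 2) * ∫ s, zonal (legendreP (l + 2)) s * zonal (legendreP l) s ∂area
        = (2 * l + 3) * K - (l + 1) *
          ∫ s, zonal (legendreP l) s * zonal (legendreP l) s ∂area := by
      rw [← integral_const_mul, ← integral_const_mul, ← integral_const_mul, ← integral_sub]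
      · congr 1
        funext s
        have := isLegendre_P.recur l ((s : E3) 2)
        simp only [zonal]
        linear_combination (legendreP l ((s : E3) 2)) * this
      · exact (integrable_mul_of_continuous (f := fun s : S2 => (s : E3) 2) (by fun_prop)
          ((continuous_zonal_P l).mul (continuous_zonal_P (l + 1)))).const_mul _
      · exact (i _ _).const_mul _
    rw [integral_zonal_P_mul (by omega), ih] at e1
    have e2 : ((l : ℝ) + 1) * ∫ s, zonal (legendreP (l + 1)) s * zonal (legendreP (l + 1)) s ∂area
        = (2 * l + 1) * K := by
      cases l with
      | zero =>
        rw [← integral_const_mul, ← integral_const_mul]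
        congr 1
        funext s
        simp [zonal, legendreP, legendreRec]
      | succ l =>
        have : ((l : ℝ) + 2) * ∫ s, zonal (legendreP (l + 2)) s * zonal (legendreP (l + 2)) s ∂area
            = (2 * l + 3) * K - (l + 1) *
              ∫ s, zonal (legendreP l) s * zonal (legendreP (l + 2)) s ∂area := by
          rw [← integral_const_mul, ← integral_const_mul, ← integral_const_mul, ← integral_sub]
          · congr 1
            funext s
            have := isLegendre_P.recur l ((s : E3) 2)
            simp only [zonal]
            linear_combination (legendreP (l + 2) ((s : E3) 2)) * this
          · exact (integrable_mul_of_continuous (f := fun s : S2 => (s : E3) 2) (by fun_prop)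
              ((continuous_zonal_P (l + 1)).mul (continuous_zonal_P (l + 2)))).const_mul _
          · exact (i _ _).const_mul _
        rw [integral_zonal_P_mul (by omega : l ≠ l + 2)] at this
        push_cast
        linear_combination this
    push_cast
    have h1 : (2 * (l : ℝ) + 1) ≠ 0 := by positivity
    have h2 : (2 * ((l : ℝ) + 1) + 1) ≠ 0 := by positivity
    have h3 : ((l : ℝ) + 1) ≠ 0 := by positivity
    rw [eq_div_iff h2]
    apply mul_left_cancel₀ h3
    field_simp at e1
    linear_combination (2 * (l : ℝ) + 3) * e2 - e1

lemma integral_Yl0_mul (l m : ℕ) :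
    ∫ s, Yl0 l s * Yl0 m s ∂area = if l = m then 1 else 0 := by
  have e : ∀ s, Yl0 l s * Yl0 m s = (Real.sqrt ((2 * l + 1) / (4 * Real.pi)) *
      Real.sqrt ((2 * m + 1) / (4 * Real.pi))) *
      (zonal (legendreP l) s * zonal (legendreP m) s) := fun s => by
    rw [Yl0_eq, Yl0_eq]; simp only [Pi.smul_apply, smul_eq_mul]; ring
  simp only [e]
  rw [integral_const_mul]
  split_ifs with h
  · subst h
    rw [integral_zonal_P_sq, Real.mul_self_sqrt (by positivity)]
    have := Real.pi_pos
    field_simp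
  · rw [integral_zonal_P_mul h, mul_zero]

/-! ### Parseval's identity for axially symmetric functions -/

/-- Parseval's identity for a vector in the closed span of an orthonormal family. -/
lemma hasSum_inner_mul_inner_of_mem_closure {𝕜 E ι : Type*} [RCLike 𝕜] [NormedAddCommGroup E]
    [InnerProductSpace 𝕜 E] [CompleteSpace E] {v : ι → E} (hv : Orthonormal 𝕜 v) {x : E}
    (hx : x ∈ closure (Submodule.span 𝕜 (Set.range v) : Set E)) (y : E) :
    HasSum (fun i => inner 𝕜 y (v i) * inner 𝕜 (v i) x) (inner 𝕜 y x) := by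
  have hV := hv.orthogonalFamily
  have hx' : x ∈ hV.linearIsometry.range := by
    rw [hV.range_linearIsometry]
    rw [← SetLike.mem_coe, Submodule.topologicalClosure_coe]
    convert hx using 3
    rw [Submodule.span_range_eq_iSup]
    congr 1
    funext i
    ext z
    simp [Submodule.mem_span_singleton]
  obtain ⟨f, rfl⟩ := hx'
  have hs := hV.hasSum_linearIsometry f
  have hf : ∀ i, inner 𝕜 (v i) (hV.linearIsometry f) = f i := by
    intro i
    have h1 := hs.mapL (innerSL 𝕜 (v i))
    have h2 := h1.unique (hasSum_single i fun j hj => ?_)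
    · rw [innerSL_apply_apply] at h2
      rw [h2]
      simp [hv.1 i]
    · simp [hv.2 hj.symm]
  have h1 := hs.mapL (innerSL 𝕜 y)
  rw [innerSL_apply_apply] at h1
  refine h1.congr_fun fun i => ?_
  have := hf i
  simp only [LinearIsometry.coe_toLinearMap] at this ⊢
  rw [this]
  simp [mul_comm]

/-- Invariance of a function on the sphere under the rotations about the axis. -/
def AxiSym (f : S2 → ℝ) : Prop := ∀ a s, f (rotatePoint (rot 2 a) s) = f s

/-- The point of the zero meridian at height `x`. -/
def meridian (x : ℝ) (hx : x ∈ Set.Icc (-1 : ℝ) 1) : S2 :=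
  ⟨Real.sqrt (1 - x ^ 2) • ev 0 + x • ev 2, by
    rw [mem_sphere_zero_iff_norm]
    have h : ‖Real.sqrt (1 - x ^ 2) • ev 0 + x • ev 2‖ ^ 2 = 1 := by
      rw [norm_sq_axis 0]
      simp [ev_apply]
      rw [Real.sq_sqrt (by nlinarith [hx.1, hx.2])]
      ring
    nlinarith [norm_nonneg (Real.sqrt (1 - x ^ 2) • ev 0 + x • ev 2)]⟩

/-- The rotation about the axis by the argument of s₀ + i s₁ carries the meridian point to s. -/
lemma AxiSym.eq_meridian {f : S2 → ℝ} (hf : AxiSym f) (s : S2) :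
    f s = f (meridian ((s : E3) 2) (sphere_coord_mem s)) := by
  set z : ℂ := ⟨(s : E3) 0, (s : E3) 1⟩ with hz
  rw [← hf (Complex.arg z) (meridian ((s : E3) 2) (sphere_coord_mem s))]
  congr 1
  ext1
  have hn : Real.sqrt (1 - (s : E3) 2 ^ 2) = ‖z‖ := by
    rw [Complex.norm_def, Complex.normSq_mk]
    congr 1
    linear_combination -sphere_sq_sum s
  have hc := Complex.norm_mul_cos_arg z
  have hs := Complex.norm_mul_sin_arg z
  rw [rotatePoint_coe, rot_apply]
  obtain ⟨p0, p1, p2⟩ := rotVec_apply 2 (Complex.arg z)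
    (meridian ((s : E3) 2) (sphere_coord_mem s) : E3)
  apply ext_axis 2
  · rw [p0]; simp [meridian, ev_apply]
  · rw [p1]; simp [meridian, ev_apply]; rw [hn]; linarith
  · rw [p2]; simp [meridian, ev_apply]; rw [hn]; linarith

/-- A continuous function on the sphere as an element of `C(S², ℝ)`. -/
def cm (f : S2 → ℝ) (hf : Continuous f) : C(S2, ℝ) := ⟨f, hf⟩

/-- Weierstrass approximation of the profile along a meridian, followed by expansion of the
polynomial in Legendre polynomials, gives approximation in the uniform norm. -/
lemma AxiSym.mem_closure_zonal {f : S2 → ℝ} (hf : AxiSym f) (hc : Continuous f) :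
    cm f hc ∈ closure (Submodule.span ℝ
      (Set.range fun l => cm (Yl0 l) (smoothS_Yl0 l).continuous) : Set C(S2, ℝ)) := by
  classical
  set F : ℝ → ℝ := fun x => if hx : x ∈ Set.Icc (-1 : ℝ) 1 then f (meridian x hx) else 0 with hF
  have hFc : ContinuousOn F (Set.Icc (-1) 1) := by
    rw [continuousOn_iff_continuous_domRestrict]
    have : (Set.Icc (-1 : ℝ) 1).domRestrict F =
        fun x : Set.Icc (-1 : ℝ) 1 => f (meridian x.1 x.2) := by
      funext x; exact dif_pos x.2
    rw [this]
    refine hc.comp (Continuous.subtype_mk ?_ _)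
    fun_prop
  rw [Metric.mem_closure_iff]
  intro ε hε
  obtain ⟨p, hp⟩ := exists_polynomial_near_of_continuousOn (-1) 1 F hFc (ε / 2) (by positivity)
  obtain ⟨n, c, hc'⟩ := exists_legendre_expansion p
  have hsq : ∀ l : ℕ, Real.sqrt ((2 * l + 1) / (4 * Real.pi)) ≠ 0 := fun l =>
    Real.sqrt_ne_zero'.mpr (by positivity)
  refine ⟨∑ l ∈ Finset.range n, (c l / Real.sqrt ((2 * l + 1) / (4 * Real.pi))) •
      cm (Yl0 l) (smoothS_Yl0 l).continuous,
    Submodule.sum_mem _ fun l _ => Submodule.smul_mem _ _ (Submodule.subset_span ⟨l, rfl⟩), ?_⟩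
  refine lt_of_le_of_lt ((ContinuousMap.dist_le (by positivity)).mpr fun s => ?_)
    (half_lt_self hε)
  have e1 : F ((s : E3) 2) = f s := by
    rw [hF]; simp only [dif_pos (sphere_coord_mem s)]; exact (hf.eq_meridian s).symm
  have e2 : (∑ l ∈ Finset.range n, (c l / Real.sqrt ((2 * l + 1) / (4 * Real.pi))) •
      cm (Yl0 l) (smoothS_Yl0 l).continuous) s = p.eval ((s : E3) 2) := by
    rw [hc', ContinuousMap.sum_apply]
    refine Finset.sum_congr rfl fun l _ => ?_
    show c l / Real.sqrt ((2 * l + 1) / (4 * Real.pi)) * Yl0 l s = _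
    rw [Yl0]
    have := hsq l
    field_simp
  rw [e2, dist_comm, Real.dist_eq]
  show |p.eval ((s : E3) 2) - f s| ≤ ε / 2
  rw [← e1]
  exact (hp _ (sphere_coord_mem s)).le

lemma inner_toLp_cm {f g : S2 → ℝ} (hf : Continuous f) (hg : Continuous g) :
    inner ℝ (ContinuousMap.toLp 2 area ℝ (cm f hf)) (ContinuousMap.toLp 2 area ℝ (cm g hg))
      = ∫ s, f s * g s ∂area := by
  rw [ContinuousMap.inner_toLp]
  congr 1
  funext s
  exact mul_comm _ _

/-- The coefficient of a function on the sphere with respect to a zonal harmonic. -/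
def coef (l : ℕ) (f : S2 → ℝ) : ℝ := ∫ s, f s * Yl0 l s ∂area

/-- Uniform approximation passes to L², where Parseval's identity holds on the closed span. Only one
of the two functions has to be axially symmetric. -/
lemma AxiSym.hasSum_coef {f g : S2 → ℝ} (hf : AxiSym f) (hfc : Continuous f)
    (hgc : Continuous g) : HasSum (fun l => coef l f * coef l g) (∫ s, f s * g s ∂area) := by
  set T := ContinuousMap.toLp (E := ℝ) 2 area ℝ
  have ho : Orthonormal ℝ fun l => T (cm (Yl0 l) (smoothS_Yl0 l).continuous) := by
    rw [orthonormal_iff_ite]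
    intro l m
    rw [inner_toLp_cm, integral_Yl0_mul]
  have hmem : T (cm f hfc) ∈ closure (Submodule.span ℝ
      (Set.range fun l => T (cm (Yl0 l) (smoothS_Yl0 l).continuous)) : Set _) := by
    have h := map_mem_closure T.continuous (hf.mem_closure_zonal hfc)
      (t := (Submodule.span ℝ
      (Set.range fun l => T (cm (Yl0 l) (smoothS_Yl0 l).continuous)) : Set _)) ?_
    · exact h
    · intro x hx
      have := Submodule.mem_map_of_mem (f := T.toLinearMap) hx
      rw [Submodule.map_span, ← Set.range_comp] at this
      exact this
  have h := hasSum_inner_mul_inner_of_mem_closure ho hmem (T (cm g hgc))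
  simp only [T, inner_toLp_cm] at h
  have e : (∫ s, f s * g s ∂area) = ∫ s, g s * f s ∂area := by
    congr 1; funext s; ring
  rw [e]
  refine h.congr_fun fun l => ?_
  rw [coef, coef, mul_comm]
  congr 1
  congr 1
  funext s; ring

/-- A smooth axially symmetric eigenfunction of the sphere Laplacian is a zonal harmonic. -/
lemma AxiSym.eq_of_eigen {f : S2 → ℝ} (hf : AxiSym f) (hs : SmoothS f) {l : ℕ}
    (h : ∀ s, sphereLaplacian f s = -(l * (l + 1)) * f s) (s : S2) :
    f s = coef l f * Yl0 l s := by
  have hY : AxiSym (Yl0 l) := by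
    intro a s
    simp only [Yl0, rotatePoint_coe, rot_apply, (rotVec_apply 2 a (s : E3)).1]
  set g : S2 → ℝ := fun s => f s - coef l f * Yl0 l s with hg
  have hgc : Continuous g := hs.continuous.sub (continuous_const.mul (smoothS_Yl0 l).continuous)
  have hga : AxiSym g := fun a s => by simp only [hg, hf a s, hY a s]
  have hcoef : ∀ m, coef m g = 0 := by
    intro m
    have e : ∀ s, g s * Yl0 m s = f s * Yl0 m s - coef l f * (Yl0 l s * Yl0 m s) := fun s => by
      simp only [hg]; ring
    rw [coef]
    simp only [e]
    rw [integral_sub (integrable_mul_of_continuous hs.continuous (smoothS_Yl0 m).continuous)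
      ((integrable_mul_of_continuous (smoothS_Yl0 l).continuous
        (smoothS_Yl0 m).continuous).const_mul _), integral_const_mul, integral_Yl0_mul]
    split_ifs with hlm
    · subst hlm; rw [coef]; ring
    · rw [integral_mul_Yl0_of_eigen hs hlm h]; ring
  -- After removal of the l-th component every zonal coefficient vanishes, so Parseval's identity
  -- leaves norm zero.
  have h0 : ∫ s, g s * g s ∂area = 0 := by
    have := hga.hasSum_coef hgc hgc
    simp only [hcoef, mul_zero] at this
    exact this.unique hasSum_zero
  have h1 : (fun s => g s * g s) = 0 := by
    have h2 := (integral_eq_zero_iff_of_nonneg (fun s => mul_self_nonneg (g s))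
      (integrable_mul_of_continuous hgc hgc)).mp h0
    exact (Continuous.ae_eq_iff_eq area (hgc.mul hgc) continuous_const).mp h2
  have h2 := mul_self_eq_zero.mp (congrFun h1 s)
  simp only [hg] at h2
  linarith


/-! ### Reduction of the field equation to oscillators. -/

open MeasureTheory

/-! ### Time dependence of the coefficients of a solution -/

/-- The time interval. -/
abbrev IT : Set ℝ := Set.Ioo 0 Real.pi

lemma half_pi_mem : Real.pi / 2 ∈ IT := ⟨by positivity, by linarith [Real.pi_pos]⟩

/-- Smooth functions on `(0, π) × S²`. -/
def SmoothT (H : ℝ → S2 → ℝ) : Prop :=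
  ContDiffOn ℝ ∞ (fun p : ℝ × E3 => radialExt (H p.1) p.2) (IT ×ˢ {0}ᶜ)

namespace SmoothT

variable {H : ℝ → S2 → ℝ}

lemma contDiffAt (hH : SmoothT H) {t : ℝ} (ht : t ∈ IT) {x : E3} (hx : x ≠ 0) :
    ContDiffAt ℝ ∞ (fun p : ℝ × E3 => radialExt (H p.1) p.2) (t, x) :=
  ContDiffOn.contDiffAt hH ((isOpen_Ioo.prod isOpen_compl_singleton).mem_nhds ⟨ht, hx⟩)

lemma smoothS (hH : SmoothT H) {t : ℝ} (ht : t ∈ IT) : SmoothS (H t) := fun _ hx =>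
  ((hH.contDiffAt ht hx).comp _ (f := fun y : E3 => (t, y))
    (contDiffAt_const.prodMk contDiffAt_id)).contDiffWithinAt

lemma hasDerivAt_aux (hH : SmoothT H) {t : ℝ} (ht : t ∈ IT) {x : E3} (hx : x ≠ 0) :
    HasDerivAt (fun τ => radialExt (H τ) x)
      (fderiv ℝ (fun p : ℝ × E3 => radialExt (H p.1) p.2) (t, x) (1, 0)) t := by
  have h1 := ((hH.contDiffAt ht hx).differentiableAt (by simp)).hasFDerivAt
  have h2 : HasDerivAt (fun τ : ℝ => (τ, x)) (1, 0) t :=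
    (hasDerivAt_id t).prodMk (hasDerivAt_const t x)
  exact h1.comp_hasDerivAt t h2

lemma dt_eq (hH : SmoothT H) {t : ℝ} (ht : t ∈ IT) {x : E3} (hx : x ≠ 0) :
    radialExt (dt H t) x = fderiv ℝ (fun p : ℝ × E3 => radialExt (H p.1) p.2) (t, x) (1, 0) := by
  rw [← (hH.hasDerivAt_aux ht hx).deriv, radialExt_of_ne _ hx, dt]
  congr 1
  funext τ
  rw [radialExt_of_ne _ hx]

lemma dt (hH : SmoothT H) : SmoothT (dt H) := by
  have h : ContDiffOn ℝ ∞ (fun p : ℝ × E3 =>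
      fderiv ℝ (fun p : ℝ × E3 => radialExt (H p.1) p.2) p (1, 0)) (IT ×ˢ {0}ᶜ) :=
    (ContDiffOn.fderiv_of_isOpen hH (isOpen_Ioo.prod isOpen_compl_singleton)
      (by simp)).clm_apply contDiffOn_const
  exact h.congr fun p hp => hH.dt_eq hp.1 hp.2

lemma hasDerivAt (hH : SmoothT H) {t : ℝ} (ht : t ∈ IT) (s : S2) :
    HasDerivAt (fun τ => H τ s) (Gowdy.dt H t s) t := by
  have h := hH.hasDerivAt_aux ht (coe_ne_zero s)
  rw [← hH.dt_eq ht (coe_ne_zero s)] at h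
  simpa only [radialExt_coe] using h

lemma continuousOn (hH : SmoothT H) :
    ContinuousOn (fun p : ℝ × S2 => H p.1 p.2) (IT ×ˢ Set.univ) := by
  have h : ContinuousOn (fun p : ℝ × S2 => radialExt (H p.1) (p.2 : E3)) (IT ×ˢ Set.univ) :=
    ContinuousOn.comp (f := fun p : ℝ × S2 => (p.1, (p.2 : E3))) (ContDiffOn.continuousOn hH)
      (by fun_prop) fun p hp => ⟨hp.1, coe_ne_zero p.2⟩
  simpa only [radialExt_coe] using h

lemma hasDerivAt_coef (hH : SmoothT H) (l : ℕ) {t : ℝ} (ht : t ∈ IT) :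
    HasDerivAt (fun τ => coef l (H τ)) (coef l (Gowdy.dt H t)) t := by
  refine hasDerivAt_integral_area (G := fun τ s => H τ s * Yl0 l s)
    (G' := fun τ s => Gowdy.dt H τ s * Yl0 l s) isOpen_Ioo ht
    (fun τ hτ => (hH.smoothS hτ).continuous.mul (smoothS_Yl0 l).continuous) ?_
    (fun τ hτ s => (hH.hasDerivAt hτ s).mul_const _)
  exact hH.dt.continuousOn.mul
    ((smoothS_Yl0 l).continuous.comp continuous_snd).continuousOn

end SmoothT

/-- The squared frequency of the `ℓ`-th mode. -/
def freqSq (l : ℕ) (t : ℝ) : ℝ := (l + 1 / 2 : ℝ) ^ 2 + 1 / (4 * Real.sin t ^ 2)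

/-- `z`, with derivative `z'`, satisfies the equation of the `ℓ`-th mode. -/
def IsModeFn (l : ℕ) (z z' : ℝ → ℝ) : Prop :=
  ∀ t ∈ IT, HasDerivAt z (z' t) t ∧ HasDerivAt z' (-(freqSq l t) * z t) t

lemma sin_pos_of_mem {t : ℝ} (ht : t ∈ IT) : 0 < Real.sin t := Real.sin_pos_of_mem_Ioo ht

lemma coef_smul_add {f g : S2 → ℝ} (hf : Continuous f) (hg : Continuous g) (l : ℕ) (a b : ℝ) :
    coef l (fun s => a * f s + b * g s) = a * coef l f + b * coef l g := by
  have e : ∀ s, (a * f s + b * g s) * Yl0 l s = a * (f s * Yl0 l s) + b * (g s * Yl0 l s) :=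
    fun s => by ring
  rw [coef]
  simp only [e]
  rw [integral_add ((integrable_mul_of_continuous hf (smoothS_Yl0 l).continuous).const_mul _)
    ((integrable_mul_of_continuous hg (smoothS_Yl0 l).continuous).const_mul _),
    integral_const_mul, integral_const_mul, coef, coef]

lemma coef_sphereLaplacian {f : S2 → ℝ} (hf : SmoothS f) (l : ℕ) :
    coef l (sphereLaplacian f) = -(l * (l + 1)) * coef l f := by
  rw [coef, integral_sphereLaplacian_mul hf (smoothS_Yl0 l), coef, ← integral_const_mul]
  congr 1
  funext s
  rw [sphereLaplacian_Yl0]; ring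

lemma dt_dt (ξ : ℝ → S2 → ℝ) (t : ℝ) (s : S2) :
    dt (dt ξ) t s = iteratedDeriv 2 (fun τ => ξ τ s) t := by
  rw [iteratedDeriv_succ, iteratedDeriv_one]; rfl

lemma smoothT_sol (ξ : Sol) : SmoothT (ξ : ℝ → S2 → ℝ) := ξ.2.smooth

/-- The coefficients of a solution satisfy the mode equations. -/
lemma isModeFn_coef (ξ : Sol) (l : ℕ) :
    IsModeFn l (fun t => coef l ((ξ : ℝ → S2 → ℝ) t)) (fun t => coef l (dt ξ t)) := by
  intro t ht
  refine ⟨(smoothT_sol ξ).hasDerivAt_coef l ht, ?_⟩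
  have h := (smoothT_sol ξ).dt.hasDerivAt_coef l ht
  refine h.congr_deriv ?_
  have hs := (smoothT_sol ξ).smoothS ht
  have e : dt (dt ξ) t = fun s => 1 * sphereLaplacian ((ξ : ℝ → S2 → ℝ) t) s
      + (-(1 / 4 * (1 + 1 / Real.sin t ^ 2))) * (ξ : ℝ → S2 → ℝ) t s := by
    funext s
    have := ξ.2.equation t ht s
    rw [dt_dt]
    linarith
  rw [e, coef_smul_add (continuous_sphereLaplacian hs) hs.continuous, coef_sphereLaplacian hs,
    freqSq]
  have := (sin_pos_of_mem ht).ne'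
  field_simp
  ring

/-! ### The mode functions -/

lemma cos_mem_of_mem {t : ℝ} (ht : t ∈ IT) : Real.cos t ∈ Set.Ioo (-1 : ℝ) 1 := by
  have h1 := sin_pos_of_mem ht
  have h2 := Real.sin_sq_add_cos_sq t
  constructor <;> nlinarith

/-- The mode function built from a Legendre function. -/
def modeOf (R : ℕ → ℝ → ℝ) (l : ℕ) (t : ℝ) : ℝ :=
  Real.sqrt (Real.sin t) * (R l (Real.cos t) / Real.sqrt 2)

/-- The derivative of `modeOf`. -/
def modeOf' (R : ℕ → ℝ → ℝ) (l : ℕ) (t : ℝ) : ℝ :=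
  Real.cos t / (2 * Real.sqrt (Real.sin t)) * (R l (Real.cos t) / Real.sqrt 2)
    - Real.sqrt (Real.sin t) ^ 3 * (legendreD R l (Real.cos t) / Real.sqrt 2)

lemma u₀_eq (l : ℕ) : u₀ l = modeOf legendreP l := rfl
lemma v₀_eq (l : ℕ) : v₀ l = modeOf legendreQ l := rfl

/-- With x = cos t Legendre's equation becomes y'' + cot t y' + l(l+1) y = 0. The factor √(sin t)
removes the first order term and shifts the potential to (l + 1/2)² + 1/(4 sin² t). -/
lemma isModeFn_modeOf {R : ℕ → ℝ → ℝ} (hR : IsLegendre R) (l : ℕ) :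
    IsModeFn l (modeOf R l) (modeOf' R l) := by
  intro t ht
  have hs := sin_pos_of_mem ht
  have hx := cos_mem_of_mem ht
  set S := Real.sqrt (Real.sin t) with hS
  have hSpos : 0 < S := Real.sqrt_pos.mpr hs
  have hS2 : Real.sin t = S ^ 2 := (Real.sq_sqrt hs.le).symm
  -- In the variable S = √(sin t) every expression is rational, and this is the only relation left
  -- between S and cos t.
  have hc2 : Real.cos t ^ 2 = 1 - S ^ 4 := by
    have := Real.sin_sq_add_cos_sq t
    rw [hS2] at this
    linear_combination this
  have h2 : Real.sqrt 2 ≠ 0 := by positivity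
  have dS : HasDerivAt (fun τ => Real.sqrt (Real.sin τ)) (Real.cos t / (2 * S)) t :=
    (Real.hasDerivAt_sin t).sqrt hs.ne'
  have dR : HasDerivAt (fun τ => R l (Real.cos τ)) (legendreD R l (Real.cos t) * (-Real.sin t)) t :=
    (hR.hasDerivAt l hx).comp t (Real.hasDerivAt_cos t)
  have dD : HasDerivAt (fun τ => legendreD R l (Real.cos τ))
      (((2 * Real.cos t * legendreD R l (Real.cos t) - l * (l + 1) * R l (Real.cos t))
        / (1 - Real.cos t ^ 2)) * (-Real.sin t)) t :=
    (hR.hasDerivAt_D l hx).comp t (Real.hasDerivAt_cos t)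
  constructor
  · refine (dS.mul (dR.div_const (Real.sqrt 2))).congr_deriv ?_
    rw [modeOf', ← hS, hS2]
    ring
  · have d1 := ((Real.hasDerivAt_cos t).div (dS.const_mul 2) (by positivity)).mul
      (dR.div_const (Real.sqrt 2))
    have d2 := (dS.pow 3).mul (dD.div_const (Real.sqrt 2))
    refine (d1.sub d2).congr_deriv ?_
    simp only [Pi.div_apply, Pi.pow_apply]
    rw [modeOf, freqSq, ← hS, hS2, hc2]
    have e : (1 : ℝ) - (1 - S ^ 4) = S ^ 4 := by ring
    rw [e]
    field_simp
    ring_nf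
    rw [hc2]
    ring

lemma isModeFn_u₀ (l : ℕ) : IsModeFn l (u₀ l) (modeOf' legendreP l) :=
  isModeFn_modeOf isLegendre_P l

lemma isModeFn_v₀ (l : ℕ) : IsModeFn l (v₀ l) (modeOf' legendreQ l) :=
  isModeFn_modeOf isLegendre_Q l

/-- The value 1/2 comes from the two factors 1/√2; the sign comes from (cos t)' = -sin t. -/
lemma wronskian_u₀_v₀ (l : ℕ) {t : ℝ} (ht : t ∈ IT) :
    v₀ l t * modeOf' legendreP l t - u₀ l t * modeOf' legendreQ l t = 1 / 2 := by
  have hs := sin_pos_of_mem ht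
  have hw := legendre_wronskian l (cos_mem_of_mem ht)
  rw [u₀_eq, v₀_eq, modeOf', modeOf', modeOf, modeOf]
  set S := Real.sqrt (Real.sin t) with hS
  have hSpos : 0 < S := Real.sqrt_pos.mpr hs
  have hS2 : Real.sin t = S ^ 2 := (Real.sq_sqrt hs.le).symm
  have hc2 : 1 - Real.cos t ^ 2 = S ^ 4 := by
    have := Real.sin_sq_add_cos_sq t
    rw [hS2] at this
    linear_combination -this
  rw [hc2] at hw
  have h2 : Real.sqrt 2 ^ 2 = 2 := Real.sq_sqrt (by norm_num)
  have h2' : Real.sqrt 2 ≠ 0 := by positivity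
  field_simp
  rw [h2]
  linear_combination 2 * hw

/-- The Wronskian of two solutions of a mode equation is constant. -/
lemma IsModeFn.wronskian_const {l : ℕ} {a a' b b' : ℝ → ℝ} (ha : IsModeFn l a a')
    (hb : IsModeFn l b b') {t₀ t₁ : ℝ} (h0 : t₀ ∈ IT) (h1 : t₁ ∈ IT) :
    b t₀ * a' t₀ - a t₀ * b' t₀ = b t₁ * a' t₁ - a t₁ * b' t₁ := by
  have hd : ∀ t ∈ IT, HasDerivAt (fun t => b t * a' t - a t * b' t) 0 t := by
    intro t ht
    refine (((hb t ht).1.mul (ha t ht).2).sub ((ha t ht).1.mul (hb t ht).2)).congr_deriv ?_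
    ring
  exact isOpen_Ioo.is_const_of_deriv_eq_zero isPreconnected_Ioo
    (fun t ht => (hd t ht).differentiableAt.differentiableWithinAt)
    (fun t ht => (hd t ht).deriv) h0 h1

lemma IsModeFn.comb {l : ℕ} {a a' b b' : ℝ → ℝ} (ha : IsModeFn l a a') (hb : IsModeFn l b b')
    (x y : ℝ) : IsModeFn l (fun t => x * a t + y * b t) (fun t => x * a' t + y * b' t) := by
  intro t ht
  refine ⟨((ha t ht).1.const_mul x).add ((hb t ht).1.const_mul y), ?_⟩
  refine (((ha t ht).2.const_mul x).add ((hb t ht).2.const_mul y)).congr_deriv ?_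
  ring

lemma contDiffOn_u₀ (l : ℕ) : ContDiffOn ℝ ∞ (u₀ l) IT := by
  intro t ht
  have hs : ContDiffAt ℝ ∞ (fun τ => Real.sqrt (Real.sin τ)) t :=
    Real.contDiff_sin.contDiffAt.sqrt (sin_pos_of_mem ht).ne'
  exact (hs.mul (((contDiff_legendreP l).contDiffAt.comp t
    Real.contDiff_cos.contDiffAt).div_const _)).contDiffWithinAt

lemma contDiffOn_v₀ (l : ℕ) : ContDiffOn ℝ ∞ (v₀ l) IT := by
  intro t ht
  have hs : ContDiffAt ℝ ∞ (fun τ => Real.sqrt (Real.sin τ)) t :=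
    Real.contDiff_sin.contDiffAt.sqrt (sin_pos_of_mem ht).ne'
  exact (hs.mul (((contDiffAt_legendreQ l (cos_mem_of_mem ht)).comp t
    Real.contDiff_cos.contDiffAt).div_const _)).contDiffWithinAt

/-! ### Mode solutions -/

/-- The function `z(t) Y_{ℓ0}(s)` on `(0, π) × S²`, extended by zero. -/
def modeFun (l : ℕ) (z : ℝ → ℝ) (t : ℝ) (s : S2) : ℝ :=
  open Classical in if t ∈ IT then z t * Yl0 l s else 0

lemma modeFun_of_mem (l : ℕ) (z : ℝ → ℝ) {t : ℝ} (ht : t ∈ IT) :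
    modeFun l z t = z t • Yl0 l := by
  funext s; simp [modeFun, ht]

lemma isSolution_modeFun {l : ℕ} {z z' : ℝ → ℝ} (hz : IsModeFn l z z')
    (hc : ContDiffOn ℝ ∞ z IT) : IsSolution (modeFun l z) := by
  refine ⟨?_, ?_, ?_⟩
  · have h : ContDiffOn ℝ ∞ (fun p : ℝ × E3 => z p.1 * radialExt (Yl0 l) p.2)
        (IT ×ˢ {0}ᶜ) :=
      (hc.comp contDiffOn_fst fun p hp => hp.1).mul
        (ContDiffOn.comp (smoothS_Yl0 l) contDiffOn_snd fun p hp => hp.2)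
    refine h.congr fun p hp => ?_
    rw [modeFun_of_mem l z hp.1, radialExt_smul]; rfl
  · intro t ht s
    have e1 : (fun τ => modeFun l z τ s) =ᶠ[nhds t] fun τ => z τ * Yl0 l s := by
      filter_upwards [isOpen_Ioo.mem_nhds ht] with τ hτ
      rw [modeFun_of_mem l z hτ]; rfl
    have e2 : deriv (fun τ => modeFun l z τ s) =ᶠ[nhds t] fun τ => z' τ * Yl0 l s := by
      filter_upwards [isOpen_Ioo.mem_nhds ht] with τ hτ
      have e3 : (fun τ => modeFun l z τ s) =ᶠ[nhds τ] fun τ => z τ * Yl0 l s := by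
        filter_upwards [isOpen_Ioo.mem_nhds hτ] with τ hτ
        rw [modeFun_of_mem l z hτ]; rfl
      rw [e3.deriv_eq]
      exact ((hz τ hτ).1.mul_const _).deriv
    have e4 : iteratedDeriv 2 (fun τ => modeFun l z τ s) t = -(freqSq l t) * z t * Yl0 l s := by
      rw [iteratedDeriv_succ, iteratedDeriv_one, e2.deriv_eq]
      exact ((hz t ht).2.mul_const _).deriv
    rw [e4, modeFun_of_mem l z ht, sphereLaplacian_smul (smoothS_Yl0 l), sphereLaplacian_Yl0,
      freqSq]
    have := (sin_pos_of_mem ht).ne'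
    simp only [Pi.smul_apply, smul_eq_mul]
    field_simp
    ring
  · intro t ht s
    simp [modeFun, ht]

/-- The mode solutions `ũ_{0ℓ} Y_{ℓ0}`. -/
def uSol (l : ℕ) : Sol := ⟨modeFun l (u₀ l), isSolution_modeFun (isModeFn_u₀ l) (contDiffOn_u₀ l)⟩

/-- The mode solutions `ṽ_{0ℓ} Y_{ℓ0}`. -/
def vSol (l : ℕ) : Sol := ⟨modeFun l (v₀ l), isSolution_modeFun (isModeFn_v₀ l) (contDiffOn_v₀ l)⟩

lemma isMode_uv (l : ℕ) (x y : ℝ) :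
    IsMode (x • uSol l + y • vSol l) (fun t => x * u₀ l t + y * v₀ l t) l := by
  intro t ht s
  show x * modeFun l (u₀ l) t s + y * modeFun l (v₀ l) t s = _
  rw [modeFun_of_mem l _ ht, modeFun_of_mem l _ ht]
  simp only [Pi.smul_apply, smul_eq_mul]
  ring

lemma IsMode.ext {ξ η : Sol} {z : ℝ → ℝ} {l : ℕ} (h1 : IsMode ξ z l) (h2 : IsMode η z l) :
    ξ = η := by
  ext t s
  by_cases ht : t ∈ IT
  · rw [h1 t ht s, h2 t ht s]
  · rw [ξ.2.zero_off t ht s, η.2.zero_off t ht s]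

lemma IsMode.dt_eq {ξ : Sol} {z z' : ℝ → ℝ} {l : ℕ} (h : IsMode ξ z l)
    (hz : ∀ t ∈ IT, HasDerivAt z (z' t) t) {t : ℝ} (ht : t ∈ IT) (s : S2) :
    dt ξ t s = z' t * Yl0 l s := by
  have e : (fun τ => (ξ : ℝ → S2 → ℝ) τ s) =ᶠ[nhds t] fun τ => z τ * Yl0 l s := by
    filter_upwards [isOpen_Ioo.mem_nhds ht] with τ hτ
    exact h τ hτ s
  rw [dt, e.deriv_eq]
  exact ((hz t ht).mul_const _).deriv

lemma coef_const_mul_Yl0 (l m : ℕ) (c : ℝ) :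
    coef m (fun s => c * Yl0 l s) = if l = m then c else 0 := by
  rw [coef]
  simp only [mul_assoc]
  rw [integral_const_mul, integral_Yl0_mul]
  split_ifs <;> simp

/-- The symplectic form of a mode with a solution. -/
lemma Omega_mode {ξ : Sol} {z z' : ℝ → ℝ} {l : ℕ} (h : IsMode ξ z l)
    (hz : ∀ t ∈ IT, HasDerivAt z (z' t) t) (η : Sol) :
    Omega ξ η = coef l ((η : ℝ → S2 → ℝ) (Real.pi / 2)) * z' (Real.pi / 2)
      - z (Real.pi / 2) * coef l (dt η (Real.pi / 2)) := by
  have hm := half_pi_mem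
  rw [Omega, coef, coef, ← integral_mul_const, ← integral_const_mul, ← integral_sub]
  · congr 1
    funext s
    rw [h _ hm s, h.dt_eq hz hm]
    ring
  · exact (integrable_mul_of_continuous ((smoothT_sol η).smoothS hm).continuous
      (smoothS_Yl0 l).continuous).mul_const _
  · exact (integrable_mul_of_continuous ((smoothT_sol η).dt.smoothS hm).continuous
      (smoothS_Yl0 l).continuous).const_mul _

lemma Omega_antisymm (ξ η : Sol) : Omega ξ η = -Omega η ξ := by
  rw [Omega, Omega, ← integral_neg]
  congr 1
  funext s
  ring

/-! ### Axially symmetric solutions -/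

lemma rot_two_axis (a : ℝ) : rot 2 a axis = axis := by
  rw [rot_apply]
  have : axis = ev 2 := rfl
  rw [this]
  apply ext_axis 2 <;> simp [rotVec, gen_apply, ev_apply]

lemma axiSym_sol (φ : AxiSol) (t : ℝ) : AxiSym (((φ : Sol) : ℝ → S2 → ℝ) t) := by
  intro a s
  have h := φ.2 (rot 2 a)⁻¹ (SO3.inv_mem (rot_mem_SO3 2 a)) (by
    rw [rot_inv]; exact rot_two_axis (-a))
  have h2 := congrArg (fun ξ : Sol => (ξ : ℝ → S2 → ℝ) t s) h
  have h3 : ((φ : Sol) : ℝ → S2 → ℝ) t (rotatePoint ((rot 2 a)⁻¹)⁻¹ s)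
      = ((φ : Sol) : ℝ → S2 → ℝ) t s := h2
  rwa [inv_inv] at h3

lemma coord_rotatePoint {g : E3 ≃ₗᵢ[ℝ] E3} (hg : g axis = axis) (s : S2) :
    (rotatePoint g s : E3) 2 = (s : E3) 2 := by
  have e : ∀ x : E3, x 2 = inner ℝ axis x := fun x => by
    simp [axis, EuclideanSpace.inner_single_left]
  rw [e, e, rotatePoint_coe]
  conv_lhs => rw [← hg]
  exact g.inner_map_map _ _

lemma IsMode.mem_AxiSol {ξ : Sol} {z : ℝ → ℝ} {l : ℕ} (h : IsMode ξ z l) : ξ ∈ AxiSol := by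
  intro g _ hx
  have hx' : g⁻¹ axis = axis := by
    conv_lhs => rw [← hx]
    exact g.symm_apply_apply axis
  ext t s
  show (ξ : ℝ → S2 → ℝ) t (rotatePoint g⁻¹ s) = (ξ : ℝ → S2 → ℝ) t s
  by_cases ht : t ∈ IT
  · rw [h t ht, h t ht, Yl0, Yl0, coord_rotatePoint hx']
  · rw [ξ.2.zero_off t ht, ξ.2.zero_off t ht]

/-- Parseval's identity for the symplectic form. -/
lemma hasSum_Omega (φ η : AxiSol) :
    HasSum (fun l => coef l (((η : Sol) : ℝ → S2 → ℝ) (Real.pi / 2)) *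
        coef l (dt (φ : Sol) (Real.pi / 2))
      - coef l (((φ : Sol) : ℝ → S2 → ℝ) (Real.pi / 2)) * coef l (dt (η : Sol) (Real.pi / 2)))
      (Omega φ η) := by
  have hm := half_pi_mem
  have c1 := ((smoothT_sol (η : Sol)).smoothS hm).continuous
  have c2 := ((smoothT_sol (η : Sol)).dt.smoothS hm).continuous
  have c3 := ((smoothT_sol (φ : Sol)).smoothS hm).continuous
  have c4 := ((smoothT_sol (φ : Sol)).dt.smoothS hm).continuous
  have h1 := (axiSym_sol η (Real.pi / 2)).hasSum_coef c1 c4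
  have h2 := (axiSym_sol φ (Real.pi / 2)).hasSum_coef c3 c2
  have h := h1.sub h2
  rwa [← integral_sub (integrable_mul_of_continuous c1 c4)
    (integrable_mul_of_continuous c3 c2)] at h


/-! ### Rotation invariance forces the modes to be preserved. -/

open MeasureTheory

/-! ### Averages of trigonometric polynomials over roots of unity -/

/-- Trigonometric polynomials of degree at most `d`. -/
def trigPoly (d : ℕ) : Submodule ℂ (ℝ → ℂ) :=
  Submodule.span ℂ {f | ∃ j : ℤ, |j| ≤ d ∧ f = fun ψ : ℝ => Complex.exp (j * ψ * Complex.I)}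

lemma trigPoly_mono {d e : ℕ} (h : d ≤ e) : trigPoly d ≤ trigPoly e := by
  refine Submodule.span_mono ?_
  rintro f ⟨j, hj, rfl⟩
  exact ⟨j, hj.trans (by exact_mod_cast h), rfl⟩

lemma trigPoly_exp_mul {d : ℕ} (i : ℤ) (hi : |i| ≤ 1) {f : ℝ → ℂ} (hf : f ∈ trigPoly d) :
    (fun ψ : ℝ => Complex.exp (i * ψ * Complex.I) * f ψ) ∈ trigPoly (d + 1) := by
  induction hf using Submodule.span_induction with
  | mem f h =>
    obtain ⟨j, hj, rfl⟩ := h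
    refine Submodule.subset_span ⟨i + j, ?_, ?_⟩
    · have := abs_add_le i j
      push_cast
      linarith
    · funext ψ
      rw [← Complex.exp_add]
      congr 1
      push_cast
      ring
  | zero =>
    have : (fun ψ : ℝ => Complex.exp (i * ψ * Complex.I) * (0 : ℝ → ℂ) ψ) = 0 := by
      funext ψ; simp
    rw [this]; exact Submodule.zero_mem _
  | add f g _ _ hf hg =>
    have : (fun ψ : ℝ => Complex.exp (i * ψ * Complex.I) * (f + g) ψ)
        = (fun ψ : ℝ => Complex.exp (i * ψ * Complex.I) * f ψ)
          + fun ψ : ℝ => Complex.exp (i * ψ * Complex.I) * g ψ := by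
      funext ψ; simp [mul_add]
    rw [this]; exact Submodule.add_mem _ hf hg
  | smul c f _ hf =>
    have : (fun ψ : ℝ => Complex.exp (i * ψ * Complex.I) * (c • f) ψ)
        = c • fun ψ : ℝ => Complex.exp (i * ψ * Complex.I) * f ψ := by
      funext ψ; simp only [Pi.smul_apply, smul_eq_mul]; ring
    rw [this]; exact Submodule.smul_mem _ _ hf

/-- Multiplication by a + b cos ψ + c sin ψ raises the trigonometric degree by at most one, and the
recurrence multiplies by it once at each step. -/
lemma legendreP_trigPoly (a b c : ℝ) (l : ℕ) :
    (fun ψ : ℝ => (legendreP l (a + b * Real.cos ψ + c * Real.sin ψ) : ℂ)) ∈ trigPoly l := by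
  have hmul : ∀ {d : ℕ} {f : ℝ → ℂ}, f ∈ trigPoly d →
      (fun ψ : ℝ => ((a + b * Real.cos ψ + c * Real.sin ψ : ℝ) : ℂ) * f ψ) ∈ trigPoly (d + 1) := by
    intro d f hf
    have e : (fun ψ : ℝ => ((a + b * Real.cos ψ + c * Real.sin ψ : ℝ) : ℂ) * f ψ)
        = (a : ℂ) • f
          + ((b - c * Complex.I) / 2) • (fun ψ : ℝ => Complex.exp ((1 : ℤ) * ψ * Complex.I) * f ψ)
          + ((b + c * Complex.I) / 2) •
            (fun ψ : ℝ => Complex.exp ((-1 : ℤ) * ψ * Complex.I) * f ψ) := by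
      funext ψ
      simp only [Pi.add_apply, Pi.smul_apply, smul_eq_mul]
      push_cast
      rw [Complex.cos, Complex.sin]
      have e1 : (1 : ℂ) * ψ * Complex.I = ψ * Complex.I := by ring
      have e2 : (-1 : ℂ) * ψ * Complex.I = -ψ * Complex.I := by ring
      rw [e1, e2]
      ring
    rw [e]
    exact Submodule.add_mem _ (Submodule.add_mem _
      (Submodule.smul_mem _ _ (trigPoly_mono (Nat.le_succ d) hf))
      (Submodule.smul_mem _ _ (trigPoly_exp_mul 1 (by norm_num) hf)))
      (Submodule.smul_mem _ _ (trigPoly_exp_mul (-1) (by norm_num) hf))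
  have hone : (fun _ : ℝ => (1 : ℂ)) ∈ trigPoly 0 :=
    Submodule.subset_span ⟨0, by simp, by funext ψ; simp⟩
  have : ∀ l, (fun ψ : ℝ => (legendreP l (a + b * Real.cos ψ + c * Real.sin ψ) : ℂ)) ∈ trigPoly l ∧
      (fun ψ : ℝ => (legendreP (l + 1) (a + b * Real.cos ψ + c * Real.sin ψ) : ℂ))
        ∈ trigPoly (l + 1) := by
    intro l
    induction l with
    | zero =>
      refine ⟨by simpa only [legendreP, legendreRec, Complex.ofReal_one] using hone, ?_⟩
      have := hmul hone
      simp only [mul_one] at this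
      exact this
    | succ l ih =>
      refine ⟨ih.2, ?_⟩
      have e : (fun ψ : ℝ => (legendreP (l + 2) (a + b * Real.cos ψ + c * Real.sin ψ) : ℂ))
          = (((2 * l + 3) / (l + 2) : ℝ) : ℂ) • (fun ψ : ℝ =>
              ((a + b * Real.cos ψ + c * Real.sin ψ : ℝ) : ℂ) *
                (legendreP (l + 1) (a + b * Real.cos ψ + c * Real.sin ψ) : ℂ))
            - (((l + 1) / (l + 2) : ℝ) : ℂ) •
              (fun ψ : ℝ => (legendreP l (a + b * Real.cos ψ + c * Real.sin ψ) : ℂ)) := by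
        funext ψ
        have := isLegendre_P.recur l (a + b * Real.cos ψ + c * Real.sin ψ)
        have e2 : legendreP (l + 2) (a + b * Real.cos ψ + c * Real.sin ψ)
            = (2 * l + 3) / (l + 2) * ((a + b * Real.cos ψ + c * Real.sin ψ)
                * legendreP (l + 1) (a + b * Real.cos ψ + c * Real.sin ψ))
              - (l + 1) / (l + 2) * legendreP l (a + b * Real.cos ψ + c * Real.sin ψ) := by
          field_simp
          linear_combination this
        simp only [Pi.sub_apply, Pi.smul_apply, smul_eq_mul]
        rw [e2, Complex.ofReal_sub, Complex.ofReal_mul, Complex.ofReal_mul, Complex.ofReal_mul]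
      show (fun ψ : ℝ => (legendreP (l + 2) (a + b * Real.cos ψ + c * Real.sin ψ) : ℂ))
        ∈ trigPoly (l + 2)
      rw [e]
      exact Submodule.sub_mem _ (Submodule.smul_mem _ _ (hmul ih.2))
        (Submodule.smul_mem _ _ (trigPoly_mono (by omega) ih.1))
  exact (this l).1

/-- The average of a trigonometric polynomial of low degree over a regular polygon does not
change when the polygon is rotated. -/
lemma sum_trigPoly {d N : ℕ} (hdN : d < N) {f : ℝ → ℂ} (hf : f ∈ trigPoly d) (φ : ℝ) :
    ∑ k ∈ Finset.range N, f (φ - 2 * Real.pi * k / N)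
      = ∑ k ∈ Finset.range N, f (0 - 2 * Real.pi * k / N) := by
  have hN : (N : ℂ) ≠ 0 := by
    have : N ≠ 0 := by omega
    exact_mod_cast this
  induction hf using Submodule.span_induction with
  | mem f h =>
    obtain ⟨j, hj, rfl⟩ := h
    by_cases hj0 : j = 0
    · subst hj0; simp
    -- For 0 < |j| < N this is an N-th root of unity different from 1, so the geometric sum over the
    -- polygon vanishes for every position of the polygon.
    set w₀ := Complex.exp (-(2 * Real.pi * j / N) * Complex.I) with hw₀
    have e : ∀ x : ℝ, ∀ k : ℕ, Complex.exp (j * ((x - 2 * Real.pi * k / N : ℝ) : ℂ) * Complex.I)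
        = Complex.exp (j * x * Complex.I) * w₀ ^ k := by
      intro x k
      rw [hw₀, ← Complex.exp_nat_mul, ← Complex.exp_add]
      congr 1
      push_cast
      ring
    have hw₀N : w₀ ^ N = 1 := by
      rw [hw₀, ← Complex.exp_nat_mul, Complex.exp_eq_one_iff]
      refine ⟨-j, ?_⟩
      push_cast
      field_simp
    have hw₀1 : w₀ ≠ 1 := by
      intro h
      rw [hw₀, Complex.exp_eq_one_iff] at h
      obtain ⟨n, hn⟩ := h
      have hpi : (Real.pi : ℂ) ≠ 0 := by exact_mod_cast Real.pi_ne_zero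
      have h2 : (-(j : ℂ)) = n * N := by
        have hI := Complex.I_ne_zero
        field_simp at hn
        linear_combination hn
      have h3 : -j = n * N := by exact_mod_cast h2
      have h4 : (N : ℤ) ∣ j := ⟨-n, by linarith⟩
      have h5 := Int.le_of_dvd (abs_pos.mpr hj0) ((dvd_abs _ _).mpr h4)
      omega
    have hg : ∑ k ∈ Finset.range N, w₀ ^ k = 0 := by
      have := mul_geom_sum w₀ N
      rw [hw₀N, sub_self] at this
      exact (mul_eq_zero.mp this).resolve_left (sub_ne_zero.mpr hw₀1)
    simp only [e, ← Finset.mul_sum, hg, mul_zero]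
  | zero => simp
  | add f g _ _ hf hg =>
    simp only [Pi.add_apply, Finset.sum_add_distrib, hf, hg]
  | smul c f _ hf =>
    simp only [Pi.smul_apply, ← Finset.smul_sum, hf]

/-! ### The discrete addition theorem for zonal harmonics -/

lemma sphereLaplacian_rotate (g : E3 ≃ₗᵢ[ℝ] E3) (f : S2 → ℝ) (s : S2) :
    sphereLaplacian (fun s => f (rotatePoint g s)) s = sphereLaplacian f (rotatePoint g s) := by
  have h1 : radialExt (fun s => f (rotatePoint g s)) = fun x => radialExt f (g x) :=
    funext fun x => radialExt_rotate g f x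
  rw [sphereLaplacian, h1, laplacian_comp_isometry]
  rfl

lemma sphereLaplacian_add {f g : S2 → ℝ} (hf : SmoothS f) (hg : SmoothS g) (s : S2) :
    sphereLaplacian (f + g) s = sphereLaplacian f s + sphereLaplacian g s := by
  simp only [sphereLaplacian, radialExt_add]
  exact ((hf.contDiffAt (coe_ne_zero s)).of_le (by norm_cast)).laplacian_add
    ((hg.contDiffAt (coe_ne_zero s)).of_le (by norm_cast))

lemma eigen_sum {c : ℝ} (F : ℕ → S2 → ℝ) (hF : ∀ k, SmoothS (F k))
    (he : ∀ k s, sphereLaplacian (F k) s = c * F k s) (N : ℕ) :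
    SmoothS (∑ k ∈ Finset.range N, F k) ∧
      ∀ s, sphereLaplacian (∑ k ∈ Finset.range N, F k) s
        = c * (∑ k ∈ Finset.range N, F k) s := by
  induction N with
  | zero =>
    have h0 : radialExt (0 : S2 → ℝ) = fun _ => 0 := by
      funext x; by_cases h : x = 0 <;> simp [radialExt, h]
    refine ⟨?_, fun s => ?_⟩
    · simp only [Finset.range_zero, Finset.sum_empty, SmoothS, h0]
      exact contDiffOn_const
    · have := congrFun (InnerProductSpace.laplacian_const (E := E3) (c := (0 : ℝ))) (s : E3)
      simp only [Finset.range_zero, Finset.sum_empty, sphereLaplacian, h0]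
      simp
  | succ N ih =>
    rw [Finset.sum_range_succ]
    refine ⟨ih.1.add (hF N), fun s => ?_⟩
    rw [sphereLaplacian_add ih.1 (hF N), ih.2, he]
    simp [mul_add]

/-- The north pole. -/
def northPole : S2 := meridian 1 ⟨by norm_num, le_rfl⟩

lemma northPole_coe : (northPole : E3) = ev 2 := by simp [northPole, meridian]

lemma coord_rot_one (β : ℝ) (s : S2) :
    (rotatePoint (rot 1 β)⁻¹ s : E3) 2
      = Real.cos β * (s : E3) 2 + Real.sin β * (s : E3) 0 := by
  rw [rot_inv, rotatePoint_coe, rot_apply]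
  have := (rotVec_apply 1 (-β) (s : E3)).2.1
  simpa using this

/-- On each parallel the tilted harmonic is a trigonometric polynomial of degree at most l, so a sum
over l + 1 equally spaced rotations is already axially symmetric. It is still an eigenfunction,
hence a multiple of `Yl0 l`, and evaluation at the north pole gives the factor. Finite sums are
essential: a linear map without continuity commutes with them but not with an average over the
circle. -/
lemma sum_rotate_Yl0 (l : ℕ) (β : ℝ) (s : S2) :
    ∑ k ∈ Finset.range (l + 1),
      Yl0 l (rotatePoint (rot 1 β)⁻¹ (rotatePoint (rot 2 (2 * Real.pi * k / (l + 1 : ℕ)))⁻¹ s))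
      = (l + 1) * legendreP l (Real.cos β) * Yl0 l s := by
  set F : ℕ → S2 → ℝ := fun k s => Yl0 l (rotatePoint (rot 1 β)⁻¹
    (rotatePoint (rot 2 (2 * Real.pi * k / (l + 1 : ℕ)))⁻¹ s)) with hF
  obtain ⟨hs, he⟩ := eigen_sum (c := -(l * (l + 1))) F
    (fun k => ((smoothS_Yl0 l).rotate _).rotate _) (fun k s => by
      rw [hF]
      simp only
      rw [sphereLaplacian_rotate _ (fun s => Yl0 l (rotatePoint (rot 1 β)⁻¹ s)),
        sphereLaplacian_rotate, sphereLaplacian_Yl0]) (l + 1)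
  have hsum : ∀ (φ : ℝ) (s : S2), (∑ k ∈ Finset.range (l + 1), F k) (rotatePoint (rot 2 φ) s)
      = Real.sqrt ((2 * l + 1) / (4 * Real.pi)) * ∑ k ∈ Finset.range (l + 1),
        legendreP l (Real.cos β * (s : E3) 2
          + (Real.sin β * (s : E3) 0) * Real.cos (φ - 2 * Real.pi * k / (l + 1 : ℕ))
          + (-(Real.sin β * (s : E3) 1)) * Real.sin (φ - 2 * Real.pi * k / (l + 1 : ℕ))) := by
    intro φ s
    rw [Finset.sum_apply, Finset.mul_sum]
    refine Finset.sum_congr rfl fun k _ => ?_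
    simp only [hF, Yl0]
    rw [coord_rot_one, ← rotatePoint_mul, rot_inv, ← rot_add, rotatePoint_coe, rot_apply]
    obtain ⟨p0, p1, -⟩ := rotVec_apply 2 (-(2 * Real.pi * k / (l + 1 : ℕ)) + φ) (s : E3)
    have p1' : rotVec 2 (-(2 * Real.pi * k / (l + 1 : ℕ)) + φ) (s : E3) 0 = _ := p1
    rw [p0, p1']
    have e : -(2 * Real.pi * k / (l + 1 : ℕ)) + φ = φ - 2 * Real.pi * k / (l + 1 : ℕ) := by ring
    rw [e]
    congr 2
    simp
    ring
  have hax : AxiSym (∑ k ∈ Finset.range (l + 1), F k) := by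
    intro φ s
    have h0 := hsum 0 s
    rw [rot_zero, rotatePoint_one] at h0
    rw [hsum, h0]
    congr 1
    have := sum_trigPoly (Nat.lt_succ_self l) (legendreP_trigPoly (Real.cos β * (s : E3) 2)
      (Real.sin β * (s : E3) 0) (-(Real.sin β * (s : E3) 1)) l) φ
    exact_mod_cast this
  have key := hax.eq_of_eigen hs he
  have hY : Yl0 l northPole = Real.sqrt ((2 * l + 1) / (4 * Real.pi)) := by
    rw [Yl0, northPole_coe]; simp [ev_apply, legendreP_one]
  have hne : Yl0 l northPole ≠ 0 := by
    rw [hY]; exact Real.sqrt_ne_zero'.mpr (by positivity)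
  have h1 : (∑ k ∈ Finset.range (l + 1), F k) northPole
      = (l + 1) * legendreP l (Real.cos β) * Yl0 l northPole := by
    have h0 := hsum 0 northPole
    rw [rot_zero, rotatePoint_one] at h0
    rw [h0, hY, northPole_coe]
    simp [ev_apply]
    ring
  have h2 := key northPole
  rw [h1] at h2
  have h3 := mul_right_cancel₀ hne h2
  have h4 := key s
  rw [← h3, Finset.sum_apply] at h4
  exact h4

/-! ### Invariant complex structures act on the modes -/

namespace IsInvariantComplexStructure

variable {J : Sol →ₗ[ℝ] Sol}

lemma map_mem (hJ : IsInvariantComplexStructure J) {φ : Sol} (hφ : φ ∈ AxiSol) : J φ ∈ AxiSol := by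
  intro g hg hx
  rw [← hJ.invariant g hg, hφ g hg hx]

lemma Omega_left (hJ : IsInvariantComplexStructure J) (ξ η : Sol) :
    Omega (J ξ) η = -Omega ξ (J η) := by
  have h := hJ.symplectic ξ (J η)
  rw [hJ.sq] at h
  have e : Omega (J ξ) (-η) = -Omega (J ξ) η := by
    rw [Omega, Omega, ← integral_neg]
    congr 1
    funext s
    have : dt ((-η : Sol) : ℝ → S2 → ℝ) (Real.pi / 2) s = -dt η (Real.pi / 2) s := by
      show deriv (fun τ => -((η : ℝ → S2 → ℝ) τ s)) _ = _
      rw [deriv.fun_neg]; rfl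
    rw [this]
    show -((η : ℝ → S2 → ℝ) (Real.pi / 2) s) * _ - _ = _
    ring
  rw [e] at h
  linarith

/-- Schur's lemma in elementary form. The discrete addition theorem says that a finite sum of
rotations multiplies ξ by (l+1) P_l(cos β); since J commutes with rotations, the same relation holds
for Jξ. At the pole, which rotations about the axis fix, it reads off the value of Jξ at colatitude
β as P_l(cos β) times the value at the pole. -/
lemma isMode_map (hJ : IsInvariantComplexStructure J) {ξ : Sol} {z : ℝ → ℝ} {l : ℕ}
    (h : IsMode ξ z l) : IsMode (J ξ) (fun t => coef l ((J ξ : ℝ → S2 → ℝ) t)) l := by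
  have hax : J ξ ∈ AxiSol := hJ.map_mem h.mem_AxiSol
  have hrel : ∀ β : ℝ, ∑ k ∈ Finset.range (l + 1),
      rotate (rot 2 (2 * Real.pi * k / (l + 1 : ℕ))) (rotate (rot 1 β) ξ)
        = ((l + 1) * legendreP l (Real.cos β)) • ξ := by
    intro β
    ext t s
    have e : ((∑ k ∈ Finset.range (l + 1), rotate (rot 2 (2 * Real.pi * k / (l + 1 : ℕ)))
        (rotate (rot 1 β) ξ) : Sol) : ℝ → S2 → ℝ) t s
        = ∑ k ∈ Finset.range (l + 1), (ξ : ℝ → S2 → ℝ) t (rotatePoint (rot 1 β)⁻¹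
          (rotatePoint (rot 2 (2 * Real.pi * k / (l + 1 : ℕ)))⁻¹ s)) := by
      rw [AddSubmonoidClass.coe_finsetSum, Finset.sum_apply, Finset.sum_apply]
      rfl
    rw [e]
    show _ = ((l + 1) * legendreP l (Real.cos β)) * (ξ : ℝ → S2 → ℝ) t s
    by_cases ht : t ∈ IT
    · simp only [h t ht]
      rw [← Finset.mul_sum, sum_rotate_Yl0]
      ring
    · simp [ξ.2.zero_off t ht]
  have hpole : ∀ (t β : ℝ), (J ξ : ℝ → S2 → ℝ) t (rotatePoint (rot 1 β)⁻¹ northPole)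
      = legendreP l (Real.cos β) * (J ξ : ℝ → S2 → ℝ) t northPole := by
    intro t β
    have h1 := congrArg J (hrel β)
    rw [map_sum, map_smul] at h1
    simp only [hJ.invariant _ (rot_mem_SO3 _ _)] at h1
    have h2 := congrArg (fun η : Sol => (η : ℝ → S2 → ℝ) t northPole) h1
    simp only [AddSubmonoidClass.coe_finsetSum, Finset.sum_apply] at h2
    have e : ∀ k : ℕ, (rotate (rot 2 (2 * Real.pi * k / (l + 1 : ℕ)))
        (rotate (rot 1 β) (J ξ)) : ℝ → S2 → ℝ) t northPole
        = (J ξ : ℝ → S2 → ℝ) t (rotatePoint (rot 1 β)⁻¹ northPole) := by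
      intro k
      show (J ξ : ℝ → S2 → ℝ) t (rotatePoint (rot 1 β)⁻¹ (rotatePoint
        (rot 2 (2 * Real.pi * k / (l + 1 : ℕ)))⁻¹ northPole)) = _
      have e0 : ∀ a, rotatePoint (rot 2 a)⁻¹ northPole = northPole := fun a =>
        Subtype.ext (by rw [rotatePoint_coe, northPole_coe, rot_inv]; exact rot_two_axis _)
      rw [e0]
    simp only [e, Finset.sum_const, Finset.card_range, nsmul_eq_mul] at h2
    have h3 : ((l + 1 : ℕ) : ℝ) * (J ξ : ℝ → S2 → ℝ) t (rotatePoint (rot 1 β)⁻¹ northPole)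
      = ((l + 1) * legendreP l (Real.cos β)) * (J ξ : ℝ → S2 → ℝ) t northPole := h2
    have h4 : ((l + 1 : ℕ) : ℝ) ≠ 0 := by positivity
    apply mul_left_cancel₀ h4
    rw [h3]
    push_cast
    ring
  have hall : ∀ t s, (J ξ : ℝ → S2 → ℝ) t s
      = legendreP l ((s : E3) 2) * (J ξ : ℝ → S2 → ℝ) t northPole := by
    intro t s
    have hA := axiSym_sol ⟨J ξ, hax⟩ t
    have hcos : Real.cos (Real.arccos ((s : E3) 2)) = (s : E3) 2 :=
      Real.cos_arccos (sphere_coord_mem s).1 (sphere_coord_mem s).2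
    have h1 := hpole t (Real.arccos ((s : E3) 2))
    rw [hcos] at h1
    rw [← h1]
    have h2 := hA.eq_meridian s
    have h3 := hA.eq_meridian (rotatePoint (rot 1 (Real.arccos ((s : E3) 2)))⁻¹ northPole)
    have h4 : (rotatePoint (rot 1 (Real.arccos ((s : E3) 2)))⁻¹ northPole : E3) 2
        = (s : E3) 2 := by
      rw [coord_rot_one, northPole_coe, hcos]; simp [ev_apply]
    simp only [h4] at h3
    exact h2.trans h3.symm
  have hsq : Real.sqrt ((2 * l + 1) / (4 * Real.pi)) ≠ 0 :=
    Real.sqrt_ne_zero'.mpr (by positivity)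
  intro t _ s
  have e : (J ξ : ℝ → S2 → ℝ) t = fun s => ((J ξ : ℝ → S2 → ℝ) t northPole
      / Real.sqrt ((2 * l + 1) / (4 * Real.pi))) * Yl0 l s := by
    funext s
    rw [hall, Yl0]
    field_simp
  simp only
  rw [e, coef_const_mul_Yl0, if_pos rfl]

end IsInvariantComplexStructure


/-! ### Complex structures and Bogoliubov coefficients in mode coordinates. -/

open MeasureTheory ComplexConjugate

/-! ### Linear combinations of the basic modes -/

/-- The mode solution `(a ũ_{0ℓ} + b ṽ_{0ℓ}) Y_{ℓ0}`. -/
def uv (l : ℕ) (a b : ℝ) : Sol := a • uSol l + b • vSol l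

/-- The time dependence of `uv l a b`. -/
def uvFn (l : ℕ) (a b t : ℝ) : ℝ := a * u₀ l t + b * v₀ l t

/-- The derivative of `uvFn l a b`. -/
def uvFn' (l : ℕ) (a b t : ℝ) : ℝ := a * modeOf' legendreP l t + b * modeOf' legendreQ l t

lemma isMode_uv' (l : ℕ) (a b : ℝ) : IsMode (uv l a b) (uvFn l a b) l := isMode_uv l a b

lemma isModeFn_uvFn (l : ℕ) (a b : ℝ) : IsModeFn l (uvFn l a b) (uvFn' l a b) :=
  (isModeFn_u₀ l).comb (isModeFn_v₀ l) a b

lemma smul_uv (l : ℕ) (c a b : ℝ) : c • uv l a b = uv l (c * a) (c * b) := by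
  simp only [uv, smul_add, smul_smul]

lemma add_uv (l : ℕ) (a b c d : ℝ) : uv l a b + uv l c d = uv l (a + c) (b + d) := by
  simp only [uv, add_smul]; abel

lemma neg_uv (l : ℕ) (a b : ℝ) : -uv l a b = uv l (-a) (-b) := by
  simp only [uv]; module

lemma wronskian_uvFn (l : ℕ) (a b c d : ℝ) {t : ℝ} (ht : t ∈ IT) :
    uvFn l c d t * uvFn' l a b t - uvFn l a b t * uvFn' l c d t = (a * d - b * c) / 2 := by
  have := wronskian_u₀_v₀ l ht
  simp only [uvFn, uvFn']
  linear_combination (a * d - b * c) * this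

/-- The coefficient functions of a solution. -/
def cf (φ : Sol) (l : ℕ) (t : ℝ) : ℝ := coef l ((φ : ℝ → S2 → ℝ) t)

/-- The derivatives of the coefficient functions of a solution. -/
def cf' (φ : Sol) (l : ℕ) (t : ℝ) : ℝ := coef l (dt φ t)

lemma isModeFn_cf (φ : Sol) (l : ℕ) : IsModeFn l (cf φ l) (cf' φ l) := isModeFn_coef φ l

lemma Omega_uv (l : ℕ) (a b : ℝ) (η : Sol) {t : ℝ} (ht : t ∈ IT) :
    Omega (uv l a b) η = cf η l t * uvFn' l a b t - uvFn l a b t * cf' η l t := by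
  rw [Omega_mode (isMode_uv' l a b) (fun t ht => (isModeFn_uvFn l a b t ht).1)]
  exact (isModeFn_uvFn l a b).wronskian_const (isModeFn_cf η l) half_pi_mem ht

lemma cf_uv (l m : ℕ) (a b : ℝ) {t : ℝ} (ht : t ∈ IT) :
    cf (uv l a b) m t = if l = m then uvFn l a b t else 0 := by
  rw [cf, show ((uv l a b : Sol) : ℝ → S2 → ℝ) t = fun s => uvFn l a b t * Yl0 l s from
    funext fun s => isMode_uv' l a b t ht s, coef_const_mul_Yl0]

lemma cf'_uv (l m : ℕ) (a b : ℝ) {t : ℝ} (ht : t ∈ IT) :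
    cf' (uv l a b) m t = if l = m then uvFn' l a b t else 0 := by
  rw [cf', show dt (uv l a b) t = fun s => uvFn' l a b t * Yl0 l s from
    funext fun s => (isMode_uv' l a b).dt_eq (fun t ht => (isModeFn_uvFn l a b t ht).1) ht s,
    coef_const_mul_Yl0]

lemma Omega_uv_uv (l m : ℕ) (a b c d : ℝ) :
    Omega (uv l a b) (uv m c d) = if l = m then (a * d - b * c) / 2 else 0 := by
  rw [Omega_uv l a b _ half_pi_mem, cf_uv _ _ _ _ half_pi_mem, cf'_uv _ _ _ _ half_pi_mem]
  by_cases h : m = l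
  · subst h
    simpa using wronskian_uvFn m a b c d half_pi_mem
  · simp [h, Ne.symm h]

/-- A mode function is determined by its Wronskians with two basic modes. -/
lemma IsMode.eq_uv {ξ : Sol} {z z' : ℝ → ℝ} {l : ℕ} (h : IsMode ξ z l) (hz : IsModeFn l z z') :
    ξ = uv l (2 * Omega ξ (uv l 0 1)) (-(2 * Omega ξ (uv l 1 0))) := by
  refine h.ext (z := z) ?_
  intro t ht s
  rw [isMode_uv' l _ _ t ht s]
  congr 1
  have hm := half_pi_mem
  have e : ∀ c d, Omega ξ (uv l c d) = uvFn l c d t * z' t - z t * uvFn' l c d t := by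
    intro c d
    rw [Omega_mode h (fun t ht => (hz t ht).1)]
    have := hz.wronskian_const (isModeFn_uvFn l c d) hm ht
    rw [← this]
    have h1 := cf_uv l l c d hm
    have h2 := cf'_uv l l c d hm
    rw [if_pos rfl] at h1 h2
    rw [← h1, ← h2]; rfl
  rw [e, e]
  have w := wronskian_u₀_v₀ l ht
  simp only [uvFn, uvFn']
  linear_combination (2 * z t) * w

/-! ### Parameters of an invariant complex structure -/

/-- The relations `J x = -y`, `J y = x` for the modes with parameters `(ρ, ν)`. -/
def IsParam (J : Sol →ₗ[ℝ] Sol) (ρ ν : ℕ → ℝ) : Prop :=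
  ∀ l, 0 < ρ l ∧ J (uv l (ρ l) (ν l)) = -uv l 0 (ρ l)⁻¹ ∧ J (uv l 0 (ρ l)⁻¹) = uv l (ρ l) (ν l)

lemma hasParameters_iff {J : Sol →ₗ[ℝ] Sol} {ρ ν : ℕ → ℝ} :
    HasParameters J ρ ν ↔ IsParam J ρ ν := by
  refine forall_congr' fun l => and_congr_right fun _ => ?_
  have hy : IsMode (uv l 0 (ρ l)⁻¹) (fun t => (ρ l)⁻¹ * v₀ l t) l := by
    intro t ht s
    rw [isMode_uv' l _ _ t ht s, uvFn]
    ring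
  constructor
  · rintro ⟨x, y, hx, hy', h1, h2⟩
    rw [hx.ext (isMode_uv' l (ρ l) (ν l)), hy'.ext hy] at h1
    rw [hx.ext (isMode_uv' l (ρ l) (ν l)), hy'.ext hy] at h2
    exact ⟨h1, h2⟩
  · rintro ⟨h1, h2⟩
    exact ⟨_, _, isMode_uv' l (ρ l) (ν l), hy, h1, h2⟩

/-- In the two dimensional mode space J maps the ṽ-mode to A ũ + B ṽ, where A is twice a value of
the positive form Ω(Jξ, ξ). Thus ρ = √A and ν = B/√A satisfy J(ρ⁻¹ ṽ) = ρ ũ + ν ṽ, and the other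
relation is J² = -1. -/
lemma IsInvariantComplexStructure.exists_param {J : Sol →ₗ[ℝ] Sol}
    (hJ : IsInvariantComplexStructure J) : ∃ ρ ν : ℕ → ℝ, IsParam J ρ ν := by
  have key : ∀ l, ∃ r n : ℝ, 0 < r ∧ J (uv l r n) = -uv l 0 r⁻¹ ∧ J (uv l 0 r⁻¹) = uv l r n := by
    intro l
    have hm := hJ.isMode_map (isMode_uv' l 0 1)
    have he := hm.eq_uv (isModeFn_coef (J (uv l 0 1)) l)
    set A := 2 * Omega (J (uv l 0 1)) (uv l 0 1) with hA
    set B := -(2 * Omega (J (uv l 0 1)) (uv l 1 0)) with hB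
    have hne : uv l 0 1 ≠ 0 := by
      intro h0
      have := Omega_uv_uv l l 1 0 0 1
      rw [h0] at this
      have h2 : Omega (uv l 1 0) 0 = 0 := by
        have : (0 : Sol) = uv l 0 0 := by simp [uv]
        rw [this, Omega_uv_uv]; simp
      rw [h2] at this
      norm_num at this
    have hApos : 0 < A := mul_pos two_pos (hJ.pos _ hne)
    have hr : 0 < Real.sqrt A := Real.sqrt_pos.mpr hApos
    have hrr : Real.sqrt A * Real.sqrt A = A := Real.mul_self_sqrt hApos.le
    have h1 : J (uv l 0 (Real.sqrt A)⁻¹) = uv l (Real.sqrt A) (B / Real.sqrt A) := by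
      have : uv l 0 (Real.sqrt A)⁻¹ = (Real.sqrt A)⁻¹ • uv l 0 1 := by rw [smul_uv]; simp
      rw [this, map_smul, he, smul_uv]
      congr 1
      · field_simp
        rw [pow_two, hrr]
      · field_simp
    refine ⟨Real.sqrt A, B / Real.sqrt A, hr, ?_, h1⟩
    rw [← h1, hJ.sq]
  choose r n h using key
  exact ⟨r, n, h⟩

/-! ### The one-particle basis of modes -/

/-- The axially symmetric solution with the mode coefficient `w z + w̄ z̄`, where `z` has the
parameters `(r, n)`. -/
def wmode (l : ℕ) (r n : ℝ) (w : ℂ) : AxiSol :=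
  ⟨uv l (2 * w.re * r) (2 * w.re * n - 2 * w.im * r⁻¹), (isMode_uv' l _ _).mem_AxiSol⟩

/-- The complex coordinate of a solution with respect to the mode `z` with parameters `(r, n)`. -/
def fco (l : ℕ) (r n : ℝ) (φ : Sol) : ℂ := ⟨-Omega (uv l 0 r⁻¹) φ, -Omega (uv l r n) φ⟩

lemma wmode_coe (l : ℕ) (r n : ℝ) (w : ℂ) :
    (wmode l r n w : Sol) = (2 * w.re) • uv l r n - (2 * w.im) • uv l 0 r⁻¹ := by
  rw [sub_eq_add_neg, smul_uv, smul_uv, neg_uv, add_uv, wmode]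
  simp only [mul_zero, neg_zero, add_zero, ← sub_eq_add_neg]

namespace IsParam

variable {J : Sol →ₗ[ℝ] Sol} {ρ ν : ℕ → ℝ}

lemma map_wmode (hp : IsParam J ρ ν) (l : ℕ) (w : ℂ) :
    J (wmode l (ρ l) (ν l) w) = wmode l (ρ l) (ν l) (Complex.I * w) := by
  rw [wmode_coe, wmode_coe, map_sub, map_smul, map_smul, (hp l).2.1, (hp l).2.2]
  simp
  module

lemma innerJ_wmode_left (hp : IsParam J ρ ν) (l : ℕ) (φ : Sol) :
    innerJ J (wmode l (ρ l) (ν l) 1) φ = fco l (ρ l) (ν l) φ := by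
  have h1 : (wmode l (ρ l) (ν l) 1 : Sol) = uv l (2 * ρ l) (2 * ν l) := by
    simp [wmode]
  have h2 : (wmode l (ρ l) (ν l) (Complex.I * 1) : Sol) = uv l (2 * 0) (-(2 * (ρ l)⁻¹)) := by
    simp [wmode]
  have hm := half_pi_mem
  rw [innerJ, hp.map_wmode, h1, h2, fco, Omega_uv _ _ _ _ hm, Omega_uv _ _ _ _ hm,
    Omega_uv _ _ _ _ hm, Omega_uv _ _ _ _ hm]
  apply Complex.ext <;> simp [uvFn, uvFn'] <;> ring

lemma fco_wmode (hp : IsParam J ρ ν) (l m : ℕ) (w : ℂ) :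
    fco l (ρ l) (ν l) (wmode m (ρ m) (ν m) w) = if l = m then w else 0 := by
  have hr := (hp l).1.ne'
  rw [fco, wmode, Omega_uv_uv, Omega_uv_uv]
  split_ifs with h
  · subst h
    apply Complex.ext <;> simp <;> field_simp <;> ring
  · apply Complex.ext <;> simp

/-- The modes form an orthonormal basis of the one-particle space. -/
lemma isOneParticleBasis (hp : IsParam J ρ ν) (hJ : IsInvariantComplexStructure J) :
    IsOneParticleBasis J (fun l => wmode l (ρ l) (ν l) 1) := by
  refine ⟨fun k l => ?_, fun φ => ?_⟩
  · rw [hp.innerJ_wmode_left, hp.fco_wmode]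
  · have hm := half_pi_mem
    have h := (hasSum_Omega ⟨J φ, hJ.map_mem φ.2⟩ φ).mul_left (1 / 2)
    refine h.congr_fun fun l => ?_
    rw [hp.innerJ_wmode_left, ← Complex.normSq_eq_norm_sq, fco, Complex.normSq_mk]
    have hr := (hp l).1.ne'
    have e1 : Omega (uv l (ρ l) (ν l)) (J φ) = Omega (uv l 0 (ρ l)⁻¹) φ := by
      have := hJ.Omega_left (uv l (ρ l) (ν l)) φ
      rw [(hp l).2.1, neg_uv, Omega_uv _ _ _ _ hm] at this
      rw [Omega_uv l 0 _ _ hm]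
      simp only [uvFn, uvFn'] at this ⊢
      linarith
    have e2 : Omega (uv l 0 (ρ l)⁻¹) (J φ) = -Omega (uv l (ρ l) (ν l)) φ := by
      have := hJ.Omega_left (uv l 0 (ρ l)⁻¹) φ
      rw [(hp l).2.2] at this
      linarith
    have w := wronskian_uvFn l (ρ l) (ν l) 0 (ρ l)⁻¹ hm
    rw [Omega_uv _ _ _ _ hm, Omega_uv _ _ _ _ hm] at e1 e2
    rw [Omega_uv _ _ _ _ hm, Omega_uv _ _ _ _ hm]
    have w2 : (ρ l * (ρ l)⁻¹ - ν l * 0) / 2 = 1 / 2 := by field_simp; ring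
    rw [w2] at w
    show _ = 1 / 2 * (cf φ l (Real.pi / 2) * cf' (J φ) l (Real.pi / 2)
      - cf (J φ) l (Real.pi / 2) * cf' φ l (Real.pi / 2))
    set x := uvFn l (ρ l) (ν l) (Real.pi / 2)
    set x' := uvFn' l (ρ l) (ν l) (Real.pi / 2)
    set y := uvFn l 0 (ρ l)⁻¹ (Real.pi / 2)
    set y' := uvFn' l 0 (ρ l)⁻¹ (Real.pi / 2)
    set p := cf φ l (Real.pi / 2)
    set p' := cf' φ l (Real.pi / 2)
    set q := cf (J φ) l (Real.pi / 2)
    set q' := cf' (J φ) l (Real.pi / 2)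
    -- Plücker's relation for four plane vectors: the Wronskian of φ and Jφ is expressed by their
    -- Wronskians with the real and imaginary parts of the mode.
    have e3 : (p * q' - q * p') * (y * x' - x * y')
        = (p * y' - y * p') * (q * x' - x * q') - (p * x' - x * p') * (q * y' - y * q') := by ring
    rw [e1, e2, w] at e3
    linear_combination -e3

end IsParam

/-! ### Bogoliubov coefficients -/

/-- The mode `z` with parameters `(r, n)`. -/
def zf (l : ℕ) (r n t : ℝ) : ℂ := ⟨uvFn l r n t, uvFn l 0 r⁻¹ t⟩

/-- The canonical momentum `ż - ½ cot t z`. -/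
def pf (l : ℕ) (r n t : ℝ) : ℂ :=
  ⟨uvFn' l r n t - 1 / 2 * Real.cot t * uvFn l r n t,
    uvFn' l 0 r⁻¹ t - 1 / 2 * Real.cot t * uvFn l 0 r⁻¹ t⟩

/-- The real term ½ cot t z in the momentum cancels in this combination, and the parameters r and
r⁻¹ are matched so that the remaining Wronskian is normalized. -/
lemma zf_pf (l : ℕ) {r : ℝ} (n : ℝ) (hr : r ≠ 0) {t : ℝ} (ht : t ∈ IT) :
    zf l r n t * conj (pf l r n t) - conj (zf l r n t) * pf l r n t = Complex.I := by
  have w := wronskian_uvFn l r n 0 r⁻¹ ht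
  have w2 : (r * r⁻¹ - n * 0) / 2 = 1 / 2 := by field_simp; ring
  rw [w2] at w
  apply Complex.ext
  · simp [zf, pf]; ring
  · simp [zf, pf]; linear_combination 2 * w

/-- The linear Bogoliubov coefficient relating two complex frames. -/
def bogA (z₁ p₁ z₀ p₀ : ℂ) : ℂ := -Complex.I * (z₁ * conj p₀ - conj z₀ * p₁)

/-- The antilinear Bogoliubov coefficient relating two complex frames. -/
def bogB (z₁ p₁ z₀ p₀ : ℂ) : ℂ := -Complex.I * (conj z₁ * conj p₀ - conj z₀ * conj p₁)

/-- Both frames are symplectically normalized, so the matrix with rows (α, β) and (β̄, ᾱ) relating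
them has determinant 1. -/
lemma bog_normalized {z₁ p₁ z₀ p₀ : ℂ} (h1 : z₁ * conj p₁ - conj z₁ * p₁ = Complex.I)
    (h0 : z₀ * conj p₀ - conj z₀ * p₀ = Complex.I) :
    ‖bogA z₁ p₁ z₀ p₀‖ ^ 2 - ‖bogB z₁ p₁ z₀ p₀‖ ^ 2 = 1 := by
  have key : ∀ w : ℂ, ((‖w‖ ^ 2 : ℝ) : ℂ) = w * conj w := fun w => by
    rw [Complex.mul_conj, Complex.normSq_eq_norm_sq]
  have h : ((‖bogA z₁ p₁ z₀ p₀‖ ^ 2 - ‖bogB z₁ p₁ z₀ p₀‖ ^ 2 : ℝ) : ℂ) = 1 := by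
    rw [Complex.ofReal_sub, key, key, bogA, bogB]
    simp only [map_mul, map_sub, map_neg, Complex.conj_I, Complex.conj_conj]
    linear_combination (-(z₀ * conj p₀ - conj z₀ * p₀)) * h1 - Complex.I * h0
      + (-1 + (z₁ * conj p₁ - conj z₁ * p₁) * (z₀ * conj p₀ - conj z₀ * p₀)) * Complex.I_sq
  exact_mod_cast h

/-- The expansion of the coefficients of a solution in a normalized mode. -/
lemma fco_eq (l : ℕ) {r : ℝ} (n : ℝ) (φ : Sol) {t : ℝ} (ht : t ∈ IT) :
    fco l r n φ = -Complex.I * (cf φ l t * conj (pf l r n t)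
      - conj (zf l r n t) * (cf' φ l t - 1 / 2 * Real.cot t * cf φ l t : ℝ)) := by
  rw [fco, Omega_uv _ _ _ _ ht, Omega_uv _ _ _ _ ht]
  generalize hc : Real.cot t = c
  apply Complex.ext <;> simp [zf, pf, hc] <;> ring

lemma cf_eq (l : ℕ) {r : ℝ} (n : ℝ) (hr : r ≠ 0) (φ : Sol) {t : ℝ} (ht : t ∈ IT) :
    (cf φ l t : ℂ) = fco l r n φ * zf l r n t + conj (fco l r n φ) * conj (zf l r n t) ∧
    ((cf' φ l t - 1 / 2 * Real.cot t * cf φ l t : ℝ) : ℂ)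
      = fco l r n φ * pf l r n t + conj (fco l r n φ) * conj (pf l r n t) := by
  have h := zf_pf l n hr ht
  rw [fco_eq l n φ ht]
  simp only [map_mul, map_sub, map_neg, Complex.conj_I, Complex.conj_conj, Complex.conj_ofReal]
  constructor
  · linear_combination (Complex.I * (cf φ l t : ℂ)) * h + (cf φ l t : ℂ) * Complex.I_sq
  · linear_combination (Complex.I * ((cf' φ l t - 1 / 2 * Real.cot t * cf φ l t : ℝ) : ℂ)) * h
      + ((cf' φ l t - 1 / 2 * Real.cot t * cf φ l t : ℝ) : ℂ) * Complex.I_sq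

/-- Change of the complex coordinate between two parameter pairs. -/
lemma fco_change (l : ℕ) {r r' : ℝ} (n n' : ℝ) (hr : r ≠ 0) (φ : Sol) {t : ℝ} (ht : t ∈ IT) :
    fco l r' n' φ
      = bogA (zf l r n t) (pf l r n t) (zf l r' n' t) (pf l r' n' t) * fco l r n φ
        + bogB (zf l r n t) (pf l r n t) (zf l r' n' t) (pf l r' n' t) * conj (fco l r n φ) := by
  obtain ⟨e1, e2⟩ := cf_eq l n hr φ ht
  rw [fco_eq l n' φ ht, e1, e2, bogA, bogB]
  ring

lemma cf_evolution {t₁ t₀ : ℝ} {φ φ' : Sol} (h : IsEvolution t₁ t₀ φ φ') (h0 : t₀ ∈ IT)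
    (h1 : t₁ ∈ IT) (l : ℕ) : cf φ' l t₀ = cf φ l t₁ ∧
      cf' φ' l t₀ - 1 / 2 * Real.cot t₀ * cf φ' l t₀
        = cf' φ l t₁ - 1 / 2 * Real.cot t₁ * cf φ l t₁ := by
  have e1 : ((φ' : ℝ → S2 → ℝ) t₀) = (φ : ℝ → S2 → ℝ) t₁ := funext fun s => (h s).1
  refine ⟨by rw [cf, e1, cf], ?_⟩
  have e2 : ∀ (ψ : Sol) {t : ℝ} (_ : t ∈ IT), cf' ψ l t - 1 / 2 * Real.cot t * cf ψ l t
      = coef l (fun s => 1 * dt ψ t s + (-(1 / 2 * Real.cot t)) * (ψ : ℝ → S2 → ℝ) t s) := by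
    intro ψ t ht
    rw [coef_smul_add ((smoothT_sol ψ).dt.smoothS ht).continuous
      ((smoothT_sol ψ).smoothS ht).continuous, cf', cf]
    ring
  rw [e2 φ' h0, e2 φ h1]
  congr 1
  funext s
  have := (h s).2
  linarith

/-- The action of the evolution on the complex coordinates. -/
lemma fco_evolution {t₁ t₀ : ℝ} {φ φ' : Sol} (h : IsEvolution t₁ t₀ φ φ') (h0 : t₀ ∈ IT)
    (h1 : t₁ ∈ IT) (l : ℕ) {r : ℝ} (n : ℝ) (hr : r ≠ 0) :
    fco l r n φ'
      = bogA (zf l r n t₁) (pf l r n t₁) (zf l r n t₀) (pf l r n t₀) * fco l r n φ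
        + bogB (zf l r n t₁) (pf l r n t₁) (zf l r n t₀) (pf l r n t₀) * conj (fco l r n φ) := by
  obtain ⟨c1, c2⟩ := cf_evolution h h0 h1 l
  obtain ⟨e1, e2⟩ := cf_eq l n hr φ h1
  rw [fco_eq l n φ' h0, c2, c1, e2, e1, bogA, bogB]
  ring

/-- The evolution of a mode. -/
lemma isEvolution_wmode {t₁ t₀ : ℝ} (h0 : t₀ ∈ IT) (h1 : t₁ ∈ IT) (l : ℕ) {r : ℝ} (n : ℝ)
    (hr : r ≠ 0) (w : ℂ) :
    IsEvolution t₁ t₀ (wmode l r n w : Sol) (wmode l r n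
      (bogA (zf l r n t₁) (pf l r n t₁) (zf l r n t₀) (pf l r n t₀) * w
        + bogB (zf l r n t₁) (pf l r n t₁) (zf l r n t₀) (pf l r n t₀) * conj w) : Sol) := by
  set w' := bogA (zf l r n t₁) (pf l r n t₁) (zf l r n t₀) (pf l r n t₀) * w
        + bogB (zf l r n t₁) (pf l r n t₁) (zf l r n t₀) (pf l r n t₀) * conj w with hw'
  have hfn : ∀ (w : ℂ) (t : ℝ), t ∈ IT → ∀ s,
      ((wmode l r n w : Sol) : ℝ → S2 → ℝ) t s = 2 * (w * zf l r n t).re * Yl0 l s ∧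
      dt (wmode l r n w : Sol) t s - 1 / 2 * Real.cot t *
        ((wmode l r n w : Sol) : ℝ → S2 → ℝ) t s = 2 * (w * pf l r n t).re * Yl0 l s := by
    intro w t ht s
    have hm := isMode_uv' l (2 * w.re * r) (2 * w.re * n - 2 * w.im * r⁻¹)
    have a1 : ((wmode l r n w : Sol) : ℝ → S2 → ℝ) t s = _ := hm t ht s
    have a2 : dt (wmode l r n w : Sol) t s = _ :=
      hm.dt_eq (fun t ht => (isModeFn_uvFn l _ _ t ht).1) ht s
    rw [a2, a1]
    constructor <;> simp only [uvFn, uvFn', zf, pf, Complex.mul_re] <;> ring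
  have hz := zf_pf l n hr h0
  have key : ∀ w : ℂ, ((2 * w.re : ℝ) : ℂ) = w + conj w := fun w => by
    rw [Complex.add_conj]
  intro s
  obtain ⟨a1, a2⟩ := hfn w' t₀ h0 s
  obtain ⟨b1, b2⟩ := hfn w t₁ h1 s
  rw [a2, b2, a1, b1]
  constructor
  · congr 1
    have : ((2 * (w' * zf l r n t₀).re : ℝ) : ℂ) = ((2 * (w * zf l r n t₁).re : ℝ) : ℂ) := by
      rw [key, key, hw', bogA, bogB]
      simp only [map_mul, map_sub, map_add, map_neg, Complex.conj_I, Complex.conj_conj]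
      linear_combination (-Complex.I * (w * zf l r n t₁ + conj w * conj (zf l r n t₁))) * hz
        - (w * zf l r n t₁ + conj w * conj (zf l r n t₁)) * Complex.I_sq
    exact_mod_cast this
  · congr 1
    have : ((2 * (w' * pf l r n t₀).re : ℝ) : ℂ) = ((2 * (w * pf l r n t₁).re : ℝ) : ℂ) := by
      rw [key, key, hw', bogA, bogB]
      simp only [map_mul, map_sub, map_add, map_neg, Complex.conj_I, Complex.conj_conj]
      linear_combination (-Complex.I * (w * pf l r n t₁ + conj w * conj (pf l r n t₁))) * hz
        - (w * pf l r n t₁ + conj w * conj (pf l r n t₁)) * Complex.I_sq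
    exact_mod_cast this


/-! ### Fock space, field operators and Weyl operators. -/

open ComplexConjugate

/-! ### Square summable families -/

/-- Square summable families of complex numbers. -/
abbrev Ltwo (ι : Type*) : Type _ := lp (fun _ : ι => ℂ) 2

section Ltwo

variable {ι : Type*}

lemma memLtwo_iff {f : ι → ℂ} : Memℓp f 2 ↔ Summable fun i => ‖f i‖ ^ 2 := by
  rw [memℓp_gen_iff (by norm_num)]
  simp

lemma hasSum_norm_sq (f : Ltwo ι) : HasSum (fun i => ‖f i‖ ^ 2) (‖f‖ ^ 2) := by
  simpa using lp.hasSum_norm (p := 2) (by norm_num) f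

lemma exists_Ltwo_of_sum_le {f : ι → ℂ} {C : ℝ} (hC : 0 ≤ C)
    (h : ∀ s : Finset ι, ∑ i ∈ s, ‖f i‖ ^ 2 ≤ C ^ 2) :
    ∃ hf : Memℓp f 2, ‖(⟨f, hf⟩ : Ltwo ι)‖ ≤ C := by
  have hs : Summable fun i => ‖f i‖ ^ 2 :=
    summable_of_sum_le (fun _ => by positivity) h
  refine ⟨memLtwo_iff.mpr hs, ?_⟩
  have h1 := hasSum_norm_sq (⟨f, memLtwo_iff.mpr hs⟩ : Ltwo ι)
  have h2 : ‖(⟨f, memLtwo_iff.mpr hs⟩ : Ltwo ι)‖ ^ 2 ≤ C ^ 2 :=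
    hasSum_le_of_sum_le h1 h
  exact (pow_le_pow_iff_left₀ (norm_nonneg _) hC two_ne_zero).mp h2

variable [DecidableEq ι]

/-- The basis vectors. -/
def ket (i : ι) : Ltwo ι := lp.single 2 i (1 : ℂ)

lemma ket_apply (i j : ι) : ket i j = if j = i then 1 else 0 := by
  rw [ket, lp.coeFn_single, Pi.single_apply]

lemma inner_ket (i : ι) (f : Ltwo ι) : inner ℂ (ket i) f = f i := by
  rw [ket, lp.inner_single_left]
  simp

lemma inner_ket_right (i : ι) (f : Ltwo ι) : inner ℂ f (ket i) = conj (f i) := by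
  rw [← inner_conj_symm, inner_ket]

lemma norm_ket (i : ι) : ‖(ket i : Ltwo ι)‖ = 1 := by
  rw [ket, lp.norm_single (by norm_num)]
  simp

lemma hasSum_ket (f : Ltwo ι) : HasSum (fun i => f i • ket i) f := by
  have h := lp.hasSum_single (p := 2) (by norm_num) f
  refine h.congr_fun fun i => ?_
  rw [ket, ← lp.single_smul]
  simp

end Ltwo

/-! ### Creation and annihilation operators on bounded particle number -/

lemma creation_add (f g : ℕ → ℂ) (ψ : (ℕ →₀ ℕ) → ℂ) (n : ℕ →₀ ℕ) :
    creation (f + g) ψ n = creation f ψ n + creation g ψ n := by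
  simp only [creation, ← Finset.sum_add_distrib, Pi.add_apply, add_mul]

lemma creation_smul (c : ℂ) (f : ℕ → ℂ) (ψ : (ℕ →₀ ℕ) → ℂ) (n : ℕ →₀ ℕ) :
    creation (c • f) ψ n = c * creation f ψ n := by
  simp only [creation, Finset.mul_sum, Pi.smul_apply, smul_eq_mul, mul_assoc]

lemma creation_add_right (f : ℕ → ℂ) (ψ χ : (ℕ →₀ ℕ) → ℂ) (n : ℕ →₀ ℕ) :
    creation f (ψ + χ) n = creation f ψ n + creation f χ n := by
  simp only [creation, ← Finset.sum_add_distrib, Pi.add_apply, mul_add]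

lemma creation_smul_right (c : ℂ) (f : ℕ → ℂ) (ψ : (ℕ →₀ ℕ) → ℂ) (n : ℕ →₀ ℕ) :
    creation f (c • ψ) n = c * creation f ψ n := by
  simp only [creation, Finset.mul_sum, Pi.smul_apply, smul_eq_mul]
  exact Finset.sum_congr rfl fun k _ => by ring

lemma sub_single_add {n : ℕ →₀ ℕ} {k : ℕ} (hk : k ∈ n.support) :
    n - Finsupp.single k 1 + Finsupp.single k 1 = n :=
  tsub_add_cancel_of_le (Finsupp.single_le_iff.mpr
    (Nat.one_le_iff_ne_zero.mpr (Finsupp.mem_support_iff.mp hk)))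

lemma degree_add_single (n : ℕ →₀ ℕ) (k : ℕ) :
    (n + Finsupp.single k 1).degree = n.degree + 1 := by
  rw [map_add, Finsupp.degree_single]

lemma degree_sub_single {n : ℕ →₀ ℕ} {k : ℕ} (hk : k ∈ n.support) :
    (n - Finsupp.single k 1).degree + 1 = n.degree := by
  rw [← degree_add_single, sub_single_add hk]

/-- Cauchy–Schwarz with the factors √(n k), whose squares add up to the particle number. -/
lemma norm_creation_sq_le (f : ℕ → ℂ) (ψ : (ℕ →₀ ℕ) → ℂ) (n : ℕ →₀ ℕ) :
    ‖creation f ψ n‖ ^ 2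
      ≤ n.degree * ∑ k ∈ n.support, ‖f k‖ ^ 2 * ‖ψ (n - Finsupp.single k 1)‖ ^ 2 := by
  have h1 : ‖creation f ψ n‖ ≤ ∑ k ∈ n.support,
      Real.sqrt (n k) * (‖f k‖ * ‖ψ (n - Finsupp.single k 1)‖) := by
    refine (norm_sum_le _ _).trans (le_of_eq (Finset.sum_congr rfl fun k _ => ?_))
    rw [norm_mul, norm_mul, Complex.norm_real, Real.norm_of_nonneg (Real.sqrt_nonneg _)]
    ring
  refine (pow_le_pow_left₀ (norm_nonneg _) h1 2).trans
    ((Finset.sum_mul_sq_le_sq_mul_sq _ _ _).trans (le_of_eq ?_))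
  congr 1
  · rw [Finsupp.degree_apply]
    push_cast
    exact Finset.sum_congr rfl fun k _ => Real.sq_sqrt (Nat.cast_nonneg _)
  · exact Finset.sum_congr rfl fun k _ => by ring

/-- The map (n, k) ↦ (k, n - δ_k) is injective on pairs with k occupied in n, so the double sum is
part of the product ∑ |f_k|² ∑ |ψ(m)|². The cut at N + 1 particles bounds the remaining factor. -/
lemma sum_creation_sq_le (f : Ltwo ℕ) (ψ : Fock) (N : ℕ) (s : Finset (ℕ →₀ ℕ)) :
    ∑ n ∈ s, ‖if n.degree ≤ N + 1 then creation f ψ n else 0‖ ^ 2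
      ≤ (Real.sqrt (N + 1) * ‖f‖ * ‖ψ‖) ^ 2 := by
  have hterm : ∀ n : ℕ →₀ ℕ, ‖if n.degree ≤ N + 1 then creation f ψ n else 0‖ ^ 2
      ≤ (N + 1) * ∑ k ∈ n.support, ‖f k‖ ^ 2 * ‖ψ (n - Finsupp.single k 1)‖ ^ 2 := by
    intro n
    split_ifs with h
    · refine (norm_creation_sq_le _ _ _).trans (mul_le_mul_of_nonneg_right ?_ ?_)
      · exact_mod_cast h
      · exact Finset.sum_nonneg fun k _ => by positivity
    · rw [norm_zero, zero_pow two_ne_zero]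
      positivity
  refine (Finset.sum_le_sum fun n _ => hterm n).trans ?_
  rw [← Finset.mul_sum, mul_assoc, mul_pow, Real.sq_sqrt (by positivity)]
  refine mul_le_mul_of_nonneg_left ?_ (by positivity)
  rw [mul_pow]
  have hp : HasSum (fun p : ℕ × (ℕ →₀ ℕ) => ‖f p.1‖ ^ 2 * ‖ψ p.2‖ ^ 2) (‖f‖ ^ 2 * ‖ψ‖ ^ 2) :=
    (hasSum_norm_sq f).mul (hasSum_norm_sq ψ)
      ((hasSum_norm_sq f).summable.mul_of_nonneg (hasSum_norm_sq ψ).summable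
        (fun _ => by positivity) (fun _ => by positivity))
  rw [Finset.sum_sigma']
  have himg : ∑ x ∈ s.sigma fun n => n.support, ‖f x.2‖ ^ 2 * ‖ψ (x.1 - Finsupp.single x.2 1)‖ ^ 2
      = ∑ p ∈ (s.sigma fun n => n.support).image
          (fun x : (Σ _ : (ℕ →₀ ℕ), ℕ) => (x.2, x.1 - Finsupp.single x.2 1)),
          ‖f p.1‖ ^ 2 * ‖ψ p.2‖ ^ 2 := by
    rw [Finset.sum_image]
    rintro ⟨n, k⟩ hx ⟨m, j⟩ hy hxy
    simp only [Finset.coe_sigma, Set.mem_sigma_iff, Finset.mem_coe] at hx hy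
    simp only [Prod.mk.injEq] at hxy
    obtain ⟨rfl, h2⟩ := hxy
    have : n = m := by rw [← sub_single_add hx.2, h2, sub_single_add hy.2]
    subst this
    rfl
  rw [himg]
  exact sum_le_hasSum _ (fun _ _ => by positivity) hp

/-- The creation operator cut off to states with at most `N` particles. -/
def cop (N : ℕ) : Ltwo ℕ →L[ℂ] Fock →L[ℂ] Fock :=
  LinearMap.mkContinuous₂
    (LinearMap.mk₂ ℂ
      (fun f ψ => (⟨fun n => if n.degree ≤ N + 1 then creation f ψ n else 0,
        (exists_Ltwo_of_sum_le (by positivity) (sum_creation_sq_le f ψ N)).1⟩ : Fock))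
      (fun f g ψ => by
        ext n
        simp only [lp.coeFn_add, Pi.add_apply, creation_add]
        split_ifs <;> simp)
      (fun c f ψ => by
        ext n
        simp only [lp.coeFn_smul, Pi.smul_apply, creation_smul]
        split_ifs <;> simp)
      (fun f ψ χ => by
        ext n
        simp only [lp.coeFn_add, Pi.add_apply, creation_add_right]
        split_ifs <;> simp)
      (fun c f ψ => by
        ext n
        simp only [lp.coeFn_smul, Pi.smul_apply, creation_smul_right]
        split_ifs <;> simp))
    (Real.sqrt (N + 1))
    (fun f ψ => (exists_Ltwo_of_sum_le (by positivity) (sum_creation_sq_le f ψ N)).2)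

lemma cop_apply (N : ℕ) (f : Ltwo ℕ) (ψ : Fock) (n : ℕ →₀ ℕ) :
    cop N f ψ n = if n.degree ≤ N + 1 then creation f ψ n else 0 := rfl

lemma norm_cop_le (N : ℕ) (f : Ltwo ℕ) : ‖cop N f‖ ≤ Real.sqrt (N + 1) * ‖f‖ :=
  ContinuousLinearMap.opNorm_le_bound _ (by positivity) fun ψ =>
    (exists_Ltwo_of_sum_le (by positivity) (sum_creation_sq_le f ψ N)).2

lemma creation_ket_add_single (f : ℕ → ℂ) (n : ℕ →₀ ℕ) (k : ℕ) :
    creation f (ket n) (n + Finsupp.single k 1) = f k * Real.sqrt (n k + 1) := by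
  rw [creation, Finset.sum_eq_single k]
  · rw [add_tsub_cancel_right, ket_apply, if_pos rfl]
    simp
  · intro j hj hjk
    rw [ket_apply, if_neg, mul_zero]
    intro h
    have h1 := sub_single_add hj
    rw [h] at h1
    have := (Finsupp.single_left_inj (one_ne_zero)).mp (add_left_cancel h1)
    exact hjk this
  · intro h
    simp at h

lemma creation_ket_of_forall_ne (f : ℕ → ℂ) (n m : ℕ →₀ ℕ)
    (h : ∀ k, n + Finsupp.single k 1 ≠ m) : creation f (ket n) m = 0 := by
  refine Finset.sum_eq_zero fun k hk => ?_
  rw [ket_apply, if_neg, mul_zero]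
  intro h1
  exact h k (by rw [← h1, sub_single_add hk])

/-- The adjoint of the cut off creation operator is a cut off annihilation operator. -/
lemma adjoint_cop_apply (N : ℕ) (f : Ltwo ℕ) (ψ : Fock) (n : ℕ →₀ ℕ) :
    (ContinuousLinearMap.adjoint (cop N f) ψ) n
      = if n.degree ≤ N then annihilation f ψ n else 0 := by
  rw [← inner_ket n, ContinuousLinearMap.adjoint_inner_right]
  have h := lp.hasSum_inner (𝕜 := ℂ) (cop N f (ket n)) ψ
  have hinj : Function.Injective fun k : ℕ => n + Finsupp.single k 1 := fun i j hij =>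
    (Finsupp.single_left_inj (one_ne_zero)).mp (add_left_cancel hij)
  -- Creation from |n⟩ only reaches the states n + δ_k, so the sum over all states becomes a sum
  -- over k.
  rw [← h.tsum_eq, ← hinj.tsum_eq]
  · split_ifs with hn
    · refine tsum_congr fun k => ?_
      rw [cop_apply, if_pos (by rw [degree_add_single]; omega), creation_ket_add_single]
      simp [mul_comm]
    · simp only [cop_apply]
      rw [← tsum_zero (α := ℂ) (β := ℕ)]
      refine tsum_congr fun k => ?_
      rw [if_neg (by rw [degree_add_single]; omega)]
      simp
  · intro m hm
    by_contra hr
    apply hm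
    have h0 : cop N f (ket n) m = 0 := by
      rw [cop_apply, creation_ket_of_forall_ne f n m fun k hk => hr ⟨k, hk⟩, ite_self]
    show inner ℂ (cop N f (ket n) m) (ψ m) = 0
    rw [h0, inner_zero_left]

/-! ### The cut off generators -/

/-- The state has at most `N` particles. -/
def DegLE (N : ℕ) (ψ : Fock) : Prop := ∀ n : ℕ →₀ ℕ, N < n.degree → ψ n = 0

lemma DegLE.mono {N M : ℕ} {ψ : Fock} (h : DegLE N ψ) (hNM : N ≤ M) : DegLE M ψ :=
  fun n hn => h n (hNM.trans_lt hn)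

lemma degLE_ket {N : ℕ} {n : ℕ →₀ ℕ} (h : n.degree ≤ N) : DegLE N (ket n) := fun m hm => by
  rw [ket_apply, if_neg]
  rintro rfl
  omega

/-- The operator `C(f) - A(f)` cut off to states with at most `N` particles. -/
def gop (N : ℕ) (f : Ltwo ℕ) : Fock →L[ℂ] Fock :=
  cop N f - ContinuousLinearMap.adjoint (cop N f)

lemma continuous_gop (N : ℕ) : Continuous (gop N) :=
  (cop N).continuous.sub (ContinuousLinearMap.adjoint.continuous.comp (cop N).continuous)

lemma gop_add (N : ℕ) (f g : Ltwo ℕ) : gop N (f + g) = gop N f + gop N g := by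
  simp only [gop, map_add]; abel

lemma gop_neg (N : ℕ) (f : Ltwo ℕ) : gop N (-f) = -gop N f := by
  simp only [gop, map_neg]; abel

lemma gop_real_smul (N : ℕ) (c : ℝ) (f : Ltwo ℕ) : gop N ((c : ℂ) • f) = (c : ℂ) • gop N f := by
  simp only [gop, map_smul, smul_sub, map_smulₛₗ, Complex.conj_ofReal]

lemma adjoint_gop (N : ℕ) (f : Ltwo ℕ) : ContinuousLinearMap.adjoint (gop N f) = gop N (-f) := by
  rw [gop_neg, gop, map_sub, ContinuousLinearMap.adjoint_adjoint, neg_sub]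

lemma norm_gop_le (N : ℕ) (f : Ltwo ℕ) : ‖gop N f‖ ≤ 2 * ‖f‖ * Real.sqrt (N + 1) := by
  refine (norm_sub_le _ _).trans ?_
  rw [LinearIsometryEquiv.norm_map]
  linarith [norm_cop_le N f]

lemma annihilation_eq_zero {N : ℕ} {ψ : Fock} (h : DegLE N ψ) (f : ℕ → ℂ) {n : ℕ →₀ ℕ}
    (hn : N ≤ n.degree) : annihilation f ψ n = 0 := by
  rw [annihilation, ← tsum_zero (α := ℂ) (β := ℕ)]
  refine tsum_congr fun k => ?_
  rw [h _ (by rw [degree_add_single]; omega), mul_zero]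

lemma creation_eq_zero {N : ℕ} {ψ : Fock} (h : DegLE N ψ) (f : ℕ → ℂ) {n : ℕ →₀ ℕ}
    (hn : N + 1 < n.degree) : creation f ψ n = 0 := by
  refine Finset.sum_eq_zero fun k hk => ?_
  have := degree_sub_single hk
  rw [h _ (by omega), mul_zero]

/-- On states with at most N particles the cut off is invisible: creation ends at N + 1 particles
and annihilation at N - 1. -/
lemma gop_apply_of_degLE {N : ℕ} {ψ : Fock} (h : DegLE N ψ) (f : Ltwo ℕ) (n : ℕ →₀ ℕ) :
    gop N f ψ n = creation f ψ n - annihilation f ψ n := by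
  show cop N f ψ n - (ContinuousLinearMap.adjoint (cop N f) ψ) n = _
  rw [cop_apply, adjoint_cop_apply]
  congr 1
  · split_ifs with hn
    · rfl
    · exact (creation_eq_zero h f (by omega)).symm
  · split_ifs with hn
    · rfl
    · exact (annihilation_eq_zero h f (by omega)).symm

lemma gop_coe_of_degLE {N : ℕ} {ψ : Fock} (h : DegLE N ψ) (f : Ltwo ℕ) :
    (gop N f ψ : (ℕ →₀ ℕ) → ℂ) = Complex.I • fieldOperator f ψ := by
  funext n
  rw [gop_apply_of_degLE h, Pi.smul_apply, fieldOperator, smul_eq_mul]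
  linear_combination (-(annihilation f ψ n - creation f ψ n)) * Complex.I_sq

lemma gop_eq_of_degLE {N M : ℕ} {ψ : Fock} (h : DegLE N ψ) (hNM : N ≤ M) (f : Ltwo ℕ) :
    gop M f ψ = gop N f ψ := by
  ext n
  rw [gop_apply_of_degLE h, gop_apply_of_degLE (h.mono hNM)]

lemma DegLE.gop_self (N : ℕ) (f : Ltwo ℕ) (ψ : Fock) : DegLE (N + 1) (gop N f ψ) := by
  intro n hn
  show cop N f ψ n - (ContinuousLinearMap.adjoint (cop N f) ψ) n = _
  rw [cop_apply, adjoint_cop_apply, if_neg (by omega), if_neg (by omega), sub_zero]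

lemma DegLE.gop {N : ℕ} {ψ : Fock} (h : DegLE N ψ) (M : ℕ) (f : Ltwo ℕ) :
    DegLE (N + 1) (gop M f ψ) := by
  rcases le_total N M with hNM | hNM
  · rw [gop_eq_of_degLE h hNM]
    exact DegLE.gop_self N f ψ
  · exact (DegLE.gop_self M f ψ).mono (by omega)

lemma DegLE.norm_gop_le {N : ℕ} {ψ : Fock} (h : DegLE N ψ) (M : ℕ) (f : Ltwo ℕ) :
    ‖Gowdy.gop M f ψ‖ ≤ 2 * ‖f‖ * Real.sqrt (N + 1) * ‖ψ‖ := by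
  rcases le_total N M with hNM | hNM
  · rw [gop_eq_of_degLE h hNM]
    exact ContinuousLinearMap.le_of_opNorm_le _ (Gowdy.norm_gop_le N f) ψ
  · refine (ContinuousLinearMap.le_of_opNorm_le _ (Gowdy.norm_gop_le M f) ψ).trans ?_
    gcongr

lemma DegLE.gop_pow {N : ℕ} {ψ : Fock} (h : DegLE N ψ) (M : ℕ) (f : Ltwo ℕ) (m : ℕ) :
    DegLE (N + m) ((Gowdy.gop M f ^ m) ψ) := by
  induction m with
  | zero => simpa using h
  | succ m ih =>
    rw [pow_succ', mul_apply_eq_comp]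
    exact ih.gop M f

/-- Each application adds at most one particle, so the j-th one (counted from 0) costs 2‖f‖ √(N + j
+ 1). The product grows like √(m!), which the factor 1/m! of the exponential series beats: finite
particle states are analytic vectors. -/
lemma DegLE.norm_gop_pow_le {N : ℕ} {ψ : Fock} (h : DegLE N ψ) (M : ℕ) (f : Ltwo ℕ) (m : ℕ) :
    ‖(Gowdy.gop M f ^ m) ψ‖ ≤ (2 * ‖f‖) ^ m * Real.sqrt ((N + 1).ascFactorial m) * ‖ψ‖ := by
  induction m with
  | zero => simp
  | succ m ih =>
    rw [pow_succ', mul_apply_eq_comp]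
    refine ((h.gop_pow M f m).norm_gop_le M f).trans ?_
    refine (mul_le_mul_of_nonneg_left ih (by positivity)).trans (le_of_eq ?_)
    rw [Nat.ascFactorial_succ, Nat.cast_mul, Real.sqrt_mul (by positivity)]
    push_cast
    rw [show (N : ℝ) + 1 + m = N + m + 1 by ring]
    ring

lemma DegLE.gop_pow_eq {N M M' m : ℕ} {ψ : Fock} (h : DegLE N ψ) (hM : N + m ≤ M)
    (hM' : N + m ≤ M') (f : Ltwo ℕ) : (Gowdy.gop M f ^ m) ψ = (Gowdy.gop M' f ^ m) ψ := by
  induction m with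
  | zero => simp
  | succ m ih =>
    rw [pow_succ', pow_succ', mul_apply_eq_comp, mul_apply_eq_comp,
      ← ih (by omega) (by omega), gop_eq_of_degLE (h.gop_pow M f m) (by omega : N + m ≤ M),
      gop_eq_of_degLE (h.gop_pow M f m) (by omega : N + m ≤ M')]

lemma DegLE.gop_pow_coe {N M m : ℕ} {ψ : Fock} (h : DegLE N ψ) (hM : N + m ≤ M) (f : Ltwo ℕ) :
    ((Gowdy.gop M f ^ m) ψ : (ℕ →₀ ℕ) → ℂ)
      = (fun χ : (ℕ →₀ ℕ) → ℂ => Complex.I • fieldOperator f χ)^[m] ψ := by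
  induction m with
  | zero => simp
  | succ m ih =>
    rw [pow_succ', mul_apply_eq_comp, Function.iterate_succ_apply', ← ih (by omega),
      ← gop_coe_of_degLE ((h.gop_pow M f m).mono (by omega : N + m ≤ M))]


open ComplexConjugate Filter Topology

/-! ### Strong limits of unitary operators -/

section StrongLimit

variable {H : Type*} [NormedAddCommGroup H] [InnerProductSpace ℂ H]

lemma cauchySeq_of_dense {U : ℕ → H ≃ₗᵢ[ℂ] H} {D : Set H} (hD : Dense D)
    (h : ∀ ψ ∈ D, CauchySeq fun n => U n ψ) (ψ : H) : CauchySeq fun n => U n ψ := by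
  rw [Metric.cauchySeq_iff']
  intro ε hε
  obtain ⟨φ, hφ, hd⟩ := Metric.dense_iff.mp hD ψ (ε / 3) (by positivity)
  rw [Metric.mem_ball, dist_comm] at hφ
  obtain ⟨N, hN⟩ := Metric.cauchySeq_iff'.mp (h φ hd) (ε / 3) (by positivity)
  refine ⟨N, fun n hn => ?_⟩
  calc dist (U n ψ) (U N ψ)
      ≤ dist (U n ψ) (U n φ) + dist (U n φ) (U N φ) + dist (U N φ) (U N ψ) :=
        dist_triangle4 _ _ _ _
    _ < ε / 3 + ε / 3 + ε / 3 := by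
        rw [(U n).dist_map, (U N).dist_map, dist_comm φ ψ]
        gcongr
        exact hN n hn
    _ = ε := by ring

/-- A sequence of unitary operators which, together with the inverses, converges on a dense set
has a unitary strong limit. -/
theorem exists_unitary_limit [CompleteSpace H] (U : ℕ → H ≃ₗᵢ[ℂ] H) {D : Set H} (hD : Dense D)
    (h : ∀ ψ ∈ D, CauchySeq fun n => U n ψ) (h' : ∀ ψ ∈ D, CauchySeq fun n => (U n).symm ψ) :
    ∃ V : H ≃ₗᵢ[ℂ] H, (∀ ψ, Tendsto (fun n => U n ψ) atTop (𝓝 (V ψ))) ∧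
      ∀ ψ, Tendsto (fun n => (U n).symm ψ) atTop (𝓝 (V.symm ψ)) := by
  have hlim : ∀ U : ℕ → H ≃ₗᵢ[ℂ] H, (∀ ψ ∈ D, CauchySeq fun n => U n ψ) →
      ∃ V : H →ₗᵢ[ℂ] H, ∀ ψ, Tendsto (fun n => U n ψ) atTop (𝓝 (V ψ)) := by
    intro U h
    choose V hV using fun ψ => cauchySeq_tendsto_of_complete (cauchySeq_of_dense hD h ψ)
    refine ⟨⟨⟨⟨V, fun x y => ?_⟩, fun c x => ?_⟩, fun x => ?_⟩, hV⟩
    · refine tendsto_nhds_unique (hV (x + y)) ?_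
      simpa using (hV x).add (hV y)
    · refine tendsto_nhds_unique (hV (c • x)) ?_
      simpa using (hV x).const_smul c
    · refine tendsto_nhds_unique (hV x).norm ?_
      simp
  obtain ⟨V, hV⟩ := hlim U h
  obtain ⟨W, hW⟩ := hlim (fun n => (U n).symm) h'
  -- A strong limit of unitaries is in general only an isometry; convergence of the inverses
  -- supplies surjectivity.
  have hVW : ∀ ψ, V (W ψ) = ψ := by
    intro ψ
    refine tendsto_nhds_unique (hV (W ψ)) ?_
    rw [tendsto_iff_dist_tendsto_zero]
    have := tendsto_iff_dist_tendsto_zero.mp (hW ψ)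
    refine this.congr fun n => ?_
    rw [dist_comm, ← (U n).dist_map, LinearIsometryEquiv.apply_symm_apply]
  refine ⟨⟨LinearEquiv.ofBijective V.toLinearMap
    ⟨V.injective, fun ψ => ⟨W ψ, hVW ψ⟩⟩, V.norm_map⟩, hV, fun ψ => ?_⟩
  have : W ψ = (LinearIsometryEquiv.symm ⟨LinearEquiv.ofBijective V.toLinearMap
    ⟨V.injective, fun ψ => ⟨W ψ, hVW ψ⟩⟩, V.norm_map⟩) ψ := by
    rw [LinearIsometryEquiv.eq_symm_apply]
    exact hVW ψ
  rw [← this]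
  exact hW ψ

end StrongLimit

/-! ### Weyl operators -/

lemma dense_degLE : Dense {ψ : Fock | ∃ N, DegLE N ψ} := by
  intro ψ
  refine mem_closure_of_tendsto (hasSum_ket ψ) (Eventually.of_forall fun s => ?_)
  refine ⟨∑ n ∈ s, n.degree, fun m hm => ?_⟩
  rw [lp.coeFn_sum, Finset.sum_apply]
  refine Finset.sum_eq_zero fun n hn => ?_
  rw [lp.coeFn_smul, Pi.smul_apply, ket_apply, if_neg, smul_zero]
  rintro rfl
  exact absurd (Finset.single_le_sum (f := fun n : ℕ →₀ ℕ => n.degree) (fun _ _ => Nat.zero_le _) hn)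
    (by omega)

/-- The majorant of the exponential series on states with at most `N` particles. -/
def expBound (c : ℝ) (N m : ℕ) : ℝ :=
  ((m.factorial : ℝ))⁻¹ * ((2 * c) ^ m * Real.sqrt ((N + 1).ascFactorial m))

lemma expBound_nonneg {c : ℝ} (hc : 0 ≤ c) (N m : ℕ) : 0 ≤ expBound c N m := by
  unfold expBound; positivity

lemma expBound_succ (c : ℝ) (N m : ℕ) :
    expBound c N (m + 1) = 2 * c * (Real.sqrt (N + 1 + m) / (m + 1)) * expBound c N m := by
  rw [expBound, expBound, Nat.ascFactorial_succ, Nat.factorial_succ]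
  push_cast
  rw [Real.sqrt_mul (by positivity)]
  field_simp
  ring

/-- Ratio test: consecutive terms have ratio 2c √(N + 1 + m)/(m + 1), which tends to 0. -/
lemma summable_expBound {c : ℝ} (hc : 0 ≤ c) (N : ℕ) : Summable (expBound c N) := by
  have hlim : Tendsto (fun m : ℕ => 2 * c * (Real.sqrt (N + 1 + m) / (m + 1))) atTop (𝓝 0) := by
    rw [← mul_zero (2 * c)]
    refine Tendsto.const_mul _ ?_
    have h1 : Tendsto (fun m : ℕ => Real.sqrt (N + 1) / Real.sqrt (m + 1)) atTop (𝓝 0) := by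
      refine Tendsto.div_atTop tendsto_const_nhds (Real.tendsto_sqrt_atTop.comp ?_)
      exact tendsto_atTop_add_const_right _ _ tendsto_natCast_atTop_atTop
    refine squeeze_zero (fun m => by positivity) (fun m => ?_) h1
    have hm : (0 : ℝ) < m + 1 := by positivity
    rw [div_le_div_iff₀ hm (Real.sqrt_pos.mpr hm)]
    have h2 : (m : ℝ) + 1 = Real.sqrt (m + 1) * Real.sqrt (m + 1) :=
      (Real.mul_self_sqrt hm.le).symm
    have h3 : Real.sqrt (N + 1 + m) ≤ Real.sqrt (N + 1) * Real.sqrt (m + 1) := by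
      rw [← Real.sqrt_mul (by positivity)]
      refine Real.sqrt_le_sqrt ?_
      have : (0 : ℝ) ≤ N * m := by positivity
      nlinarith
    calc Real.sqrt (N + 1 + m) * Real.sqrt (m + 1)
        ≤ Real.sqrt (N + 1) * Real.sqrt (m + 1) * Real.sqrt (m + 1) := by gcongr
      _ = Real.sqrt (N + 1) * (m + 1) := by rw [mul_assoc, ← h2]
  refine summable_of_ratio_norm_eventually_le (r := 1 / 2) (by norm_num) ?_
  filter_upwards [hlim.eventually (gt_mem_nhds (by norm_num : (0 : ℝ) < 1 / 2))] with m hm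
  rw [Real.norm_of_nonneg (expBound_nonneg hc _ _), Real.norm_of_nonneg (expBound_nonneg hc _ _),
    expBound_succ]
  exact mul_le_mul_of_nonneg_right hm.le (expBound_nonneg hc _ _)

lemma DegLE.norm_term_le {N : ℕ} {ψ : Fock} (h : DegLE N ψ) (M : ℕ) (f : Ltwo ℕ) (m : ℕ) :
    ‖((m.factorial : ℂ))⁻¹ • (Gowdy.gop M f ^ m) ψ‖ ≤ expBound ‖f‖ N m * ‖ψ‖ := by
  rw [norm_smul, norm_inv, Complex.norm_natCast, expBound, mul_assoc]
  exact mul_le_mul_of_nonneg_left (h.norm_gop_pow_le M f m) (by positivity)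

/-- The sum of the exponential series. -/
def expSum (f : Ltwo ℕ) (N : ℕ) (ψ : Fock) : Fock :=
  ∑' m : ℕ, ((m.factorial : ℂ))⁻¹ • (gop (N + m) f ^ m) ψ

lemma DegLE.hasSum_expSum {N : ℕ} {ψ : Fock} (h : DegLE N ψ) (f : Ltwo ℕ) :
    HasSum (fun m : ℕ => ((m.factorial : ℂ))⁻¹ • (Gowdy.gop (N + m) f ^ m) ψ) (expSum f N ψ) :=
  (Summable.of_norm_bounded ((summable_expBound (norm_nonneg f) N).mul_right ‖ψ‖)
    fun m => h.norm_term_le (N + m) f m).hasSum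

/-- The exponential of the cut off generator. -/
def expGop (f : Ltwo ℕ) (M : ℕ) : Fock ≃ₗᵢ[ℂ] Fock :=
  Unitary.linearIsometryEquiv ⟨NormedSpace.exp (gop M f), by
    let _ : NormedAlgebra ℚ (Fock →L[ℂ] Fock) := NormedAlgebra.restrictScalars ℚ ℂ _
    refine NormedSpace.exp_mem_unitary_of_mem_skewAdjoint ?_
    rw [skewAdjoint.mem_iff, ContinuousLinearMap.star_eq_adjoint, adjoint_gop, gop_neg]⟩

lemma hasSum_expGop (f : Ltwo ℕ) (M : ℕ) (ψ : Fock) :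
    HasSum (fun m : ℕ => ((m.factorial : ℂ))⁻¹ • (gop M f ^ m) ψ) (expGop f M ψ) :=
  (NormedSpace.exp_series_hasSum_exp' (𝕂 := ℂ) (gop M f)).mapL
    (ContinuousLinearMap.apply ℂ Fock ψ)

lemma expGop_symm (f : Ltwo ℕ) (M : ℕ) : (expGop f M).symm = expGop (-f) M := by
  have h : (expGop f M).symm = (expGop f M)⁻¹ := rfl
  rw [h, expGop, ← map_inv, expGop]
  congr 1
  apply Subtype.ext
  show star (NormedSpace.exp (gop M f)) = NormedSpace.exp (gop M (-f))
  rw [NormedSpace.star_exp, ContinuousLinearMap.star_eq_adjoint, adjoint_gop]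

/-- The m-th term is constant in M once M ≥ N + m, and all terms share one summable majorant, so
dominated convergence applies to the series. -/
lemma DegLE.tendsto_expGop {N : ℕ} {ψ : Fock} (h : DegLE N ψ) (f : Ltwo ℕ) :
    Tendsto (fun M => expGop f M ψ) atTop (𝓝 (expSum f N ψ)) := by
  have h1 : (fun M => expGop f M ψ)
      = fun M => ∑' m : ℕ, ((m.factorial : ℂ))⁻¹ • (Gowdy.gop M f ^ m) ψ :=
    funext fun M => (hasSum_expGop f M ψ).tsum_eq.symm
  rw [h1]
  refine tendsto_tsum_of_dominated_convergence
    ((summable_expBound (norm_nonneg f) N).mul_right ‖ψ‖) (fun m => ?_)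
    (Eventually.of_forall fun M m => h.norm_term_le M f m)
  refine tendsto_const_nhds.congr' ?_
  filter_upwards [eventually_ge_atTop (N + m)] with M hM
  rw [h.gop_pow_eq le_rfl hM]

/-- The field operator is unbounded, so unitarity of its exponential is obtained as a strong limit:
the cut off generators are bounded and skew-adjoint, with unitary exponentials, and the inverses are
of the same kind with -f. -/
lemma exists_weyl (f : Ltwo ℕ) : ∃ V : Fock ≃ₗᵢ[ℂ] Fock,
    (∀ N ψ, DegLE N ψ → V ψ = expSum f N ψ) ∧ ∀ N ψ, DegLE N ψ → V.symm ψ = expSum (-f) N ψ := by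
  obtain ⟨V, h1, h2⟩ := exists_unitary_limit (expGop f) dense_degLE
    (fun ψ ⟨N, h⟩ => (h.tendsto_expGop f).cauchySeq)
    (fun ψ ⟨N, h⟩ => by
      simp only [expGop_symm]
      exact (h.tendsto_expGop (-f)).cauchySeq)
  refine ⟨V, fun N ψ h => tendsto_nhds_unique (h1 ψ) (h.tendsto_expGop f), fun N ψ h => ?_⟩
  have h3 := h2 ψ
  simp only [expGop_symm] at h3
  exact tendsto_nhds_unique h3 (h.tendsto_expGop (-f))

/-- The Weyl operator `exp (C(f) - A(f))`. -/
def weyl (f : Ltwo ℕ) : Fock ≃ₗᵢ[ℂ] Fock := (exists_weyl f).choose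

lemma DegLE.weyl_eq {N : ℕ} {ψ : Fock} (h : DegLE N ψ) (f : Ltwo ℕ) :
    Gowdy.weyl f ψ = expSum f N ψ := (exists_weyl f).choose_spec.1 N ψ h

lemma DegLE.hasSum_weyl {N : ℕ} {ψ : Fock} (h : DegLE N ψ) (f : Ltwo ℕ) :
    HasSum (fun m : ℕ => ((m.factorial : ℂ))⁻¹ • (Gowdy.gop (N + m) f ^ m) ψ) (Gowdy.weyl f ψ) := by
  rw [h.weyl_eq]
  exact h.hasSum_expSum f

lemma eq_of_eq_on_degLE {S T : Fock → Fock} (hS : Continuous S) (hT : Continuous T)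
    (h : ∀ N ψ, DegLE N ψ → S ψ = T ψ) : S = T :=
  hS.ext_on dense_degLE hT fun ψ ⟨N, hN⟩ => h N ψ hN

lemma weyl_symm (f : Ltwo ℕ) : (weyl f).symm = weyl (-f) := by
  apply DFunLike.coe_injective
  refine eq_of_eq_on_degLE (LinearIsometryEquiv.continuous _) (LinearIsometryEquiv.continuous _)
    fun N ψ h => ?_
  rw [h.weyl_eq]
  exact (exists_weyl f).choose_spec.2 N ψ h

lemma isWeylOperator_weyl (f : Ltwo ℕ) : IsWeylOperator f (weyl f) := by
  rintro ψ ⟨N, h⟩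
  have h' : DegLE N ψ := h
  exact ⟨fun m => (gop (N + m) f ^ m) ψ, fun m => h'.gop_pow_coe le_rfl f, h'.hasSum_weyl f⟩

/-- The exponential series determines the operator on the dense set of finite particle states. Hence
every Fock representation, in whatever basis, consists of the operators `weyl`. -/
lemma IsWeylOperator.eq_weyl {f : Ltwo ℕ} {V : Fock ≃ₗᵢ[ℂ] Fock} (hV : IsWeylOperator f V) :
    V = weyl f := by
  apply DFunLike.coe_injective
  refine eq_of_eq_on_degLE (LinearIsometryEquiv.continuous _) (LinearIsometryEquiv.continuous _)
    fun N ψ h => ?_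
  obtain ⟨v, hv, hs⟩ := hV ψ ⟨N, h⟩
  refine hs.unique ?_
  have : v = fun m => (gop (N + m) f ^ m) ψ := by
    funext m
    exact lp.ext ((hv m).trans (h.gop_pow_coe le_rfl f).symm)
  rw [this]
  exact h.hasSum_weyl f


open ComplexConjugate Filter Topology

/-! ### Intertwining Weyl operators -/

/-- `gop N` as an additive map. -/
def gopHom (N : ℕ) : Ltwo ℕ →+ (Fock →L[ℂ] Fock) :=
  ⟨⟨gop N, by simp [gop]⟩, gop_add N⟩

/-- U need not preserve finite particle states, so the generators are never applied to Uψ; they are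
moved one at a time from the left entry to the right one. Every move can raise the particle number
by one, whence the bounds N + m ≤ M and N' + m ≤ M. -/
lemma inner_gop_pow {U : Fock ≃ₗᵢ[ℂ] Fock} {f g : Ltwo ℕ} {M : ℕ}
    (h : ∀ φ ψ, DegLE M φ → DegLE M ψ →
      inner ℂ (gop M (-g) φ) (U ψ) = inner ℂ φ (U (gop M f ψ))) (m : ℕ) :
    ∀ (N N' : ℕ) (φ ψ : Fock), DegLE N φ → DegLE N' ψ → N + m ≤ M → N' + m ≤ M →
      inner ℂ ((gop M (-g) ^ m) φ) (U ψ) = inner ℂ φ (U ((gop M f ^ m) ψ)) := by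
  induction m with
  | zero => intro N N' φ ψ _ _ _ _; simp
  | succ m ih =>
    intro N N' φ ψ hφ hψ hN hN'
    rw [pow_succ', mul_apply_eq_comp, h _ _ ((hφ.gop_pow M _ m).mono (by omega))
      (hψ.mono (by omega)), ih N (N' + 1) φ _ hφ (hψ.gop M f) (by omega) (by omega), pow_succ,
      mul_apply_eq_comp]

/-- Intertwining of the generators, in the weak sense, implies intertwining of Weyl operators. -/
theorem weyl_intertwine {U : Fock ≃ₗᵢ[ℂ] Fock} {f g : Ltwo ℕ}
    (h : ∀ M φ ψ, DegLE M φ → DegLE M ψ →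
      inner ℂ (gop M (-g) φ) (U ψ) = inner ℂ φ (U (gop M f ψ))) (ψ : Fock) :
    U (weyl f ψ) = weyl g (U ψ) := by
  have key : ∀ N φ ψ, DegLE N φ → DegLE N ψ →
      inner ℂ (weyl (-g) φ) (U ψ) = inner ℂ φ (U (weyl f ψ)) := by
    intro N φ ψ hφ hψ
    have h1 := (hφ.hasSum_weyl (-g)).map
      ((innerₛₗ ℂ (E := Fock)).flip (U ψ)).toAddMonoidHom
      (by exact continuous_id.inner continuous_const)
    have h2 := ((hψ.hasSum_weyl f).mapL U.toContinuousLinearEquiv.toContinuousLinearMap).mapL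
      (innerSL ℂ φ)
    refine h1.unique (h2.congr_fun fun m => ?_)
    show inner ℂ (((m.factorial : ℂ))⁻¹ • _) (U ψ) = inner ℂ φ (U (((m.factorial : ℂ))⁻¹ • _))
    rw [inner_smul_left, map_smul, inner_smul_right,
      inner_gop_pow (h (N + m)) m N N φ ψ hφ hψ le_rfl le_rfl]
    simp
  have hfun : (fun ψ => U (weyl f ψ)) = fun ψ => weyl g (U ψ) := by
    refine eq_of_eq_on_degLE (U.continuous.comp (weyl f).continuous)
      ((weyl g).continuous.comp U.continuous) fun N ψ hψ => ?_
    ext n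
    rw [← inner_ket n, ← inner_ket n, ← key (max N n.degree) _ _
      (degLE_ket (le_max_right _ _)) (hψ.mono (le_max_left _ _)), ← weyl_symm,
      ← (weyl g).inner_map_map, LinearIsometryEquiv.apply_symm_apply]
  exact congrFun hfun ψ

lemma creation_ket_single (k : ℕ) (w : ℂ) (n m : ℕ →₀ ℕ) :
    creation (w • ket k : Ltwo ℕ) (ket n) m
      = w * Real.sqrt (n k + 1) * ket (n + Finsupp.single k 1) m := by
  rw [ket_apply]
  by_cases h : ∃ j, n + Finsupp.single j 1 = m
  · obtain ⟨j, rfl⟩ := h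
    rw [creation_ket_add_single, lp.coeFn_smul, Pi.smul_apply, ket_apply]
    by_cases hj : j = k
    · subst hj; simp
    · have : n + Finsupp.single j 1 ≠ n + Finsupp.single k 1 := fun h =>
        hj ((Finsupp.single_left_inj one_ne_zero).mp (add_left_cancel h))
      simp [hj, this]
  · push Not at h
    rw [creation_ket_of_forall_ne _ _ _ h, if_neg (h k).symm, mul_zero]

lemma annihilation_ket_single (k : ℕ) (w : ℂ) (n m : ℕ →₀ ℕ) :
    annihilation (w • ket k : Ltwo ℕ) (ket n) m
      = conj w * Real.sqrt (n k) * ket (n - Finsupp.single k 1) m := by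
  rw [annihilation, tsum_eq_single k, lp.coeFn_smul, Pi.smul_apply, ket_apply, ket_apply, ket_apply]
  · by_cases h : m + Finsupp.single k 1 = n
    · subst h
      simp
    · rw [if_neg h, mul_zero]
      by_cases hk : k ∈ n.support
      · rw [if_neg, mul_zero]
        rintro rfl
        exact h (sub_single_add hk)
      · rw [Finsupp.notMem_support_iff.mp hk]
        simp
  · intro j hj
    rw [lp.coeFn_smul, Pi.smul_apply, ket_apply, if_neg hj]
    simp

lemma gop_single_ket {N k : ℕ} (w : ℂ) {n : ℕ →₀ ℕ} (hn : n.degree ≤ N) :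
    gop N (w • ket k) (ket n) = (w * Real.sqrt (n k + 1)) • ket (n + Finsupp.single k 1)
      - (conj w * Real.sqrt (n k)) • ket (n - Finsupp.single k 1) := by
  ext m
  rw [gop_apply_of_degLE (degLE_ket hn), creation_ket_single, annihilation_ket_single]
  rfl

/-- Intertwining can be checked on matrix elements. -/
theorem weyl_intertwine_of_matrix {U : Fock ≃ₗᵢ[ℂ] Fock} {f g : Ltwo ℕ}
    (h : ∀ (k : ℕ) (m n : ℕ →₀ ℕ),
      -(conj (g k) * Real.sqrt (m k + 1)) * U (ket n) (m + Finsupp.single k 1)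
        + g k * Real.sqrt (m k) * U (ket n) (m - Finsupp.single k 1)
      = f k * Real.sqrt (n k + 1) * U (ket (n + Finsupp.single k 1)) m
        - conj (f k) * Real.sqrt (n k) * U (ket (n - Finsupp.single k 1)) m) (ψ : Fock) :
    U (weyl f ψ) = weyl g (U ψ) := by
  refine weyl_intertwine (fun N φ ψ hφ hψ => ?_) ψ
  -- The generator is only real linear in f, so it is expanded as a continuous additive map and the
  -- scalars f k stay inside.
  have hgop : ∀ f : Ltwo ℕ, HasSum (fun k => gop N (f k • ket k)) (gop N f) := fun f =>
    (hasSum_ket f).map (gopHom N) (continuous_gop N)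
  -- matrix elements
  have step1 : ∀ (m n : ℕ →₀ ℕ), m.degree ≤ N → n.degree ≤ N →
      inner ℂ (gop N (-g) (ket m)) (U (ket n)) = inner ℂ (ket m) (U (gop N f (ket n))) := by
    intro m n hm hn
    have h1 := (((hgop (-g)).mapL (ContinuousLinearMap.apply ℂ Fock (ket m))).map
      ((innerₛₗ ℂ (E := Fock)).flip (U (ket n))).toAddMonoidHom
      (by exact continuous_id.inner continuous_const))
    have h2 := (((hgop f).mapL (ContinuousLinearMap.apply ℂ Fock (ket n))).mapL
      U.toContinuousLinearEquiv.toContinuousLinearMap).mapL (innerSL ℂ (ket m))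
    refine h1.unique (h2.congr_fun fun k => ?_)
    show inner ℂ (gop N ((-g) k • ket k) (ket m)) (U (ket n))
      = inner ℂ (ket m) (U (gop N (f k • ket k) (ket n)))
    rw [gop_single_ket _ hm, gop_single_ket _ hn, map_sub, map_smul, map_smul, inner_sub_left,
      inner_sub_right, inner_smul_left, inner_smul_left, inner_smul_right, inner_smul_right,
      inner_ket, inner_ket, inner_ket, inner_ket, ← h k m n]
    simp
  have step2 : ∀ (m : ℕ →₀ ℕ) (_ : m.degree ≤ N),
      inner ℂ (gop N (-g) (ket m)) (U ψ) = inner ℂ (ket m) (U (gop N f ψ)) := by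
    intro m hm
    have h1 := ((hasSum_ket ψ).mapL U.toContinuousLinearEquiv.toContinuousLinearMap).mapL
      (innerSL ℂ (gop N (-g) (ket m)))
    have h2 := (((hasSum_ket ψ).mapL (gop N f)).mapL
      U.toContinuousLinearEquiv.toContinuousLinearMap).mapL (innerSL ℂ (ket m))
    refine h1.unique (h2.congr_fun fun n => ?_)
    show inner ℂ (gop N (-g) (ket m)) (U (ψ n • ket n))
      = inner ℂ (ket m) (U (gop N f (ψ n • ket n)))
    rw [map_smul, map_smul, map_smul, inner_smul_right, inner_smul_right]
    by_cases hn : n.degree ≤ N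
    · rw [step1 m n hm hn]
    · rw [hψ n (by omega), zero_mul, zero_mul]
  have h1 := ((hasSum_ket φ).mapL (gop N (-g))).map
    ((innerₛₗ ℂ (E := Fock)).flip (U ψ)).toAddMonoidHom
    (by exact continuous_id.inner continuous_const)
  have h2 := (hasSum_ket φ).map
    ((innerₛₗ ℂ (E := Fock)).flip (U (gop N f ψ))).toAddMonoidHom
    (by exact continuous_id.inner continuous_const)
  refine h1.unique (h2.congr_fun fun m => ?_)
  show inner ℂ (gop N (-g) (φ m • ket m)) (U ψ) = inner ℂ (φ m • ket m) (U (gop N f ψ))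
  rw [map_smul, inner_smul_left, inner_smul_left]
  by_cases hm : m.degree ≤ N
  · rw [step2 m hm]
  · rw [hφ m (by omega)]
    simp

/-! ### Unitary operators from matrices -/

/-- Orthonormal columns give an isometry V. Rows of norm one suffice for surjectivity, because ‖V V*
e_a - e_a‖² = 1 - 2 + 1 = 0 for every basis vector. -/
theorem exists_unitary_of_matrix {ι : Type*} [DecidableEq ι] (M : ι → ι → ℂ)
    (hc : ∀ b b', HasSum (fun a => conj (M a b) * M a b') (if b = b' then 1 else 0))
    (hr : ∀ a, HasSum (fun b => ‖M a b‖ ^ 2) 1) :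
    ∃ U : Ltwo ι ≃ₗᵢ[ℂ] Ltwo ι, ∀ a b, U (ket b) a = M a b := by
  have hmem : ∀ b, Memℓp (fun a => M a b) 2 := by
    intro b
    refine memLtwo_iff.mpr ?_
    have h := hc b b
    rw [if_pos rfl] at h
    have h2 := (Complex.hasSum_iff _ _).mp h
    refine h2.1.summable.congr fun a => ?_
    rw [← Complex.normSq_eq_conj_mul_self, Complex.ofReal_re, Complex.normSq_eq_norm_sq]
  set v : ι → Ltwo ι := fun b => ⟨fun a => M a b, hmem b⟩ with hv
  have hon : Orthonormal ℂ v := by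
    rw [orthonormal_iff_ite]
    intro b b'
    refine (lp.hasSum_inner (𝕜 := ℂ) (v b) (v b')).unique ((hc b b').congr_fun fun a => ?_)
    show inner ℂ (M a b) (M a b') = _
    rw [RCLike.inner_apply, mul_comm]
  set V := hon.orthogonalFamily.linearIsometry with hV
  have hVket : ∀ b, V (ket b) = v b := by
    intro b
    rw [ket, hV, OrthogonalFamily.linearIsometry_apply_single]
    simp
  have hsurj : Function.Surjective V := by
    set W := ContinuousLinearMap.adjoint V.toContinuousLinearMap with hW
    have hker : ∀ a, V (W (ket a)) = ket a := by
      intro a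
      have h1 : ∀ b, W (ket a) b = conj (M a b) := by
        intro b
        rw [← inner_ket b, hW, ContinuousLinearMap.adjoint_inner_right]
        show inner ℂ (V (ket b)) (ket a) = _
        rw [hVket, inner_ket_right]
      have h2 : ‖W (ket a)‖ ^ 2 = 1 := by
        refine (hasSum_norm_sq _).unique ((hr a).congr_fun fun b => ?_)
        rw [h1, RCLike.norm_conj]
      have h3 : inner ℂ (V (W (ket a))) (ket a) = (1 : ℂ) := by
        have : inner ℂ (W (ket a)) (W (ket a)) = inner ℂ (V (W (ket a))) (ket a) :=
          ContinuousLinearMap.adjoint_inner_right V.toContinuousLinearMap _ _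
        rw [← this, inner_self_eq_norm_sq_to_K]
        simpa using congrArg (RCLike.ofReal (K := ℂ)) h2
      have h4 : ‖V (W (ket a)) - ket a‖ ^ 2 = 0 := by
        rw [norm_sub_sq (𝕜 := ℂ), h3, V.norm_map, h2, norm_ket]
        norm_num
      exact sub_eq_zero.mp (norm_eq_zero.mp (pow_eq_zero_iff two_ne_zero |>.mp h4))
    intro ψ
    refine ⟨W ψ, ?_⟩
    have h1 := ((hasSum_ket ψ).mapL W).mapL V.toContinuousLinearMap
    refine h1.unique ((hasSum_ket ψ).congr_fun fun a => ?_)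
    rw [map_smul, map_smul]
    exact congrArg _ (hker a)
  refine ⟨⟨LinearEquiv.ofBijective V.toLinearMap ⟨V.injective, hsurj⟩, V.norm_map⟩, fun a b => ?_⟩
  show V (ket b) a = M a b
  rw [hVket]


/-! ### Implementation of square summable Bogoliubov transformations. -/

open ComplexConjugate Filter Topology

/-! ### One-mode squeezing -/

/-- The unnormalized coefficients of a squeezed vacuum. -/
def sqz (μ : ℂ) : ℕ → ℂ
  | 0 => 1
  | 1 => 0
  | m + 2 => μ * Real.sqrt ((m + 1) / (m + 2)) * sqz μ m

lemma sqrt_ratio_le_one (m : ℕ) : Real.sqrt (((m : ℝ) + 1) / (m + 2)) ≤ 1 := by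
  rw [Real.sqrt_le_one]
  rw [div_le_one (by positivity)]
  linarith

lemma norm_sqz_add_two (μ : ℂ) (m : ℕ) :
    ‖sqz μ (m + 2)‖ = ‖μ‖ * Real.sqrt ((m + 1) / (m + 2)) * ‖sqz μ m‖ := by
  rw [sqz, norm_mul, norm_mul, Complex.norm_real, Real.norm_of_nonneg (Real.sqrt_nonneg _)]

lemma norm_sqz_add_two_le (μ : ℂ) (m : ℕ) : ‖sqz μ (m + 2)‖ ≤ ‖μ‖ * ‖sqz μ m‖ := by
  rw [norm_sqz_add_two]
  gcongr
  exact mul_le_of_le_one_right (norm_nonneg _) (sqrt_ratio_le_one m)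

/-- Sequences of rapid decay. -/
def RapidDecay (φ : ℕ → ℂ) : Prop := ∀ k : ℕ, Summable fun m : ℕ => ((m : ℝ) + 1) ^ k * ‖φ m‖

lemma rapidDecay_sqz {μ : ℂ} (hμ : ‖μ‖ < 1) : RapidDecay (sqz μ) := by
  -- Two steps of the recursion contract by at most |μ|, so any ρ with |μ| ≤ ρ² < 1 gives geometric
  -- decay ρ^m; here ρ² is the midpoint of |μ| and 1.
  set ρ := Real.sqrt ((‖μ‖ + 1) / 2) with hρ
  have h0 : 0 < ρ := Real.sqrt_pos.mpr (by positivity)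
  have hsq : ρ * ρ = (‖μ‖ + 1) / 2 := Real.mul_self_sqrt (by positivity)
  have h1 : ρ < 1 := by nlinarith
  have hb : ∀ m, ‖sqz μ m‖ ≤ ρ ^ m ∧ ‖sqz μ (m + 1)‖ ≤ ρ ^ (m + 1) := by
    intro m
    induction m with
    | zero => simp [sqz, h0.le]
    | succ m ih =>
      refine ⟨ih.2, (norm_sqz_add_two_le μ m).trans ?_⟩
      calc ‖μ‖ * ‖sqz μ m‖ ≤ (ρ * ρ) * ρ ^ m := by
            gcongr
            · rw [hsq]; linarith
            · exact ih.1
        _ = ρ ^ (m + 1 + 1) := by ring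
  intro k
  have h2 := summable_pow_mul_geometric_of_norm_lt_one k
    (r := ρ) (by rwa [Real.norm_of_nonneg h0.le])
  have h3 := ((summable_nat_add_iff 1).mpr h2).mul_left ρ⁻¹
  refine Summable.of_nonneg_of_le (fun m => by positivity) (fun m => ?_) h3
  calc ((m : ℝ) + 1) ^ k * ‖sqz μ m‖ ≤ ((m : ℝ) + 1) ^ k * ρ ^ m := by
        gcongr
        exact (hb m).1
    _ = ρ⁻¹ * (((m + 1 : ℕ) : ℝ) ^ k * ρ ^ (m + 1)) := by
        push_cast
        rw [pow_succ ρ m]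
        field_simp

namespace RapidDecay

variable {φ ψ : ℕ → ℂ}

lemma const_mul (h : RapidDecay φ) (c : ℂ) : RapidDecay fun m => c * φ m := fun k => by
  refine ((h k).mul_left ‖c‖).congr fun m => ?_
  rw [norm_mul]; ring

lemma sub (h : RapidDecay φ) (h' : RapidDecay ψ) : RapidDecay fun m => φ m - ψ m := fun k => by
  refine Summable.of_nonneg_of_le (fun m => by positivity) (fun m => ?_) ((h k).add (h' k))
  rw [← mul_add]
  gcongr
  exact norm_sub_le _ _

lemma summable_norm (h : RapidDecay φ) : Summable fun m => ‖φ m‖ := by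
  simpa using h 0

lemma sqrt_le_succ (m : ℕ) : Real.sqrt ((m : ℝ) + 1) ≤ m + 1 := by
  have h : (0 : ℝ) ≤ m := Nat.cast_nonneg m
  exact (Real.sqrt_le_left (by positivity)).mpr (by nlinarith)

lemma lower (h : RapidDecay φ) : RapidDecay fun m => Real.sqrt (m + 1) * φ (m + 1) := fun k => by
  refine Summable.of_nonneg_of_le (fun m => by positivity) (fun m => ?_)
    ((summable_nat_add_iff 1).mpr (h (k + 1)))
  rw [norm_mul, Complex.norm_real, Real.norm_of_nonneg (Real.sqrt_nonneg _), pow_succ, ← mul_assoc]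
  push_cast
  gcongr
  · linarith
  · exact (sqrt_le_succ m).trans (by linarith)

lemma raise (h : RapidDecay φ) : RapidDecay fun m => Real.sqrt m * φ (m - 1) := fun k => by
  rw [← summable_nat_add_iff 1]
  refine Summable.of_nonneg_of_le (fun m => by positivity) (fun m => ?_)
    ((h (k + 1)).mul_left (2 ^ k))
  rw [norm_mul, Complex.norm_real, Real.norm_of_nonneg (Real.sqrt_nonneg _), add_tsub_cancel_right]
  push_cast
  calc ((m : ℝ) + 1 + 1) ^ k * (Real.sqrt (m + 1) * ‖φ m‖)
      ≤ (2 * ((m : ℝ) + 1)) ^ k * ((m + 1) * ‖φ m‖) := by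
        gcongr
        · linarith [(Nat.cast_nonneg m : (0 : ℝ) ≤ m)]
        · exact sqrt_le_succ m
    _ = 2 ^ k * (((m : ℝ) + 1) ^ (k + 1) * ‖φ m‖) := by
        rw [mul_pow]; ring

lemma summable_mul (h : RapidDecay φ) (h' : RapidDecay ψ) :
    Summable fun m => conj (φ m) * ψ m := by
  refine Summable.of_norm_bounded (h'.summable_norm.mul_left (∑' m, ‖φ m‖)) fun m => ?_
  rw [norm_mul, RCLike.norm_conj]
  gcongr
  exact h.summable_norm.le_tsum m fun _ _ => norm_nonneg _

end RapidDecay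

/-- The relations satisfied by the matrix of a one-mode Bogoliubov transformation. -/
structure IsSqueezing (α β : ℂ) (u : ℕ → ℕ → ℂ) : Prop where
  -- Matrix elements of U a† = (α a† - β̄ a) U; the second field is U a = (ᾱ a - β a†) U. The
  -- truncated difference a - 1 at a = 0 is harmless because of the factor √a.
  raise : ∀ a b : ℕ, Real.sqrt (b + 1) * u a (b + 1)
    = α * (Real.sqrt a * u (a - 1) b) - conj β * (Real.sqrt (a + 1) * u (a + 1) b)
  lower : ∀ a b : ℕ, Real.sqrt b * u a (b - 1)
    = conj α * (Real.sqrt (a + 1) * u (a + 1) b) - β * (Real.sqrt a * u (a - 1) b)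

lemma sqrt_succ_ne_zero (b : ℕ) : (Real.sqrt (b + 1) : ℂ) ≠ 0 := by
  have : Real.sqrt ((b : ℝ) + 1) ≠ 0 := (Real.sqrt_pos.mpr (by positivity)).ne'
  exact_mod_cast this

lemma sqrt_mul_self' (b : ℕ) : (Real.sqrt (b + 1) : ℂ) * Real.sqrt (b + 1) = b + 1 := by
  have : Real.sqrt ((b : ℝ) + 1) * Real.sqrt (b + 1) = b + 1 := Real.mul_self_sqrt (by positivity)
  exact_mod_cast this

lemma norm_sq_cast (w : ℂ) : ((‖w‖ ^ 2 : ℝ) : ℂ) = w * conj w := by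
  rw [Complex.mul_conj, Complex.normSq_eq_norm_sq]

namespace IsSqueezing

variable {α β : ℂ} {u : ℕ → ℕ → ℂ}

lemma norm_alpha_pos (h : ‖α‖ ^ 2 - ‖β‖ ^ 2 = 1) : 0 < ‖α‖ := by
  have := sq_nonneg ‖β‖
  exact (norm_nonneg α).lt_of_ne fun h0 => by rw [← h0] at h; nlinarith

lemma ratio_lt_one (h : ‖α‖ ^ 2 - ‖β‖ ^ 2 = 1) : ‖β‖ / ‖α‖ < 1 := by
  rw [div_lt_one (norm_alpha_pos h)]
  exact lt_of_pow_lt_pow_left₀ 2 (norm_nonneg _) (by linarith)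

/-- The lowering relation at b = 0 says that ᾱ a - β a† annihilates the image of the vacuum; this is
the two step recursion of `sqz` with μ = β/ᾱ. -/
lemma zero_column (hu : IsSqueezing α β u) (h : ‖α‖ ^ 2 - ‖β‖ ^ 2 = 1) (m : ℕ) :
    u m 0 = u 0 0 * sqz (β / conj α) m := by
  have hα : conj α ≠ 0 := by
    rw [Ne, map_eq_zero]
    exact norm_ne_zero_iff.mp (norm_alpha_pos h).ne'
  have key : ∀ m, u m 0 = u 0 0 * sqz (β / conj α) m ∧
      u (m + 1) 0 = u 0 0 * sqz (β / conj α) (m + 1) := by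
    intro m
    induction m with
    | zero =>
      refine ⟨by simp [sqz], ?_⟩
      have := hu.lower 0 0
      simpa [sqz, hα] using this
    | succ m ih =>
      refine ⟨ih.2, ?_⟩
      have h1 := hu.lower (m + 1) 0
      simp only [Nat.cast_zero, Real.sqrt_zero, Complex.ofReal_zero, zero_mul,
        add_tsub_cancel_right, ih.1] at h1
      push_cast at h1
      rw [sqz, Real.sqrt_div (by positivity)]
      have h2 := sqrt_succ_ne_zero (m + 1)
      push_cast at h2 ⊢
      rw [show ((m : ℝ) + 1 + 1) = m + 2 by ring] at h1 h2
      field_simp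
      linear_combination -h1
  exact (key m).1

lemma rapidDecay (hu : IsSqueezing α β u) (h : ‖α‖ ^ 2 - ‖β‖ ^ 2 = 1) (b : ℕ) :
    RapidDecay fun a => u a b := by
  induction b with
  | zero =>
    rw [show (fun a => u a 0) = fun a => u 0 0 * sqz (β / conj α) a from
      funext fun a => hu.zero_column h a]
    refine (rapidDecay_sqz ?_).const_mul _
    rw [norm_div, RCLike.norm_conj]
    exact ratio_lt_one h
  | succ b ih =>
    have h1 := (((ih.raise).const_mul α).sub ((ih.lower).const_mul (conj β))).const_mul
      (Real.sqrt (b + 1) : ℂ)⁻¹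
    have h2 : (fun a : ℕ => u a (b + 1)) = fun a : ℕ => (Real.sqrt (b + 1) : ℂ)⁻¹ *
        (α * (Real.sqrt a * u (a - 1) b) - conj β * (Real.sqrt (a + 1) * u (a + 1) b)) := by
      funext a
      rw [← hu.raise, inv_mul_cancel_left₀ (sqrt_succ_ne_zero b)]
    rw [h2]
    exact h1

lemma tsum_shift {φ ψ : ℕ → ℂ} (hφ : RapidDecay φ) (hψ : RapidDecay ψ) :
    ∑' a : ℕ, conj (φ a) * (Real.sqrt a * ψ (a - 1))
      = ∑' a : ℕ, conj (Real.sqrt (a + 1) * φ (a + 1)) * ψ a := by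
  rw [(hφ.summable_mul hψ.raise).tsum_eq_zero_add]
  simp only [Nat.cast_zero, Real.sqrt_zero, Complex.ofReal_zero, zero_mul, mul_zero, zero_add,
    add_tsub_cancel_right, map_mul, Complex.conj_ofReal]
  refine tsum_congr fun a => ?_
  push_cast
  ring

lemma tsum_shift' {φ ψ : ℕ → ℂ} (hφ : RapidDecay φ) (hψ : RapidDecay ψ) :
    ∑' a : ℕ, conj (φ a) * (Real.sqrt (a + 1) * ψ (a + 1))
      = ∑' a : ℕ, conj (Real.sqrt a * φ (a - 1)) * ψ a := by
  rw [(hφ.raise.summable_mul hψ).tsum_eq_zero_add]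
  simp only [Nat.cast_zero, Real.sqrt_zero, Complex.ofReal_zero, zero_mul, map_zero, zero_add,
    add_tsub_cancel_right, map_mul, Complex.conj_ofReal]
  refine tsum_congr fun a => ?_
  push_cast
  ring

/-- This says ⟨U e_a, U a† e_b⟩ = ⟨U a e_a, U e_b⟩: the transformed ladder operators are again
mutually adjoint. Rapid decay of the columns permits the index shifts in the sums. -/
lemma pairing (hu : IsSqueezing α β u) (h : ‖α‖ ^ 2 - ‖β‖ ^ 2 = 1) (a b : ℕ) :
    Real.sqrt (b + 1) * ∑' i, conj (u i a) * u i (b + 1)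
      = Real.sqrt a * ∑' i, conj (u i (a - 1)) * u i b := by
  have ha := hu.rapidDecay h a
  have hb := hu.rapidDecay h b
  have e1 : ∀ i, (Real.sqrt (b + 1) : ℂ) * (conj (u i a) * u i (b + 1))
      = α * (conj (u i a) * (Real.sqrt i * u (i - 1) b))
        - conj β * (conj (u i a) * (Real.sqrt (i + 1) * u (i + 1) b)) := fun i => by
    linear_combination conj (u i a) * hu.raise i b
  have e2 : ∀ i, (Real.sqrt a : ℂ) * (conj (u i (a - 1)) * u i b)
      = α * (conj (Real.sqrt (i + 1) * u (i + 1) a) * u i b)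
        - conj β * (conj (Real.sqrt i * u (i - 1) a) * u i b) := fun i => by
    have := congrArg conj (hu.lower i a)
    simp only [map_mul, map_sub, Complex.conj_ofReal, Complex.conj_conj] at this ⊢
    linear_combination u i b * this
  rw [← tsum_mul_left, ← tsum_mul_left, tsum_congr e1, tsum_congr e2,
    Summable.tsum_sub ((ha.summable_mul hb.raise).mul_left _)
      ((ha.summable_mul hb.lower).mul_left _),
    Summable.tsum_sub ((ha.lower.summable_mul hb).mul_left _)
      ((ha.raise.summable_mul hb).mul_left _),
    tsum_mul_left, tsum_mul_left, tsum_mul_left, tsum_mul_left, tsum_shift ha hb,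
    tsum_shift' ha hb]

/-- The pairing identity lowers both indices by one, so the Gram matrix is determined by the norm of
the vacuum column. -/
lemma orthonormal (hu : IsSqueezing α β u) (h : ‖α‖ ^ 2 - ‖β‖ ^ 2 = 1)
    (h0 : ∑' i, conj (u i 0) * u i 0 = 1) (a b : ℕ) :
    ∑' i, conj (u i a) * u i b = if a = b then 1 else 0 := by
  have hzero : ∀ b, ∑' i, conj (u i 0) * u i (b + 1) = 0 := fun b => by
    have := hu.pairing h 0 b
    rw [Nat.cast_zero, Real.sqrt_zero, Complex.ofReal_zero, zero_mul] at this
    exact (mul_eq_zero.mp this).resolve_left (sqrt_succ_ne_zero b)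
  induction b generalizing a with
  | zero =>
    rcases a with _ | a
    · simpa using h0
    · have h1 := congrArg conj (hzero a)
      rw [Complex.conj_tsum] at h1
      simp only [map_mul, Complex.conj_conj, map_zero] at h1
      rw [if_neg (Nat.succ_ne_zero a), ← h1]
      exact tsum_congr fun i => mul_comm _ _
  | succ b ih =>
    rcases a with _ | a
    · rw [hzero, if_neg (Nat.succ_ne_zero b).symm]
    · have h1 := hu.pairing h (a + 1) b
      rw [add_tsub_cancel_right, ih] at h1
      by_cases hab : a = b
      · subst hab
        push_cast at h1
        rw [if_pos rfl, mul_one] at h1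
        rw [if_pos rfl]
        exact mul_left_cancel₀ (sqrt_succ_ne_zero a) (h1.trans (mul_one _).symm)
      · rw [if_neg hab, mul_zero] at h1
        rw [if_neg (by omega)]
        exact (mul_eq_zero.mp h1).resolve_left (sqrt_succ_ne_zero b)

/-- The adjoint matrix belongs to the inverse transformation, with coefficients ᾱ and -β. Statements
about rows thereby follow from those about columns. -/
lemma transpose (hu : IsSqueezing α β u) (h : ‖α‖ ^ 2 - ‖β‖ ^ 2 = 1) :
    IsSqueezing (conj α) (-β) fun a b => conj (u b a) := by
  have hd : α * conj α - β * conj β = 1 := by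
    rw [← norm_sq_cast, ← norm_sq_cast]
    exact_mod_cast h
  constructor
  · intro a b
    have h1 := congrArg conj (hu.raise b a)
    have h2 := congrArg conj (hu.lower b a)
    simp only [map_mul, map_sub, Complex.conj_ofReal, Complex.conj_conj, map_neg] at h1 h2 ⊢
    linear_combination (-conj α) * h2 - conj β * h1
      - (Real.sqrt (b + 1) : ℂ) * conj (u (b + 1) a) * hd
  · intro a b
    have h1 := congrArg conj (hu.raise b a)
    have h2 := congrArg conj (hu.lower b a)
    simp only [map_mul, map_sub, Complex.conj_ofReal, Complex.conj_conj] at h1 h2 ⊢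
    linear_combination (-α) * h1 - β * h2
      - (Real.sqrt b : ℂ) * conj (u (b - 1) a) * hd

end IsSqueezing

/-- The columns of the matrix of a one-mode Bogoliubov transformation. -/
def sqzMatrix (α β : ℂ) (c : ℝ) : ℕ → ℕ → ℂ
  | 0, a => c * sqz (β / conj α) a
  | b + 1, a => (α * (Real.sqrt a * sqzMatrix α β c b (a - 1))
      - conj β * (Real.sqrt (a + 1) * sqzMatrix α β c b (a + 1))) / Real.sqrt (b + 1)

/-- The raising relation is the definition of the columns. The lowering relation propagates from
column to column because the transformed ladder operators still satisfy the canonical commutation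
relation, which is |α|² - |β|² = 1. -/
lemma isSqueezing_sqzMatrix {α β : ℂ} (h : ‖α‖ ^ 2 - ‖β‖ ^ 2 = 1) (c : ℝ) :
    IsSqueezing α β fun a b => sqzMatrix α β c b a := by
  have hd : α * conj α - β * conj β = 1 := by
    rw [← norm_sq_cast, ← norm_sq_cast]
    exact_mod_cast h
  have hα : conj α ≠ 0 := by
    rw [Ne, map_eq_zero]
    exact norm_ne_zero_iff.mp (IsSqueezing.norm_alpha_pos h).ne'
  have hraise : ∀ a b : ℕ, (Real.sqrt (b + 1) : ℂ) * sqzMatrix α β c (b + 1) a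
      = α * (Real.sqrt a * sqzMatrix α β c b (a - 1))
        - conj β * (Real.sqrt (a + 1) * sqzMatrix α β c b (a + 1)) := fun a b => by
    rw [sqzMatrix, mul_div_cancel₀ _ (sqrt_succ_ne_zero b)]
  refine ⟨hraise, fun a b => ?_⟩
  induction b generalizing a with
  | zero =>
    simp only [sqzMatrix]
    rcases a with _ | a
    · simp [sqz]
    · rw [add_tsub_cancel_right, sqz, Real.sqrt_div (by positivity)]
      have h2 := sqrt_succ_ne_zero (a + 1)
      push_cast at h2 ⊢
      rw [show ((a : ℝ) + 1 + 1) = a + 2 by ring] at h2 ⊢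
      simp only [Real.sqrt_zero, Complex.ofReal_zero, zero_mul]
      field_simp
      ring
  | succ b ih =>
    refine mul_left_cancel₀ (sqrt_succ_ne_zero b) ?_
    have hb := sqrt_mul_self' b
    rw [add_tsub_cancel_right]
    -- Column b is rebuilt from column b - 1; the factor √b makes the formula valid at b = 0 too.
    have r0 : ∀ a : ℕ, (b : ℂ) * sqzMatrix α β c b a
        = Real.sqrt b * (α * (Real.sqrt a * sqzMatrix α β c (b - 1) (a - 1))
        - conj β * (Real.sqrt (a + 1) * sqzMatrix α β c (b - 1) (a + 1))) := by
      intro a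
      rcases b with _ | b
      · simp
      · rw [add_tsub_cancel_right, ← hraise a b]
        push_cast
        linear_combination (-sqzMatrix α β c (b + 1) a) * sqrt_mul_self' b
    have hr0 := r0 a
    have i1 := ih (a + 1)
    have r1 := hraise (a + 1) b
    have hA := sqrt_mul_self' a
    rw [Nat.add_sub_cancel] at i1 r1
    rcases a with _ | a
    · simp only [Nat.cast_zero, Real.sqrt_zero, Complex.ofReal_zero, zero_mul, mul_zero, zero_sub,
        sub_zero, zero_add, Nat.cast_one, Real.sqrt_one, Complex.ofReal_one, one_mul] at *
      push_cast
      linear_combination sqzMatrix α β c b 0 * hb - conj α * r1 + hr0 - conj β * i1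
        - sqzMatrix α β c b 0 * hd
    · have i2 := ih a
      have r2 := hraise a b
      have hS := sqrt_mul_self' a
      rw [Nat.add_sub_cancel] at hr0 ⊢
      push_cast at *
      linear_combination sqzMatrix α β c b (a + 1) * hb
        - conj α * Real.sqrt (a + 1 + 1) * r1 + β * Real.sqrt (a + 1) * r2 + hr0
        + α * Real.sqrt (a + 1) * i2 - conj β * Real.sqrt (a + 1 + 1) * i1
        - sqzMatrix α β c b (a + 1) * (Real.sqrt (a + 1 + 1) * Real.sqrt (a + 1 + 1)
          - Real.sqrt (a + 1) * Real.sqrt (a + 1)) * hd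
        - sqzMatrix α β c b (a + 1) * hA + sqzMatrix α β c b (a + 1) * hS

/-- The norm squared of the unnormalized squeezed vacuum. -/
def sqzNorm (r : ℝ) : ℝ := ∑' m, ‖sqz r m‖ ^ 2

lemma summable_sqz_sq {μ : ℂ} (h : ‖μ‖ < 1) : Summable fun m => ‖sqz μ m‖ ^ 2 := by
  have := ((rapidDecay_sqz h).summable_mul (rapidDecay_sqz h)).norm
  refine this.congr fun m => ?_
  rw [norm_mul, RCLike.norm_conj, sq]

lemma norm_sqz (μ : ℂ) (m : ℕ) : ‖sqz μ m‖ = ‖sqz (‖μ‖ : ℝ) m‖ := by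
  have key : ∀ m, ‖sqz μ m‖ = ‖sqz (‖μ‖ : ℝ) m‖ ∧
      ‖sqz μ (m + 1)‖ = ‖sqz (‖μ‖ : ℝ) (m + 1)‖ := by
    intro m
    induction m with
    | zero => simp [sqz]
    | succ m ih =>
      refine ⟨ih.2, ?_⟩
      rw [norm_sqz_add_two, norm_sqz_add_two, ih.1]
      simp
  exact (key m).1

/-- The leading coefficient is 1, the odd ones vanish, and a shift by two loses at least the factor
r², so S ≤ 1 + r² S. -/
lemma sqzNorm_bounds {r : ℝ} (h0 : 0 ≤ r) (h : r < 1) :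
    1 ≤ sqzNorm r ∧ sqzNorm r * (1 - r ^ 2) ≤ 1 := by
  have hr : ‖(r : ℂ)‖ = r := by rw [Complex.norm_real, Real.norm_of_nonneg h0]
  have hs := summable_sqz_sq (μ := r) (by rwa [hr])
  constructor
  · have := hs.le_tsum 0 fun _ _ => by positivity
    rw [sqzNorm]
    simpa [sqz] using this
  · have h1 : sqzNorm r = 1 + ∑' m, ‖sqz r (m + 2)‖ ^ 2 := by
      rw [sqzNorm, ← hs.sum_add_tsum_nat_add 2]
      simp [Finset.sum_range_succ, sqz]
    have h2 : ∑' m, ‖sqz r (m + 2)‖ ^ 2 ≤ r ^ 2 * sqzNorm r := by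
      rw [sqzNorm, ← tsum_mul_left]
      refine Summable.tsum_le_tsum (fun m => ?_) ((summable_nat_add_iff 2).mpr hs)
        (hs.mul_left _)
      rw [← mul_pow]
      have := norm_sqz_add_two_le r m
      rw [hr] at this
      gcongr
    linarith

/-- The matrix of a unitary operator implementing a one-mode Bogoliubov transformation. -/
theorem exists_squeezing {α β : ℂ} (h : ‖α‖ ^ 2 - ‖β‖ ^ 2 = 1) :
    ∃ (u : ℕ → ℕ → ℂ) (c : ℝ), IsSqueezing α β u ∧
      (∀ b b', HasSum (fun a => conj (u a b) * u a b') (if b = b' then 1 else 0)) ∧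
      (∀ a, HasSum (fun b => ‖u a b‖ ^ 2) 1) ∧ u 0 0 = c ∧ 1 - ‖β‖ ^ 2 ≤ c ∧ 0 ≤ c ∧ c ≤ 1 := by
  set r := ‖β‖ / ‖α‖ with hr
  have hr0 : 0 ≤ r := by positivity
  have hr1 : r < 1 := IsSqueezing.ratio_lt_one h
  obtain ⟨hS1, hS2⟩ := sqzNorm_bounds hr0 hr1
  have hS0 : 0 < sqzNorm r := by linarith
  -- The constant that normalizes the image of the vacuum; it is also the vacuum expectation of the
  -- implementer, chosen positive.
  set c := (Real.sqrt (sqzNorm r))⁻¹ with hc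
  have hcc : c * c * sqzNorm r = 1 := by
    have := Real.mul_self_sqrt hS0.le
    have hne := (Real.sqrt_pos.mpr hS0).ne'
    rw [hc]
    field_simp
    rw [sq, this]
  have hcpos : 0 < c := by rw [hc]; exact inv_pos.mpr (Real.sqrt_pos.mpr hS0)
  have hc1 : c ≤ 1 := by
    by_contra hlt
    push Not at hlt
    nlinarith
  set u : ℕ → ℕ → ℂ := fun a b => sqzMatrix α β c b a with hu
  have hsq : IsSqueezing α β u := isSqueezing_sqzMatrix h c
  have hu0 : u 0 0 = c := by simp [hu, sqzMatrix, sqz]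
  have hcol : ∀ {α β : ℂ} {u : ℕ → ℕ → ℂ}, IsSqueezing α β u → ‖α‖ ^ 2 - ‖β‖ ^ 2 = 1 →
      u 0 0 = c → ‖β‖ / ‖α‖ = r → ∀ b b',
      HasSum (fun a => conj (u a b) * u a b') (if b = b' then 1 else 0) := by
    intro α β u hsq h hu0 hr b b'
    have hs : ∀ b b', Summable (fun a => conj (u a b) * u a b') := fun b b' =>
      (hsq.rapidDecay h b).summable_mul (hsq.rapidDecay h b')
    rw [← hsq.orthonormal h ?_ b b']
    · exact (hs b b').hasSum
    · have e1 : ∀ i, conj (u i 0) * u i 0 = ((c * c * ‖sqz r i‖ ^ 2 : ℝ) : ℂ) := by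
        intro i
        rw [mul_comm, ← norm_sq_cast, hsq.zero_column h, hu0, norm_mul, Complex.norm_real,
          Real.norm_of_nonneg hcpos.le, norm_sqz, norm_div, RCLike.norm_conj, hr]
        push_cast
        ring
      rw [tsum_congr e1, ← Complex.ofReal_tsum, tsum_mul_left]
      exact_mod_cast hcc
  refine ⟨u, c, hsq, hcol hsq h hu0 rfl, fun a => ?_, hu0, ?_, hcpos.le, hc1⟩
  · have h' : ‖conj α‖ ^ 2 - ‖-β‖ ^ 2 = 1 := by rwa [RCLike.norm_conj, norm_neg]
    have h1 := hcol (hsq.transpose h) h' (by simp [hu0]) (by rw [RCLike.norm_conj, norm_neg]) a a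
    rw [if_pos rfl] at h1
    have h2 := ((Complex.hasSum_iff _ _).mp h1).1
    refine h2.congr_fun fun b => ?_
    rw [Complex.conj_conj, Complex.mul_conj, Complex.ofReal_re, Complex.normSq_eq_norm_sq]
  -- Since |α| ≥ 1, r ≤ |β|; and c ≥ c² because 0 ≤ c ≤ 1. Hence c ≥ 1 - r² ≥ 1 - |β|².
  · have h1 : 1 - r ^ 2 ≤ c * c := by
      have : 0 ≤ c * c := by positivity
      nlinarith
    have h2 : r ^ 2 ≤ ‖β‖ ^ 2 := by
      have hα1 : 1 ≤ ‖α‖ := by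
        have := sq_nonneg ‖β‖
        nlinarith [norm_nonneg α]
      gcongr
      rw [hr]
      exact div_le_self (norm_nonneg _) hα1
    nlinarith


open ComplexConjugate Filter Topology

/-! ### Strong continuity of the Weyl operators -/

lemma expBound_mono {c c' : ℝ} (h0 : 0 ≤ c) (h : c ≤ c') (N m : ℕ) :
    expBound c N m ≤ expBound c' N m := by
  unfold expBound
  gcongr

lemma tendsto_of_dense {H : Type*} [NormedAddCommGroup H] [InnerProductSpace ℂ H]
    {U : ℕ → H ≃ₗᵢ[ℂ] H} {V : H ≃ₗᵢ[ℂ] H} {D : Set H} (hD : Dense D)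
    (h : ∀ ψ ∈ D, Tendsto (fun n => U n ψ) atTop (𝓝 (V ψ))) (ψ : H) :
    Tendsto (fun n => U n ψ) atTop (𝓝 (V ψ)) := by
  rw [Metric.tendsto_atTop]
  intro ε hε
  obtain ⟨φ, hφ, hd⟩ := Metric.dense_iff.mp hD ψ (ε / 3) (by positivity)
  rw [Metric.mem_ball] at hφ
  obtain ⟨N, hN⟩ := Metric.tendsto_atTop.mp (h φ hd) (ε / 3) (by positivity)
  refine ⟨N, fun n hn => ?_⟩
  calc dist (U n ψ) (V ψ) ≤ dist (U n ψ) (U n φ) + dist (U n φ) (V φ) + dist (V φ) (V ψ) :=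
        dist_triangle4 _ _ _ _
    _ < ε / 3 + ε / 3 + ε / 3 := by
        rw [(U n).dist_map, V.dist_map, dist_comm ψ φ]
        gcongr
        exact hN n hn
    _ = ε := by ring

/-- On finite particle states the exponential series converges term by term, with a common majorant
as soon as ‖g K‖ ≤ ‖f‖ + 1. -/
lemma tendsto_weyl {g : ℕ → Ltwo ℕ} {f : Ltwo ℕ} (h : Tendsto g atTop (𝓝 f)) (ψ : Fock) :
    Tendsto (fun K => weyl (g K) ψ) atTop (𝓝 (weyl f ψ)) := by
  refine tendsto_of_dense dense_degLE (fun ψ ⟨N, hψ⟩ => ?_) ψ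
  rw [hψ.weyl_eq]
  simp only [hψ.weyl_eq]
  refine tendsto_tsum_of_dominated_convergence
    ((summable_expBound (c := ‖f‖ + 1) (by positivity) N).mul_right ‖ψ‖) (fun m => ?_) ?_
  · have h1 : Tendsto (fun K => gop (N + m) (g K) ^ m) atTop (𝓝 (gop (N + m) f ^ m)) :=
      (((continuous_gop (N + m)).tendsto f).comp h).pow m
    exact (((ContinuousLinearMap.apply ℂ Fock ψ).continuous.tendsto _).comp h1).const_smul _
  · filter_upwards [h.norm.eventually (gt_mem_nhds (lt_add_one ‖f‖))] with K hK m
    refine (hψ.norm_term_le _ _ _).trans ?_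
    gcongr
    exact expBound_mono (norm_nonneg _) hK.le _ _

/-! ### Unitary operators acting on one mode -/

/-- The operator acts on the mode `k` by the matrix `u`. -/
def IsLift (k : ℕ) (u : ℕ → ℕ → ℂ) (T : Fock ≃ₗᵢ[ℂ] Fock) : Prop :=
  ∀ m n : ℕ →₀ ℕ, T (ket n) m = if m.erase k = n.erase k then u (m k) (n k) else 0

lemma eq_iff_erase {k : ℕ} {m n : ℕ →₀ ℕ} : m = n ↔ m.erase k = n.erase k ∧ m k = n k := by
  refine ⟨fun h => by simp [h], fun ⟨h1, h2⟩ => ?_⟩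
  rw [← m.single_add_erase k, ← n.single_add_erase k, h1, h2]

lemma erase_eq_apply {k i : ℕ} {m n : ℕ →₀ ℕ} (h : m.erase k = n.erase k) (hi : i ≠ k) :
    m i = n i := by
  have := DFunLike.congr_fun h i
  rwa [Finsupp.erase_ne hi, Finsupp.erase_ne hi] at this

/-- This is u acting in the k-th tensor factor and the identity in the others. The matrix is block
diagonal over the occupation numbers of the other modes, so each sum runs over one line n k = 0, 1,
2, …. -/
lemma exists_isLift (k : ℕ) (u : ℕ → ℕ → ℂ)
    (hc : ∀ b b', HasSum (fun a => conj (u a b) * u a b') (if b = b' then 1 else 0))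
    (hr : ∀ a, HasSum (fun b => ‖u a b‖ ^ 2) 1) : ∃ T, IsLift k u T := by
  have hline : ∀ n : ℕ →₀ ℕ, Function.Injective fun i : ℕ => n.erase k + Finsupp.single k i :=
    fun n i j hij => Finsupp.single_injective k (add_left_cancel hij)
  have herase : ∀ (n : ℕ →₀ ℕ) (i : ℕ), (n.erase k + Finsupp.single k i).erase k = n.erase k ∧
      (n.erase k + Finsupp.single k i) k = i := fun n i => by
    constructor
    · rw [Finsupp.erase_add, Finsupp.erase_single, add_zero, Finsupp.erase_idem]
    · simp
  have hrange : ∀ {m n : ℕ →₀ ℕ}, m.erase k = n.erase k →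
      m ∈ Set.range fun i : ℕ => n.erase k + Finsupp.single k i := fun {m n} h =>
    ⟨m k, by rw [eq_iff_erase (k := k)]; exact ⟨(herase n _).1.trans h.symm, (herase n _).2⟩⟩
  refine exists_unitary_of_matrix (fun m n : ℕ →₀ ℕ =>
    if m.erase k = n.erase k then u (m k) (n k) else 0) (fun n n' => ?_) (fun m => ?_)
  · by_cases h : n.erase k = n'.erase k
    · rw [← (hline n).hasSum_iff]
      · have h1 : (if n = n' then (1 : ℂ) else 0) = if n k = n' k then 1 else 0 := by
          simp only [eq_iff_erase (k := k) (m := n), h, true_and]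
        rw [h1]
        refine (hc (n k) (n' k)).congr_fun fun i => ?_
        rw [Function.comp_apply, if_pos (herase n i).1, if_pos ((herase n i).1.trans h),
          (herase n i).2]
      · intro m hm
        simp only [if_neg fun h => hm (hrange h), map_zero, zero_mul]
    · rw [if_neg fun h' => h (by rw [h'])]
      refine hasSum_zero.congr_fun fun m => ?_
      by_cases h1 : m.erase k = n.erase k
      · rw [if_neg (c := m.erase k = n'.erase k) fun h2 => h (h1.symm.trans h2), mul_zero]
      · rw [if_neg h1, map_zero, zero_mul]
  · rw [← (hline m).hasSum_iff]
    · refine (hr (m k)).congr_fun fun i => ?_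
      simp only [Function.comp_apply, (herase m i).1, (herase m i).2, if_true]
    · intro n hn
      rw [if_neg fun h => hn (hrange h.symm)]
      simp

lemma hasSum_apply (T : Fock ≃ₗᵢ[ℂ] Fock) (ψ : Fock) (m : ℕ →₀ ℕ) :
    HasSum (fun n => ψ n * T (ket n) m) (T ψ m) := by
  have h := ((hasSum_ket ψ).mapL T.toContinuousLinearEquiv.toContinuousLinearMap).mapL
    (innerSL ℂ (ket m))
  have e : innerSL ℂ (ket m) (T ψ) = T ψ m := inner_ket m _
  rw [← e]
  refine h.congr_fun fun n => ?_
  show _ = inner ℂ (ket m) (T (ψ n • ket n))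
  rw [map_smul, inner_smul_right, inner_ket]

/-- The mode `i` is not occupied. -/
def Unocc (i : ℕ) (ψ : Fock) : Prop := ∀ m : ℕ →₀ ℕ, m i ≠ 0 → ψ m = 0

namespace IsLift

variable {k : ℕ} {u : ℕ → ℕ → ℂ} {T : Fock ≃ₗᵢ[ℂ] Fock}

lemma unocc (hT : IsLift k u T) {i : ℕ} (hi : i ≠ k) {ψ : Fock} (h : Unocc i ψ) :
    Unocc i (T ψ) := by
  intro m hm
  refine (hasSum_apply T ψ m).unique (hasSum_zero.congr_fun fun n => ?_)
  rw [hT]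
  split_ifs with he
  · rw [h n (by rwa [← erase_eq_apply he hi]), zero_mul]
  · rw [mul_zero]

lemma unocc_symm (hT : IsLift k u T) {i : ℕ} (hi : i ≠ k) {ψ : Fock} (h : Unocc i ψ) :
    Unocc i (T.symm ψ) := by
  intro m hm
  rw [← inner_ket m, ← T.inner_map_map, LinearIsometryEquiv.apply_symm_apply]
  refine (lp.hasSum_inner (𝕜 := ℂ) (T (ket m)) ψ).unique (hasSum_zero.congr_fun fun n => ?_)
  rw [hT]
  split_ifs with he
  · rw [h n (by rwa [erase_eq_apply he hi]), inner_zero_right]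
  · rw [inner_zero_left]

lemma apply_unocc (hT : IsLift k u T) {ψ : Fock} (h : Unocc k ψ) {m : ℕ →₀ ℕ} (hm : m k = 0) :
    T ψ m = u 0 0 * ψ m := by
  refine (hasSum_apply T ψ m).unique ?_
  have h1 := hasSum_single (f := fun n => ψ n * T (ket n) m) m fun n hn => ?_
  · simp only [hT m m, if_true, hm] at h1
    rwa [mul_comm] at h1
  · show ψ n * T (ket n) m = 0
    by_cases hk : n k = 0
    · rw [hT, if_neg, mul_zero]
      intro he
      exact hn (eq_iff_erase.mpr ⟨he.symm, hk.trans hm.symm⟩)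
    · rw [h n hk, zero_mul]

lemma raise_lower (hT : IsLift k u T) {i : ℕ} (hi : i ≠ k) (m n : ℕ →₀ ℕ) :
    (Real.sqrt (m i + 1) : ℂ) * T (ket n) (m + Finsupp.single i 1)
      = Real.sqrt (n i) * T (ket (n - Finsupp.single i 1)) m ∧
    (Real.sqrt (m i) : ℂ) * T (ket n) (m - Finsupp.single i 1)
      = Real.sqrt (n i + 1) * T (ket (n + Finsupp.single i 1)) m := by
  have key : ∀ m n : ℕ →₀ ℕ, (m + Finsupp.single i 1).erase k = (n + Finsupp.single i 1).erase k ↔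
      m.erase k = n.erase k := by
    intro m n
    rw [Finsupp.erase_add, Finsupp.erase_add, add_left_inj]
  have hval : ∀ m : ℕ →₀ ℕ, (m + Finsupp.single i 1 : ℕ →₀ ℕ) k = m k := fun m => by
    simp [hi.symm]
  have hi1 : ∀ m : ℕ →₀ ℕ, (m + Finsupp.single i 1 : ℕ →₀ ℕ) i = m i + 1 := fun m => by simp
  have sub : ∀ {m : ℕ →₀ ℕ}, m i ≠ 0 → ∃ m', m = m' + Finsupp.single i 1 := fun {m} h =>
    ⟨m - Finsupp.single i 1, (sub_single_add (Finsupp.mem_support_iff.mpr h)).symm⟩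
  constructor
  · by_cases hn : n i = 0
    · rw [hT, if_neg, hn]
      · simp
      · intro he
        have := erase_eq_apply he hi
        rw [hi1, hn] at this
        omega
    · obtain ⟨n', rfl⟩ := sub hn
      rw [add_tsub_cancel_right, hT, hT, hval, hval]
      simp only [key, hi1]
      split_ifs with he
      · rw [erase_eq_apply he hi]; push_cast; ring
      · simp
  · by_cases hm : m i = 0
    · rw [hT (m := m), if_neg, hm]
      · simp
      · intro he
        have := erase_eq_apply he hi
        rw [hi1, hm] at this
        omega
    · obtain ⟨m', rfl⟩ := sub hm
      rw [add_tsub_cancel_right, hT, hT, hval, hval]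
      simp only [key, hi1]
      split_ifs with he
      · rw [erase_eq_apply he hi]; push_cast; ring
      · simp

/-- A one-mode Bogoliubov transformation is implemented by the lift of its matrix. -/
lemma intertwine (hT : IsLift k u T) {α β : ℂ} (hu : IsSqueezing α β u) {f g : Ltwo ℕ}
    (hk : g k = α * f k + β * conj (f k)) (hg : ∀ i, i ≠ k → g i = f i) (ψ : Fock) :
    T (weyl f ψ) = weyl g (T ψ) := by
  refine weyl_intertwine_of_matrix (fun i m n => ?_) ψ
  by_cases hi : i = k
  · subst hi
    have h1 : ∀ m : ℕ →₀ ℕ, (m + Finsupp.single i 1).erase i = m.erase i := fun m => by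
      rw [Finsupp.erase_add, Finsupp.erase_single, add_zero]
    have h2 : ∀ m : ℕ →₀ ℕ, (m - Finsupp.single i 1).erase i = m.erase i := fun m => by
      ext j
      by_cases hj : j = i
      · subst hj; simp
      · simp [Finsupp.erase_ne hj, Ne.symm hj]
    rw [hT, hT, hT, hT]
    simp only [h1, h2]
    split_ifs with he
    · have r1 := hu.raise (m i) (n i)
      have r2 := hu.lower (m i) (n i)
      have e1 : (m + Finsupp.single i 1 : ℕ →₀ ℕ) i = m i + 1 := by simp
      have e2 : (n + Finsupp.single i 1 : ℕ →₀ ℕ) i = n i + 1 := by simp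
      have e3 : (m - Finsupp.single i 1 : ℕ →₀ ℕ) i = m i - 1 := by simp
      have e4 : (n - Finsupp.single i 1 : ℕ →₀ ℕ) i = n i - 1 := by simp
      rw [e1, e2, e3, e4, hk]
      simp only [map_add, map_mul, Complex.conj_conj]
      linear_combination (-f i) * r1 + conj (f i) * r2
    · simp
  · obtain ⟨r1, r2⟩ := hT.raise_lower hi m n
    rw [hg i hi]
    linear_combination (-conj (f i)) * r1 + f i * r2

end IsLift

/-! ### Infinitely many modes -/

lemma one_sub_prod_le (c b : ℕ → ℝ) (hc : ∀ j, 0 ≤ c j) (hc1 : ∀ j, c j ≤ 1)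
    (h : ∀ j, 1 - b j ≤ c j) (d : ℕ) :
    1 - ∏ j ∈ Finset.range d, c j ≤ ∑ j ∈ Finset.range d, b j := by
  induction d with
  | zero => simp
  | succ d ih =>
    rw [Finset.prod_range_succ, Finset.sum_range_succ]
    have h1 : ∏ j ∈ Finset.range d, c j ≤ 1 := Finset.prod_le_one (fun j _ => hc j) fun j _ => hc1 j
    have h2 : 0 ≤ ∏ j ∈ Finset.range d, c j := Finset.prod_nonneg fun j _ => hc j
    nlinarith [h d, hc1 d]

/-- The composition `T K ∘ T (K + 1) ∘ ⋯ ∘ T (K + d - 1)`. -/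
def compFrom (T : ℕ → Fock ≃ₗᵢ[ℂ] Fock) : ℕ → ℕ → Fock ≃ₗᵢ[ℂ] Fock
  | _, 0 => LinearIsometryEquiv.refl ℂ Fock
  | K, d + 1 => (compFrom T (K + 1) d).trans (T K)

lemma compFrom_succ (T : ℕ → Fock ≃ₗᵢ[ℂ] Fock) (K d : ℕ) (ψ : Fock) :
    compFrom T K (d + 1) ψ = T K (compFrom T (K + 1) d ψ) := rfl

lemma compFrom_add (T : ℕ → Fock ≃ₗᵢ[ℂ] Fock) (K d e : ℕ) (ψ : Fock) :
    compFrom T K (d + e) ψ = compFrom T K d (compFrom T (K + d) e ψ) := by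
  induction d generalizing K with
  | zero => simp [compFrom]
  | succ d ih =>
    rw [show d + 1 + e = (d + e) + 1 by ring, compFrom_succ, ih, compFrom_succ,
      show K + 1 + d = K + (d + 1) by ring]

section Modes

variable {u : ℕ → ℕ → ℕ → ℂ} {T : ℕ → Fock ≃ₗᵢ[ℂ] Fock}

lemma compFrom_unocc (hT : ∀ k, IsLift k (u k) (T k)) (d : ℕ) : ∀ {K i : ℕ}, i < K ∨ K + d ≤ i →
    ∀ {ψ : Fock}, Unocc i ψ → Unocc i (compFrom T K d ψ) := by
  induction d with
  | zero => intro K i _ ψ h; exact h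
  | succ d ih =>
    intro K i hi ψ h
    rw [compFrom_succ]
    exact (hT K).unocc (by omega) (ih (by omega) h)

lemma compFrom_symm_unocc (hT : ∀ k, IsLift k (u k) (T k)) (d : ℕ) : ∀ {K i : ℕ},
    i < K ∨ K + d ≤ i → ∀ {ψ : Fock}, Unocc i ψ → Unocc i ((compFrom T K d).symm ψ) := by
  induction d with
  | zero => intro K i _ ψ h; exact h
  | succ d ih =>
    intro K i hi ψ h
    exact ih (by omega) ((hT K).unocc_symm (by omega) h)

lemma compFrom_apply (hT : ∀ k, IsLift k (u k) (T k)) (d : ℕ) : ∀ {K : ℕ} {ψ : Fock},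
    (∀ i, K ≤ i → Unocc i ψ) → ∀ {m : ℕ →₀ ℕ}, (∀ i, K ≤ i → m i = 0) →
    compFrom T K d ψ m = (∏ j ∈ Finset.range d, u (K + j) 0 0) * ψ m := by
  induction d with
  | zero => intro K ψ _ m _; simp [compFrom]
  | succ d ih =>
    intro K ψ hψ m hm
    rw [compFrom_succ, (hT K).apply_unocc (compFrom_unocc hT d (by omega) (hψ K le_rfl))
      (hm K le_rfl), ih (fun i hi => hψ i (by omega)) (fun i hi => hm i (by omega)),
      Finset.prod_range_succ', add_zero]
    simp only [show ∀ j, K + 1 + j = K + (j + 1) by intro j; ring]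
    ring

/-- If the modes from K on are empty, every factor contributes only its vacuum entry to ⟨ψ, T ψ⟩,
which is therefore ∏ c times ‖ψ‖². Isometry gives ‖Tψ - ψ‖² = 2‖ψ‖² - 2 Re⟨ψ, Tψ⟩. -/
lemma norm_compFrom_sub (hT : ∀ k, IsLift k (u k) (T k)) {c : ℕ → ℝ} (hc : ∀ k, u k 0 0 = c k)
    (d : ℕ) {K : ℕ} {ψ : Fock} (hψ : ∀ i, K ≤ i → Unocc i ψ) :
    ‖compFrom T K d ψ - ψ‖ ^ 2 = 2 * (1 - ∏ j ∈ Finset.range d, c (K + j)) * ‖ψ‖ ^ 2 := by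
  have h1 : inner ℂ ψ (compFrom T K d ψ)
      = ((∏ j ∈ Finset.range d, c (K + j) : ℝ) : ℂ) * inner ℂ ψ ψ := by
    refine (lp.hasSum_inner (𝕜 := ℂ) ψ (compFrom T K d ψ)).unique ?_
    refine ((lp.hasSum_inner (𝕜 := ℂ) ψ ψ).mul_left _).congr_fun fun m => ?_
    by_cases hm : ∀ i, K ≤ i → m i = 0
    · rw [compFrom_apply hT d hψ hm]
      simp only [hc, ← Complex.ofReal_prod]
      rw [← smul_eq_mul, inner_smul_right]
    · push Not at hm
      obtain ⟨i, hi, hm⟩ := hm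
      rw [hψ i hi m hm]
      simp
  rw [norm_sub_sq (𝕜 := ℂ), LinearIsometryEquiv.norm_map, ← inner_re_symm, h1,
    inner_self_eq_norm_sq_to_K]
  have h2 : RCLike.re (((∏ j ∈ Finset.range d, c (K + j) : ℝ) : ℂ) * ((‖ψ‖ : ℂ)) ^ 2)
      = (∏ j ∈ Finset.range d, c (K + j)) * ‖ψ‖ ^ 2 := by
    rw [← Complex.ofReal_pow, ← Complex.ofReal_mul]
    exact Complex.ofReal_re _
  erw [h2]
  ring

lemma dense_unocc : Dense {ψ : Fock | ∃ K, ∀ i, K ≤ i → Unocc i ψ} := by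
  intro ψ
  refine mem_closure_of_tendsto (hasSum_ket ψ) (Eventually.of_forall fun s => ?_)
  refine ⟨(s.biUnion fun n => n.support).sup id + 1, fun i hi m hm => ?_⟩
  rw [lp.coeFn_sum, Finset.sum_apply]
  refine Finset.sum_eq_zero fun n hn => ?_
  rw [lp.coeFn_smul, Pi.smul_apply, ket_apply, if_neg, smul_zero]
  rintro rfl
  have : i ≤ (s.biUnion fun n => n.support).sup id := Finset.le_sup (f := id)
    (Finset.mem_biUnion.mpr ⟨m, hn, Finsupp.mem_support_iff.mpr hm⟩)
  omega

/-- A diagonal Bogoliubov transformation whose antilinear part is square summable is implemented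
by a unitary operator on Fock space. -/
theorem exists_implementer {α β : ℕ → ℂ} (h : ∀ k, ‖α k‖ ^ 2 - ‖β k‖ ^ 2 = 1)
    (hs : Summable fun k => ‖β k‖ ^ 2) :
    ∃ U : Fock ≃ₗᵢ[ℂ] Fock, ∀ f g : Ltwo ℕ, (∀ k, g k = α k * f k + β k * conj (f k)) →
      ∀ ψ, U (weyl f ψ) = weyl g (U ψ) := by
  choose u c hu hcol hrow hc hcb hc0 hc1 using fun k => exists_squeezing (h k)
  choose T hT using fun k => exists_isLift k (u k) (hcol k) (hrow k)
  set tail : ℕ → ℝ := fun K => ∑' j, ‖β (j + K)‖ ^ 2 with htail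
  have htail0 : Tendsto tail atTop (𝓝 0) := tendsto_sum_nat_add fun k => ‖β k‖ ^ 2
  have hbound : ∀ (K d : ℕ) (ψ : Fock), (∀ i, K ≤ i → Unocc i ψ) →
      ‖compFrom T K d ψ - ψ‖ ≤ Real.sqrt (2 * tail K) * ‖ψ‖ := by
    intro K d ψ hψ
    refine (Real.le_sqrt (norm_nonneg _) (by positivity)).mpr ?_ |>.trans (le_of_eq ?_) (b :=
      Real.sqrt (2 * tail K * ‖ψ‖ ^ 2))
    · rw [norm_compFrom_sub hT hc d hψ]
      gcongr
      refine (one_sub_prod_le (fun j => c (K + j)) (fun j => ‖β (K + j)‖ ^ 2) (fun j => hc0 _)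
        (fun j => hc1 _) (fun j => hcb _) d).trans ?_
      simp only [htail, add_comm _ K]
      refine Summable.sum_le_tsum _ (fun _ _ => by positivity) ?_
      simpa only [add_comm _ K] using (summable_nat_add_iff K).mpr hs
    · rw [Real.sqrt_mul' _ (by positivity), Real.sqrt_sq (norm_nonneg _)]
  have hsmall : ∀ (ψ : Fock) (K₀ : ℕ) (ε : ℝ), 0 < ε →
      ∃ N, K₀ ≤ N ∧ Real.sqrt (2 * tail N) * ‖ψ‖ < ε := by
    intro ψ K₀ ε hε
    have h1 : Tendsto (fun N => Real.sqrt (2 * tail N) * ‖ψ‖) atTop (𝓝 0) := by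
      have := ((htail0.const_mul 2).sqrt).mul_const ‖ψ‖
      simpa using this
    obtain ⟨N, h2, h3⟩ := ((h1.eventually (gt_mem_nhds hε)).and (eventually_ge_atTop K₀)).exists
    exact ⟨N, h3, h2⟩
  -- On a state with finitely many occupied modes the factors beyond N act on empty modes only and
  -- move it by at most √(2 tail N) ‖ψ‖; the preceding factors are isometric.
  obtain ⟨U, hU, -⟩ := exists_unitary_limit (fun K => compFrom T 0 K) dense_unocc
    (by
      rintro ψ ⟨K₀, hψ⟩
      rw [Metric.cauchySeq_iff']
      intro ε hε
      obtain ⟨N, hN, hlt⟩ := hsmall ψ K₀ ε hε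
      refine ⟨N, fun n hn => ?_⟩
      obtain ⟨d, rfl⟩ := Nat.exists_eq_add_of_le hn
      rw [compFrom_add, LinearIsometryEquiv.dist_map, zero_add, dist_eq_norm]
      exact (hbound N d ψ fun i hi => hψ i (hN.trans hi)).trans_lt hlt)
    (by
      rintro ψ ⟨K₀, hψ⟩
      rw [Metric.cauchySeq_iff']
      intro ε hε
      obtain ⟨N, hN, hlt⟩ := hsmall ψ K₀ ε hε
      refine ⟨N, fun n hn => ?_⟩
      obtain ⟨d, rfl⟩ := Nat.exists_eq_add_of_le hn
      -- For the inverses the modes beyond N are still empty in χ, since the first N factors do not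
      -- touch them, so the same bound applies.
      set χ := (compFrom T 0 N).symm ψ with hχ
      have e : (compFrom T 0 (N + d)).symm ψ = (compFrom T N d).symm χ := by
        rw [LinearIsometryEquiv.symm_apply_eq, compFrom_add, zero_add,
          LinearIsometryEquiv.apply_symm_apply, hχ, LinearIsometryEquiv.apply_symm_apply]
      show dist ((compFrom T 0 (N + d)).symm ψ) χ < ε
      rw [e, ← (compFrom T N d).dist_map, LinearIsometryEquiv.apply_symm_apply, dist_comm,
        dist_eq_norm]
      refine (hbound N d χ fun i hi => compFrom_symm_unocc hT N (by omega)
        (hψ i (hN.trans hi))).trans_lt ?_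
      rwa [hχ, LinearIsometryEquiv.norm_map])
  refine ⟨U, fun f g hfg ψ => ?_⟩
  have hfin : ∀ (K K' : ℕ) (f g : Ltwo ℕ), (∀ k, K' ≤ k → k < K' + K →
      g k = α k * f k + β k * conj (f k)) → (∀ k, k < K' ∨ K' + K ≤ k → g k = f k) → ∀ ψ,
      compFrom T K' K (weyl f ψ) = weyl g (compFrom T K' K ψ) := by
    intro K
    induction K with
    | zero =>
      intro K' f g _ h2 ψ
      have : f = g := lp.ext (funext fun k => (h2 k (by omega)).symm)
      rw [this]; rfl
    | succ K ih =>
      intro K' f g h1 h2 ψ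
      set e : Ltwo ℕ := g + (f K' - g K') • ket K' with he
      have hek : e K' = f K' := by
        rw [he, lp.coeFn_add, Pi.add_apply, lp.coeFn_smul, Pi.smul_apply, ket_apply]
        simp
      have hei : ∀ i, i ≠ K' → e i = g i := fun i hi => by
        rw [he, lp.coeFn_add, Pi.add_apply, lp.coeFn_smul, Pi.smul_apply, ket_apply, if_neg hi]
        simp
      rw [compFrom_succ, compFrom_succ, ih (K' + 1) f e
        (fun k hk hk' => by rw [hei k (by omega), h1 k (by omega) (by omega)])
        (fun k hk => by
          by_cases hk' : k = K'
          · rw [hk', hek]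
          · rw [hei k hk', h2 k (by omega)])]
      exact (hT K').intertwine (hu K') (by rw [hek, h1 K' (by omega) (by omega)])
        (fun i hi => (hei i hi).symm) _
  -- The first K factors transform the first K coordinates only. Since `gK` tends to g in norm,
  -- strong continuity of the Weyl operators carries the intertwining relation to the limit.
  set gK : ℕ → Ltwo ℕ := fun K => f + ∑ k ∈ Finset.range K, (g - f) k • ket k with hgK
  have hgKlim : Tendsto gK atTop (𝓝 g) := by
    have h1 := ((hasSum_ket (g - f)).tendsto_sum_nat).const_add f
    rw [add_sub_cancel] at h1
    exact h1
  have hgKapply : ∀ K k, gK K k = if k < K then g k else f k := by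
    intro K k
    simp only [hgK, lp.coeFn_add, Pi.add_apply, lp.coeFn_sum, Finset.sum_apply, lp.coeFn_smul,
      Pi.smul_apply, ket_apply, smul_eq_mul, mul_ite, mul_one, mul_zero, Finset.sum_ite_eq,
      Finset.mem_range]
    split_ifs
    · simp
    · simp
  have hstep : ∀ K, compFrom T 0 K (weyl f ψ) = weyl (gK K) (compFrom T 0 K ψ) := fun K =>
    hfin K 0 f (gK K) (fun k _ hk => by rw [hgKapply, if_pos (by omega), hfg])
      (fun k hk => by rw [hgKapply, if_neg (by omega)]) ψ
  refine tendsto_nhds_unique (hU (weyl f ψ)) ?_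
  simp only [hstep]
  have h1 := tendsto_weyl hgKlim (U ψ)
  rw [tendsto_iff_dist_tendsto_zero] at h1 ⊢
  have h2 := tendsto_iff_dist_tendsto_zero.mp (hU ψ)
  refine squeeze_zero (fun _ => dist_nonneg) (fun K => ?_) (by simpa using h2.add h1)
  refine (dist_triangle _ (weyl (gK K) (U ψ)) _).trans (le_of_eq ?_)
  rw [LinearIsometryEquiv.dist_map]

end Modes


/-! ### An implementable transformation has a square summable antilinear part. -/

open ComplexConjugate Filter Topology

/-! ### Generators of implemented transformations -/

lemma gop_real_smul_pow (N : ℕ) (s : ℝ) (f : Ltwo ℕ) (m : ℕ) (ψ : Fock) :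
    (gop N ((s : ℂ) • f) ^ m) ψ = (s : ℂ) ^ m • (gop N f ^ m) ψ := by
  rw [gop_real_smul, smul_pow]
  rfl

/-- First order Taylor expansion at s = 0 with quadratic remainder, from which generators are
recovered from Weyl operators. -/
lemma DegLE.weyl_sub_le {N : ℕ} {ψ : Fock} (h : DegLE N ψ) (f : Ltwo ℕ) :
    ∃ K : ℝ, ∀ s : ℝ, |s| ≤ 1 →
      ‖Gowdy.weyl ((s : ℂ) • f) ψ - (ψ + (s : ℂ) • Gowdy.gop N f ψ)‖ ≤ K * s ^ 2 := by
  have hsum := (summable_expBound (norm_nonneg f) N).mul_right ‖ψ‖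
  have hsum2 := (summable_nat_add_iff 2).mpr hsum
  refine ⟨∑' m, expBound ‖f‖ N (m + 2) * ‖ψ‖, fun s hs => ?_⟩
  have h1 := (hasSum_nat_add_iff' 2).mpr (h.hasSum_weyl ((s : ℂ) • f))
  have e : ∑ i ∈ Finset.range 2, ((i.factorial : ℂ))⁻¹ •
      (Gowdy.gop (N + i) ((s : ℂ) • f) ^ i) ψ = ψ + (s : ℂ) • Gowdy.gop N f ψ := by
    rw [Finset.sum_range_succ, Finset.sum_range_one, gop_real_smul_pow, gop_real_smul_pow]
    simp [gop_eq_of_degLE h (Nat.le_succ N) f]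
  rw [e] at h1
  rw [← h1.tsum_eq, ← tsum_mul_right]
  refine tsum_of_norm_bounded (hsum2.mul_right (s ^ 2)).hasSum fun m => ?_
  rw [gop_real_smul_pow, smul_comm, norm_smul, norm_pow, Complex.norm_real, Real.norm_eq_abs,
    pow_add, sq_abs, mul_comm]
  have h2 := h.norm_term_le (N + (m + 2)) f (m + 2)
  have h3 : |s| ^ m ≤ 1 := pow_le_one₀ (abs_nonneg _) hs
  have h4 : 0 ≤ expBound ‖f‖ N (m + 2) * ‖ψ‖ :=
    mul_nonneg (expBound_nonneg (norm_nonneg _) _ _) (norm_nonneg _)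
  calc _ ≤ (expBound ‖f‖ N (m + 2) * ‖ψ‖) * (1 * s ^ 2) := by gcongr
    _ = _ := by ring

lemma eq_zero_of_norm_le_sq {D : ℂ} {K : ℝ} (h : ∀ s : ℝ, |s| ≤ 1 → ‖(s : ℂ) * D‖ ≤ K * s ^ 2) :
    D = 0 := by
  by_contra hD
  have hpos : 0 < ‖D‖ := norm_pos_iff.mpr hD
  have hK : 0 ≤ K := by
    have := (norm_nonneg _).trans (h 1 (by simp))
    simpa using this
  set s := min 1 (‖D‖ / (2 * (K + 1))) with hs
  have hs0 : 0 < s := lt_min one_pos (by positivity)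
  have hs1 : s ≤ 1 := min_le_left _ _
  have h1 := h s (by rw [abs_of_pos hs0]; exact hs1)
  rw [norm_mul, Complex.norm_real, Real.norm_of_nonneg hs0.le, sq, ← mul_assoc, mul_comm s,
    mul_le_mul_iff_of_pos_right hs0] at h1
  have h2 : s ≤ ‖D‖ / (2 * (K + 1)) := min_le_right _ _
  rw [le_div_iff₀ (by positivity)] at h2
  nlinarith

/-- Intertwining of Weyl operators implies intertwining of the generators. -/
lemma gop_intertwine {U : Fock ≃ₗᵢ[ℂ] Fock} {f g : Ltwo ℕ}
    (h : ∀ (s : ℝ) ψ, U (weyl ((s : ℂ) • f) ψ) = weyl ((s : ℂ) • g) (U ψ)) {N : ℕ} {φ ψ : Fock}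
    (hφ : DegLE N φ) (hψ : DegLE N ψ) :
    inner ℂ (gop N (-g) φ) (U ψ) = inner ℂ φ (U (gop N f ψ)) := by
  obtain ⟨K₁, h1⟩ := hφ.weyl_sub_le (-g)
  obtain ⟨K₂, h2⟩ := hψ.weyl_sub_le f
  rw [← sub_eq_zero]
  refine eq_zero_of_norm_le_sq (K := K₁ * ‖ψ‖ + ‖φ‖ * K₂) fun s hs => ?_
  have e : inner ℂ (weyl ((s : ℂ) • (-g)) φ) (U ψ) = inner ℂ φ (U (weyl ((s : ℂ) • f) ψ)) := by
    rw [h, smul_neg, ← weyl_symm, ← (weyl ((s : ℂ) • g)).inner_map_map,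
      LinearIsometryEquiv.apply_symm_apply]
  have e2 : (s : ℂ) * (inner ℂ (gop N (-g) φ) (U ψ) - inner ℂ φ (U (gop N f ψ)))
      = inner ℂ φ (U (weyl ((s : ℂ) • f) ψ - (ψ + (s : ℂ) • gop N f ψ)))
        - inner ℂ (weyl ((s : ℂ) • (-g)) φ - (φ + (s : ℂ) • gop N (-g) φ)) (U ψ) := by
    rw [map_sub, map_add, map_smul, inner_sub_left, inner_sub_right, inner_add_left,
      inner_add_right, inner_smul_left, inner_smul_right, e, Complex.conj_ofReal]
    ring
  rw [e2]
  refine (norm_sub_le _ _).trans ?_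
  have n1 := norm_inner_le_norm (𝕜 := ℂ) φ (U (weyl ((s : ℂ) • f) ψ - (ψ + (s : ℂ) • gop N f ψ)))
  have n2 := norm_inner_le_norm (𝕜 := ℂ)
    (weyl ((s : ℂ) • (-g)) φ - (φ + (s : ℂ) • gop N (-g) φ)) (U ψ)
  rw [LinearIsometryEquiv.norm_map] at n1 n2
  calc _ ≤ ‖φ‖ * (K₂ * s ^ 2) + K₁ * s ^ 2 * ‖ψ‖ := by
        refine add_le_add (n1.trans ?_) (n2.trans ?_)
        · exact mul_le_mul_of_nonneg_left (h2 s hs) (norm_nonneg _)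
        · exact mul_le_mul_of_nonneg_right (h1 s hs) (norm_nonneg _)
    _ = _ := by ring

/-! ### Necessity of square summability -/

/-- The vacuum. -/
def vac : Fock := ket 0

lemma degLE_vac : DegLE 0 vac := degLE_ket (by simp)

lemma adjoint_cop_vac (N : ℕ) (f : Ltwo ℕ) :
    ContinuousLinearMap.adjoint (cop N f) vac = 0 := by
  ext n
  rw [adjoint_cop_apply, annihilation_eq_zero degLE_vac f (Nat.zero_le _), ite_self]
  rfl

/-- The vacuum relation: the image of the vacuum under an implementing unitary operator is
annihilated by the transformed annihilation operators. -/
lemma vacuum_relation {U : Fock ≃ₗᵢ[ℂ] Fock} {F : Ltwo ℕ} {α β : ℂ}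
    (hU : ∀ (w : ℂ) ψ, U (weyl (w • F) ψ) = weyl ((α * w + β * conj w) • F) (U ψ)) {N : ℕ}
    {φ : Fock} (hφ : DegLE N φ) :
    conj α * inner ℂ (cop N F φ) (U vac)
      = β * inner ℂ (ContinuousLinearMap.adjoint (cop N F) φ) (U vac) := by
  have key : ∀ w : ℂ, -conj (α * w + β * conj w) * inner ℂ (cop N F φ) (U vac)
      + (α * w + β * conj w) * inner ℂ (ContinuousLinearMap.adjoint (cop N F) φ) (U vac)
      = w * inner ℂ φ (U (cop N F vac)) := by
    intro w
    have h1 := gop_intertwine (U := U) (f := w • F) (g := (α * w + β * conj w) • F)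
      (fun s ψ => by
        rw [smul_smul, hU, smul_smul]
        congr 3
        simp only [map_mul, Complex.conj_ofReal]
        ring) hφ (degLE_vac.mono (Nat.zero_le N))
    rw [gop_neg, gop, gop] at h1
    simp only [map_smul, map_smulₛₗ, sub_apply, neg_apply,
      smul_apply, adjoint_cop_vac, smul_zero, sub_zero, inner_neg_left,
      inner_sub_left, inner_smul_left, inner_smul_right, Complex.conj_conj] at h1
    linear_combination h1
  -- The identity is real linear in w; w = 1 and w = i separate the linear from the antilinear part,
  -- and the latter is the claim.
  have k1 := key 1
  have k2 := key Complex.I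
  simp only [map_add, map_mul, map_neg, Complex.conj_I, map_one, mul_one] at k1 k2
  linear_combination (-1 / 2) * k1 + (-Complex.I / 2) * k2
    + (1 / 2) * ((α - β) * inner ℂ (ContinuousLinearMap.adjoint (cop N F) φ) (U vac)
      + (conj α - conj β) * inner ℂ (cop N F φ) (U vac)
      - inner ℂ φ (U (cop N F vac))) * Complex.I_sq

lemma cop_ket_ket {N k : ℕ} {n : ℕ →₀ ℕ} (hn : n.degree ≤ N) :
    cop N (ket k) (ket n) = (Real.sqrt (n k + 1) : ℂ) • ket (n + Finsupp.single k 1) := by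
  ext m
  have h1 := creation_ket_single k 1 n m
  rw [one_smul, one_mul] at h1
  rw [cop_apply, h1, lp.coeFn_smul, Pi.smul_apply, smul_eq_mul, ite_eq_left_iff, ket_apply]
  intro hm
  rw [if_neg, mul_zero]
  rintro rfl
  rw [degree_add_single] at hm
  omega

/-- The vector representing `f ↦ ⟨C(f) n | χ⟩`. -/
def kernelVec (N : ℕ) (n : ℕ →₀ ℕ) (χ : Fock) : Ltwo ℕ :=
  ContinuousLinearMap.adjoint ((cop N).flip (ket n)) χ

lemma inner_kernelVec (N : ℕ) (n : ℕ →₀ ℕ) (χ : Fock) (f : Ltwo ℕ) :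
    inner ℂ f (kernelVec N n χ) = inner ℂ (cop N f (ket n)) χ := by
  rw [kernelVec, ContinuousLinearMap.adjoint_inner_right]
  rfl

lemma kernelVec_apply {N : ℕ} {n : ℕ →₀ ℕ} (hn : n.degree ≤ N) (χ : Fock) (k : ℕ) :
    kernelVec N n χ k = Real.sqrt (n k + 1) * χ (n + Finsupp.single k 1) := by
  rw [← inner_ket k, inner_kernelVec, cop_ket_ket hn, inner_smul_left, inner_ket,
    Complex.conj_ofReal]

lemma exists_add_single {m : ℕ →₀ ℕ} {N : ℕ} (h : m.degree = N + 1) :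
    ∃ (n : ℕ →₀ ℕ) (k : ℕ), n.degree = N ∧ n + Finsupp.single k 1 = m := by
  have hne : m.support.Nonempty := by
    rw [Finset.nonempty_iff_ne_empty, Ne, Finsupp.support_eq_empty]
    rintro rfl
    simp at h
  obtain ⟨k, hk⟩ := hne
  have := degree_sub_single hk
  exact ⟨m - Finsupp.single k 1, k, by omega, sub_single_add hk⟩

/-- The transformed vacuum is not orthogonal to the vacuum. -/
lemma vacuum_overlap_ne_zero {U : Fock ≃ₗᵢ[ℂ] Fock} {F : ℕ → Ltwo ℕ} {α β : ℕ → ℂ}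
    (htot : ∀ x : Ltwo ℕ, (∀ l, inner ℂ (F l) x = 0) → x = 0) (hα : ∀ l, α l ≠ 0)
    (hU : ∀ l (w : ℂ) ψ, U (weyl (w • F l) ψ) = weyl ((α l * w + β l * conj w) • F l) (U ψ)) :
    U vac 0 ≠ 0 := by
  intro h0
  -- Were the overlap zero, the vacuum relation would kill all components by induction on the
  -- particle number. The annihilation side involves only lower, already vanishing components, so
  -- the vector of (N+1)-particle amplitudes above n is orthogonal to all F l.
  have hzero : ∀ N : ℕ, ∀ n : ℕ →₀ ℕ, n.degree ≤ N → U vac n = 0 := by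
    intro N
    induction N with
    | zero =>
      intro n hn
      rw [(Finsupp.degree_eq_zero_iff n).mp (Nat.le_zero.mp hn), h0]
    | succ N ih =>
      intro m hm
      rcases hm.lt_or_eq with hlt | heq
      · exact ih m (by omega)
      obtain ⟨n, k, hn, rfl⟩ := exists_add_single heq
      have hx : kernelVec N n (U vac) = 0 := by
        refine htot _ fun l => ?_
        have h1 := vacuum_relation (hU l) (degLE_ket hn.le)
        have h2 : inner ℂ (ContinuousLinearMap.adjoint (cop N (F l)) (ket n)) (U vac) = 0 := by
          refine (lp.hasSum_inner (𝕜 := ℂ) _ _).unique (hasSum_zero.congr_fun fun m => ?_)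
          rw [adjoint_cop_apply]
          split_ifs with hm
          · rw [ih m hm, inner_zero_right]
          · rw [inner_zero_left]
        rw [h2, mul_zero] at h1
        rw [inner_kernelVec]
        exact (mul_eq_zero.mp h1).resolve_left (by simpa using hα l)
      have h3 := kernelVec_apply hn.le (U vac) k
      rw [hx] at h3
      exact (mul_eq_zero.mp h3.symm).resolve_left (sqrt_succ_ne_zero _)
  have h1 : U vac = 0 := by
    ext n
    rw [hzero n.degree n le_rfl]
    rfl
  have h2 : ‖U vac‖ = 1 := by rw [LinearIsometryEquiv.norm_map, vac, norm_ket]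
  rw [h1, norm_zero] at h2
  exact zero_ne_one h2

lemma card_support_le_degree (n : ℕ →₀ ℕ) : n.support.card ≤ n.degree := by
  rw [Finsupp.degree_apply, Finset.card_eq_sum_ones]
  exact Finset.sum_le_sum fun k hk => Nat.one_le_iff_ne_zero.mpr (Finsupp.mem_support_iff.mp hk)

/-- A state with at most two particles arises as n + δ_k from at most two pairs, each with weight n
k + 1 ≤ 2, so the total is at most 4‖χ‖². This is the Hilbert–Schmidt property of the pair
amplitudes. -/
lemma summable_kernelVec (χ : Fock) :
    Summable fun p : {n : ℕ →₀ ℕ // n.degree ≤ 1} × ℕ => ‖kernelVec 1 p.1 χ p.2‖ ^ 2 := by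
  refine summable_of_sum_le (c := 4 * ‖χ‖ ^ 2) (fun _ => by positivity) fun s => ?_
  set g : {n : ℕ →₀ ℕ // n.degree ≤ 1} × ℕ → (Σ _ : ℕ →₀ ℕ, ℕ) :=
    fun p => ⟨p.1.1 + Finsupp.single p.2 1, p.2⟩ with hg
  have hinj : Set.InjOn g s := by
    rintro ⟨⟨n, hn⟩, k⟩ _ ⟨⟨m, hm⟩, j⟩ _ h
    simp only [hg, Sigma.mk.injEq, heq_eq_eq] at h
    obtain ⟨h1, rfl⟩ := h
    have := add_right_cancel h1
    subst this
    rfl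
  set G : (Σ _ : ℕ →₀ ℕ, ℕ) → ℝ := fun q => if q.1.degree ≤ 2 then 2 * ‖χ q.1‖ ^ 2 else 0 with hG
  have hG0 : ∀ q, 0 ≤ G q := fun q => by
    simp only [hG]; split_ifs <;> positivity
  set t := s.image fun p => (p.1.1 + Finsupp.single p.2 1 : ℕ →₀ ℕ) with ht
  calc ∑ p ∈ s, ‖kernelVec 1 p.1 χ p.2‖ ^ 2 ≤ ∑ p ∈ s, G (g p) := by
        refine Finset.sum_le_sum fun p _ => ?_
        obtain ⟨⟨n, hn⟩, k⟩ := p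
        simp only [hG, hg]
        rw [kernelVec_apply hn, if_pos (by rw [degree_add_single]; omega), norm_mul, mul_pow,
          Complex.norm_real, Real.norm_of_nonneg (Real.sqrt_nonneg _), Real.sq_sqrt (by positivity)]
        gcongr
        have : n k ≤ 1 := (Finsupp.le_degree k n).trans hn
        have : (n k : ℝ) ≤ 1 := by exact_mod_cast this
        linarith
    _ = ∑ q ∈ s.image g, G q := (Finset.sum_image hinj).symm
    _ ≤ ∑ q ∈ t.sigma fun n => n.support, G q := by
        refine Finset.sum_le_sum_of_subset_of_nonneg (fun q hq => ?_) fun q _ _ => hG0 q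
        obtain ⟨p, hp, rfl⟩ := Finset.mem_image.mp hq
        rw [Finset.mem_sigma]
        exact ⟨Finset.mem_image.mpr ⟨p, hp, rfl⟩, by simp [hg]⟩
    _ ≤ ∑ n ∈ t, 4 * ‖χ n‖ ^ 2 := by
        rw [Finset.sum_sigma]
        refine Finset.sum_le_sum fun n _ => ?_
        simp only [hG, Finset.sum_const, nsmul_eq_mul]
        split_ifs with hn
        · have : (n.support.card : ℝ) ≤ 2 := by
            exact_mod_cast (card_support_le_degree n).trans hn
          nlinarith [sq_nonneg ‖χ n‖]
        · rw [mul_zero]; positivity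
    _ ≤ 4 * ‖χ‖ ^ 2 := by
        rw [← Finset.mul_sum]
        gcongr
        exact sum_le_hasSum _ (fun _ _ => by positivity) (hasSum_norm_sq χ)

/-- Cauchy–Schwarz bounds the amplitude by the norm of A(F l) χ on states with at most one particle.
Bessel's inequality for each such state and the Hilbert–Schmidt bound allow summation over l. The
system F need not be the basis in which Fock space is written. -/
lemma summable_pair_overlap {F : ℕ → Ltwo ℕ} (hF : Orthonormal ℂ F) (χ : Fock) :
    Summable fun l => ‖(inner ℂ (cop 1 (F l) (cop 0 (F l) vac)) χ : ℂ)‖ ^ 2 := by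
  have hx : Summable fun n : {n : ℕ →₀ ℕ // n.degree ≤ 1} => ‖kernelVec 1 n χ‖ ^ 2 := by
    refine (summable_kernelVec χ).prod.congr fun n => ?_
    exact (hasSum_norm_sq (kernelVec 1 n χ)).tsum_eq
  have hle : ∀ l (n : {n : ℕ →₀ ℕ // n.degree ≤ 1}),
      ‖(inner ℂ (F l) (kernelVec 1 n χ) : ℂ)‖ ^ 2 ≤ ‖kernelVec 1 n χ‖ ^ 2 := fun l n => by
    have := norm_inner_le_norm (𝕜 := ℂ) (F l) (kernelVec 1 n χ)
    rw [hF.1 l, one_mul] at this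
    gcongr
  have hs : ∀ l, Summable fun n : {n : ℕ →₀ ℕ // n.degree ≤ 1} =>
      ‖(inner ℂ (F l) (kernelVec 1 n χ) : ℂ)‖ ^ 2 := fun l =>
    Summable.of_nonneg_of_le (fun _ => by positivity) (hle l) hx
  have hterm : ∀ l, ‖(inner ℂ (cop 1 (F l) (cop 0 (F l) vac)) χ : ℂ)‖ ^ 2
      ≤ ∑' n : {n : ℕ →₀ ℕ // n.degree ≤ 1}, ‖(inner ℂ (F l) (kernelVec 1 n χ) : ℂ)‖ ^ 2 := by
    intro l
    have h1 : ‖cop 0 (F l) vac‖ ≤ 1 := by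
      refine (ContinuousLinearMap.le_of_opNorm_le _ (norm_cop_le 0 (F l)) vac).trans (le_of_eq ?_)
      rw [hF.1 l, vac, norm_ket]
      simp
    have h2 := norm_inner_le_norm (𝕜 := ℂ) (cop 0 (F l) vac)
      (ContinuousLinearMap.adjoint (cop 1 (F l)) χ)
    rw [ContinuousLinearMap.adjoint_inner_right] at h2
    have h3 : ‖ContinuousLinearMap.adjoint (cop 1 (F l)) χ‖ ^ 2
        = ∑' n : {n : ℕ →₀ ℕ // n.degree ≤ 1},
          ‖(inner ℂ (F l) (kernelVec 1 n χ) : ℂ)‖ ^ 2 := by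
      have hval : ∀ n : ℕ →₀ ℕ, ContinuousLinearMap.adjoint (cop 1 (F l)) χ n
          = inner ℂ (F l) (kernelVec 1 n χ) := fun n => by
        rw [inner_kernelVec, ← inner_ket n, ContinuousLinearMap.adjoint_inner_right]
      rw [← (hasSum_norm_sq _).tsum_eq]
      simp only [← hval]
      refine (tsum_subtype_eq_of_support_subset (s := {n : ℕ →₀ ℕ | n.degree ≤ 1})
        (f := fun n => ‖ContinuousLinearMap.adjoint (cop 1 (F l)) χ n‖ ^ 2) fun n hn => ?_).symm
      by_contra hd
      apply hn
      show ‖ContinuousLinearMap.adjoint (cop 1 (F l)) χ n‖ ^ 2 = 0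
      rw [adjoint_cop_apply, if_neg (show ¬n.degree ≤ 1 from hd)]
      simp
    rw [← h3]
    gcongr
    refine h2.trans ?_
    exact mul_le_of_le_one_left (norm_nonneg _) h1
  refine summable_of_sum_le (c := ∑' n : {n : ℕ →₀ ℕ // n.degree ≤ 1}, ‖kernelVec 1 n χ‖ ^ 2)
    (fun _ => by positivity) fun s => ?_
  refine (Finset.sum_le_sum fun l _ => hterm l).trans ?_
  rw [← Summable.tsum_finsetSum fun l _ => hs l]
  refine Summable.tsum_le_tsum (fun n => ?_) (summable_sum fun l _ => hs l) hx
  exact (hF.inner_products_summable (x := kernelVec 1 n χ)).sum_le_tsum s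
    (fun _ _ => by positivity) |>.trans
    (hF.tsum_inner_products_le _)

/-- If a Bogoliubov transformation, diagonal in a complete orthonormal system, is implemented by a
unitary operator, then its antilinear part is square summable. -/
theorem summable_of_implemented {U : Fock ≃ₗᵢ[ℂ] Fock} {F : ℕ → Ltwo ℕ} {α β : ℕ → ℂ}
    (hF : Orthonormal ℂ F) (htot : ∀ x : Ltwo ℕ, (∀ l, inner ℂ (F l) x = 0) → x = 0)
    (h : ∀ l, ‖α l‖ ^ 2 - ‖β l‖ ^ 2 = 1)
    (hU : ∀ l (w : ℂ) ψ, U (weyl (w • F l) ψ) = weyl ((α l * w + β l * conj w) • F l) (U ψ)) :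
    Summable fun l => ‖β l‖ ^ 2 := by
  have hα : ∀ l, α l ≠ 0 := fun l => norm_ne_zero_iff.mp (IsSqueezing.norm_alpha_pos (h l)).ne'
  have h0 := vacuum_overlap_ne_zero htot hα hU
  have hs := summable_pair_overlap hF (U vac)
  -- The vacuum relation with φ the one-particle state F l: annihilating F l returns the vacuum, so
  -- the pair amplitude is tied to the vacuum overlap.
  have hrel : ∀ l, conj (α l) * inner ℂ (cop 1 (F l) (cop 0 (F l) vac)) (U vac)
      = β l * U vac 0 := by
    intro l
    have hdeg : DegLE 1 (cop 0 (F l) vac) := fun n hn => by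
      rw [cop_apply, if_neg (by omega)]
    have h1 := vacuum_relation (hU l) hdeg
    have h2 : ContinuousLinearMap.adjoint (cop 1 (F l)) (cop 0 (F l) vac) = vac := by
      ext n
      rw [adjoint_cop_apply, vac, ket_apply]
      by_cases hn : n = 0
      · subst hn
        rw [if_pos (by simp), if_pos rfl]
        have h3 := (hasSum_norm_sq (F l)).mapL Complex.ofRealCLM
        rw [hF.1 l] at h3
        have h4 : annihilation (F l) (cop 0 (F l) (ket 0)) 0 = ((1 : ℝ) ^ 2 : ℝ) := by
          refine Eq.trans (tsum_congr fun k => ?_) h3.tsum_eq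
          rw [cop_apply, if_pos (by rw [degree_add_single]; simp), creation_ket_add_single]
          show _ = ((‖F l k‖ ^ 2 : ℝ) : ℂ)
          rw [norm_sq_cast]
          simp [mul_comm]
        rw [h4]
        simp
      · rw [if_neg hn]
        have hn1 : 1 ≤ n.degree :=
          Nat.one_le_iff_ne_zero.mpr fun h => hn ((Finsupp.degree_eq_zero_iff n).mp h)
        rw [annihilation_eq_zero (ψ := cop 0 (F l) (ket 0)) hdeg _ hn1, ite_self]
    rw [h1, h2, vac, inner_ket]
  have hβ : ∀ l, ‖β l‖ ^ 2 * ‖U vac 0‖ ^ 2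
      = ‖α l‖ ^ 2 * ‖(inner ℂ (cop 1 (F l) (cop 0 (F l) vac)) (U vac) : ℂ)‖ ^ 2 := by
    intro l
    rw [← mul_pow, ← norm_mul, ← hrel l, norm_mul, RCLike.norm_conj, mul_pow]
  set c : ℝ := ‖U vac 0‖ ^ 2 with hc
  have hcpos : 0 < c := by positivity
  have hlim := hs.tendsto_atTop_zero
  refine (summable_norm_iff.mp ?_)
  refine Summable.of_norm_bounded_eventually_nat (g := fun l => 2 / c *
    ‖(inner ℂ (cop 1 (F l) (cop 0 (F l) vac)) (U vac) : ℂ)‖ ^ 2) (hs.mul_left _) ?_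
  filter_upwards [hlim.eventually (gt_mem_nhds (half_pos hcpos))] with l hl
  rw [norm_norm, Real.norm_of_nonneg (by positivity), div_mul_eq_mul_div, le_div_iff₀ hcpos, hβ]
  set d := ‖(inner ℂ (cop 1 (F l) (cop 0 (F l) vac)) (U vac) : ℂ)‖ ^ 2 with hd
  have hd0 : 0 ≤ d := by positivity
  have h1 := hβ l
  have h2 := h l
  -- With |β|² c = |α|² d = (1 + |β|²) d and d < c/2, the bound |β|² ≤ 1 follows; so |α|² ≤ 2 and
  -- |β|² ≤ 2d/c.
  have h3 : ‖β l‖ ^ 2 ≤ 1 := by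
    have : ‖α l‖ ^ 2 = 1 + ‖β l‖ ^ 2 := by linarith
    rw [this] at h1
    by_contra hlt
    push Not at hlt
    nlinarith
  have : ‖α l‖ ^ 2 ≤ 2 := by linarith
  gcongr


/-! ### Asymptotics of the evolution for large frequencies. -/

open ComplexConjugate Filter Topology

/-! ### High frequency asymptotics of the modes -/

/-- The asymptotic frequency of the `ℓ`-th mode. -/
def lam (l : ℕ) : ℝ := l + 1 / 2

lemma lam_pos (l : ℕ) : 0 < lam l := by unfold lam; positivity

lemma half_le_lam (l : ℕ) : 1 / 2 ≤ lam l := by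
  have : (0 : ℝ) ≤ l := Nat.cast_nonneg l
  unfold lam; linarith

/-- The derivative of the mode `zf l r n`. -/
def zf' (l : ℕ) (r n t : ℝ) : ℂ := ⟨uvFn' l r n t, uvFn' l 0 r⁻¹ t⟩

lemma hasDerivAt_mk {f g : ℝ → ℝ} {f' g' t : ℝ} (hf : HasDerivAt f f' t) (hg : HasDerivAt g g' t) :
    HasDerivAt (fun t => (⟨f t, g t⟩ : ℂ)) ⟨f', g'⟩ t := by
  have h := hf.ofReal_comp.add (hg.ofReal_comp.mul_const Complex.I)
  have e1 : (fun t => (⟨f t, g t⟩ : ℂ)) = (fun t => (f t : ℂ)) + fun t => (g t : ℂ) * Complex.I := by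
    funext t; exact Complex.mk_eq_add_mul_I _ _
  rw [e1, Complex.mk_eq_add_mul_I]
  exact h

lemma hasDerivAt_zf (l : ℕ) (r n : ℝ) {t : ℝ} (ht : t ∈ IT) :
    HasDerivAt (zf l r n) (zf' l r n t) t :=
  hasDerivAt_mk (isModeFn_uvFn l r n t ht).1 (isModeFn_uvFn l 0 r⁻¹ t ht).1

lemma hasDerivAt_zf' (l : ℕ) (r n : ℝ) {t : ℝ} (ht : t ∈ IT) :
    HasDerivAt (zf' l r n) (-(freqSq l t : ℂ) * zf l r n t) t := by
  refine (hasDerivAt_mk (isModeFn_uvFn l r n t ht).2 (isModeFn_uvFn l 0 r⁻¹ t ht).2).congr_deriv ?_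
  apply Complex.ext <;> simp [zf]

lemma pf_eq (l : ℕ) (r n t : ℝ) :
    pf l r n t = zf' l r n t - ((1 / 2 * Real.cot t : ℝ) : ℂ) * zf l r n t := by
  generalize hc : Real.cot t = c
  apply Complex.ext <;> simp [pf, zf, zf', hc]

/-- The incoming amplitude of the mode. -/
def wAmp (l : ℕ) (r n t : ℝ) : ℂ :=
  Real.sqrt (lam l) * zf l r n t + Complex.I * (zf' l r n t / Real.sqrt (lam l))

/-- The outgoing amplitude of the mode. -/
def vAmp (l : ℕ) (r n t : ℝ) : ℂ :=
  Real.sqrt (lam l) * zf l r n t - Complex.I * (zf' l r n t / Real.sqrt (lam l))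

/-- The cross terms are the conserved Wronskian of the real and imaginary parts; they contribute +1
to the incoming and -1 to the outgoing amplitude. -/
lemma norm_amp_sq (l : ℕ) {r : ℝ} (n : ℝ) (hr : r ≠ 0) {t : ℝ} (ht : t ∈ IT) :
    ‖wAmp l r n t‖ ^ 2 = lam l * ‖zf l r n t‖ ^ 2 + ‖zf' l r n t‖ ^ 2 / lam l + 1 ∧
    ‖vAmp l r n t‖ ^ 2 = lam l * ‖zf l r n t‖ ^ 2 + ‖zf' l r n t‖ ^ 2 / lam l - 1 := by
  have hs : Real.sqrt (lam l) ≠ 0 := (Real.sqrt_pos.mpr (lam_pos l)).ne'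
  have hl : lam l = Real.sqrt (lam l) ^ 2 := (Real.sq_sqrt (lam_pos l).le).symm
  have w := wronskian_uvFn l r n 0 r⁻¹ ht
  have w2 : (r * r⁻¹ - n * 0) / 2 = 1 / 2 := by field_simp; ring
  rw [w2] at w
  rw [hl]
  simp only [wAmp, vAmp, ← Complex.normSq_eq_norm_sq, Complex.normSq_apply]
  set q := Real.sqrt (lam l)
  have hdiv : ∀ x : ℂ, x / (q : ℂ) = ⟨x.re / q, x.im / q⟩ := fun x => by
    apply Complex.ext <;> simp
  rw [hdiv]
  simp only [zf, zf', Complex.add_re, Complex.add_im, Complex.sub_re, Complex.sub_im,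
    Complex.mul_re, Complex.mul_im, Complex.ofReal_re, Complex.ofReal_im, Complex.I_re,
    Complex.I_im]
  generalize uvFn l 0 r⁻¹ t = y at *
  generalize uvFn' l 0 r⁻¹ t = y' at *
  constructor
  · field_simp
    linear_combination (2 * q ^ 2) * w
  · field_simp
    linear_combination (-2 * q ^ 2) * w

/-- The slowly varying amplitudes. -/
def ampVec (l : ℕ) (r n t : ℝ) : ℂ × ℂ :=
  (wAmp l r n t * Complex.exp ((lam l * (t - Real.pi / 2) : ℝ) * Complex.I),
    vAmp l r n t * Complex.exp ((-(lam l * (t - Real.pi / 2)) : ℝ) * Complex.I))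

/-- The derivative of the slowly varying amplitudes. -/
def ampVec' (l : ℕ) (r n t : ℝ) : ℂ × ℂ :=
  let g : ℂ := ((1 / (4 * Real.sin t ^ 2) / lam l : ℝ) : ℂ)
    * (Complex.I * (Real.sqrt (lam l) * zf l r n t))
  (-g * Complex.exp ((lam l * (t - Real.pi / 2) : ℝ) * Complex.I),
    g * Complex.exp ((-(lam l * (t - Real.pi / 2)) : ℝ) * Complex.I))

/-- At constant frequency λ the amplitudes would be pure exponentials e^{∓iλ(t - π/2)}, which the
phase factors undo. Only the potential 1/(4 sin² t) divided by λ survives in the derivative. -/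
lemma hasDerivAt_ampVec (l : ℕ) (r n : ℝ) {t : ℝ} (ht : t ∈ IT) :
    HasDerivAt (ampVec l r n) (ampVec' l r n t) t := by
  have hs : (Real.sqrt (lam l) : ℂ) ≠ 0 := by
    exact_mod_cast (Real.sqrt_pos.mpr (lam_pos l)).ne'
  have hl : (lam l : ℂ) = (Real.sqrt (lam l) : ℂ) ^ 2 := by
    exact_mod_cast (Real.sq_sqrt (lam_pos l).le).symm
  have hz := hasDerivAt_zf l r n ht
  have hz' := hasDerivAt_zf' l r n ht
  have dw := (hz.const_mul (Real.sqrt (lam l) : ℂ)).add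
    ((hz'.div_const (Real.sqrt (lam l) : ℂ)).const_mul Complex.I)
  have dv := (hz.const_mul (Real.sqrt (lam l) : ℂ)).sub
    ((hz'.div_const (Real.sqrt (lam l) : ℂ)).const_mul Complex.I)
  have dph : HasDerivAt (fun t : ℝ => lam l * (t - Real.pi / 2)) (lam l) t := by
    simpa using ((hasDerivAt_id t).sub_const (Real.pi / 2)).const_mul (lam l)
  have de := (dph.ofReal_comp.mul_const Complex.I).cexp
  have de' := (dph.neg.ofReal_comp.mul_const Complex.I).cexp
  have hq : (freqSq l t : ℂ) = (lam l : ℂ) ^ 2 + ((1 / (4 * Real.sin t ^ 2) : ℝ) : ℂ) := by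
    rw [freqSq, lam]; push_cast; ring
  have hdiv : ((1 / (4 * Real.sin t ^ 2) / lam l : ℝ) : ℂ)
      = ((1 / (4 * Real.sin t ^ 2) : ℝ) : ℂ) / (lam l : ℂ) := by push_cast; ring
  refine ((dw.mul de).prodMk (dv.mul de')).congr_deriv ?_
  rw [ampVec']
  simp only [hq, hdiv, Pi.add_apply, Pi.sub_apply, Pi.neg_apply]
  generalize ((1 / (4 * Real.sin t ^ 2) : ℝ) : ℂ) = q
  generalize Complex.exp ((lam l * (t - Real.pi / 2) : ℝ) * Complex.I) = E
  generalize Complex.exp ((-(lam l * (t - Real.pi / 2)) : ℝ) * Complex.I) = E'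
  rw [Complex.ofReal_neg, hl]
  generalize (Real.sqrt (lam l) : ℂ) = s at *
  refine Prod.ext ?_ ?_
  · show _ = _
    field_simp
    linear_combination (zf' l r n t * s ^ 2 * E) * Complex.I_sq
  · show _ = _
    field_simp
    linear_combination (zf' l r n t * s ^ 2 * E') * Complex.I_sq

lemma norm_ampVec' (l : ℕ) (r n t : ℝ) :
    ‖ampVec' l r n t‖ ≤ 1 / (4 * Real.sin t ^ 2) / lam l * ‖ampVec l r n t‖ := by
  have hpos : 0 ≤ 1 / (4 * Real.sin t ^ 2) / lam l := by
    have := lam_pos l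
    positivity
  have h1 : ‖wAmp l r n t‖ ≤ ‖ampVec l r n t‖ := by
    refine le_trans (le_of_eq ?_) (norm_fst_le _)
    rw [ampVec, norm_mul, Complex.norm_exp_ofReal_mul_I, mul_one]
  have h2 : ‖vAmp l r n t‖ ≤ ‖ampVec l r n t‖ := by
    refine le_trans (le_of_eq ?_) (norm_snd_le _)
    rw [ampVec, norm_mul, Complex.norm_exp_ofReal_mul_I, mul_one]
  have h3 : ‖(Real.sqrt (lam l) : ℂ) * zf l r n t‖ ≤ ‖ampVec l r n t‖ := by
    have e : (Real.sqrt (lam l) : ℂ) * zf l r n t = (1 / 2 : ℂ) * (wAmp l r n t + vAmp l r n t) := by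
      rw [wAmp, vAmp]; ring
    rw [e, norm_mul]
    have := norm_add_le (wAmp l r n t) (vAmp l r n t)
    norm_num
    linarith
  have h4 : ‖((1 / (4 * Real.sin t ^ 2) / lam l : ℝ) : ℂ)
      * (Complex.I * (Real.sqrt (lam l) * zf l r n t))‖
      ≤ 1 / (4 * Real.sin t ^ 2) / lam l * ‖ampVec l r n t‖ := by
    rw [norm_mul, norm_mul, Complex.norm_I, one_mul, Complex.norm_real,
      Real.norm_of_nonneg hpos]
    exact mul_le_mul_of_nonneg_left h3 hpos
  rw [ampVec', Prod.norm_def]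
  simp only [norm_mul, norm_neg, Complex.norm_exp_ofReal_mul_I, mul_one] at h4 ⊢
  exact max_le h4 h4

/-- The sine decreases away from π/2, so along the segment from π/2 to t the potential is bounded by
its value at t. -/
lemma segment_mem {t s : ℝ} (ht : t ∈ IT) (hs : s ∈ Set.Icc (0 : ℝ) 1) :
    Real.pi / 2 + s * (t - Real.pi / 2) ∈ IT ∧
      Real.sin t ≤ Real.sin (Real.pi / 2 + s * (t - Real.pi / 2)) := by
  have hd : |t - Real.pi / 2| < Real.pi / 2 := by
    rw [abs_lt]; exact ⟨by linarith [ht.1], by linarith [ht.2]⟩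
  have hsd : |s * (t - Real.pi / 2)| ≤ |t - Real.pi / 2| := by
    rw [abs_mul, abs_of_nonneg hs.1]
    exact mul_le_of_le_one_left (abs_nonneg _) hs.2
  constructor
  · have := abs_lt.mp (hsd.trans_lt hd)
    exact ⟨by linarith [this.1], by linarith [this.2]⟩
  · have e : ∀ x, Real.sin (Real.pi / 2 + x) = Real.cos |x| := fun x => by
      rw [add_comm, Real.sin_add_pi_div_two, Real.cos_abs]
    have e2 : Real.sin t = Real.cos |t - Real.pi / 2| := by rw [← e]; congr 1; ring
    rw [e, e2]
    exact Real.cos_le_cos_of_nonneg_of_le_pi (abs_nonneg _) (by linarith [Real.pi_pos]) hsd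

/-- The slowly varying amplitudes change by a relative amount of the order of the inverse
frequency. -/
lemma exists_ampVec_bound {t : ℝ} (ht : t ∈ IT) : ∃ D : ℝ, 1 ≤ D ∧ ∀ (l : ℕ) (r n : ℝ),
    ‖ampVec l r n t‖ ≤ D * ‖ampVec l r n (Real.pi / 2)‖ ∧
    ‖ampVec l r n t - ampVec l r n (Real.pi / 2)‖
      ≤ D / lam l * ‖ampVec l r n (Real.pi / 2)‖ := by
  set Q := 1 / (4 * Real.sin t ^ 2) with hQ
  have hsin := sin_pos_of_mem ht
  have hQ0 : 0 ≤ Q := by positivity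
  set δ := |t - Real.pi / 2| with hδ
  have hδ0 : 0 ≤ δ := abs_nonneg _
  set D := Real.exp (2 * δ * Q) * (1 + δ * Q) with hD
  have hexp1 : 1 ≤ Real.exp (2 * δ * Q) := Real.one_le_exp (by positivity)
  have hDexp : Real.exp (2 * δ * Q) ≤ D := by
    rw [hD]
    have : 0 ≤ δ * Q := by positivity
    nlinarith
  refine ⟨D, hexp1.trans hDexp, fun l r n => ?_⟩
  have hlam := lam_pos l
  set M := ‖ampVec l r n (Real.pi / 2)‖ with hM
  set K := δ * (Q / lam l) with hK
  have hK0 : 0 ≤ K := by positivity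
  -- From λ_l ≥ 1/2; it makes the Grönwall factor independent of l, while K itself retains the decay
  -- 1/λ_l.
  have hK1 : K ≤ 2 * δ * Q := by
    have h1 : Q / lam l ≤ 2 * Q := by
      rw [div_le_iff₀ hlam]
      nlinarith [half_le_lam l]
    calc K ≤ δ * (2 * Q) := mul_le_mul_of_nonneg_left h1 hδ0
      _ = _ := by ring
  -- Parametrizing by [0, 1] treats times before and after π/2 together.
  set f : ℝ → ℂ × ℂ := fun s => ampVec l r n (Real.pi / 2 + s * (t - Real.pi / 2)) with hf
  set f' : ℝ → ℂ × ℂ := fun s =>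
    (t - Real.pi / 2) • ampVec' l r n (Real.pi / 2 + s * (t - Real.pi / 2)) with hf'
  have hder : ∀ s ∈ Set.Icc (0 : ℝ) 1, HasDerivAt f (f' s) s := by
    intro s hs
    have h1 : HasDerivAt (fun s : ℝ => Real.pi / 2 + s * (t - Real.pi / 2)) (t - Real.pi / 2) s := by
      simpa using ((hasDerivAt_id s).mul_const (t - Real.pi / 2)).const_add (Real.pi / 2)
    exact (hasDerivAt_ampVec l r n (segment_mem ht hs).1).scomp s h1
  have hbd : ∀ s ∈ Set.Icc (0 : ℝ) 1, ‖f' s‖ ≤ K * ‖f s‖ := by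
    intro s hs
    obtain ⟨-, h2⟩ := segment_mem ht hs
    simp only [hf', hf]
    rw [norm_smul, Real.norm_eq_abs, hK, mul_assoc]
    refine mul_le_mul_of_nonneg_left ((norm_ampVec' l r n _).trans ?_) hδ0
    rw [hQ]
    gcongr
  have hgr : ∀ s ∈ Set.Icc (0 : ℝ) 1, ‖f s‖ ≤ Real.exp (2 * δ * Q) * M := by
    intro s hs
    have h1 := norm_le_gronwallBound_of_norm_deriv_right_le (f := f) (f' := f') (δ := M) (K := K)
      (ε := 0) (a := 0) (b := 1) (fun s hs => (hder s hs).continuousAt.continuousWithinAt)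
      (fun s hs => (hder s ⟨hs.1, hs.2.le⟩).hasDerivWithinAt) (by simp [hf, hM])
      (fun s hs => by rw [add_zero]; exact hbd s ⟨hs.1, hs.2.le⟩) s hs
    rw [gronwallBound_ε0, sub_zero] at h1
    refine h1.trans ?_
    rw [mul_comm]
    refine mul_le_mul_of_nonneg_right (Real.exp_le_exp.mpr ?_) (norm_nonneg _)
    calc K * s ≤ K * 1 := mul_le_mul_of_nonneg_left hs.2 hK0
      _ ≤ _ := by rw [mul_one]; exact hK1
  have e1 : f 1 = ampVec l r n t := by simp [hf]
  have e0 : f 0 = ampVec l r n (Real.pi / 2) := by simp [hf]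
  constructor
  · rw [← e1]
    exact (hgr 1 ⟨zero_le_one, le_rfl⟩).trans (by gcongr)
  · rw [← e1, ← e0]
    refine norm_image_sub_le_of_norm_deriv_le_segment_01'
      (fun s hs => (hder s hs).hasDerivWithinAt) fun s hs => ?_
    refine (hbd s ⟨hs.1, hs.2.le⟩).trans ?_
    refine (mul_le_mul_of_nonneg_left (hgr s ⟨hs.1, hs.2.le⟩) hK0).trans ?_
    rw [← mul_assoc]
    refine mul_le_mul_of_nonneg_right ?_ (norm_nonneg _)
    rw [hK, le_div_iff₀ hlam, hD]
    have : δ * (Q / lam l) * Real.exp (2 * δ * Q) * lam l = Real.exp (2 * δ * Q) * (δ * Q) := by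
      field_simp
    rw [this]
    gcongr
    linarith

lemma norm_ampVec_half_pi (l : ℕ) {r : ℝ} (n : ℝ) (hr : r ≠ 0) :
    ‖ampVec l r n (Real.pi / 2)‖ = ‖wAmp l r n (Real.pi / 2)‖ := by
  obtain ⟨h1, h2⟩ := norm_amp_sq l n hr half_pi_mem
  have hle : ‖vAmp l r n (Real.pi / 2)‖ ≤ ‖wAmp l r n (Real.pi / 2)‖ :=
    (pow_le_pow_iff_left₀ (norm_nonneg _) (norm_nonneg _) two_ne_zero).mp (by linarith)
  simp [ampVec, Prod.norm_def, hle]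

/-- The antilinear Bogoliubov coefficient of the evolution. -/
def evB (l : ℕ) (r n t₁ t₀ : ℝ) : ℂ := bogB (zf l r n t₁) (pf l r n t₁) (zf l r n t₀) (pf l r n t₀)

lemma norm_evB (l : ℕ) (r n t₁ t₀ : ℝ) : ‖evB l r n t₁ t₀‖
    = ‖(zf l r n t₁ * zf' l r n t₀ - zf l r n t₀ * zf' l r n t₁)
      + ((1 / 2 * (Real.cot t₁ - Real.cot t₀) : ℝ) : ℂ) * (zf l r n t₀ * zf l r n t₁)‖ := by
  rw [evB, bogB, norm_mul, norm_neg, Complex.norm_I, one_mul, ← map_mul, ← map_mul, ← map_sub,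
    RCLike.norm_conj, pf_eq, pf_eq]
  congr 1
  push_cast
  ring

/-- In terms of the slow amplitudes all rapid time dependence sits in the factors e^{±iλ(t₁ - t₀)}.
-/
lemma zf_comm_eq (l : ℕ) (r n t₁ t₀ : ℝ) :
    zf l r n t₁ * zf' l r n t₀ - zf l r n t₀ * zf' l r n t₁
      = -Complex.I / 2 * ((ampVec l r n t₁).2 * (ampVec l r n t₀).1
          * Complex.exp ((lam l * (t₁ - t₀) : ℝ) * Complex.I)
        - (ampVec l r n t₁).1 * (ampVec l r n t₀).2
          * Complex.exp ((-(lam l * (t₁ - t₀)) : ℝ) * Complex.I)) := by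
  have hs : (Real.sqrt (lam l) : ℂ) ≠ 0 := by
    exact_mod_cast (Real.sqrt_pos.mpr (lam_pos l)).ne'
  have e1 : (ampVec l r n t₁).2 * (ampVec l r n t₀).1
      * Complex.exp ((lam l * (t₁ - t₀) : ℝ) * Complex.I) = vAmp l r n t₁ * wAmp l r n t₀ := by
    simp only [ampVec]
    rw [show ∀ a b x y z : ℂ, a * x * (b * y) * z = a * b * (x * y * z) by intros; ring,
      ← Complex.exp_add, ← Complex.exp_add]
    rw [show ∀ x y : ℂ, x * y = x * y from fun _ _ => rfl]
    convert mul_one _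
    rw [Complex.exp_eq_one_iff]
    exact ⟨0, by push_cast; ring⟩
  have e2 : (ampVec l r n t₁).1 * (ampVec l r n t₀).2
      * Complex.exp ((-(lam l * (t₁ - t₀)) : ℝ) * Complex.I) = wAmp l r n t₁ * vAmp l r n t₀ := by
    simp only [ampVec]
    rw [show ∀ a b x y z : ℂ, a * x * (b * y) * z = a * b * (x * y * z) by intros; ring,
      ← Complex.exp_add, ← Complex.exp_add]
    convert mul_one _
    rw [Complex.exp_eq_one_iff]
    exact ⟨0, by push_cast; ring⟩
  rw [e1, e2, wAmp, vAmp, wAmp, vAmp]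
  field_simp
  linear_combination (2 * (zf l r n t₁ * zf' l r n t₀ - zf l r n t₀ * zf' l r n t₁)
    * (Real.sqrt (lam l) : ℂ) ^ 2) * Complex.I_sq

/-- The leading behaviour of the antilinear Bogoliubov coefficient of the evolution. -/
theorem exists_evB_bound {t₀ t₁ : ℝ} (h0 : t₀ ∈ IT) (h1 : t₁ ∈ IT) :
    ∃ C : ℝ, 0 ≤ C ∧ ∀ (l : ℕ) (r n : ℝ), r ≠ 0 →
      abs (‖evB l r n t₁ t₀‖ - ‖wAmp l r n (Real.pi / 2)‖ * ‖vAmp l r n (Real.pi / 2)‖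
          * abs (Real.sin (lam l * (t₁ - t₀)))) ≤ C * ‖wAmp l r n (Real.pi / 2)‖ ^ 2 / lam l := by
  obtain ⟨D₀, hD₀, b0⟩ := exists_ampVec_bound h0
  obtain ⟨D₁, hD₁, b1⟩ := exists_ampVec_bound h1
  set k := |1 / 2 * (Real.cot t₁ - Real.cot t₀)| with hk
  have hk0 : 0 ≤ k := abs_nonneg _
  refine ⟨D₁ * D₀ + D₀ + k * (D₀ * D₁), by positivity, fun l r n hr => ?_⟩
  have hlam := lam_pos l
  obtain ⟨n0, d0⟩ := b0 l r n
  obtain ⟨n1, d1⟩ := b1 l r n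
  rw [norm_ampVec_half_pi l n hr] at n0 d0 n1 d1
  set M := ‖wAmp l r n (Real.pi / 2)‖ with hM
  have hM0 : 0 ≤ M := norm_nonneg _
  set F₀ := ampVec l r n t₀
  set F₁ := ampVec l r n t₁
  set F := ampVec l r n (Real.pi / 2) with hF
  have hF1 : F.1 = wAmp l r n (Real.pi / 2) := by simp [hF, ampVec]
  have hF2 : F.2 = vAmp l r n (Real.pi / 2) := by simp [hF, ampVec]
  have hFM : ‖F‖ = M := norm_ampVec_half_pi l n hr
  set E := Complex.exp ((lam l * (t₁ - t₀) : ℝ) * Complex.I) with hE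
  set E' := Complex.exp ((-(lam l * (t₁ - t₀)) : ℝ) * Complex.I) with hE'
  have hEn : ‖E‖ = 1 := Complex.norm_exp_ofReal_mul_I _
  have hEn' : ‖E'‖ = 1 := Complex.norm_exp_ofReal_mul_I _
  -- Leading term: both amplitude vectors frozen at π/2. Freezing them costs O(1/λ) relative to M²,
  -- and the cot term is of the same order because |z| = O(M/√λ).
  have hmain : ‖-Complex.I / 2 * (F.1 * F.2 * (E - E'))‖
      = M * ‖vAmp l r n (Real.pi / 2)‖ * |Real.sin (lam l * (t₁ - t₀))| := by
    have : E - E' = 2 * Complex.I * ((Real.sin (lam l * (t₁ - t₀)) : ℝ) : ℂ) := by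
      rw [hE, hE', Complex.exp_mul_I, Complex.exp_mul_I, ← Complex.ofReal_cos, ← Complex.ofReal_sin,
        ← Complex.ofReal_cos, ← Complex.ofReal_sin, Real.cos_neg, Real.sin_neg]
      push_cast
      ring
    rw [this, hF1, hF2]
    simp only [norm_mul, norm_div, norm_neg, Complex.norm_I, Complex.norm_real, Real.norm_eq_abs]
    norm_num
    ring
  have hz : ∀ t, ‖zf l r n t‖ ≤ ‖ampVec l r n t‖ / Real.sqrt (lam l) := by
    intro t
    have hs : 0 < Real.sqrt (lam l) := Real.sqrt_pos.mpr hlam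
    rw [le_div_iff₀ hs]
    have h1 : ‖wAmp l r n t‖ ≤ ‖ampVec l r n t‖ := by
      refine le_trans (le_of_eq ?_) (norm_fst_le _)
      rw [ampVec, norm_mul, Complex.norm_exp_ofReal_mul_I, mul_one]
    have h2 : ‖vAmp l r n t‖ ≤ ‖ampVec l r n t‖ := by
      refine le_trans (le_of_eq ?_) (norm_snd_le _)
      rw [ampVec, norm_mul, Complex.norm_exp_ofReal_mul_I, mul_one]
    have e : zf l r n t * (Real.sqrt (lam l) : ℂ)
        = (1 / 2 : ℂ) * (wAmp l r n t + vAmp l r n t) := by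
      rw [wAmp, vAmp]; ring
    have h3 := congrArg norm e
    rw [norm_mul, norm_mul, Complex.norm_real, Real.norm_of_nonneg hs.le] at h3
    rw [h3]
    have := norm_add_le (wAmp l r n t) (vAmp l r n t)
    norm_num
    linarith
  have herr : ‖((1 / 2 * (Real.cot t₁ - Real.cot t₀) : ℝ) : ℂ) * (zf l r n t₀ * zf l r n t₁)‖
      ≤ k * (D₀ * D₁) * M ^ 2 / lam l := by
    rw [norm_mul, norm_mul, Complex.norm_real, Real.norm_eq_abs]
    have h0 := (hz t₀).trans (div_le_div_of_nonneg_right n0 (Real.sqrt_nonneg _))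
    have h1 := (hz t₁).trans (div_le_div_of_nonneg_right n1 (Real.sqrt_nonneg _))
    calc _ ≤ k * ((D₀ * M / Real.sqrt (lam l)) * (D₁ * M / Real.sqrt (lam l))) := by gcongr
      _ = k * (D₀ * D₁) * M ^ 2 / (Real.sqrt (lam l) * Real.sqrt (lam l)) := by ring
      _ = _ := by rw [Real.mul_self_sqrt hlam.le]
  have p0 : ‖F₀ - F‖ ≤ D₀ / lam l * M := d0
  have p1 : ‖F₁ - F‖ ≤ D₁ / lam l * M := d1
  have hdiff : ‖(F₁.2 * F₀.1 * E - F₁.1 * F₀.2 * E') - F.1 * F.2 * (E - E')‖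
      ≤ 2 * ((D₁ * D₀ + D₀) * M ^ 2 / lam l) := by
    have e : (F₁.2 * F₀.1 * E - F₁.1 * F₀.2 * E') - F.1 * F.2 * (E - E')
        = (((F₁ - F).2 * F₀.1 + F.2 * (F₀ - F).1) * E)
          - (((F₁ - F).1 * F₀.2 + F.1 * (F₀ - F).2) * E') := by
      simp only [Prod.fst_sub, Prod.snd_sub]; ring
    rw [e]
    have hb : ∀ a b c d : ℂ, ‖a‖ ≤ ‖F₁ - F‖ → ‖b‖ ≤ ‖F₀‖ → ‖c‖ ≤ ‖F‖ → ‖d‖ ≤ ‖F₀ - F‖ →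
        ‖a * b + c * d‖ ≤ (D₁ * D₀ + D₀) * M ^ 2 / lam l := by
      intro a b c d ha hb hc hd
      refine (norm_add_le _ _).trans ?_
      rw [norm_mul, norm_mul]
      calc ‖a‖ * ‖b‖ + ‖c‖ * ‖d‖ ≤ (D₁ / lam l * M) * (D₀ * M) + M * (D₀ / lam l * M) := by
            gcongr
            · exact ha.trans p1
            · exact hb.trans n0
            · exact hc.trans hFM.le
            · exact hd.trans p0
        _ = _ := by ring
    refine (norm_sub_le _ _).trans ?_
    rw [norm_mul, norm_mul, hEn, hEn', mul_one, mul_one, two_mul]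
    exact add_le_add
      (hb _ _ _ _ (norm_snd_le _) (norm_fst_le _) (norm_snd_le _) (norm_fst_le _))
      (hb _ _ _ _ (norm_fst_le _) (norm_snd_le _) (norm_fst_le _) (norm_snd_le _))
  rw [← hmain, norm_evB, zf_comm_eq]
  refine (abs_norm_sub_norm_le _ _).trans ?_
  have e : -Complex.I / 2 * (F₁.2 * F₀.1 * E - F₁.1 * F₀.2 * E')
        + ((1 / 2 * (Real.cot t₁ - Real.cot t₀) : ℝ) : ℂ) * (zf l r n t₀ * zf l r n t₁)
        - -Complex.I / 2 * (F.1 * F.2 * (E - E'))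
      = -Complex.I / 2 * ((F₁.2 * F₀.1 * E - F₁.1 * F₀.2 * E') - F.1 * F.2 * (E - E'))
        + ((1 / 2 * (Real.cot t₁ - Real.cot t₀) : ℝ) : ℂ) * (zf l r n t₀ * zf l r n t₁) := by ring
  rw [e]
  refine (norm_add_le _ _).trans ?_
  rw [norm_mul, norm_div, norm_neg, Complex.norm_I]
  have h2 : ‖(2 : ℂ)‖ = 2 := by norm_num
  rw [h2]
  calc _ ≤ 1 / 2 * (2 * ((D₁ * D₀ + D₀) * M ^ 2 / lam l)) + k * (D₀ * D₁) * M ^ 2 / lam l := by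
        gcongr
    _ = _ := by ring


/-! ### From the parameters to square summability. -/

open ComplexConjugate Filter Topology

/-! ### The parameters of the modes and the equator values of the Legendre functions -/

/-- At x = 0 the recurrence is P_{2n+2} = -(2n+1)/(2n+2) P_{2n}, whose square cancels the Wallis
factor. The limit of W explains the constant √(π/2) in (*). -/
lemma legendreP_zero_sq (n : ℕ) : legendreP (2 * n) 0 ^ 2 * ((2 * n + 1) * Real.Wallis.W n) = 1 := by
  induction n with
  | zero => simp [legendreP, legendreRec, Real.Wallis.W]
  | succ n ih =>
    have h := isLegendre_P.recur (2 * n) 0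
    rw [mul_zero, zero_mul, zero_sub] at h
    rw [Real.Wallis.W_succ, show 2 * (n + 1) = 2 * n + 2 by ring]
    have e : legendreP (2 * n + 2) 0 = -((2 * n + 1) / (2 * n + 2)) * legendreP (2 * n) 0 := by
      push_cast at h
      field_simp
      linarith
    rw [e]
    push_cast
    have h2 : (2 * (n : ℝ) + 1) ≠ 0 := by positivity
    have h3 : (2 * (n : ℝ) + 2) ≠ 0 := by positivity
    have h4 : (2 * (n : ℝ) + 3) ≠ 0 := by positivity
    field_simp
    linear_combination (2 * (n : ℝ) + 3) * ih

lemma legendreP_odd_zero (n : ℕ) : legendreP (2 * n + 1) 0 = 0 := by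
  induction n with
  | zero => simp [legendreP, legendreRec]
  | succ n ih =>
    have h := isLegendre_P.recur (2 * n + 1) 0
    rw [ih] at h
    rw [mul_zero, zero_mul, mul_zero, sub_zero] at h
    exact (mul_eq_zero.mp h).resolve_left (by positivity)

lemma legendreQ_even_zero (n : ℕ) : legendreQ (2 * n) 0 = 0 := by
  induction n with
  | zero => simp [legendreQ, legendreRec]
  | succ n ih =>
    have h := isLegendre_Q.recur (2 * n) 0
    rw [ih] at h
    rw [mul_zero, zero_mul, mul_zero, sub_zero] at h
    exact (mul_eq_zero.mp h).resolve_left (by positivity)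

/-- At π/2 one has cos = 0 and sin = 1, so each basic mode reduces to R_l(0)/√2 and its derivative
to (l+1) R_{l+1}(0)/√2. -/
lemma two_mul_norm_vAmp_sq (l : ℕ) {r : ℝ} (n : ℝ) (hr : r ≠ 0) :
    2 * ‖vAmp l r n (Real.pi / 2)‖ ^ 2
      = lam l * ((r * legendreP l 0 + n * legendreQ l 0) ^ 2 + (r⁻¹ * legendreQ l 0) ^ 2)
        + ((l + 1) ^ 2 * ((r * legendreP (l + 1) 0 + n * legendreQ (l + 1) 0) ^ 2
          + (r⁻¹ * legendreQ (l + 1) 0) ^ 2)) / lam l - 2 := by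
  rw [(norm_amp_sq l n hr half_pi_mem).2, ← Complex.normSq_eq_norm_sq, ← Complex.normSq_eq_norm_sq]
  have h2 : Real.sqrt 2 ^ 2 = 2 := Real.sq_sqrt zero_le_two
  have h2' : Real.sqrt 2 ≠ 0 := by positivity
  simp only [zf, zf', Complex.normSq_mk, uvFn, uvFn', u₀, v₀, modeOf', legendreD, Real.cos_pi_div_two,
    Real.sin_pi_div_two, Real.sqrt_one]
  have hl := (lam_pos l).ne'
  field_simp
  rw [h2]
  ring

/-- The combination of Legendre values which determines the size of the outgoing amplitudes. -/
lemma exists_kappa (l : ℕ) : ∃ κ : ℝ, 0 < κ ∧ |κ * Real.sqrt (Real.pi / 2) - 1| ≤ 1 / lam l ∧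
    ∀ r n : ℝ, r ≠ 0 → 2 * ‖vAmp l r n (Real.pi / 2)‖ ^ 2
      = (r * κ - 1 / (r * κ)) ^ 2 + n ^ 2 / κ ^ 2 := by
  have hlam := lam_pos l
  -- For y ≥ 0 one has |y - 1| ≤ |y² - 1|, so it is enough to estimate κ², which is rational in l
  -- and W.
  suffices h : ∃ κ : ℝ, 0 < κ ∧ |κ ^ 2 * (Real.pi / 2) - 1| ≤ 1 / lam l ∧
    ∀ r n : ℝ, r ≠ 0 → 2 * ‖vAmp l r n (Real.pi / 2)‖ ^ 2
      = (r * κ - 1 / (r * κ)) ^ 2 + n ^ 2 / κ ^ 2 by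
    obtain ⟨κ, h1, h2, h3⟩ := h
    refine ⟨κ, h1, le_trans ?_ h2, h3⟩
    have hy : 0 ≤ κ * Real.sqrt (Real.pi / 2) := by positivity
    have e : κ ^ 2 * (Real.pi / 2) - 1
        = (κ * Real.sqrt (Real.pi / 2) - 1) * (κ * Real.sqrt (Real.pi / 2) + 1) := by
      have : Real.sqrt (Real.pi / 2) ^ 2 = Real.pi / 2 := Real.sq_sqrt (by positivity)
      linear_combination (-κ ^ 2) * this
    rw [e, abs_mul, abs_of_nonneg (a := κ * Real.sqrt (Real.pi / 2) + 1) (by linarith)]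
    exact le_mul_of_one_le_right (abs_nonneg _) (by linarith)
  have hcas := legendre_casoratian l 0
  obtain ⟨m, hm⟩ := Nat.even_or_odd' l
  have hW := Real.Wallis.W_pos m
  have hW1 := Real.Wallis.W_le m
  have hW2 := Real.Wallis.le_W m
  have hp := legendreP_zero_sq m
  have hm0 : (0 : ℝ) ≤ m := Nat.cast_nonneg m
  set W := Real.Wallis.W m
  have hpi := Real.pi_pos
  have hW3 : Real.pi / 2 / W ≤ (2 * m + 2) / (2 * m + 1) := by
    rw [div_mul_eq_mul_div, div_le_iff₀ (by positivity)] at hW2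
    rw [div_le_div_iff₀ hW (by positivity)]
    linarith
  have hW4 : 1 ≤ Real.pi / 2 / W := by rw [le_div_iff₀ hW]; linarith
  rcases hm with rfl | rfl
  · have hl : lam (2 * m) = 2 * m + 1 / 2 := by simp [lam]
    rw [legendreP_odd_zero, legendreQ_even_zero] at hcas
    have hP0 : legendreP (2 * m) 0 ≠ 0 := by rintro h; simp [h] at hp
    -- For even l both Q_l(0) and P_{l+1}(0) vanish, and the Casoratian gives Q_{l+1}(0) = -1/((l+1)
    -- P_l(0)). Only P_l(0) remains, and the expression becomes a sum of two squares.
    refine ⟨Real.sqrt (lam (2 * m)) * |legendreP (2 * m) 0|, by positivity, ?_, fun r n hr => ?_⟩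
    · rw [mul_pow, sq_abs, Real.sq_sqrt hlam.le, hl]
      have e : (2 * m + 1 / 2 : ℝ) * legendreP (2 * m) 0 ^ 2 * (Real.pi / 2)
          = (2 * m + 1 / 2) / (2 * m + 1) * (Real.pi / 2 / W) := by
        rw [eq_div_of_mul_eq (by positivity) hp]
        field_simp
      rw [e, abs_le]
      constructor
      · have : (2 * m + 1 / 2) / (2 * m + 1) * 1 ≤ (2 * m + 1 / 2) / (2 * m + 1) * (Real.pi / 2 / W) := by
          gcongr
        have h5 : 1 - 1 / (2 * m + 1 / 2 : ℝ) ≤ (2 * m + 1 / 2) / (2 * m + 1) * 1 := by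
          rw [mul_one, one_sub_div (by positivity), div_le_div_iff₀ (by positivity) (by positivity)]
          nlinarith
        linarith
      · have : (2 * m + 1 / 2) / (2 * m + 1) * (Real.pi / 2 / W)
            ≤ 1 * ((2 * m + 2) / (2 * m + 1)) := by
          gcongr
          rw [div_le_one (by positivity)]; linarith
        have h5 : (2 * m + 2) / (2 * m + 1) ≤ 1 + 1 / (2 * m + 1 / 2 : ℝ) := by
          rw [one_add_div (by positivity), div_le_div_iff₀ (by positivity) (by positivity)]
          nlinarith
        linarith
    · rw [two_mul_norm_vAmp_sq _ n hr, legendreP_odd_zero, legendreQ_even_zero]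
      have hq : legendreQ (2 * m + 1) 0
          = -1 / (((2 * m : ℕ) + 1) * legendreP (2 * m) 0) := by
        rw [eq_div_iff (by positivity)]; linarith
      rw [hq]
      have hs2 : Real.sqrt (lam (2 * m)) ^ 2 = lam (2 * m) := Real.sq_sqrt hlam.le
      have ha : |legendreP (2 * m) 0| ^ 2 = legendreP (2 * m) 0 ^ 2 := sq_abs _
      have ha0 : |legendreP (2 * m) 0| ≠ 0 := abs_ne_zero.mpr hP0
      have hs0 : Real.sqrt (lam (2 * m)) ≠ 0 := (Real.sqrt_pos.mpr hlam).ne'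
      have hc0 : (((2 * m : ℕ) : ℝ) + 1) ≠ 0 := by positivity
      generalize (((2 * m : ℕ) : ℝ) + 1) = c at *
      generalize Real.sqrt (lam (2 * m)) = s at *
      rw [← hs2]
      generalize legendreP (2 * m) 0 = p at *
      generalize |p| = a at *
      rw [show (r * p + n * 0) ^ 2 = r ^ 2 * a ^ 2 by rw [ha]; ring]
      rw [show (c ^ 2 * ((r * 0 + n * (-1 / (c * p))) ^ 2 + (r⁻¹ * (-1 / (c * p))) ^ 2))
        = (n ^ 2 + (r⁻¹) ^ 2) / a ^ 2 by rw [ha, mul_zero, zero_add]; field_simp]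
      field_simp
      ring
  · have hl : lam (2 * m + 1) = 2 * m + 3 / 2 := by simp [lam]; ring
    rw [legendreP_odd_zero] at hcas
    have hP0 : legendreP (2 * m + 1 + 1) 0 ≠ 0 := by rintro h; simp [h] at hcas
    have hrec := isLegendre_P.recur (2 * m) 0
    -- For odd l the roles are exchanged: P_l(0) and Q_{l+1}(0) vanish, and P_{l+1}(0), with weight
    -- l + 1 = 2m + 2, determines κ.
    refine ⟨(2 * m + 2) * |legendreP (2 * m + 1 + 1) 0| / Real.sqrt (lam (2 * m + 1)),
      by positivity, ?_, fun r n hr => ?_⟩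
    · rw [div_pow, mul_pow, sq_abs, Real.sq_sqrt hlam.le, hl]
      have e : ((2 * m + 2) ^ 2 * legendreP (2 * m + 1 + 1) 0 ^ 2 / (2 * m + 3 / 2) : ℝ) * (Real.pi / 2)
          = (2 * m + 1) / (2 * m + 3 / 2) * (Real.pi / 2 / W) := by
        have e1 : ((2 * m + 2) ^ 2 * legendreP (2 * m + 1 + 1) 0 ^ 2 : ℝ)
            = (2 * m + 1) ^ 2 * legendreP (2 * m) 0 ^ 2 := by
          rw [← mul_pow, ← mul_pow]
          push_cast at hrec
          rw [hrec]
          ring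
        rw [e1, eq_div_of_mul_eq (by positivity) hp]
        field_simp
      rw [e, abs_le]
      constructor
      · have : (2 * m + 1) / (2 * m + 3 / 2) * 1 ≤ (2 * m + 1) / (2 * m + 3 / 2) * (Real.pi / 2 / W) := by
          gcongr
        have h5 : 1 - 1 / (2 * m + 3 / 2 : ℝ) ≤ (2 * m + 1) / (2 * m + 3 / 2) * 1 := by
          rw [mul_one, one_sub_div (by positivity), div_le_div_iff₀ (by positivity) (by positivity)]
          nlinarith
        linarith
      · have : (2 * m + 1) / (2 * m + 3 / 2) * (Real.pi / 2 / W)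
            ≤ (2 * m + 1) / (2 * m + 3 / 2) * ((2 * m + 2) / (2 * m + 1)) := by
          gcongr
        have h5 : (2 * m + 1) / (2 * m + 3 / 2) * ((2 * m + 2) / (2 * m + 1))
            ≤ 1 + 1 / (2 * m + 3 / 2 : ℝ) := by
          rw [one_add_div (by positivity), div_mul_div_comm,
            div_le_div_iff₀ (by positivity) (by positivity)]
          nlinarith
        linarith
    · have hQ0 : legendreQ (2 * m + 1 + 1) 0 = 0 := legendreQ_even_zero (m + 1)
      rw [two_mul_norm_vAmp_sq _ n hr, legendreP_odd_zero, hQ0]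
      have hcc : (((2 * m + 1 : ℕ) : ℝ) + 1) = 2 * m + 2 := by push_cast; ring
      rw [hcc] at hcas ⊢
      have hc0 : (2 * (m : ℝ) + 2) ≠ 0 := by positivity
      have hq : legendreQ (2 * m + 1) 0 = 1 / ((2 * m + 2) * legendreP (2 * m + 1 + 1) 0) := by
        rw [eq_div_iff (by positivity)]; linarith
      rw [hq]
      have hs2 : Real.sqrt (lam (2 * m + 1)) ^ 2 = lam (2 * m + 1) := Real.sq_sqrt hlam.le
      have ha : |legendreP (2 * m + 1 + 1) 0| ^ 2 = legendreP (2 * m + 1 + 1) 0 ^ 2 := sq_abs _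
      have ha0 : |legendreP (2 * m + 1 + 1) 0| ≠ 0 := abs_ne_zero.mpr hP0
      have hs0 : Real.sqrt (lam (2 * m + 1)) ≠ 0 := (Real.sqrt_pos.mpr hlam).ne'
      generalize 2 * (m : ℝ) + 2 = c at *
      generalize Real.sqrt (lam (2 * m + 1)) = s at *
      rw [← hs2]
      generalize legendreP (2 * m + 1 + 1) 0 = p at *
      generalize |p| = a at *
      rw [show (r * 0 + n * (1 / (c * p))) ^ 2 + (r⁻¹ * (1 / (c * p))) ^ 2
        = (n ^ 2 + (r⁻¹) ^ 2) / (c ^ 2 * a ^ 2) by rw [ha, mul_zero, zero_add]; field_simp]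
      rw [show (r * p + n * 0) ^ 2 + (r⁻¹ * 0) ^ 2 = r ^ 2 * a ^ 2 by rw [ha]; ring]
      field_simp
      ring


open ComplexConjugate Filter Topology

/-! ### Square summability of the Bogoliubov coefficients -/

lemma summable_inv_lam_sq : Summable fun l => (1 / lam l) ^ 2 := by
  have h := (summable_nat_add_iff 1).mpr (Real.summable_one_div_nat_pow.mpr one_lt_two)
  refine Summable.of_nonneg_of_le (fun l => by positivity) (fun l => ?_) (h.mul_left 4)
  have h0 : (0 : ℝ) ≤ l := Nat.cast_nonneg l
  rw [lam, div_pow, one_pow, mul_one_div, div_le_div_iff₀ (by positivity) (by positivity)]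
  push_cast
  nlinarith

lemma tendsto_inv_lam : Tendsto (fun l => 1 / lam l) atTop (𝓝 0) := by
  have h : Tendsto lam atTop atTop :=
    tendsto_atTop_add_const_right _ _ tendsto_natCast_atTop_atTop
  exact h.inv_tendsto_atTop.congr fun l => (one_div _).symm

lemma tendsto_zero_of_summable_sq {x : ℕ → ℝ} (h : Summable fun l => x l ^ 2) :
    Tendsto x atTop (𝓝 0) := by
  have := h.tendsto_atTop_zero
  rw [tendsto_zero_iff_abs_tendsto_zero]
  have h2 := (Real.continuous_sqrt.tendsto 0).comp this
  simpa [Function.comp_def, Real.sqrt_sq_eq_abs] using h2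

lemma summable_of_eventually_le {f g : ℕ → ℝ} (hf : ∀ l, 0 ≤ f l) (hg : Summable g)
    (h : ∀ᶠ l in atTop, f l ≤ g l) : Summable f :=
  hg.of_norm_bounded_eventually_nat (h.mono fun l hl => by rwa [Real.norm_of_nonneg (hf l)])

lemma sub_inv_sq_le {x : ℝ} (hx : 1 / 4 ≤ x) : (x - 1 / x) ^ 2 ≤ 25 * (x - 1) ^ 2 := by
  have hx0 : 0 < x := by linarith
  have e : x - 1 / x = (x - 1) * (1 + 1 / x) := by field_simp; ring
  have h1 : 1 / x ≤ 4 := by rw [div_le_iff₀ hx0]; linarith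
  have h2 : 0 < 1 / x := by positivity
  rw [e, mul_pow, mul_comm]
  refine mul_le_mul_of_nonneg_right ?_ (sq_nonneg _)
  nlinarith

lemma sq_sub_one_le {x : ℝ} (hx : 0 < x) : (x - 1) ^ 2 ≤ (x - 1 / x) ^ 2 := by
  have e : x - 1 / x = (x - 1) * (1 + 1 / x) := by field_simp; ring
  have h2 : 0 < 1 / x := by positivity
  rw [e, mul_pow]
  exact le_mul_of_one_le_right (sq_nonneg _) (by nlinarith)

/-- The outgoing amplitudes at the moment of time symmetry are square summable precisely if the
parameters satisfy the summability condition. -/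
theorem summable_vAmp_iff {ρ ν : ℕ → ℝ} (hρ : ∀ l, 0 < ρ l) :
    (Summable fun l => ‖vAmp l (ρ l) (ν l) (Real.pi / 2)‖ ^ 2) ↔
      (Summable fun l => (ρ l - Real.sqrt (Real.pi / 2)) ^ 2) ∧ Summable fun l => ν l ^ 2 := by
  choose κ hκ hκ1 hv using exists_kappa
  set s := Real.sqrt (Real.pi / 2)
  have hs : 0 < s := Real.sqrt_pos.mpr (by positivity)
  have hv' := fun l => hv l (ρ l) (ν l) (hρ l).ne'
  have ha : ∀ᶠ l in atTop, 1 / lam l ≤ 1 / 2 :=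
    tendsto_inv_lam.eventually_le_const (by norm_num)
  have hκs : ∀ᶠ l in atTop, 1 / 2 ≤ κ l * s ∧ κ l * s ≤ 3 / 2 := ha.mono fun l hl => by
    have := abs_le.mp ((hκ1 l).trans hl)
    exact ⟨by linarith [this.1], by linarith [this.2]⟩
  constructor
  · intro h
    constructor
    · refine summable_of_eventually_le (fun l => sq_nonneg _)
        (((h.mul_left 2).add summable_inv_lam_sq).mul_left (8 * s ^ 2)) ?_
      filter_upwards [hκs] with l hl
      have h1 := sq_sub_one_le (mul_pos (hρ l) (hκ l))
      have h2 := hv' l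
      have h3 : 0 ≤ ν l ^ 2 / κ l ^ 2 := by positivity
      have h4 : (κ l * s - 1) ^ 2 ≤ (1 / lam l) ^ 2 := by
        rw [← sq_abs (κ l * s - 1)]
        exact pow_le_pow_left₀ (abs_nonneg _) (hκ1 l) 2
      have h5 : 0 < κ l := hκ l
      have h6 : (ρ l - s) ^ 2 ≤ 4 * s ^ 2 * (κ l * (ρ l - s)) ^ 2 := by
        have : 1 ≤ (2 * (κ l * s)) ^ 2 := by nlinarith
        calc (ρ l - s) ^ 2 = 1 * (ρ l - s) ^ 2 := (one_mul _).symm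
          _ ≤ (2 * (κ l * s)) ^ 2 * (ρ l - s) ^ 2 :=
            mul_le_mul_of_nonneg_right this (sq_nonneg _)
          _ = _ := by ring
      -- κ(ρ - s) = (ρκ - 1) - (κs - 1): the first difference is controlled by ρκ - 1/(ρκ), the
      -- second is O(1/λ) and square summable.
      have h7 : (κ l * (ρ l - s)) ^ 2 ≤ 2 * ((ρ l * κ l - 1) ^ 2 + (κ l * s - 1) ^ 2) := by
        nlinarith [sq_nonneg ((ρ l * κ l - 1) + (κ l * s - 1))]
      refine h6.trans ?_
      calc _ ≤ 4 * s ^ 2 * (2 * (2 * ‖vAmp l (ρ l) (ν l) (Real.pi / 2)‖ ^ 2 + (1 / lam l) ^ 2)) := by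
            refine mul_le_mul_of_nonneg_left (h7.trans ?_) (by positivity)
            linarith
        _ = _ := by ring
    · refine summable_of_eventually_le (fun l => sq_nonneg _) (h.mul_left (9 / 2 / s ^ 2)) ?_
      filter_upwards [hκs] with l hl
      have h2 := hv' l
      have h5 : 0 < κ l := hκ l
      have h3 : ν l ^ 2 / κ l ^ 2 ≤ 2 * ‖vAmp l (ρ l) (ν l) (Real.pi / 2)‖ ^ 2 := by
        rw [h2]; linarith [sq_nonneg (ρ l * κ l - 1 / (ρ l * κ l))]
      rw [div_le_iff₀ (by positivity)] at h3
      refine h3.trans ?_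
      have h4 : κ l ^ 2 ≤ 9 / 4 / s ^ 2 := by
        rw [le_div_iff₀ (by positivity), ← mul_pow]
        nlinarith
      calc _ ≤ 2 * ‖vAmp l (ρ l) (ν l) (Real.pi / 2)‖ ^ 2 * (9 / 4 / s ^ 2) :=
            mul_le_mul_of_nonneg_left h4 (by positivity)
        _ = _ := by ring
  · rintro ⟨hr, hn⟩
    refine summable_of_eventually_le (fun l => sq_nonneg _)
      (((hr.mul_left (9 / (4 * s ^ 2))).add summable_inv_lam_sq).mul_left 25 |>.add
        (hn.mul_left (2 * s ^ 2))) ?_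
    have hrs : ∀ᶠ l in atTop, -(s / 2) ≤ ρ l - s :=
      (tendsto_zero_of_summable_sq hr).eventually_const_le (by linarith)
    filter_upwards [hκs, hrs] with l hl hrl
    have h5 : 0 < κ l := hκ l
    have h2 := hv' l
    -- Eventually ρ ≥ s/2 and κs ≥ 1/2; away from 0 the quantity x - 1/x is comparable to x - 1.
    have hx : 1 / 4 ≤ ρ l * κ l := by nlinarith
    have h1 := sub_inv_sq_le hx
    have h4 : (κ l * s - 1) ^ 2 ≤ (1 / lam l) ^ 2 := by
      rw [← sq_abs (κ l * s - 1)]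
      exact pow_le_pow_left₀ (abs_nonneg _) (hκ1 l) 2
    have h6 : κ l ^ 2 ≤ 9 / (4 * s ^ 2) := by
      rw [le_div_iff₀ (by positivity)]
      nlinarith
    have h7 : (ρ l * κ l - 1) ^ 2 ≤ 2 * (9 / (4 * s ^ 2) * (ρ l - s) ^ 2 + (1 / lam l) ^ 2) := by
      have : κ l ^ 2 * (ρ l - s) ^ 2 ≤ 9 / (4 * s ^ 2) * (ρ l - s) ^ 2 :=
        mul_le_mul_of_nonneg_right h6 (sq_nonneg _)
      nlinarith [sq_nonneg (κ l * (ρ l - s) - (κ l * s - 1))]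
    have h8 : ν l ^ 2 / κ l ^ 2 ≤ 4 * s ^ 2 * ν l ^ 2 := by
      rw [div_le_iff₀ (by positivity)]
      have : 1 ≤ (2 * (κ l * s)) ^ 2 := by nlinarith
      calc ν l ^ 2 ≤ ν l ^ 2 * (2 * (κ l * s)) ^ 2 := le_mul_of_one_le_right (sq_nonneg _) this
        _ = _ := by ring
    linarith

/-- The relation between the norms of the incoming and the outgoing amplitudes. -/
lemma norm_wAmp_sq (l : ℕ) {r : ℝ} (n : ℝ) (hr : r ≠ 0) :
    ‖wAmp l r n (Real.pi / 2)‖ ^ 2 = 2 + ‖vAmp l r n (Real.pi / 2)‖ ^ 2 := by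
  obtain ⟨h1, h2⟩ := norm_amp_sq l n hr half_pi_mem
  linarith

/-- The evolution is square summable if the outgoing amplitudes are. -/
theorem summable_evB {ρ ν : ℕ → ℝ} (hρ : ∀ l, 0 < ρ l)
    (h : Summable fun l => ‖vAmp l (ρ l) (ν l) (Real.pi / 2)‖ ^ 2) {t₀ t₁ : ℝ} (h0 : t₀ ∈ IT)
    (h1 : t₁ ∈ IT) : Summable fun l => ‖evB l (ρ l) (ν l) t₁ t₀‖ ^ 2 := by
  obtain ⟨C, hC, hb⟩ := exists_evB_bound h0 h1
  refine summable_of_eventually_le (fun l => sq_nonneg _)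
    ((h.mul_left 6).add (summable_inv_lam_sq.mul_left (18 * C ^ 2))) ?_
  filter_upwards [h.tendsto_atTop_zero.eventually_le_const one_pos] with l hl
  have hlam := lam_pos l
  have h2 := (abs_le.mp (hb l (ρ l) (ν l) (hρ l).ne')).2
  have hw := norm_wAmp_sq l (ν l) (hρ l).ne'
  set v := ‖vAmp l (ρ l) (ν l) (Real.pi / 2)‖
  set w := ‖wAmp l (ρ l) (ν l) (Real.pi / 2)‖
  have hv0 : 0 ≤ v := norm_nonneg _
  have hw0 : 0 ≤ w := norm_nonneg _
  have hw3 : w ^ 2 ≤ 3 := by linarith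
  have h3 : w * v * |Real.sin (lam l * (t₁ - t₀))| ≤ w * v :=
    mul_le_of_le_one_right (by positivity) (Real.abs_sin_le_one _)
  have h4 : C * w ^ 2 / lam l ≤ 3 * C * (1 / lam l) := by
    rw [mul_one_div, mul_comm 3 C]
    exact div_le_div_of_nonneg_right (mul_le_mul_of_nonneg_left hw3 hC) hlam.le
  have h5 : ‖evB l (ρ l) (ν l) t₁ t₀‖ ≤ w * v + 3 * C * (1 / lam l) := by linarith
  calc _ ≤ (w * v + 3 * C * (1 / lam l)) ^ 2 := pow_le_pow_left₀ (norm_nonneg _) h5 2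
    _ ≤ 2 * (w ^ 2 * v ^ 2 + 9 * C ^ 2 * (1 / lam l) ^ 2) := by
        nlinarith [sq_nonneg (w * v - 3 * C * (1 / lam l))]
    _ ≤ 2 * (3 * v ^ 2 + 9 * C ^ 2 * (1 / lam l) ^ 2) := by gcongr
    _ = _ := by ring

/-- Here λ_l π/2 = π/4 + l π/2 is an odd multiple of π/4. The pair of times π/4, 3π/4 is chosen so
that the sine is bounded away from 0 for every l. -/
lemma abs_sin_lam_mul (l : ℕ) :
    |Real.sin (lam l * (3 * Real.pi / 4 - Real.pi / 4))| = Real.sqrt 2 / 2 := by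
  have key : ∀ l : ℕ, |Real.sin (lam l * (3 * Real.pi / 4 - Real.pi / 4))| = Real.sqrt 2 / 2 ∧
      |Real.cos (lam l * (3 * Real.pi / 4 - Real.pi / 4))| = Real.sqrt 2 / 2 := by
    intro l
    induction l with
    | zero =>
      have e : lam 0 * (3 * Real.pi / 4 - Real.pi / 4) = Real.pi / 4 := by simp [lam]; ring
      rw [e, Real.sin_pi_div_four, Real.cos_pi_div_four, abs_of_nonneg (by positivity)]
      exact ⟨rfl, rfl⟩
    | succ l ih =>
      have e : lam (l + 1) * (3 * Real.pi / 4 - Real.pi / 4)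
          = lam l * (3 * Real.pi / 4 - Real.pi / 4) + Real.pi / 2 := by
        simp only [lam]; push_cast; ring
      rw [e, Real.sin_add_pi_div_two, Real.cos_add_pi_div_two, abs_neg]
      exact ⟨ih.2, ih.1⟩
  exact (key l).1

/-- The outgoing amplitudes are square summable if a suitable evolution is. -/
theorem summable_vAmp {ρ ν : ℕ → ℝ} (hρ : ∀ l, 0 < ρ l)
    (h : Summable fun l => ‖evB l (ρ l) (ν l) (3 * Real.pi / 4) (Real.pi / 4)‖ ^ 2) :
    Summable fun l => ‖vAmp l (ρ l) (ν l) (Real.pi / 2)‖ ^ 2 := by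
  have hpi := Real.pi_pos
  obtain ⟨C, hC, hb⟩ := exists_evB_bound (t₀ := Real.pi / 4) (t₁ := 3 * Real.pi / 4)
    ⟨by linarith, by linarith⟩ ⟨by linarith, by linarith⟩
  have hev := tendsto_zero_of_summable_sq h
  refine summable_of_eventually_le (fun l => sq_nonneg _)
    ((h.mul_left 2).add (summable_inv_lam_sq.mul_left (18 * C ^ 2))) ?_
  have hsmall : ∀ᶠ l in atTop,
      ‖evB l (ρ l) (ν l) (3 * Real.pi / 4) (Real.pi / 4)‖ + 3 * C * (1 / lam l) ≤ 1 / 8 := by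
    have := hev.add (tendsto_inv_lam.const_mul (3 * C))
    rw [mul_zero, add_zero] at this
    exact this.eventually_le_const (by norm_num)
  filter_upwards [hsmall] with l hl
  have hlam := lam_pos l
  have h2 := (abs_le.mp (hb l (ρ l) (ν l) (hρ l).ne')).1
  have hw := norm_wAmp_sq l (ν l) (hρ l).ne'
  rw [abs_sin_lam_mul] at h2
  set v := ‖vAmp l (ρ l) (ν l) (Real.pi / 2)‖
  set w := ‖wAmp l (ρ l) (ν l) (Real.pi / 2)‖
  set b := ‖evB l (ρ l) (ν l) (3 * Real.pi / 4) (Real.pi / 4)‖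
  have hv0 : 0 ≤ v := norm_nonneg _
  have hw0 : 0 ≤ w := norm_nonneg _
  have hb0 : 0 ≤ b := norm_nonneg _
  have hq : 0 ≤ C * (1 / lam l) := by positivity
  have hs2 : Real.sqrt 2 ^ 2 = 2 := Real.sq_sqrt zero_le_two
  have hwm : Real.sqrt 2 ≤ w :=
    (pow_le_pow_iff_left₀ (Real.sqrt_nonneg _) hw0 two_ne_zero).mp (by rw [hs2, hw]; nlinarith)
  have hwv : v ≤ w := (pow_le_pow_iff_left₀ hv0 hw0 two_ne_zero).mp (by linarith)
  have hs1 : 1 ≤ Real.sqrt 2 := by nlinarith [Real.sqrt_nonneg 2]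
  set q := C * (1 / lam l)
  have h3 : C * w ^ 2 / lam l = q * (2 + v ^ 2) := by rw [hw]; ring
  have h3b : w * v * (Real.sqrt 2 / 2) ≤ b + q * (2 + v ^ 2) := by linarith
  have hl' : b + 3 * q ≤ 1 / 8 := by simp only [q]; linarith
  have h6 : v ≤ w * v * (Real.sqrt 2 / 2) := by
    have : 1 ≤ w * (Real.sqrt 2 / 2) := by nlinarith
    nlinarith
  -- The error term contains w² = 2 + v², which is not known to be bounded. If v > 1, the main term
  -- is at least v²/2, whereas the right side is at most (b + 3q) v² ≤ v²/8.
  have hv1 : v ≤ 1 := by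
    by_contra hc
    push Not at hc
    have h7 : v ^ 2 * (1 / 2) ≤ w * v * (Real.sqrt 2 / 2) := by
      have : v * v ≤ w * v := mul_le_mul_of_nonneg_right hwv hv0
      nlinarith [mul_nonneg hw0 hv0]
    nlinarith
  have h8 : v ≤ b + 3 * q := by
    have := mul_le_of_le_one_right hq (pow_le_one₀ hv0 hv1 (n := 2))
    linarith
  calc v ^ 2 ≤ (b + 3 * q) ^ 2 := pow_le_pow_left₀ hv0 h8 2
    _ ≤ 2 * b ^ 2 + 18 * q ^ 2 := by nlinarith [sq_nonneg (b - 3 * q)]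
    _ = _ := by simp only [q]; ring

/-- The antilinear Bogoliubov coefficient of a change of parameters. -/
lemma norm_bogB_change (l : ℕ) {r r' : ℝ} (n n' : ℝ) {t : ℝ}
    (ht : t ∈ IT) :
    2 * ‖bogB (zf l r n t) (pf l r n t) (zf l r' n' t) (pf l r' n' t)‖
      ≤ |r * n' - r' * n| + |r / r' - r' / r| := by
  have hw := wronskian_u₀_v₀ l ht
  -- The cot terms cancel and only the constant Wronskian of ũ and ṽ remains, so the coefficient
  -- depends on the parameters alone and not on the time.
  have e : (zf l r n t * pf l r' n' t - zf l r' n' t * pf l r n t) * 2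
      = -(((r * n' - r' * n : ℝ) : ℂ) + ((r / r' - r' / r : ℝ) : ℂ) * Complex.I) := by
    rw [pf_eq, pf_eq]
    have e2 : zf l r n t * (zf' l r' n' t - ((1 / 2 * Real.cot t : ℝ) : ℂ) * zf l r' n' t)
        - zf l r' n' t * (zf' l r n t - ((1 / 2 * Real.cot t : ℝ) : ℂ) * zf l r n t)
        = zf l r n t * zf' l r' n' t - zf l r' n' t * zf' l r n t := by ring
    rw [e2]
    apply Complex.ext
    · simp [zf, zf', uvFn, uvFn']
      linear_combination (-(2 * (r * n' - r' * n))) * hw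
    · simp [zf, zf', uvFn, uvFn']
      linear_combination (-(2 * (r / r' - r' / r))) * hw
  have e3 : 2 * ‖bogB (zf l r n t) (pf l r n t) (zf l r' n' t) (pf l r' n' t)‖
      = ‖(zf l r n t * pf l r' n' t - zf l r' n' t * pf l r n t) * 2‖ := by
    rw [bogB, norm_mul, norm_neg, Complex.norm_I, one_mul, ← map_mul, ← map_mul, ← map_sub,
      RCLike.norm_conj, norm_mul, mul_comm]
    norm_num
  rw [e3, e, norm_neg]
  refine (norm_add_le _ _).trans (le_of_eq ?_)
  rw [norm_mul, Complex.norm_I, mul_one, Complex.norm_real, Complex.norm_real]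
  rfl

/-- The change between two parameter families satisfying the summability condition is square
summable. -/
theorem summable_bogB_change {ρ ν ρ' ν' : ℕ → ℝ} (hρ : ∀ l, 0 < ρ l) (hρ' : ∀ l, 0 < ρ' l)
    (h1 : Summable fun l => (ρ l - Real.sqrt (Real.pi / 2)) ^ 2) (h2 : Summable fun l => ν l ^ 2)
    (h1' : Summable fun l => (ρ' l - Real.sqrt (Real.pi / 2)) ^ 2)
    (h2' : Summable fun l => ν' l ^ 2) {t : ℝ} (ht : t ∈ IT) :
    Summable fun l => ‖bogB (zf l (ρ l) (ν l) t) (pf l (ρ l) (ν l) t) (zf l (ρ' l) (ν' l) t)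
      (pf l (ρ' l) (ν' l) t)‖ ^ 2 := by
  set s := Real.sqrt (Real.pi / 2)
  have hs : 0 < s := Real.sqrt_pos.mpr (by positivity)
  have ev : ∀ {r : ℕ → ℝ}, (Summable fun l => (r l - s) ^ 2) →
      ∀ᶠ l in atTop, s / 2 ≤ r l ∧ r l ≤ 2 * s := by
    intro r hr
    have h := tendsto_zero_of_summable_sq hr
    filter_upwards [h.eventually_const_le (show -(s / 2) < 0 by linarith),
      h.eventually_le_const hs] with l ha hb
    exact ⟨by linarith, by linarith⟩
  refine summable_of_eventually_le (fun l => sq_nonneg _)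
    (((h2.add h2').mul_left (4 * s ^ 2)).add ((h1.add h1').mul_left (256 / s ^ 2))) ?_
  filter_upwards [ev h1, ev h1'] with l hl hl'
  have hb := norm_bogB_change l (r := ρ l) (r' := ρ' l) (ν l) (ν' l) ht
  set B := ‖bogB (zf l (ρ l) (ν l) t) (pf l (ρ l) (ν l) t) (zf l (ρ' l) (ν' l) t)
      (pf l (ρ' l) (ν' l) t)‖
  have hB0 : 0 ≤ B := norm_nonneg _
  clear_value B
  have hr := hρ l
  have hr' := hρ' l
  generalize ρ l = r at *
  generalize ρ' l = r' at *
  generalize ν l = n at *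
  generalize ν' l = n' at *
  have b1 : |r * n' - r' * n| ≤ 2 * s * (|n'| + |n|) := by
    refine (abs_sub _ _).trans ?_
    rw [abs_mul, abs_mul, abs_of_pos hr, abs_of_pos hr', mul_add]
    exact add_le_add (mul_le_mul_of_nonneg_right hl.2 (abs_nonneg _))
      (mul_le_mul_of_nonneg_right hl'.2 (abs_nonneg _))
  have b2 : |r / r' - r' / r| ≤ 16 / s * (|r - s| + |r' - s|) := by
    have e : r / r' - r' / r = (r - r') * ((r + r') / (r * r')) := by field_simp; ring
    have e2 : (r + r') / (r * r') ≤ 16 / s := by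
      rw [div_le_div_iff₀ (by positivity) hs]
      have : s / 2 * (s / 2) ≤ r * r' := mul_le_mul hl.1 hl'.1 (by positivity) hr.le
      nlinarith
    have e3 : |r - r'| ≤ |r - s| + |r' - s| := by
      rw [abs_sub_comm r' s]; exact abs_sub_le _ _ _
    rw [e, abs_mul, abs_of_pos (a := (r + r') / (r * r')) (by positivity), mul_comm]
    exact mul_le_mul e2 e3 (abs_nonneg _) (by positivity)
  have hsum : 2 * B ≤ 2 * s * (|n'| + |n|) + 16 / s * (|r - s| + |r' - s|) := by linarith
  have two : ∀ x y : ℝ, (x + y) ^ 2 ≤ 2 * (x ^ 2 + y ^ 2) := fun x y => by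
    nlinarith [sq_nonneg (x - y)]
  have q1 : (2 * B) ^ 2 ≤ 2 * ((2 * s) ^ 2 * (2 * (n' ^ 2 + n ^ 2))
      + (16 / s) ^ 2 * (2 * ((r - s) ^ 2 + (r' - s) ^ 2))) := by
    refine (pow_le_pow_left₀ (by positivity) hsum 2).trans ((two _ _).trans ?_)
    rw [mul_pow, mul_pow (16 / s)]
    have t1 := two |n'| |n|
    have t2 := two |r - s| |r' - s|
    rw [sq_abs, sq_abs] at t1 t2
    gcongr
  have q2 : (16 / s) ^ 2 = 256 / s ^ 2 := by rw [div_pow]; norm_num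
  rw [q2] at q1
  linarith


/-! ### Arbitrary Fock representations and the three statements. -/

open ComplexConjugate Filter Topology

/-! ### The one-particle space in mode coordinates -/

namespace IsParam

variable {J : Sol →ₗ[ℝ] Sol} {ρ ν : ℕ → ℝ}

lemma fco_map (hp : IsParam J ρ ν) (hJ : IsInvariantComplexStructure J) (l : ℕ) (φ : Sol) :
    fco l (ρ l) (ν l) (J φ) = Complex.I * fco l (ρ l) (ν l) φ := by
  have e1 := hJ.Omega_left (uv l (ρ l) (ν l)) φ
  have e2 := hJ.Omega_left (uv l 0 (ρ l)⁻¹) φ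
  have hm := half_pi_mem
  rw [(hp l).2.1, neg_uv, Omega_uv _ _ _ _ hm] at e1
  rw [(hp l).2.2] at e2
  have e3 := Omega_uv l 0 (ρ l)⁻¹ φ hm
  simp only [uvFn, uvFn'] at e1 e3
  apply Complex.ext
  · simp [fco]; linarith
  · simp [fco]; linarith

/-- The inner product in mode coordinates. -/
lemma hasSum_innerJ (hp : IsParam J ρ ν) (hJ : IsInvariantComplexStructure J) (φ η : AxiSol) :
    HasSum (fun l => conj (fco l (ρ l) (ν l) φ) * fco l (ρ l) (ν l) η) (innerJ J φ η) := by
  have hm := half_pi_mem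
  have key : ∀ φ η : AxiSol, HasSum (fun l => Complex.I *
      (conj (fco l (ρ l) (ν l) φ) * fco l (ρ l) (ν l) η
        - fco l (ρ l) (ν l) φ * conj (fco l (ρ l) (ν l) η))) ((Omega φ η : ℝ) : ℂ) := by
    intro φ η
    refine (Complex.hasSum_ofReal.mpr (hasSum_Omega φ η)).congr_fun fun l => ?_
    have hr := (hp l).1.ne'
    obtain ⟨a1, a2⟩ := cf_eq l (ν l) hr φ hm
    obtain ⟨b1, b2⟩ := cf_eq l (ν l) hr η hm
    have hz := zf_pf l (ν l) hr hm
    have e : ((cf η l (Real.pi / 2) * cf' φ l (Real.pi / 2)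
        - cf φ l (Real.pi / 2) * cf' η l (Real.pi / 2) : ℝ) : ℂ)
        = (cf η l (Real.pi / 2) : ℂ) * ((cf' φ l (Real.pi / 2)
          - 1 / 2 * Real.cot (Real.pi / 2) * cf φ l (Real.pi / 2) : ℝ) : ℂ)
        - (cf φ l (Real.pi / 2) : ℂ) * ((cf' η l (Real.pi / 2)
          - 1 / 2 * Real.cot (Real.pi / 2) * cf η l (Real.pi / 2) : ℝ) : ℂ) := by
      push_cast; ring
    refine Eq.trans ?_ (Eq.trans e.symm ?_)
    · rw [a1, a2, b1, b2, ← hz]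
      ring
    · rfl
  -- With coordinates a, b the form Ω is ∑ i(ā b - a b̄), and J multiplies a by i; the two halves of
  -- the inner product therefore keep ā b and cancel a b̄.
  have h1 := (key ⟨J φ, hJ.map_mem φ.2⟩ η).mul_left (1 / 2)
  have h2 := (key φ η).mul_left (Complex.I / 2)
  have h := h1.sub h2
  have e : innerJ J φ η = 1 / 2 * ((Omega (J φ) η : ℝ) : ℂ)
      - Complex.I / 2 * ((Omega φ η : ℝ) : ℂ) := by
    rw [innerJ]; push_cast; ring
  rw [e]
  refine h.congr_fun fun l => ?_
  show _ = 1 / 2 * (Complex.I * (conj (fco l (ρ l) (ν l) (J φ)) * fco l (ρ l) (ν l) η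
        - fco l (ρ l) (ν l) (J φ) * conj (fco l (ρ l) (ν l) η))) - _
  rw [hp.fco_map hJ, map_mul, Complex.conj_I]
  generalize fco l (ρ l) (ν l) φ = a
  generalize fco l (ρ l) (ν l) η = b
  linear_combination (conj a * b) * Complex.I_sq

lemma innerJ_self (J : Sol →ₗ[ℝ] Sol) (φ : Sol) :
    innerJ J φ φ = ((1 / 2 * Omega (J φ) φ : ℝ) : ℂ) := by
  have : Omega φ φ = 0 := by linarith [Omega_antisymm φ φ]
  rw [innerJ, this]
  simp

lemma hasSum_norm_fco (hp : IsParam J ρ ν) (hJ : IsInvariantComplexStructure J) (φ : AxiSol) :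
    HasSum (fun l => ‖fco l (ρ l) (ν l) φ‖ ^ 2) (1 / 2 * Omega (J φ) φ) :=
  ((hp.isOneParticleBasis hJ).complete φ).congr_fun fun l => by rw [hp.innerJ_wmode_left]

/-- The mode coordinates of an axially symmetric solution. -/
def coords (hp : IsParam J ρ ν) (hJ : IsInvariantComplexStructure J) (φ : AxiSol) : Ltwo ℕ :=
  ⟨fun l => fco l (ρ l) (ν l) φ, memLtwo_iff.mpr (hp.hasSum_norm_fco hJ φ).summable⟩

variable (hp : IsParam J ρ ν) (hJ : IsInvariantComplexStructure J)

lemma coords_apply (φ : AxiSol) (l : ℕ) : hp.coords hJ φ l = fco l (ρ l) (ν l) φ := rfl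

lemma inner_coords (φ η : AxiSol) : inner ℂ (hp.coords hJ φ) (hp.coords hJ η) = innerJ J φ η := by
  refine (lp.hasSum_inner (𝕜 := ℂ) _ _).unique ((hp.hasSum_innerJ hJ φ η).congr_fun fun l => ?_)
  rw [RCLike.inner_apply, coords_apply, coords_apply, mul_comm]

lemma coords_wmode (l : ℕ) (w : ℂ) :
    hp.coords hJ (wmode l (ρ l) (ν l) w) = w • (ket l : Ltwo ℕ) := by
  ext m
  rw [coords_apply, hp.fco_wmode, lp.coeFn_smul, Pi.smul_apply, ket_apply]
  simp [eq_comm]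

/-- Every one-particle basis is related to the mode coordinates by a unitary map. -/
lemma exists_isometry {e : ℕ → AxiSol} (he : IsOneParticleBasis J e) :
    ∃ R : Ltwo ℕ ≃ₗᵢ[ℂ] Ltwo ℕ, ∀ (φ : AxiSol) (k : ℕ),
      R (hp.coords hJ φ) k = innerJ J (e k) φ := by
  have hE : Orthonormal ℂ fun k => hp.coords hJ (e k) := by
    rw [orthonormal_iff_ite]
    intro k l
    rw [inner_coords, he.orthonormal]
  -- Parseval's identity is assumed only on solutions. It is applied to a mode v: if x is orthogonal
  -- to all e k, then Bessel's inequality for v + c x gives ‖v‖ ≤ ‖v + c x‖ for every c, which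
  -- forces ⟨x, v⟩ = 0.
  have htot : (Submodule.span ℂ (Set.range fun k => hp.coords hJ (e k)))ᗮ = ⊥ := by
    rw [Submodule.eq_bot_iff]
    intro x hx
    have hx' : ∀ k, inner ℂ (hp.coords hJ (e k)) x = 0 := fun k =>
      hx _ (Submodule.subset_span ⟨k, rfl⟩)
    have key : ∀ l, inner ℂ x (ket l : Ltwo ℕ) = 0 := by
      intro l
      set v : Ltwo ℕ := ket l with hv
      have hvc : v = hp.coords hJ (wmode l (ρ l) (ν l) 1) := by rw [coords_wmode, one_smul]
      have hpars : ∑' k, ‖inner ℂ (hp.coords hJ (e k)) v‖ ^ 2 = ‖v‖ ^ 2 := by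
        have h1 := (he.complete (wmode l (ρ l) (ν l) 1)).tsum_eq
        have h2 : ((‖v‖ ^ 2 : ℝ) : ℂ)
            = ((1 / 2 * Omega (J (wmode l (ρ l) (ν l) 1)) (wmode l (ρ l) (ν l) 1) : ℝ) : ℂ) := by
          rw [← innerJ_self J, ← hp.inner_coords hJ, ← hvc, inner_self_eq_norm_sq_to_K]
          push_cast
          rfl
        rw [Complex.ofReal_inj.mp h2, ← h1]
        refine tsum_congr fun k => ?_
        rw [hvc, inner_coords]
      -- A step short enough for ‖v + c x‖ to decrease unless ⟨x, v⟩ = 0; the added 1 avoids a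
      -- separate case x = 0.
      set t : ℝ := 1 / (‖x‖ ^ 2 + 1)
      have ht : 0 < t := by positivity
      set c : ℂ := -(t * inner ℂ x v)
      have h1 : ‖v‖ ^ 2 ≤ ‖v + c • x‖ ^ 2 := by
        rw [← hpars]
        refine le_trans (le_of_eq (tsum_congr fun k => ?_)) (hE.tsum_inner_products_le (v + c • x))
        rw [inner_add_right, inner_smul_right, hx', mul_zero, add_zero]
      rw [norm_add_sq (𝕜 := ℂ), inner_smul_right, norm_smul, mul_pow] at h1
      have h2 : c * inner ℂ v x = ((-(t * ‖inner ℂ x v‖ ^ 2) : ℝ) : ℂ) := by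
        rw [← inner_conj_symm v x]
        simp only [c]
        have := Complex.mul_conj' (inner ℂ x v)
        push_cast
        linear_combination (-(t : ℂ)) * this
      have h3 : ‖c‖ ^ 2 = t ^ 2 * ‖inner ℂ x v‖ ^ 2 := by
        simp only [c]
        rw [norm_neg, norm_mul, mul_pow, Complex.norm_real, Real.norm_eq_abs, sq_abs]
      rw [h2, h3] at h1
      have h4 : RCLike.re ((-(t * ‖inner ℂ x v‖ ^ 2) : ℝ) : ℂ) = -(t * ‖inner ℂ x v‖ ^ 2) :=
        Complex.ofReal_re _
      rw [h4] at h1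
      have h5 : t * (‖x‖ ^ 2 + 1) = 1 := by simp only [t]; field_simp
      have h6 : t * ‖inner ℂ x v‖ ^ 2 ≤ 0 := by
        have h7 : t ^ 2 * ‖inner ℂ x v‖ ^ 2 * ‖x‖ ^ 2
            = t * ‖inner ℂ x v‖ ^ 2 * (1 - t) := by
          linear_combination (t * ‖inner ℂ x v‖ ^ 2) * h5
        rw [h7] at h1
        nlinarith [mul_nonneg ht.le (mul_nonneg ht.le (sq_nonneg ‖inner ℂ x v‖))]
      have h8 : ‖inner ℂ x v‖ ^ 2 = 0 :=
        le_antisymm (nonpos_of_mul_nonpos_right h6 ht) (sq_nonneg _)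
      simpa using h8
    ext l
    have := key l
    rw [← inner_conj_symm, inner_ket] at this
    simpa using this
  let b := HilbertBasis.mkOfOrthogonalEqBot hE htot
  refine ⟨b.repr, fun φ k => ?_⟩
  rw [HilbertBasis.repr_apply_apply, HilbertBasis.coe_mkOfOrthogonalEqBot, inner_coords]

/-- The Fock representation in the mode basis. -/
lemma isFockRepresentation_weyl : IsFockRepresentation J fun φ => weyl (hp.coords hJ φ) := by
  refine ⟨_, hp.isOneParticleBasis hJ, fun φ => ?_⟩
  have e : (fun k => innerJ J (wmode k (ρ k) (ν k) 1) φ) = hp.coords hJ φ :=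
    funext fun k => hp.innerJ_wmode_left k φ
  rw [e]
  exact isWeylOperator_weyl _

end IsParam

/-! ### Unitary dynamics and unitary equivalence -/

variable {J J' : Sol →ₗ[ℝ] Sol}

/-- The given representation may use any one-particle basis, related to the modes by a unitary R. In
its occupation numbers the evolution need not be diagonal, but it is diagonal along the orthonormal
system R e_l, which is the generality of `summable_of_implemented`. A single pair of times is used.
-/
lemma UnitaryDynamics.hasSummableParameters (hJ : IsInvariantComplexStructure J)
    (h : UnitaryDynamics J) : HasSummableParameters J := by
  obtain ⟨ρ, ν, hp⟩ := hJ.exists_param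
  refine ⟨ρ, ν, hasParameters_iff.mpr hp, (summable_vAmp_iff fun l => (hp l).1).mp
    (summable_vAmp (fun l => (hp l).1) ?_)⟩
  obtain ⟨π, ⟨e, he, hπ⟩, hU⟩ := h
  obtain ⟨R, hR⟩ := hp.exists_isometry hJ he
  have hπ' : ∀ φ, π φ = weyl (R (hp.coords hJ φ)) := by
    intro φ
    refine IsWeylOperator.eq_weyl ?_
    rw [show (R (hp.coords hJ φ) : ℕ → ℂ) = fun k => innerJ J (e k) φ from funext (hR φ)]
    exact hπ φ
  have hpi := Real.pi_pos
  have h0 : Real.pi / 4 ∈ IT := ⟨by linarith, by linarith⟩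
  have h1 : 3 * Real.pi / 4 ∈ IT := ⟨by linarith, by linarith⟩
  obtain ⟨U, hU⟩ := hU _ h0 _ h1
  have hket : Orthonormal ℂ fun l => (ket l : Ltwo ℕ) := by
    rw [orthonormal_iff_ite]
    intro k l
    rw [inner_ket, ket_apply]
  -- In U⁻¹ π(W(φ)) U = π(W(φ')) it is U⁻¹ that intertwines the original operator with the
  -- transformed one.
  refine summable_of_implemented (U := U.symm) (F := fun l => R (ket l))
    (hket.comp_linearIsometryEquiv R) (fun x hx => ?_)
    (fun l => bog_normalized (zf_pf l (ν l) (hp l).1.ne' h1) (zf_pf l (ν l) (hp l).1.ne' h0))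
    (fun l w ψ => ?_)
  · have hz : R.symm x = 0 := by
      ext l
      have := hx l
      rw [← R.symm.inner_map_map, R.symm_apply_apply, inner_ket] at this
      exact this
    simpa using hz
  · have hev := isEvolution_wmode h0 h1 l (ν l) (hp l).1.ne' w
    have := hU _ _ hev (U.symm ψ)
    rw [U.apply_symm_apply, hπ', hπ', hp.coords_wmode hJ, hp.coords_wmode hJ, map_smul,
      map_smul] at this
    exact this

/-- Any two solutions related by the evolution have coordinates related by the diagonal Bogoliubov
transformation, so one implementer serves all of them. -/
lemma HasSummableParameters.unitaryDynamics (hJ : IsInvariantComplexStructure J)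
    (h : HasSummableParameters J) : UnitaryDynamics J := by
  obtain ⟨ρ, ν, hp, h1, h2⟩ := h
  rw [hasParameters_iff] at hp
  refine ⟨_, hp.isFockRepresentation_weyl hJ, fun t₀ h0 t₁ h1' => ?_⟩
  have hs := summable_evB (fun l => (hp l).1)
    ((summable_vAmp_iff fun l => (hp l).1).mpr ⟨h1, h2⟩) h0 h1'
  obtain ⟨V, hV⟩ := exists_implementer (fun l => bog_normalized
    (zf_pf l (ν l) (hp l).1.ne' h1') (zf_pf l (ν l) (hp l).1.ne' h0)) hs
  refine ⟨V.symm, fun φ φ' hφ ψ => ?_⟩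
  have := hV (hp.coords hJ φ) (hp.coords hJ φ')
    (fun k => fco_evolution hφ h0 h1' k (ν k) (hp k).1.ne') (V.symm ψ)
  rwa [V.apply_symm_apply] at this

/-- Passing from the mode coordinates of J to those of J' is again a diagonal Bogoliubov
transformation, and its implementer is the equivalence. The frames are compared at the time π/2. -/
lemma HasSummableParameters.fockEquivalent (hJ : IsInvariantComplexStructure J)
    (hJ' : IsInvariantComplexStructure J') (h : HasSummableParameters J)
    (h' : HasSummableParameters J') : FockEquivalent J J' := by
  obtain ⟨ρ, ν, hp, h1, h2⟩ := h
  obtain ⟨ρ', ν', hp', h1', h2'⟩ := h'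
  rw [hasParameters_iff] at hp hp'
  refine ⟨_, _, hp.isFockRepresentation_weyl hJ, hp'.isFockRepresentation_weyl hJ', ?_⟩
  have hs := summable_bogB_change (fun l => (hp l).1) (fun l => (hp' l).1) h1 h2 h1' h2' half_pi_mem
  obtain ⟨V, hV⟩ := exists_implementer (fun l => bog_normalized
    (zf_pf l (ν l) (hp l).1.ne' half_pi_mem) (zf_pf l (ν' l) (hp' l).1.ne' half_pi_mem)) hs
  exact ⟨V, fun φ => hV _ _ fun k => fco_change k (ν k) (ν' k) (hp k).1.ne' φ half_pi_mem⟩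

end Gowdy
end

theorem mainTheorem3 :
    (∀ J : Gowdy.Sol →ₗ[ℝ] Gowdy.Sol, Gowdy.IsInvariantComplexStructure J →
      (Gowdy.UnitaryDynamics J ↔ Gowdy.HasSummableParameters J)) ∧
    (∀ J J' : Gowdy.Sol →ₗ[ℝ] Gowdy.Sol,
      Gowdy.IsInvariantComplexStructure J → Gowdy.IsInvariantComplexStructure J' →
      Gowdy.HasSummableParameters J → Gowdy.HasSummableParameters J' →
      Gowdy.FockEquivalent J J') ∧
    (∀ J J' : Gowdy.Sol →ₗ[ℝ] Gowdy.Sol,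
      Gowdy.IsInvariantComplexStructure J → Gowdy.IsInvariantComplexStructure J' →
      Gowdy.UnitaryDynamics J → Gowdy.UnitaryDynamics J' →
      Gowdy.FockEquivalent J J') := by
  refine ⟨fun J hJ => ⟨fun h => h.hasSummableParameters hJ, fun h => h.unitaryDynamics hJ⟩,
    fun J J' hJ hJ' h h' => h.fockEquivalent hJ hJ' h', fun J J' hJ hJ' h h' =>
      (h.hasSummableParameters hJ).fockEquivalent hJ hJ' (h'.hasSummableParameters hJ')⟩
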